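/- Let $p$ be a prime, let $B$ be a definite quaternion algebra over $\mathbb{Q}$ with an embedding $B \hookrightarrow M_2(\mathbb{Q}_p)$ of $\mathbb{Q}$-algebras, and let $R \subset B$ be a maximal order. Put $G := \mathrm{GL}_2(\mathbb{Q}_p)$, let $\Gamma := R[1/p]^\times$, viewed as a subgroup of $G$ through the embedding, and let $\mathbf{X} := \Gamma \backslash G$, equipped with its unique $G$-invariant Borel probability measure, denoted $\int_{\mathbf{X}}$. Let $\mathcal{A}(\mathbf{X})$ be the space of functions $\varphi : \mathbf{X} \to \mathbb{C}$ that are right-invariant under some open subgroup of $G$. For $g \in G$ let $\rho(g)\varphi(x) := \varphi(xg)$. For each prime $\ell \neq p$ let $T_\ell$ be the Hecke operator $T_\ell \varphi(x) := \sum_{\alpha \in M_\ell/\Gamma} \varphi(\alpha^{-1}x)$, where $M_\ell := \{\alpha \in R[1/p] : \mathrm{nr}(\alpha) \in \ell\,\mathbb{Z}[1/p]^\times\}$ and $\mathrm{nr}$ is the reduced norm. Let $A_0(\mathbf{X})$ be the set of complex subspaces $\pi \subseteq \mathcal{A}(\mathbf{X})$ that are irreducible under the ring generated by all $\rho(g)$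 ($g \in G$) and all $T_\ell$ ($\ell \ne p$ prime), and that are not one-dimensional. Call $\varphi$ *$L^2$-normalized* if $\int_{\mathbf{X}} |\varphi|^2 = 1$; in that case let $\mu_\varphi$ be the probability measure $\mu_\varphi(E) := \int_E |\varphi|^2$ on $\mathbf{X}$. For a compact open subgroup $C$ of $\mathbb{Q}_p^\times$ and $\varepsilon > 0$ set $$B(C,\varepsilon) := \left\{ \begin{pmatrix} a & b \\ c & d \end{pmatrix} \in G : a, d \in C,\ |b|_p, |c|_p \le \varepsilon \right\}.$$ Call $\varepsilon > 0$ *admissible* if $\varepsilon = |y|_p$ for some $y \in \mathbb{Q}_p^\times$. For $x \in G$ write $\mu_\varphi(xB(C,\varepsilon))$ for the $\mu_\varphi$-measure of the image of $xB(C,\varepsilon)$ in $\mathbf{X}$. **Theorem 4.1.** For each compact subset $\Omega$ of $G$ there exist a compact open subgroup $C$ of $\mathbb{Q}_p^\times$ and constants $C_1, c_2 > 0$ such that for all admissible $\varepsilon \in (0,1)$, all $\pi \in A_0(\mathbf{X})$, all $L^2$-normalized $\varphi \in \pi$, and all $x \in \Omega$, one has $$\mu_\varphi(xB(C,\varepsilon))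 \le C_1 \varepsilon^{c_2}.$$ -/

import Mathlib

open MeasureTheory

noncomputable section

namespace ArithQuot

/-- The quaternion algebra `(a, b)` over `ℚ`, with `i² = a`, `j² = b`, `ij = -ji`.
The definite quaternion algebras over `ℚ` are those with `a < 0` and `b < 0`. -/
abbrev Quat (a b : ℚ) : Type := QuaternionAlgebra ℚ a 0 b

/-- The group `GL₂(ℚ_p)`, with its `p`-adic topology. -/
abbrev G (p : ℕ) [Fact p.Prime] : Type := GL (Fin 2) ℚ_[p]

/-- The reduced norm `nr x = x x̄`, a rational number. -/
def nr {a b : ℚ} (x : Quat a b) : ℚ := (x * star x).re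

/-- Orders: subrings that are full `ℤ`-lattices. -/
structure IsOrder {a b : ℚ} (R : Subring (Quat a b)) : Prop where
  fg : R.toAddSubgroup.FG
  span_eq_top : Submodule.span ℚ (R : Set (Quat a b)) = ⊤

/-- Maximal orders: orders that are maximal under inclusion. -/
def IsMaximalOrder {a b : ℚ} (R : Subring (Quat a b)) : Prop := Maximal IsOrder R

/-- The ring `R[1/p]`. -/
def invP (p : ℕ) {a b : ℚ} (R : Subring (Quat a b)) : Subring (Quat a b) where
  carrier := {x | ∃ k : ℕ, (p : Quat a b) ^ k * x ∈ R}
  zero_mem' := ⟨0, by simp⟩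
  one_mem' := ⟨0, by simp⟩
  add_mem' := by
    rintro x y ⟨k, hk⟩ ⟨l, hl⟩
    refine ⟨k + l, ?_⟩
    have hp (n : ℕ) : (p : Quat a b) ^ n ∈ R := pow_mem (natCast_mem R p) n
    have h : (p : Quat a b) ^ (k + l) * (x + y)
        = (p : Quat a b) ^ l * ((p : Quat a b) ^ k * x)
          + (p : Quat a b) ^ k * ((p : Quat a b) ^ l * y) := by
      rw [mul_add, pow_add, mul_assoc, mul_assoc, ← mul_assoc _ _ x, ← pow_add, add_comm k l,
        pow_add, mul_assoc]
    rw [h]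
    exact add_mem (mul_mem (hp l) hk) (mul_mem (hp k) hl)
  neg_mem' := by
    rintro x ⟨k, hk⟩
    exact ⟨k, by rw [mul_neg]; exact neg_mem hk⟩
  mul_mem' := by
    rintro x y ⟨k, hk⟩ ⟨l, hl⟩
    refine ⟨k + l, ?_⟩
    have hc : Commute ((p : Quat a b) ^ l) x := (Nat.cast_commute p x).pow_left l
    have h : (p : Quat a b) ^ (k + l) * (x * y)
        = ((p : Quat a b) ^ k * x) * ((p : Quat a b) ^ l * y) := by
      rw [pow_add, mul_assoc, mul_assoc, ← mul_assoc _ x y, hc.eq, mul_assoc]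
    rw [h]
    exact mul_mem hk hl

variable {p : ℕ} [Fact p.Prime] {a b : ℚ}
  (R : Subring (Quat a b)) (ι : Quat a b →ₐ[ℚ] Matrix (Fin 2) (Fin 2) ℚ_[p])

/-- `Γ = R[1/p]ˣ`, as a subgroup of `GL₂(ℚ_p)` through the embedding `ι`. -/
def Gam : Subgroup (G p) :=
  (Units.map (((ι : Quat a b →+* Matrix (Fin 2) (Fin 2) ℚ_[p]).comp
    (invP p R).subtype : invP p R →+* Matrix (Fin 2) (Fin 2) ℚ_[p]) :
      invP p R →* Matrix (Fin 2) (Fin 2) ℚ_[p])).range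

/-- The quotient `𝐗 = Γ \ GL₂(ℚ_p)`: `x` and `y` are identified when `Γ x = Γ y`. -/
def X : Type := Quotient (QuotientGroup.rightRel (Gam R ι))

/-- The quotient topology. -/
instance : TopologicalSpace (X R ι) :=
  inferInstanceAs (TopologicalSpace (Quotient (QuotientGroup.rightRel (Gam R ι))))

/-- The Borel `σ`-algebra of the quotient topology. -/
instance : MeasurableSpace (X R ι) := borel _

instance : BorelSpace (X R ι) := ⟨rfl⟩

/-- The projection `g ↦ Γ g`. -/
def toX (g : G p) : X R ι := Quotient.mk (QuotientGroup.rightRel (Gam R ι)) g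

/-- The right action of `GL₂(ℚ_p)` on `𝐗`: `Γ x ↦ Γ x g`. -/
def rightTr (g : G p) : X R ι → X R ι :=
  Quotient.map (fun x => x * g) (by
    intro x y h
    change QuotientGroup.rightRel (Gam R ι) _ _ at h
    change QuotientGroup.rightRel (Gam R ι) _ _
    rw [QuotientGroup.rightRel_apply] at h ⊢
    simpa [mul_assoc] using h)

/-- A measure on `𝐗` is the uniform measure when it is a probability measure
invariant under the right action of `GL₂(ℚ_p)`. (`𝐗` carries exactly one such measure.) -/
structure IsUniform (ν : Measure (X R ι)) : Prop where
  prob : IsProbabilityMeasure ν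
  invariant : ∀ g : G p, MeasurePreserving (rightTr R ι g) ν ν

/-- `𝒜(𝐗)`: the functions on `𝐗` that are right-invariant under some open subgroup. -/
def smoothFun : Submodule ℂ (X R ι → ℂ) where
  carrier := {φ | ∃ U : Subgroup (G p), IsOpen (U : Set (G p)) ∧
    ∀ u ∈ U, ∀ x, φ (rightTr R ι u x) = φ x}
  zero_mem' := ⟨⊤, by simp, by simp⟩
  add_mem' := by
    rintro φ ψ ⟨U, hU, h⟩ ⟨V, hV, h'⟩
    refine ⟨U ⊓ V, by simpa using hU.inter hV, ?_⟩
    rintro u hu x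
    have hu' := Subgroup.mem_inf.mp hu
    simp [h u hu'.1 x, h' u hu'.2 x]
  smul_mem' := by
    rintro c φ ⟨U, hU, h⟩
    exact ⟨U, hU, fun u hu x => by simp [h u hu x]⟩

/-- Right translation of functions: `(ρ(g) φ)(x) = φ(x g)`. -/
def rho (g : G p) (φ : X R ι → ℂ) : X R ι → ℂ := fun x => φ (rightTr R ι g x)

/-- `M_n = R[1/p] ∩ nr⁻¹(n ℤ[1/p]ˣ)`, viewed inside `GL₂(ℚ_p)` through `ι`;
the units of `ℤ[1/p]` are the numbers `± p^k`. -/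
def M (n : ℕ) : Set (G p) :=
  {g | ∃ α ∈ invP p R, (g : Matrix (Fin 2) (Fin 2) ℚ_[p]) = ι α ∧
    ∃ k : ℤ, nr α = n * (p : ℚ) ^ k ∨ nr α = -(n * (p : ℚ) ^ k)}

/-- The Hecke correspondence `T_n(x) = {Γ α⁻¹ g : α ∈ M_n / Γ}`, for `x = Γ g`.
Since `Γ α⁻¹ g = Γ β⁻¹ g` exactly when `α Γ = β Γ`, each coset in `M_n / Γ` contributes its
own point, so that the multiset `T_n(x)` is a set. -/
def heckeSet (n : ℕ) (x : X R ι) : Set (X R ι) :=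
  {y | ∃ g : G p, ∃ α ∈ M R ι n, x = toX R ι g ∧ y = toX R ι (α⁻¹ * g)}

/-- The Hecke operator
`(T_n φ)(x) = ∑_{α ∈ M_n / Γ} φ(α⁻¹ x) = ∑_{y ∈ T_n(x)} φ(y)` (a finite sum). -/
def hecke (n : ℕ) (φ : X R ι → ℂ) : X R ι → ℂ :=
  fun x => ∑ᶠ y ∈ heckeSet R ι n x, φ y

/-- Stability under the ring generated by the `ρ(g)`, `g ∈ GL₂(ℚ_p)`, and the
`T_ℓ`, `ℓ ≠ p` prime. -/
structure IsStable (π : Submodule ℂ (X R ι → ℂ)) : Prop where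
  rho_mem : ∀ g : G p, ∀ φ ∈ π, rho R ι g φ ∈ π
  hecke_mem : ∀ ℓ : ℕ, ℓ.Prime → ℓ ≠ p → ∀ φ ∈ π, hecke R ι ℓ φ ∈ π

/-- The irreducible submodules of `𝒜(𝐗)` under the ring generated by the translations and
the Hecke operators. -/
structure IsIrred (π : Submodule ℂ (X R ι → ℂ)) : Prop where
  le_smooth : π ≤ smoothFun R ι
  stable : IsStable R ι π
  ne_bot : π ≠ ⊥
  eq_bot_or_eq : ∀ σ ≤ π, IsStable R ι σ → σ = ⊥ ∨ σ = π

/-- `A₀(𝐗)`: the irreducible submodules that are not one-dimensional. -/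
def A₀ : Set (Submodule ℂ (X R ι → ℂ)) :=
  {π | IsIrred R ι π ∧ Module.finrank ℂ π ≠ 1}

variable {R ι} in
/-- The `L²`-mass `μ_φ = |φ|² ν` of `φ`, where `ν` is the uniform measure. -/
def mass (ν : Measure (X R ι)) (φ : X R ι → ℂ) : Measure (X R ι) :=
  ν.withDensity fun x => ENNReal.ofReal (‖φ x‖ ^ 2)

/-- `B(C, ε)`: matrices with diagonal entries in `C` and off-diagonal entries of
absolute value at most `ε`. -/
def nbhd (C : Subgroup ℚ_[p]ˣ) (ε : ℝ) : Set (G p) :=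
  {g | (∃ u ∈ C, g 0 0 = (u : ℚ_[p])) ∧ (∃ u ∈ C, g 1 1 = (u : ℚ_[p])) ∧
    ‖g 0 1‖ ≤ ε ∧ ‖g 1 0‖ ≤ ε}

/-- `ε` is admissible when it is the `p`-adic absolute value of an element of `ℚ_pˣ`. -/
def Admissible (p : ℕ) [Fact p.Prime] (ε : ℝ) : Prop := ∃ y : ℚ_[p]ˣ, ‖(y : ℚ_[p])‖ = ε

end ArithQuot

end

/-! The proof is an amplification argument. Write ε = p^(-n) and use Hecke correspondences at primes
ℓ ≤ L, where L is a small power of 1/ε.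

Eigenvalues. For ℓ ≡ 1 modulo a suitable m (`IsOrder.exists_isGood`), T_ℓ commutes with all
translations and all T_q, so by Schur's lemma (`IsIrred.exists_eigenvalue`) it acts on π by a scalar
c. The central element ℓ also acts by a scalar, of absolute value one. The correspondence is a
regular graph of some degree N ≥ ℓ, and T_ℓ² is the sum over primitive products αβ plus N times a
central translation. Hence either |c|² ≥ N/2, or the primitive part of T_ℓ² has an eigenvalue of
absolute value at least N/2. In both cases there are a finite set W of elements of norm ℓ or ℓ² up
to powers of p and a κ > 0 with |W| ≤ 4κ² and κ|φ(g)| ≤ ∑_{w ∈ W} |φ(w⁻¹g)|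
(`IsGood.exists_isAmplifier`).

Duality. All integrals become finite sums over the orbits of an open subgroup K fixing φ, since all
small cells have the same volume (`IsUniform.measure_cell_eq`). Summing the amplified inequalities
over a set P of primes and applying Cauchy–Schwarz (`sq_card_mul_sum_le`) bounds |P|² times the mass
of xB by a weighted number of coincidences between w⁻¹y and w'⁻¹y' with y, y' in xB. A coincidence
produces a quaternion η = w'γw⁻¹ whose matrix lies in xBx⁻¹. If at most C such η occur for each pair
of primes, and every prime of P is at least D, then the mass is at most 4C/|P| + 4C/D
(`IsIrred.exists_mass_eq`).

Counting returns. After clearing denominators the η lie in R and have norm O(L⁴). The commutator of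
two of them has integral norm O(L⁸). That norm is also divisible by p^(2n), because elements of B
commute modulo ε. For L a small power of p^n it vanishes, and as B is definite all the η commute.
Commuting elements of a fixed norm with at most two primes of bounded exponent, besides a fixed
power of p, are bounded in number (`card_commuting_le`, `IsOrder.exists_card_returnSet_le`).

Good primes. For a prime q outside a finite set at which -A is a square, with ℚ(√-A) a subfield of
the quaternion algebra, the norm one elements of R[1/pq] are dense in SL₂(ℚ_q)
(`IsOrder.mem_closure_of_det_eq_one`). This provides the factorizations behind the Hecke relations
and removes denominators from a rational solution of x² + Ay² = ℓ, giving an element of R[1/p] of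
norm ℓ (`IsOrder.exists_norm_eq_prime`). A power of L many good primes between a power of L and L is
enough. This weak bound follows from the pole at 1 of a Dirichlet series (`exists_many_primes`). -/

noncomputable section

namespace ArithQuot

/-! ### Reduced norm and trace on a definite quaternion algebra. -/

section Algebra

variable {a b : ℚ}

/-- The reduced trace. -/
def tr (x : Quat a b) : ℚ := 2 * x.re

lemma nr_eq (x : Quat a b) :
    nr x = x.re ^ 2 - a * x.imI ^ 2 - b * x.imJ ^ 2 + a * b * x.imK ^ 2 := by
  simp [nr]; ring

lemma mul_star_self (x : Quat a b) : x * star x = ((nr x : ℚ) : Quat a b) := by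
  rw [nr, QuaternionAlgebra.mul_star_eq_coe]; simp

lemma star_mul_self' (x : Quat a b) : star x * x = ((nr x : ℚ) : Quat a b) := by
  ext <;> simp [nr] <;> ring

lemma nr_mul (x y : Quat a b) : nr (x * y) = nr x * nr y := by
  simp [nr_eq]; ring

@[simp] lemma nr_one : nr (1 : Quat a b) = 1 := by simp [nr_eq]
@[simp] lemma nr_zero : nr (0 : Quat a b) = 0 := by simp [nr_eq]
@[simp] lemma nr_star (x : Quat a b) : nr (star x) = nr x := by simp [nr_eq]
@[simp] lemma nr_neg (x : Quat a b) : nr (-x) = nr x := by simp [nr_eq]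
@[simp] lemma nr_smul (c : ℚ) (x : Quat a b) : nr (c • x) = c ^ 2 * nr x := by
  simp [nr_eq]; ring
@[simp] lemma nr_natCast (n : ℕ) : nr (n : Quat a b) = (n : ℚ) ^ 2 := by simp [nr_eq]

lemma nr_pow (x : Quat a b) (n : ℕ) : nr (x ^ n) = nr x ^ n := by
  induction n with
  | zero => simp
  | succ n ih => rw [pow_succ, nr_mul, ih, pow_succ]

@[simp] lemma tr_smul (c : ℚ) (x : Quat a b) : tr (c • x) = c * tr x := by simp [tr]; ring

lemma star_eq (x : Quat a b) : star x = ((tr x : ℚ) : Quat a b) - x := by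
  rw [QuaternionAlgebra.star_eq_two_re_sub, tr, zero_mul, add_zero]

lemma mul_self_eq (x : Quat a b) : x * x = tr x • x - ((nr x : ℚ) : Quat a b) := by
  ext <;> simp [nr, tr] <;> ring

lemma natCast_mul_eq_smul (n : ℕ) (x : Quat a b) : (n : Quat a b) * x = (n : ℚ) • x := by
  rw [← QuaternionAlgebra.coe_natCast, QuaternionAlgebra.coe_mul_eq_smul]

lemma intCast_mul_eq_smul (n : ℤ) (x : Quat a b) : (n : Quat a b) * x = (n : ℚ) • x := by
  rw [← QuaternionAlgebra.coe_intCast, QuaternionAlgebra.coe_mul_eq_smul]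

lemma natCast_pow_mul_eq_smul (n k : ℕ) (x : Quat a b) :
    (n : Quat a b) ^ k * x = ((n : ℚ) ^ k) • x := by
  rw [← Nat.cast_pow, natCast_mul_eq_smul, Nat.cast_pow]

variable (ha : a < 0) (hb : b < 0)
include ha hb

lemma nr_nonneg (x : Quat a b) : 0 ≤ nr x := by
  rw [nr_eq]
  have h1 := mul_nonneg (neg_nonneg.2 ha.le) (sq_nonneg x.imI)
  have h2 := mul_nonneg (neg_nonneg.2 hb.le) (sq_nonneg x.imJ)
  have h3 := mul_nonneg (mul_pos_of_neg_of_neg ha hb).le (sq_nonneg x.imK)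
  nlinarith [sq_nonneg x.re]

lemma nr_eq_zero {x : Quat a b} : nr x = 0 ↔ x = 0 := by
  refine ⟨fun h => ?_, fun h => by simp [h]⟩
  rw [nr_eq] at h
  have h0 := sq_nonneg x.re
  have h1 := mul_nonneg (neg_nonneg.2 ha.le) (sq_nonneg x.imI)
  have h2 := mul_nonneg (neg_nonneg.2 hb.le) (sq_nonneg x.imJ)
  have hab := mul_pos_of_neg_of_neg ha hb
  have h3 := mul_nonneg hab.le (sq_nonneg x.imK)
  have e0 : x.re ^ 2 = 0 := by linarith
  have e1 : -a * x.imI ^ 2 = 0 := by linarith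
  have e2 : -b * x.imJ ^ 2 = 0 := by linarith
  have e3 : a * b * x.imK ^ 2 = 0 := by linarith
  have f1 : x.imI = 0 := by simpa [ha.ne] using e1
  have f2 : x.imJ = 0 := by simpa [hb.ne] using e2
  have f3 : x.imK = 0 := by simpa [ha.ne, hb.ne] using e3
  ext <;> simp_all

lemma nr_pos {x : Quat a b} (hx : x ≠ 0) : 0 < nr x :=
  lt_of_le_of_ne (nr_nonneg ha hb x) fun h => hx ((nr_eq_zero ha hb).1 h.symm)

lemma mul_eq_zero' {x y : Quat a b} : x * y = 0 ↔ x = 0 ∨ y = 0 := by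
  rw [← nr_eq_zero ha hb, nr_mul, mul_eq_zero, nr_eq_zero ha hb, nr_eq_zero ha hb]

lemma mul_left_cancel' {x y z : Quat a b} (hx : x ≠ 0) (h : x * y = x * z) : y = z := by
  have : x * (y - z) = 0 := by rw [mul_sub, h, sub_self]
  rcases (mul_eq_zero' ha hb).1 this with h | h
  · exact absurd h hx
  · exact sub_eq_zero.1 h

lemma mul_right_cancel' {x y z : Quat a b} (hx : x ≠ 0) (h : y * x = z * x) : y = z := by
  have : (y - z) * x = 0 := by rw [sub_mul, h, sub_self]
  rcases (mul_eq_zero' ha hb).1 this with h | h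
  · exact sub_eq_zero.1 h
  · exact absurd h hx

lemma tr_sq_le (x : Quat a b) : tr x ^ 2 ≤ 4 * nr x := by
  rw [nr_eq, tr]
  have h1 := mul_nonneg (neg_nonneg.2 ha.le) (sq_nonneg x.imI)
  have h2 := mul_nonneg (neg_nonneg.2 hb.le) (sq_nonneg x.imJ)
  have h3 := mul_nonneg (mul_pos_of_neg_of_neg ha hb).le (sq_nonneg x.imK)
  nlinarith

lemma nr_add_le (x y : Quat a b) : nr (x + y) ≤ 2 * (nr x + nr y) := by
  have h := nr_nonneg ha hb (x - y)
  have : nr (x + y) + nr (x - y) = 2 * (nr x + nr y) := by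
    simp [nr_eq]; ring
  linarith

/-- Two commuting elements with the same trace and norm are equal or conjugate. -/
lemma eq_or_eq_star_of_commute {x y : Quat a b} (h : x * y = y * x) (ht : tr x = tr y)
    (hn : nr x = nr y) : y = x ∨ y = star x := by
  have : (y - x) * (y - star x) = 0 := by
    have e1 : y * y = tr x • y - ((nr x : ℚ) : Quat a b) := by
      rw [mul_self_eq y, ht, hn]
    rw [sub_mul, mul_sub, mul_sub, mul_star_self, e1, star_eq, mul_sub,
      QuaternionAlgebra.mul_coe_eq_smul, h]
    abel
  rcases (mul_eq_zero' ha hb).1 this with h | h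
  · exact Or.inl (sub_eq_zero.1 h)
  · exact Or.inr (sub_eq_zero.1 h)

omit ha hb

/-- The inverse of a quaternion. -/
def qinv (x : Quat a b) : Quat a b := (nr x)⁻¹ • star x

lemma mul_qinv {x : Quat a b} (h : nr x ≠ 0) : x * qinv x = 1 := by
  rw [qinv, mul_smul_comm, mul_star_self, QuaternionAlgebra.smul_coe, inv_mul_cancel₀ h]; simp

lemma qinv_mul {x : Quat a b} (h : nr x ≠ 0) : qinv x * x = 1 := by
  rw [qinv, smul_mul_assoc, star_mul_self', QuaternionAlgebra.smul_coe, inv_mul_cancel₀ h]; simp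

@[simp] lemma nr_qinv (x : Quat a b) : nr (qinv x) = (nr x)⁻¹ := by
  rw [qinv, nr_smul, nr_star]
  rcases eq_or_ne (nr x) 0 with h | h
  · simp [h]
  · field_simp

lemma qinv_mul_rev (x y : Quat a b) : qinv (x * y) = qinv y * qinv x := by
  rw [qinv, qinv, qinv, nr_mul, star_mul, smul_mul_smul_comm, mul_inv, mul_comm (nr x)⁻¹]

end Algebra

section Embedding

/-! An embedding of the quaternion algebra into a `2 × 2` matrix algebra is compatible with norms
and traces. -/

variable {a b : ℚ} {K : Type*} [Field K] [Algebra ℚ K]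
  (ι : Quat a b →ₐ[ℚ] Matrix (Fin 2) (Fin 2) K)

lemma map_coe (c : ℚ) : ι (c : Quat a b) = algebraMap ℚ (Matrix (Fin 2) (Fin 2) K) c := by
  have : (c : Quat a b) = algebraMap ℚ (Quat a b) c := by
    rw [QuaternionAlgebra.coe_algebraMap]
  rw [this, AlgHom.commutes]

lemma map_coe' (c : ℚ) : ι (c : Quat a b) = (c : K) • 1 := by
  rw [map_coe, Algebra.algebraMap_eq_smul_one]
  ext i j
  simp [Algebra.smul_def]

lemma map_smul' (c : ℚ) (x : Quat a b) : ι (c • x) = (c : K) • ι x := by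
  rw [← QuaternionAlgebra.coe_mul_eq_smul, map_mul, map_coe', smul_mul_assoc, one_mul]

variable (ha : a < 0) (hb : b < 0)
include ha hb

lemma trace_map (x : Quat a b) : (ι x).trace = ((tr x : ℚ) : K) := by
  have : CharZero K := algebraRat.charZero K
  -- an element that is a commutator up to an invertible scalar has trace zero
  have key : ∀ u v : Quat a b, u * v = -(v * u) → nr v ≠ 0 → (ι u).trace = 0 := by
    intro u v h hv
    have e : u = -(v * u * qinv v) := by
      rw [← neg_mul, ← h, mul_assoc, mul_qinv hv, mul_one]
    have e2 : (ι u).trace = -(ι u).trace := by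
      conv_lhs => rw [e, map_neg, Matrix.trace_neg, map_mul, Matrix.trace_mul_comm, ← map_mul,
        ← mul_assoc, qinv_mul hv, one_mul]
    linear_combination (1/2 : K) * e2
  have hi : (ι ⟨0, 1, 0, 0⟩).trace = 0 := by
    refine key _ ⟨0, 0, 1, 0⟩ ?_ ?_
    · ext <;> simp
    · simp [nr_eq, hb.ne]
  have hj : (ι ⟨0, 0, 1, 0⟩).trace = 0 := by
    refine key _ ⟨0, 1, 0, 0⟩ ?_ ?_
    · ext <;> simp
    · simp [nr_eq, ha.ne]
  have hk : (ι ⟨0, 0, 0, 1⟩).trace = 0 := by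
    refine key _ ⟨0, 1, 0, 0⟩ ?_ ?_
    · ext <;> simp
    · simp [nr_eq, ha.ne]
  have ex : x = x.re • 1 + x.imI • ⟨0, 1, 0, 0⟩ + x.imJ • ⟨0, 0, 1, 0⟩ + x.imK • ⟨0, 0, 0, 1⟩ := by
    ext <;> simp
  conv_lhs => rw [ex]
  simp only [map_add, map_smul', map_one, Matrix.trace_add, Matrix.trace_smul, hi, hj, hk]
  simp [tr]; ring

lemma map_star (x : Quat a b) : ι (star x) = (ι x).adjugate := by
  rw [star_eq, map_sub, map_coe', ← trace_map ι ha hb]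
  ext i j
  fin_cases i <;> fin_cases j <;> simp [Matrix.adjugate_fin_two, Matrix.trace_fin_two]

lemma det_map (x : Quat a b) : (ι x).det = ((nr x : ℚ) : K) := by
  have h : ι x * ι (star x) = ((nr x : ℚ) : K) • 1 := by
    rw [← map_mul, mul_star_self, map_coe']
  rw [map_star ι ha hb, Matrix.mul_adjugate] at h
  have := congrFun (congrFun h 0) 0
  simpa using this

end Embedding
end ArithQuot

namespace ArithQuot

/-! ### Integrality and denominators in orders and in R[1/p]. -/

section Orders

variable {a b : ℚ}

/-- The integers inside `ℚ`. -/
abbrev intQ : Subring ℚ := (Int.castRingHom ℚ).range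

lemma mem_intQ {r : ℚ} : r ∈ intQ ↔ ∃ z : ℤ, r = z := by
  simp [intQ, RingHom.mem_range, eq_comm]

lemma intCast_mem_intQ (z : ℤ) : (z : ℚ) ∈ intQ := mem_intQ.2 ⟨z, rfl⟩
lemma natCast_mem_intQ (z : ℕ) : (z : ℚ) ∈ intQ := mem_intQ.2 ⟨z, by simp⟩

/-- Otherwise arbitrarily high powers of the denominator of `r` would divide the fixed integer `D`.
Integrality of norms is deduced from bounded denominators in this way. -/
lemma mem_intQ_of_pow {r D : ℚ} (hD : D ≠ 0) (h : ∀ n : ℕ, D * r ^ n ∈ intQ) : r ∈ intQ := by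
  obtain ⟨d, hd⟩ := mem_intQ.1 (by simpa using h 0)
  have hd0 : d ≠ 0 := by rintro rfl; exact hD (by simpa using hd)
  by_contra hr
  have hden : 2 ≤ r.den := by
    have : r.den ≠ 1 := fun h1 => hr (mem_intQ.2 ⟨r.num, ((Rat.den_eq_one_iff r).1 h1).symm⟩)
    have := r.den_pos
    omega
  have hdvd : ∀ n : ℕ, (r.den : ℤ) ^ n ∣ d := by
    intro n
    obtain ⟨z, hz⟩ := mem_intQ.1 (h n)
    have h1 : (d : ℚ) * (r.num : ℚ) ^ n = z * (r.den : ℚ) ^ n := by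
      rw [hd] at hz
      have hr' : r = r.num / r.den := (Rat.num_div_den r).symm
      have h0 : (r.den : ℚ) ≠ 0 := by exact_mod_cast r.den_ne_zero
      rw [hr', div_pow] at hz
      field_simp at hz
      linear_combination hz
    have h2 : d * r.num ^ n = z * (r.den : ℤ) ^ n := by exact_mod_cast h1
    have hc : IsCoprime ((r.den : ℤ) ^ n) (r.num ^ n) := by
      apply IsCoprime.pow
      rw [Int.isCoprime_iff_gcd_eq_one, Int.gcd_comm]
      simpa [Int.gcd, Nat.Coprime] using r.reduced
    exact hc.dvd_of_dvd_mul_right ⟨z, by rw [h2]; ring⟩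
  have hle : ∀ n : ℕ, 2 ^ n ≤ d.natAbs := by
    intro n
    have h1 := Int.natAbs_dvd_natAbs.2 (hdvd n)
    rw [Int.natAbs_pow, Int.natAbs_natCast] at h1
    exact (Nat.pow_le_pow_left hden n).trans (Nat.le_of_dvd (Int.natAbs_pos.2 hd0) h1)
  exact absurd (hle d.natAbs) (not_le.2 Nat.lt_two_pow_self)

/-- Quaternions with coordinates in `D⁻¹ ℤ`. -/
def latticeD (a b : ℚ) (D : ℚ) : AddSubgroup (Quat a b) where
  carrier := {x | D * x.re ∈ intQ ∧ D * x.imI ∈ intQ ∧ D * x.imJ ∈ intQ ∧ D * x.imK ∈ intQ}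
  zero_mem' := by simp
  add_mem' := by
    rintro x y ⟨h1, h2, h3, h4⟩ ⟨k1, k2, k3, k4⟩
    simp only [Set.mem_ofPred_eq, QuaternionAlgebra.re_add, QuaternionAlgebra.imI_add,
      QuaternionAlgebra.imJ_add, QuaternionAlgebra.imK_add, mul_add]
    exact ⟨add_mem h1 k1, add_mem h2 k2, add_mem h3 k3, add_mem h4 k4⟩
  neg_mem' := by
    rintro x ⟨h1, h2, h3, h4⟩
    simp only [Set.mem_ofPred_eq, QuaternionAlgebra.re_neg, QuaternionAlgebra.imI_neg,
      QuaternionAlgebra.imJ_neg, QuaternionAlgebra.imK_neg, mul_neg]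
    exact ⟨neg_mem h1, neg_mem h2, neg_mem h3, neg_mem h4⟩

lemma exists_mem_latticeD (x : Quat a b) : ∃ D : ℕ, 0 < D ∧ x ∈ latticeD a b D := by
  refine ⟨x.re.den * x.imI.den * x.imJ.den * x.imK.den, ?_, ?_⟩
  · have := x.re.den_pos; have := x.imI.den_pos; have := x.imJ.den_pos; have := x.imK.den_pos
    positivity
  · have h : ∀ r : ℚ, (r.den : ℚ) * r ∈ intQ := fun r => mem_intQ.2 ⟨r.num, by
      rw [mul_comm]; exact Rat.mul_den_eq_num r⟩
    have hn := natCast_mem_intQ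
    push_cast
    refine ⟨?_, ?_, ?_, ?_⟩
    · convert mul_mem (mul_mem (mul_mem (hn x.imI.den) (hn x.imJ.den)) (hn x.imK.den)) (h x.re)
        using 1; ring
    · convert mul_mem (mul_mem (mul_mem (hn x.re.den) (hn x.imJ.den)) (hn x.imK.den)) (h x.imI)
        using 1; ring
    · convert mul_mem (mul_mem (mul_mem (hn x.re.den) (hn x.imI.den)) (hn x.imK.den)) (h x.imJ)
        using 1; ring
    · convert mul_mem (mul_mem (mul_mem (hn x.re.den) (hn x.imI.den)) (hn x.imJ.den)) (h x.imK)
        using 1; ring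

lemma latticeD_mul {D : ℚ} (E : ℕ) {x : Quat a b} (hx : x ∈ latticeD a b D) :
    x ∈ latticeD a b (E * D) := by
  obtain ⟨h1, h2, h3, h4⟩ := hx
  have hn := natCast_mem_intQ E
  refine ⟨?_, ?_, ?_, ?_⟩ <;> rw [mul_assoc] <;> exact mul_mem hn (by assumption)

variable {R : Subring (Quat a b)}

lemma IsOrder.exists_latticeD (hR : IsOrder R) : ∃ D : ℕ, 0 < D ∧ ∀ x ∈ R, x ∈ latticeD a b D := by
  obtain ⟨S, hS⟩ := hR.fg
  have key : ∀ S : Finset (Quat a b), ∃ D : ℕ, 0 < D ∧ ∀ x ∈ S, x ∈ latticeD a b D := by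
    classical
    intro S
    induction S using Finset.induction_on with
    | empty => exact ⟨1, one_pos, by simp⟩
    | insert x S hx ih =>
      obtain ⟨D, hD, h⟩ := ih
      obtain ⟨E, hE, h'⟩ := exists_mem_latticeD x
      refine ⟨D * E, by positivity, ?_⟩
      intro y hy
      rcases Finset.mem_insert.1 hy with rfl | hy
      · rw [Nat.cast_mul]; exact latticeD_mul D h'
      · rw [mul_comm, Nat.cast_mul]; exact latticeD_mul E (h y hy)
  obtain ⟨D, hD, h⟩ := key S
  refine ⟨D, hD, fun x hx => ?_⟩
  have hx' : x ∈ AddSubgroup.closure (S : Set (Quat a b)) := by rw [hS]; exact hx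
  exact (AddSubgroup.closure_le _).2 h hx'

lemma natCast_smul_mem {x : Quat a b} (n : ℕ) (hx : x ∈ R) : (n : ℚ) • x ∈ R := by
  rw [← natCast_mul_eq_smul]; exact mul_mem (natCast_mem R n) hx

lemma intCast_smul_mem {x : Quat a b} (n : ℤ) (hx : x ∈ R) : (n : ℚ) • x ∈ R := by
  rw [← intCast_mul_eq_smul]; exact mul_mem (intCast_mem R n) hx

lemma intQ_smul_mem {x : Quat a b} {n : ℚ} (hn : n ∈ intQ) (hx : x ∈ R) : n • x ∈ R := by
  obtain ⟨z, rfl⟩ := mem_intQ.1 hn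
  exact intCast_smul_mem z hx

lemma intQ_coe_mem {n : ℚ} (hn : n ∈ intQ) : (n : Quat a b) ∈ R := by
  obtain ⟨z, rfl⟩ := mem_intQ.1 hn
  rw [QuaternionAlgebra.coe_intCast]; exact intCast_mem R z

/-- Bézout. This stands in for localization throughout: denominators are removed one prime at a time
by exhibiting a second denominator prime to the first. -/
lemma mem_of_coprime_smul {m n : ℕ} (h : m.Coprime n) {x : Quat a b} (hm : (m : ℚ) • x ∈ R)
    (hn : (n : ℚ) • x ∈ R) : x ∈ R := by
  have hb := Nat.gcd_eq_gcd_ab m n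
  rw [h] at hb
  have hb' : (1 : ℚ) = (m.gcdA n : ℚ) * m + (m.gcdB n : ℚ) * n := by
    have : ((1 : ℕ) : ℚ) = ((m * m.gcdA n + n * m.gcdB n : ℤ) : ℚ) := by rw [← hb]; simp
    push_cast at this
    linarith
  rw [← one_smul ℚ x, hb', add_smul, mul_smul, mul_smul]
  exact add_mem (intCast_smul_mem _ hm) (intCast_smul_mem _ hn)

/-- All powers of `x` stay in `R`, hence have a common denominator, so the powers of `nr x` have
bounded denominators. -/
lemma IsOrder.nr_mem (hR : IsOrder R) {x : Quat a b} (hx : x ∈ R) : nr x ∈ intQ := by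
  obtain ⟨D, hD, h⟩ := hR.exists_latticeD
  have hD' : (D : ℚ) ≠ 0 := by positivity
  have ha : (a.den : ℚ) ≠ 0 := by exact_mod_cast a.den_ne_zero
  have hb : (b.den : ℚ) ≠ 0 := by exact_mod_cast b.den_ne_zero
  refine mem_intQ_of_pow (D := D ^ 2 * a.den * b.den) (by positivity) fun n => ?_
  rw [← nr_pow]
  obtain ⟨h1, h2, h3, h4⟩ := h _ (pow_mem hx n)
  have hn := natCast_mem_intQ
  have e1 : (a.den : ℚ) * a = a.num := by rw [mul_comm]; exact Rat.mul_den_eq_num a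
  have e2 : (b.den : ℚ) * b = b.num := by rw [mul_comm]; exact Rat.mul_den_eq_num b
  set y := x ^ n
  have : (D : ℚ) ^ 2 * a.den * b.den * nr y
      = a.den * b.den * (D * y.re) ^ 2 - a.num * b.den * (D * y.imI) ^ 2
        - a.den * b.num * (D * y.imJ) ^ 2 + a.num * b.num * (D * y.imK) ^ 2 := by
    rw [nr_eq, ← e1, ← e2]; ring
  rw [this]
  have hz := intCast_mem_intQ
  exact add_mem (sub_mem (sub_mem (mul_mem (mul_mem (hn _) (hn _)) (pow_mem h1 2))
    (mul_mem (mul_mem (hz _) (hn _)) (pow_mem h2 2)))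
    (mul_mem (mul_mem (hn _) (hz _)) (pow_mem h3 2)))
    (mul_mem (mul_mem (hz _) (hz _)) (pow_mem h4 2))

lemma IsOrder.tr_mem (hR : IsOrder R) {x : Quat a b} (hx : x ∈ R) : tr x ∈ intQ := by
  have h1 := hR.nr_mem hx
  have h2 := hR.nr_mem (add_mem hx (one_mem R))
  have : tr x = nr (x + 1) - nr x - 1 := by simp [nr_eq, tr]; ring
  rw [this]
  exact sub_mem (sub_mem h2 h1) (one_mem _)

lemma IsOrder.star_mem (hR : IsOrder R) {x : Quat a b} (hx : x ∈ R) : star x ∈ R := by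
  rw [star_eq]
  exact sub_mem (intQ_coe_mem (hR.tr_mem hx)) hx

lemma IsOrder.exists_smul_mem (hR : IsOrder R) (x : Quat a b) :
    ∃ D : ℕ, 0 < D ∧ (D : ℚ) • x ∈ R := by
  have hx : x ∈ Submodule.span ℚ (R : Set (Quat a b)) := by rw [hR.span_eq_top]; trivial
  induction hx using Submodule.span_induction with
  | mem x h => exact ⟨1, one_pos, by simpa using h⟩
  | zero => exact ⟨1, one_pos, by simp⟩
  | add x y _ _ h1 h2 =>
    obtain ⟨D, hD, h1⟩ := h1
    obtain ⟨E, hE, h2⟩ := h2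
    refine ⟨D * E, by positivity, ?_⟩
    rw [smul_add]
    refine add_mem ?_ ?_
    · rw [mul_comm, Nat.cast_mul, mul_smul]; exact natCast_smul_mem E h1
    · rw [Nat.cast_mul, mul_smul]; exact natCast_smul_mem D h2
  | smul c x _ h =>
    obtain ⟨D, hD, h⟩ := h
    refine ⟨D * c.den, mul_pos hD c.den_pos, ?_⟩
    have : ((D * c.den : ℕ) : ℚ) • c • x = (c.num : ℚ) • (D : ℚ) • x := by
      rw [smul_smul, smul_smul]
      congr 1
      have := Rat.mul_den_eq_num c
      push_cast
      rw [← this]; ring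
    rw [this]
    exact intCast_smul_mem _ h

lemma IsOrder.exists_smul_latticeD (hR : IsOrder R) :
    ∃ N : ℕ, 0 < N ∧ ∀ x ∈ latticeD a b 1, (N : ℚ) • x ∈ R := by
  obtain ⟨N1, h1, k1⟩ := hR.exists_smul_mem ⟨0, 1, 0, 0⟩
  obtain ⟨N2, h2, k2⟩ := hR.exists_smul_mem ⟨0, 0, 1, 0⟩
  obtain ⟨N3, h3, k3⟩ := hR.exists_smul_mem ⟨0, 0, 0, 1⟩
  refine ⟨N1 * N2 * N3, by positivity, ?_⟩
  rintro x ⟨i0, i1, i2, i3⟩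
  rw [one_mul] at i0 i1 i2 i3
  have : ((N1 * N2 * N3 : ℕ) : ℚ) • x = (x.re * N1 * N2 * N3) • (1 : Quat a b)
      + (x.imI * N2 * N3) • (N1 : ℚ) • ⟨0, 1, 0, 0⟩ + (x.imJ * N1 * N3) • (N2 : ℚ) • ⟨0, 0, 1, 0⟩
      + (x.imK * N1 * N2) • (N3 : ℚ) • ⟨0, 0, 0, 1⟩ := by
    ext <;> simp <;> ring
  rw [this]
  have hn := natCast_mem_intQ
  refine add_mem (add_mem (add_mem ?_ ?_) ?_) ?_
  · exact intQ_smul_mem (mul_mem (mul_mem (mul_mem i0 (hn _)) (hn _)) (hn _)) (one_mem R)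
  · exact intQ_smul_mem (mul_mem (mul_mem i1 (hn _)) (hn _)) k1
  · exact intQ_smul_mem (mul_mem (mul_mem i2 (hn _)) (hn _)) k2
  · exact intQ_smul_mem (mul_mem (mul_mem i3 (hn _)) (hn _)) k3

lemma mem_invP {p : ℕ} {x : Quat a b} : x ∈ invP p R ↔ ∃ k : ℕ, ((p : ℚ) ^ k) • x ∈ R := by
  change (∃ k : ℕ, (p : Quat a b) ^ k * x ∈ R) ↔ _
  simp_rw [natCast_pow_mul_eq_smul]

lemma le_invP (p : ℕ) : R ≤ invP p R := fun x hx => mem_invP.2 ⟨0, by simpa using hx⟩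

lemma IsOrder.star_mem_invP (hR : IsOrder R) {p : ℕ} {x : Quat a b} (hx : x ∈ invP p R) :
    star x ∈ invP p R := by
  obtain ⟨k, hk⟩ := mem_invP.1 hx
  refine mem_invP.2 ⟨k, ?_⟩
  have := hR.star_mem hk
  rwa [QuaternionAlgebra.star_smul'] at this

lemma zpow_smul_mem_invP {p : ℕ} (hp : p ≠ 0) {x : Quat a b} (hx : x ∈ invP p R) (k : ℤ) :
    ((p : ℚ) ^ k) • x ∈ invP p R := by
  obtain ⟨j, hj⟩ := mem_invP.1 hx
  refine mem_invP.2 ⟨j + k.natAbs, ?_⟩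
  have hp' : (p : ℚ) ≠ 0 := by exact_mod_cast hp
  have : ((p : ℚ) ^ (j + k.natAbs)) • ((p : ℚ) ^ k) • x
      = ((p ^ (k.natAbs + k).toNat : ℕ) : ℚ) • ((p : ℚ) ^ j) • x := by
    rw [smul_smul, smul_smul]
    congr 1
    rw [Nat.cast_pow]
    have e : (((k.natAbs + k).toNat : ℕ) : ℤ) = k.natAbs + k := Int.toNat_of_nonneg (by omega)
    rw [← zpow_natCast (p : ℚ) (k.natAbs + k).toNat, e, zpow_add₀ hp', zpow_natCast, pow_add]
    ring
  rw [this]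
  exact natCast_smul_mem _ hj

end Orders
end ArithQuot

namespace ArithQuot

/-! ### Counting commuting elements of a fixed norm. -/

section TorusCount

variable {a b : ℚ}

lemma tr_mul_star_add (x y : Quat a b) : tr (x * star y) + tr (x * y) = tr x * tr y := by
  simp [tr]; ring

/-- The product of the two traces `tr (x ȳ)` and `tr (x y)`, for commuting `x`, `y`. -/
lemma tr_mul_star_mul {x y : Quat a b} (h : x * y = y * x) :
    tr (x * star y) * tr (x * y) = nr y * tr x ^ 2 + nr x * tr y ^ 2 - 4 * (nr x * nr y) := by
  have h1 := congrArg QuaternionAlgebra.imI h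
  have h2 := congrArg QuaternionAlgebra.imJ h
  have h3 := congrArg QuaternionAlgebra.imK h
  simp at h1 h2 h3
  have e1 : b * (x.imJ * y.imK - x.imK * y.imJ) = 0 := by linear_combination (-1/2) * h1
  have e2 : a * (x.imI * y.imK - x.imK * y.imI) = 0 := by linear_combination (1/2) * h2
  have e3 : x.imI * y.imJ - x.imJ * y.imI = 0 := by linear_combination (1/2) * h3
  simp [tr, nr_eq]
  linear_combination -4 * a * b * (x.imJ * y.imK - x.imK * y.imJ) * e1
    - 4 * a * b * (x.imI * y.imK - x.imK * y.imI) * e2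
    + 4 * a * b * (x.imI * y.imJ - x.imJ * y.imI) * e3

/-- The `ℓ`-adic absolute value on `ℚ`. -/
abbrev pabs (ℓ : ℕ) [Fact ℓ.Prime] (r : ℚ) : ℝ := ‖(r : ℚ_[ℓ])‖

variable {ℓ : ℕ} [Fact ℓ.Prime]

lemma pabs_mul (r s : ℚ) : pabs ℓ (r * s) = pabs ℓ r * pabs ℓ s := by simp [pabs]
lemma pabs_add_le (r s : ℚ) : pabs ℓ (r + s) ≤ max (pabs ℓ r) (pabs ℓ s) := by
  simpa [pabs] using Padic.nonarchimedean (r : ℚ_[ℓ]) s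
lemma pabs_neg (r : ℚ) : pabs ℓ (-r) = pabs ℓ r := by simp [pabs]
lemma pabs_sub_le (r s : ℚ) : pabs ℓ (r - s) ≤ max (pabs ℓ r) (pabs ℓ s) := by
  rw [sub_eq_add_neg, ← pabs_neg s]; exact pabs_add_le _ _
lemma pabs_nonneg (r : ℚ) : 0 ≤ pabs ℓ r := norm_nonneg _
lemma pabs_intCast_le (z : ℤ) : pabs ℓ (z : ℚ) ≤ 1 := by
  simpa [pabs] using Padic.norm_int_le_one z
lemma pabs_le_one_of_mem_intQ {r : ℚ} (h : r ∈ intQ) : pabs ℓ r ≤ 1 := by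
  obtain ⟨z, rfl⟩ := mem_intQ.1 h; exact pabs_intCast_le z

/-- Commuting elements of the same norm whose traces are small enough have a product of small
trace. -/
lemma pabs_tr_mul_star_le {x y : Quat a b} {n : ℚ} (h : x * y = y * x) (hx : nr x = n)
    (hy : nr y = n) (tx : pabs ℓ (tr x) ^ 2 ≤ pabs ℓ n) (ty : pabs ℓ (tr y) ^ 2 ≤ pabs ℓ n) :
    pabs ℓ (tr (x * star y)) ≤ pabs ℓ n := by
  set w := tr (x * star y) with hw
  -- `tr (x ȳ)` and `tr (x y)` are the two roots of a monic quadratic whose middle coefficient is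
  -- divisible by `n` and whose constant term is divisible by `n²` at ℓ, so both roots are divisible
  -- by `n` there.
  have e : w * w = (tr x * tr y) * w - n * (tr x ^ 2 + tr y ^ 2 - 4 * n) := by
    have h1 := tr_mul_star_add x y
    have h2 := tr_mul_star_mul h
    rw [hx, hy, ← hw] at h2
    rw [← hw] at h1
    linear_combination (-1) * h2 + w * h1
  have hxy : pabs ℓ (tr x * tr y) ≤ pabs ℓ n := by
    rw [pabs_mul]
    nlinarith [sq_nonneg (pabs ℓ (tr x) - pabs ℓ (tr y))]
  have hc : pabs ℓ (n * (tr x ^ 2 + tr y ^ 2 - 4 * n)) ≤ pabs ℓ n ^ 2 := by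
    rw [pabs_mul, sq (pabs ℓ n)]
    refine mul_le_mul_of_nonneg_left ?_ (pabs_nonneg (ℓ := ℓ) n)
    refine (pabs_sub_le _ _).trans (max_le ((pabs_add_le _ _).trans (max_le ?_ ?_)) ?_)
    · rw [sq, pabs_mul, ← sq]; exact tx
    · rw [sq, pabs_mul, ← sq]; exact ty
    · rw [pabs_mul]
      have := pabs_intCast_le (ℓ := ℓ) 4
      push_cast at this
      exact mul_le_of_le_one_left (pabs_nonneg _) this
  by_contra hlt
  push Not at hlt
  have h0 := pabs_nonneg (ℓ := ℓ) n
  have h1 : pabs ℓ w * pabs ℓ w ≤ max (pabs ℓ n * pabs ℓ w) (pabs ℓ n ^ 2) := by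
    rw [← pabs_mul, e]
    refine (pabs_sub_le _ _).trans (max_le_max ?_ hc)
    rw [pabs_mul]
    exact mul_le_mul_of_nonneg_right hxy (pabs_nonneg _)
  rcases le_max_iff.1 h1 with h | h <;> nlinarith

/-- Commuting elements of the same norm whose traces have the same, not too small, absolute value:
one of the two products has a small trace. -/
lemma pabs_tr_or {x y : Quat a b} {n : ℚ} (h : x * y = y * x) (hx : nr x = n)
    (hy : nr y = n) (tx : pabs ℓ n < pabs ℓ (tr x) ^ 2) (ty : pabs ℓ (tr y) = pabs ℓ (tr x)) :
    pabs ℓ (tr (x * star y)) ≤ pabs ℓ n ∨ pabs ℓ (tr (x * y)) ≤ pabs ℓ n := by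
  set t := pabs ℓ (tr x)
  have h1 := congrArg (pabs ℓ) (tr_mul_star_add x y)
  rw [pabs_mul (tr x), ty] at h1
  have h2 := congrArg (pabs ℓ) (tr_mul_star_mul h)
  rw [hx, hy, pabs_mul] at h2
  have h3 : pabs ℓ (n * tr x ^ 2 + n * tr y ^ 2 - 4 * (n * n)) ≤ pabs ℓ n * t ^ 2 := by
    have : n * tr x ^ 2 + n * tr y ^ 2 - 4 * (n * n) = n * (tr x ^ 2 + tr y ^ 2 - 4 * n) := by ring
    rw [this, pabs_mul]
    refine mul_le_mul_of_nonneg_left ?_ (pabs_nonneg (ℓ := ℓ) n)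
    refine (pabs_sub_le _ _).trans (max_le ((pabs_add_le _ _).trans (max_le ?_ ?_)) ?_)
    · rw [sq, pabs_mul, ← sq]
    · rw [sq, pabs_mul, ← sq, ty]
    · rw [pabs_mul]
      have := pabs_intCast_le (ℓ := ℓ) 4
      push_cast at this
      exact (mul_le_of_le_one_left (pabs_nonneg _) this).trans tx.le
  have h4 := pabs_add_le (ℓ := ℓ) (tr (x * star y)) (tr (x * y))
  rw [h1] at h4
  have h0 := pabs_nonneg (ℓ := ℓ) n
  have ht : 0 < t ^ 2 := h0.trans_lt tx
  rw [← sq] at h4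
  -- The sum of the two traces has absolute value t², so one of them is at least t². Their product
  -- is at most |n| t², so the other is at most |n|.
  rcases le_max_iff.1 h4 with h | h
  · right
    by_contra hlt
    push Not at hlt
    have : pabs ℓ n * t ^ 2 < pabs ℓ (tr (x * star y)) * pabs ℓ (tr (x * y)) := by nlinarith
    linarith
  · left
    by_contra hlt
    push Not at hlt
    have : pabs ℓ n * t ^ 2 < pabs ℓ (tr (x * star y)) * pabs ℓ (tr (x * y)) := by nlinarith
    linarith

/-- The elements of a commuting family with a fixed norm fall into few classes within which
the traces of `x ȳ` are divisible by the `ℓ`-part of the norm. -/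
lemma exists_class (S : Set (Quat a b)) (hc : ∀ x ∈ S, ∀ y ∈ S, x * y = y * x) (n : ℚ) (k : ℕ)
    (hn : ∀ x ∈ S, nr x = n) (hk : pabs ℓ n = (ℓ : ℝ) ^ (-(k : ℤ))) (ht : ∀ x ∈ S, tr x ∈ intQ) :
    ∃ f : Quat a b → Fin (2 * k + 1), ∀ x ∈ S, ∀ y ∈ S, f x = f y →
      pabs ℓ (tr (x * star y)) ≤ pabs ℓ n := by
  classical
  have hl1 : (1 : ℝ) < ℓ := by exact_mod_cast (Fact.out : ℓ.Prime).one_lt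
  have hn0 : 0 < pabs ℓ n := by rw [hk]; positivity
  -- A trace that is not small has valuation j with 2j < k, so fewer than k + 1 levels occur.
  have hlev : ∀ x ∈ S, pabs ℓ n < pabs ℓ (tr x) ^ 2 →
      ∃ j : Fin k, pabs ℓ (tr x) = (ℓ : ℝ) ^ (-(j : ℤ)) := by
    intro x hx h
    obtain ⟨z, hz⟩ := mem_intQ.1 (ht x hx)
    have hz0 : ((tr x : ℚ) : ℚ_[ℓ]) ≠ 0 := by
      intro h0
      have : pabs ℓ (tr x) = 0 := by rw [pabs, h0, norm_zero]
      rw [this] at h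
      nlinarith
    have hv := Padic.norm_eq_zpow_neg_valuation hz0
    have hv0 : 0 ≤ ((tr x : ℚ) : ℚ_[ℓ]).valuation := by
      have h1 := pabs_le_one_of_mem_intQ (ℓ := ℓ) (ht x hx)
      rw [pabs, hv, ← zpow_zero (ℓ : ℝ), zpow_le_zpow_iff_right₀ hl1] at h1
      omega
    obtain ⟨j, hj⟩ := Int.eq_ofNat_of_zero_le hv0
    rw [hj] at hv
    refine ⟨⟨j, ?_⟩, hv⟩
    rw [hk, pabs, hv, ← zpow_natCast, ← zpow_mul, zpow_lt_zpow_iff_right₀ hl1] at h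
    push_cast at h
    omega
  -- a reference element in each level
  let P : Fin k → Quat a b → Prop := fun j y => y ∈ S ∧ pabs ℓ n < pabs ℓ (tr y) ^ 2 ∧
    pabs ℓ (tr y) = (ℓ : ℝ) ^ (-(j : ℤ))
  let ref : Fin k → Quat a b := fun j => if h : ∃ y, P j y then h.choose else 0
  have href : ∀ j y, P j y → P j (ref j) := by
    intro j y hy
    have : ∃ y, P j y := ⟨y, hy⟩
    simp only [ref, dif_pos this]
    exact this.choose_spec
  -- `none` collects the elements of small trace. On level j the Boolean tells whether `x r̄` has
  -- small trace, where r is the reference element; if it does not, `x r` has. This makes 2k + 1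
  -- classes.
  let f : Quat a b → Option (Fin k × Bool) := fun x =>
    if h : ∃ j, P j x then
      some (h.choose, decide (pabs ℓ (tr (x * star (ref h.choose))) ≤ pabs ℓ n)) else none
  have hcard : Fintype.card (Option (Fin k × Bool)) = 2 * k + 1 := by simp [mul_comm]
  let e := Fintype.equivFinOfCardEq hcard
  refine ⟨fun x => e (f x), fun x hx y hy hxy => ?_⟩
  have hxy : f x = f y := e.injective hxy
  have hcs : ∀ x ∈ S, ∀ y ∈ S, x * star y = star y * x := by
    intro x hx y hy
    rw [star_eq, mul_sub, sub_mul, hc x hx y hy, QuaternionAlgebra.coe_commutes]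
  by_cases h1 : ∃ j, P j x
  · by_cases h2 : ∃ j, P j y
    · simp only [f, dif_pos h1, dif_pos h2, Option.some.injEq, Prod.mk.injEq] at hxy
      obtain ⟨hj, hside⟩ := hxy
      have hPx := h1.choose_spec
      have hPy := h2.choose_spec
      rw [← hj] at hPy hside
      set j := h1.choose
      have hPr := href j x hPx
      set r := ref j
      have key : ∀ u v : Quat a b, u * v = v * u → nr u = n * n → nr v = n * n →
          pabs ℓ (tr u) ≤ pabs ℓ n → pabs ℓ (tr v) ≤ pabs ℓ n →
          pabs ℓ (tr (u * star v)) ≤ pabs ℓ n * pabs ℓ n := by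
        intro u v huv hu hv hu' hv'
        rw [← pabs_mul]
        refine pabs_tr_mul_star_le huv hu hv ?_ ?_
        · rw [pabs_mul, sq]; exact mul_le_mul hu' hu' (pabs_nonneg _) hn0.le
        · rw [pabs_mul, sq]; exact mul_le_mul hv' hv' (pabs_nonneg _) hn0.le
      have hrr : nr r = n := hn r hPr.1
      have concl : pabs ℓ (n * tr (x * star y)) ≤ pabs ℓ n * pabs ℓ n →
          pabs ℓ (tr (x * star y)) ≤ pabs ℓ n := by
        rw [pabs_mul]; intro h; exact le_of_mul_le_mul_left h hn0
      -- The reference element cancels: (x r̄)(y r̄)* and (x r)(y r)* are both n x ȳ. The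
      -- small-trace estimate is applied to these products, which have norm n², and gives the claim
      -- multiplied by n.
      apply concl
      have cxr := hc x hx r hPr.1
      have cyr := hc y hy r hPr.1
      have cxy := hc x hx y hy
      have sx := hcs x hx r hPr.1
      have sy := hcs y hy r hPr.1
      by_cases hs : pabs ℓ (tr (x * star r)) ≤ pabs ℓ n
      · have hs' : pabs ℓ (tr (y * star r)) ≤ pabs ℓ n := by
          have := hside ▸ decide_eq_true hs
          simpa using this
        have e1 : tr ((x * star r) * star (y * star r)) = n * tr (x * star y) := by
          rw [star_mul, star_star, mul_assoc, ← mul_assoc (star r), star_mul_self', hrr,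
            QuaternionAlgebra.coe_mul_eq_smul, mul_smul_comm, tr_smul]
        rw [← e1]
        refine key _ _ ?_ (by rw [nr_mul, nr_star, hn x hx, hrr])
          (by rw [nr_mul, nr_star, hn y hy, hrr]) hs hs'
        exact Commute.mul_left (Commute.mul_right cxy sx)
          (Commute.mul_right sy.symm (Commute.refl _))
      · have hs' : ¬ pabs ℓ (tr (y * star r)) ≤ pabs ℓ n := by
          intro h
          have := hside.symm ▸ decide_eq_true h
          exact hs (by simpa using this)
        have o1 := (pabs_tr_or cxr (hn x hx) hrr hPx.2.1
          (hPr.2.2.trans hPx.2.2.symm)).resolve_left hs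
        have o2 := (pabs_tr_or cyr (hn y hy) hrr hPy.2.1
          (hPr.2.2.trans hPy.2.2.symm)).resolve_left hs'
        have e1 : tr ((x * r) * star (y * r)) = n * tr (x * star y) := by
          rw [star_mul, mul_assoc, ← mul_assoc r, mul_star_self, hrr,
            QuaternionAlgebra.coe_mul_eq_smul, mul_smul_comm, tr_smul]
        rw [← e1]
        refine key _ _ ?_ (by rw [nr_mul, hn x hx, hrr]) (by rw [nr_mul, hn y hy, hrr]) o1 o2
        exact Commute.mul_left (Commute.mul_right cxy cxr)
          (Commute.mul_right cyr.symm (Commute.refl _))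
    · simp [f, h1, h2] at hxy
  · by_cases h2 : ∃ j, P j y
    · simp [f, h1, h2] at hxy
    · have small : ∀ x ∈ S, (¬ ∃ j, P j x) → pabs ℓ (tr x) ^ 2 ≤ pabs ℓ n := by
        intro x hx h
        by_contra hlt
        push Not at hlt
        obtain ⟨j, hj⟩ := hlev x hx hlt
        exact h ⟨j, hx, hlt, hj⟩
      exact pabs_tr_mul_star_le (hc x hx y hy) (hn x hx) (hn y hy) (small x hx h1) (small y hy h2)

lemma dvd_of_pabs_le {z : ℤ} {k : ℕ} (h : pabs ℓ (z : ℚ) ≤ (ℓ : ℝ) ^ (-(k : ℤ))) :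
    (ℓ : ℤ) ^ k ∣ z := by
  have := (Padic.norm_int_le_pow_iff_dvd (p := ℓ) z k).1 (by simpa [pabs] using h)
  exact_mod_cast this

lemma card_le_of_fiber {α β : Type*} [DecidableEq β] (S : Finset α) (f : α → β) (T : Finset β)
    (hf : ∀ x ∈ S, f x ∈ T) (c : ℕ) (h : ∀ y ∈ T, (S.filter fun x => f x = y).card ≤ c) :
    S.card ≤ c * T.card :=
  Finset.card_le_mul_card_image_of_maps_to hf c h

/-- A commuting family of elements of an order with norm `n = P m` is small when the
prime factors of `m` are few. -/
lemma card_commuting_le (ha : a < 0) (hb : b < 0) {R : Subring (Quat a b)} (hR : IsOrder R)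
    {ℓ' : ℕ} [Fact ℓ'.Prime]
    (S : Finset (Quat a b)) (hSR : ∀ x ∈ S, x ∈ R) (hc : ∀ x ∈ S, ∀ y ∈ S, x * y = y * x)
    (m P k k' : ℕ) (hm0 : 0 < m) (hn : ∀ x ∈ S, nr x = (m * P : ℕ))
    (hk : pabs ℓ ((m * P : ℕ) : ℚ) = (ℓ : ℝ) ^ (-(k : ℤ)))
    (hk' : pabs ℓ' ((m * P : ℕ) : ℚ) = (ℓ' : ℝ) ^ (-(k' : ℤ)))
    (hm : ∀ z : ℤ, (ℓ : ℤ) ^ k ∣ z → (ℓ' : ℤ) ^ k' ∣ z → (m : ℤ) ∣ z) :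
    S.card ≤ 2 * (4 * P + 1) * ((2 * k + 1) * (2 * k' + 1)) := by
  classical
  obtain ⟨f, hf⟩ := exists_class (ℓ := ℓ) (S : Set (Quat a b)) hc _ k hn hk
    (fun x hx => hR.tr_mem (hSR x hx))
  obtain ⟨g, hg⟩ := exists_class (ℓ := ℓ') (S : Set (Quat a b)) hc _ k' hn hk'
    (fun x hx => hR.tr_mem (hSR x hx))
  have hcard : (Finset.univ : Finset (Fin (2 * k + 1) × Fin (2 * k' + 1))).card
      = (2 * k + 1) * (2 * k' + 1) := by simp
  rw [← hcard]
  refine card_le_of_fiber S (fun x => (f x, g x)) _ (by simp) _ fun c _ => ?_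
  set S' := S.filter fun x => (f x, g x) = c
  rcases S'.eq_empty_or_nonempty with h0 | ⟨x0, hx0⟩
  · simp [h0]
  have hx0' := Finset.mem_filter.1 hx0
  -- Inside a class, m divides `tr (x x̄₀)`; by definiteness this trace is at most 2mP in absolute
  -- value. Only 4P + 1 values remain.
  have hz : ∀ x ∈ S', ∃ z : ℤ, tr (x * star x0) = (m : ℚ) * z ∧ z ∈ Finset.Icc (-(2 * P : ℤ)) (2 * P) := by
    intro x hx
    have hx' := Finset.mem_filter.1 hx
    obtain ⟨z, hz⟩ := mem_intQ.1 (hR.tr_mem (mul_mem (hSR x hx'.1) (hR.star_mem (hSR x0 hx0'.1))))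
    have hcc := hx'.2.trans hx0'.2.symm
    have h1 := hf x hx'.1 x0 hx0'.1 (Prod.mk.inj hcc).1
    have h2 := hg x hx'.1 x0 hx0'.1 (Prod.mk.inj hcc).2
    rw [hk, hz] at h1
    rw [hk', hz] at h2
    obtain ⟨w, hw⟩ := hm z (dvd_of_pabs_le h1) (dvd_of_pabs_le h2)
    refine ⟨w, by rw [hz, hw]; push_cast; ring, ?_⟩
    have h3 := tr_sq_le ha hb (x * star x0)
    rw [nr_mul, nr_star, hn x hx'.1, hn x0 hx0'.1, hz, hw] at h3
    have h4 : (m : ℤ) ^ 2 * w ^ 2 ≤ (m : ℤ) ^ 2 * (2 * P) ^ 2 := by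
      have : ((m : ℚ)) ^ 2 * (w : ℚ) ^ 2 ≤ (m : ℚ) ^ 2 * (2 * P) ^ 2 := by
        push_cast at h3; linarith
      exact_mod_cast this
    have h5 : w ^ 2 ≤ (2 * P : ℤ) ^ 2 := le_of_mul_le_mul_left h4 (by positivity)
    rw [Finset.mem_Icc]
    exact abs_le.1 (abs_le_of_sq_le_sq h5 (by positivity))
  choose! t ht1 ht2 using hz
  have hIcc : (Finset.Icc (-(2 * P : ℤ)) (2 * P)).card = 4 * P + 1 := by
    rw [Int.card_Icc]; omega
  rw [← hIcc]
  refine card_le_of_fiber S' t _ ht2 2 fun w _ => ?_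
  set S'' := S'.filter fun x => t x = w
  rcases S''.eq_empty_or_nonempty with h0 | ⟨x1, hx1⟩
  · simp [h0]
  have hm' : ∀ x ∈ S'', x ∈ S ∧ tr (x * star x0) = m * w := by
    intro x hx
    have h1 := Finset.mem_filter.1 hx
    exact ⟨(Finset.mem_filter.1 h1.1).1, by rw [ht1 x h1.1, h1.2]⟩
  have hcs : ∀ x ∈ S, ∀ y ∈ S, Commute x (star y) := by
    intro x hx y hy
    rw [Commute, SemiconjBy, star_eq, mul_sub, sub_mul, hc x hx y hy,
      QuaternionAlgebra.coe_commutes]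
  have hne : x0 ≠ 0 ∨ S.card ≤ 1 := by
    by_cases h : x0 = 0
    · right
      have h0 := hn x0 hx0'.1
      rw [h, nr_zero] at h0
      refine Finset.card_le_one.2 fun x hx y hy => ?_
      rw [(nr_eq_zero ha hb).1 ((hn x hx).trans h0.symm),
        (nr_eq_zero ha hb).1 ((hn y hy).trans h0.symm)]
    · exact Or.inl h
  rcases hne with hne | hone
  · have hne' : star x0 ≠ 0 := by simpa using hne
    -- Within a commuting family, norm and trace determine `x x̄₀` up to conjugation, hence at most
    -- two `x`.
    have hsub : S'' ⊆ {x1, star x1 * x0 * qinv (star x0)} := by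
      intro x hx
      obtain ⟨hxS, hxt⟩ := hm' x hx
      obtain ⟨h1S, h1t⟩ := hm' x1 hx1
      have hcomm : (x1 * star x0) * (x * star x0) = (x * star x0) * (x1 * star x0) :=
        Commute.mul_left (Commute.mul_right (hc _ h1S _ hxS) (hcs _ h1S _ hx0'.1))
          (Commute.mul_right (hcs _ hxS _ hx0'.1).symm (Commute.refl _))
      have := eq_or_eq_star_of_commute ha hb hcomm (h1t.trans hxt.symm)
        (by rw [nr_mul, nr_mul, hn x hxS, hn x1 h1S])
      rcases this with h | h
      · rw [mul_right_cancel' ha hb hne' h]; simp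
      · have h3 : x = star x1 * x0 * qinv (star x0) := by
          apply mul_right_cancel' ha hb hne'
          rw [h, star_mul, star_star, mul_assoc (star x1 * x0), qinv_mul, mul_one]
          · exact ((hcs _ hx0'.1 _ h1S)).eq
          · rw [nr_star]; exact fun h0 => hne ((nr_eq_zero ha hb).1 h0)
        rw [h3]; simp
    exact (Finset.card_le_card hsub).trans Finset.card_le_two
  · exact (Finset.card_le_card ((Finset.filter_subset _ _).trans
      (Finset.filter_subset _ _))).trans (hone.trans (by norm_num))

end TorusCount
end ArithQuot

namespace ArithQuot

/-! ### Sizes of p-adic matrices and commutators in B(C, ε). -/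

section EntryBounds

variable {p : ℕ} [Fact p.Prime]

/-- All entries of the matrix have absolute value at most `c`. -/
def EntryLe (A : Matrix (Fin 2) (Fin 2) ℚ_[p]) (c : ℝ) : Prop := ∀ i j, ‖A i j‖ ≤ c

lemma EntryLe.mono {A : Matrix (Fin 2) (Fin 2) ℚ_[p]} {c d : ℝ} (h : EntryLe A c) (hcd : c ≤ d) :
    EntryLe A d := fun i j => (h i j).trans hcd

lemma EntryLe.mul {A B : Matrix (Fin 2) (Fin 2) ℚ_[p]} {c d : ℝ} (hA : EntryLe A c)
    (hB : EntryLe B d) : EntryLe (A * B) (c * d) := by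
  intro i j
  have hc : 0 ≤ c := (norm_nonneg _).trans (hA 0 0)
  rw [Matrix.mul_apply, Fin.sum_univ_two]
  refine (Padic.nonarchimedean _ _).trans (max_le ?_ ?_) <;> rw [norm_mul] <;>
    exact mul_le_mul (hA _ _) (hB _ _) (norm_nonneg _) hc

lemma EntryLe.add {A B : Matrix (Fin 2) (Fin 2) ℚ_[p]} {c : ℝ} (hA : EntryLe A c)
    (hB : EntryLe B c) : EntryLe (A + B) c := fun i j =>
  (Padic.nonarchimedean _ _).trans (max_le (hA i j) (hB i j))

lemma EntryLe.smul {A : Matrix (Fin 2) (Fin 2) ℚ_[p]} {c d : ℝ} {s : ℚ_[p]} (hs : ‖s‖ ≤ d)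
    (hA : EntryLe A c) : EntryLe (s • A) (d * c) := fun i j => by
  rw [Matrix.smul_apply, smul_eq_mul, norm_mul]
  exact mul_le_mul hs (hA i j) (norm_nonneg _) ((norm_nonneg _).trans hs)

lemma EntryLe.one : EntryLe (1 : Matrix (Fin 2) (Fin 2) ℚ_[p]) 1 := by
  intro i j
  fin_cases i <;> fin_cases j <;> simp

lemma EntryLe.norm_trace_le {A : Matrix (Fin 2) (Fin 2) ℚ_[p]} {c : ℝ} (hA : EntryLe A c) :
    ‖A.trace‖ ≤ c := by
  rw [Matrix.trace_fin_two]
  exact (Padic.nonarchimedean _ _).trans (max_le (hA _ _) (hA _ _))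

lemma EntryLe.norm_det_le {A : Matrix (Fin 2) (Fin 2) ℚ_[p]} {c : ℝ} (hA : EntryLe A c) :
    ‖A.det‖ ≤ c * c := by
  have hc : 0 ≤ c := (norm_nonneg _).trans (hA 0 0)
  rw [Matrix.det_fin_two, sub_eq_add_neg]
  refine (Padic.nonarchimedean _ _).trans (max_le ?_ ?_)
  · rw [norm_mul]; exact mul_le_mul (hA _ _) (hA _ _) (norm_nonneg _) hc
  · rw [norm_neg, norm_mul]; exact mul_le_mul (hA _ _) (hA _ _) (norm_nonneg _) hc

lemma EntryLe.adjugate {A : Matrix (Fin 2) (Fin 2) ℚ_[p]} {c : ℝ} (hA : EntryLe A c) :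
    EntryLe A.adjugate c := by
  intro i j
  rw [Matrix.adjugate_fin_two]
  fin_cases i <;> fin_cases j <;> simp <;> exact hA _ _

lemma exists_entryLe (A : Matrix (Fin 2) (Fin 2) ℚ_[p]) : ∃ c : ℕ, EntryLe A ((p : ℝ) ^ c) := by
  have h1 : (1 : ℝ) < p := by exact_mod_cast (Fact.out : p.Prime).one_lt
  obtain ⟨c, hc⟩ := pow_unbounded_of_one_lt (∑ i, ∑ j, ‖A i j‖) h1
  refine ⟨c, fun i j => le_trans ?_ hc.le⟩
  refine le_trans ?_ (Finset.single_le_sum (f := fun i => ∑ j, ‖A i j‖)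
    (fun i _ => Finset.sum_nonneg fun j _ => norm_nonneg _) (Finset.mem_univ i))
  exact Finset.single_le_sum (f := fun j => ‖A i j‖) (fun j _ => norm_nonneg _) (Finset.mem_univ j)

/-- Compact subsets of `GL₂(ℚ_p)` have bounded entries, as have their inverses. -/
lemma exists_entryLe_of_isCompact {Ω : Set (G p)} (hΩ : IsCompact Ω) :
    ∃ c : ℕ, ∀ x ∈ Ω, EntryLe (x : Matrix (Fin 2) (Fin 2) ℚ_[p]) ((p : ℝ) ^ c) ∧
      EntryLe ((x⁻¹ : G p) : Matrix (Fin 2) (Fin 2) ℚ_[p]) ((p : ℝ) ^ c) := by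
  have h1 : (1 : ℝ) < p := by exact_mod_cast (Fact.out : p.Prime).one_lt
  have hcont : Continuous fun x : G p =>
      (∑ i, ∑ j, ‖(x : Matrix (Fin 2) (Fin 2) ℚ_[p]) i j‖)
      + ∑ i, ∑ j, ‖((x⁻¹ : G p) : Matrix (Fin 2) (Fin 2) ℚ_[p]) i j‖ := by
    refine Continuous.add ?_ ?_ <;>
      refine continuous_finsetSum _ fun i _ => continuous_finsetSum _ fun j _ => ?_
    · exact (Units.continuous_val.matrix_elem i j).norm
    · exact ((Units.continuous_val.comp continuous_inv).matrix_elem i j).norm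
  obtain ⟨B, hB⟩ := (hΩ.image hcont).bddAbove
  obtain ⟨c, hc⟩ := pow_unbounded_of_one_lt B h1
  have hs : ∀ (A : Matrix (Fin 2) (Fin 2) ℚ_[p]) (i j), ‖A i j‖ ≤ ∑ i, ∑ j, ‖A i j‖ := by
    intro A i j
    refine le_trans ?_ (Finset.single_le_sum (f := fun i => ∑ j, ‖A i j‖)
      (fun i _ => Finset.sum_nonneg fun j _ => norm_nonneg _) (Finset.mem_univ i))
    exact Finset.single_le_sum (f := fun j => ‖A i j‖) (fun j _ => norm_nonneg _)
      (Finset.mem_univ j)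
  have hs0 : ∀ (A : Matrix (Fin 2) (Fin 2) ℚ_[p]), 0 ≤ ∑ i, ∑ j, ‖A i j‖ := fun A =>
    Finset.sum_nonneg fun i _ => Finset.sum_nonneg fun j _ => norm_nonneg _
  refine ⟨c, fun x hx => ?_⟩
  have hx' := (hB ⟨x, hx, rfl⟩).trans hc.le
  simp only at hx'
  have a1 := hs0 (x : Matrix (Fin 2) (Fin 2) ℚ_[p])
  have a2 := hs0 ((x⁻¹ : G p) : Matrix (Fin 2) (Fin 2) ℚ_[p])
  exact ⟨fun i j => by have := hs (x : Matrix (Fin 2) (Fin 2) ℚ_[p]) i j; linarith,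
    fun i j => by have := hs ((x⁻¹ : G p) : Matrix (Fin 2) (Fin 2) ℚ_[p]) i j; linarith⟩

/-- The units of `ℤ_p`, as a subgroup of `ℚ_pˣ`. -/
def unitsC (p : ℕ) [Fact p.Prime] : Subgroup ℚ_[p]ˣ where
  carrier := {u | ‖(u : ℚ_[p])‖ = 1}
  one_mem' := by simp
  mul_mem' := by intro u v hu hv; simp_all
  inv_mem' := by intro u hu; simp_all

lemma mem_unitsC {u : ℚ_[p]ˣ} : u ∈ unitsC p ↔ ‖(u : ℚ_[p])‖ = 1 := Iff.rfl

lemma mem_nbhd {ε : ℝ} {g : G p} : g ∈ nbhd (unitsC p) ε ↔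
    ‖g 0 0‖ = 1 ∧ ‖g 1 1‖ = 1 ∧ ‖g 0 1‖ ≤ ε ∧ ‖g 1 0‖ ≤ ε := by
  have h : ∀ y : ℚ_[p], (∃ u ∈ unitsC p, y = (u : ℚ_[p])) ↔ ‖y‖ = 1 := by
    intro y
    constructor
    · rintro ⟨u, hu, rfl⟩; exact hu
    · intro hy
      have h0 : y ≠ 0 := by rintro rfl; simp at hy
      exact ⟨Units.mk0 y h0, hy, rfl⟩
  change ((∃ u ∈ unitsC p, g 0 0 = (u : ℚ_[p])) ∧ (∃ u ∈ unitsC p, g 1 1 = (u : ℚ_[p])) ∧ _) ↔ _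
  rw [h, h]

/-- The commutator of two elements of `B(C, ε)` has a small determinant. -/
lemma norm_det_commutator_le {ε : ℝ} (h0 : 0 < ε) (h1 : ε ≤ 1) {g h : G p}
    (hg : g ∈ nbhd (unitsC p) ε) (hh : h ∈ nbhd (unitsC p) ε) :
    ‖(g.val * h.val - h.val * g.val).det‖ ≤ ε ^ 2 := by
  obtain ⟨a1, a2, a3, a4⟩ := mem_nbhd.1 hg
  obtain ⟨b1, b2, b3, b4⟩ := mem_nbhd.1 hh
  have hd : ∀ x y : ℚ_[p], ‖x‖ ≤ ε → ‖y‖ ≤ ε → ‖x * y‖ ≤ ε := by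
    intro x y hx hy
    rw [norm_mul]
    exact (mul_le_mul hx (hy.trans h1) (norm_nonneg _) h0.le).trans (by rw [mul_one])
  have ho : ∀ x y : ℚ_[p], ‖x‖ ≤ 1 → ‖y‖ ≤ ε → ‖x * y‖ ≤ ε := by
    intro x y hx hy
    rw [norm_mul]
    exact (mul_le_mul hx hy (norm_nonneg _) zero_le_one).trans (by rw [one_mul])
  have hs : ∀ x y : ℚ_[p], ‖x‖ ≤ ε → ‖y‖ ≤ ε → ‖x - y‖ ≤ ε := by
    intro x y hx hy
    rw [sub_eq_add_neg]
    exact (Padic.nonarchimedean _ _).trans (max_le hx (by rwa [norm_neg]))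
  have hs1 : ∀ x y : ℚ_[p], ‖x‖ = 1 → ‖y‖ = 1 → ‖x - y‖ ≤ 1 := by
    intro x y hx hy
    rw [sub_eq_add_neg]
    exact (Padic.nonarchimedean _ _).trans (max_le hx.le (by rw [norm_neg, hy]))
  have hE : EntryLe (g.val * h.val - h.val * g.val) ε := by
    intro i j
    simp only [Matrix.sub_apply, Matrix.mul_apply, Fin.sum_univ_two]
    fin_cases i <;> fin_cases j <;> simp only [Fin.zero_eta, Fin.mk_one, Fin.isValue]
    · have : g 0 0 * h 0 0 + g 0 1 * h 1 0 - (h 0 0 * g 0 0 + h 0 1 * g 1 0)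
        = g 0 1 * h 1 0 - h 0 1 * g 1 0 := by ring
      rw [this]; exact hs _ _ (hd _ _ a3 b4) (hd _ _ b3 a4)
    · have : g 0 0 * h 0 1 + g 0 1 * h 1 1 - (h 0 0 * g 0 1 + h 0 1 * g 1 1)
        = (g 0 0 - g 1 1) * h 0 1 - (h 0 0 - h 1 1) * g 0 1 := by ring
      rw [this]; exact hs _ _ (ho _ _ (hs1 _ _ a1 a2) b3) (ho _ _ (hs1 _ _ b1 b2) a3)
    · have : g 1 0 * h 0 0 + g 1 1 * h 1 0 - (h 1 0 * g 0 0 + h 1 1 * g 1 0)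
        = (g 1 1 - g 0 0) * h 1 0 - (h 1 1 - h 0 0) * g 1 0 := by ring
      rw [this]; exact hs _ _ (ho _ _ (hs1 _ _ a2 a1) b4) (ho _ _ (hs1 _ _ b2 b1) a4)
    · have : g 1 0 * h 0 1 + g 1 1 * h 1 1 - (h 1 0 * g 0 1 + h 1 1 * g 1 1)
        = g 1 0 * h 0 1 - h 1 0 * g 0 1 := by ring
      rw [this]; exact hs _ _ (hd _ _ a4 b3) (hd _ _ b4 a3)
  simpa [sq] using hE.norm_det_le

end EntryBounds

/-! ### Denominators at p controlled by matrix entries. -/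

section Returns

variable {p : ℕ} [Fact p.Prime] {a b : ℚ} {R : Subring (Quat a b)}
  (ι : Quat a b →ₐ[ℚ] Matrix (Fin 2) (Fin 2) ℚ_[p])

/-- The only possible denominator of `t` is a power of p, and its exponent is read off from the
p-adic absolute value. -/
lemma mem_intQ_of_pow_smul {t : ℚ} {s c : ℕ} (hs : (p : ℚ) ^ s * t ∈ intQ)
    (hc : pabs p t ≤ (p : ℝ) ^ c) : (p : ℚ) ^ c * t ∈ intQ := by
  have hp : (p : ℚ) ≠ 0 := by exact_mod_cast (Fact.out : p.Prime).ne_zero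
  have hpr : (0 : ℝ) < p := by exact_mod_cast (Fact.out : p.Prime).pos
  have hpp : ∀ k : ℕ, pabs p ((p : ℚ) ^ k) = (p : ℝ) ^ (-(k : ℤ)) := by
    intro k; simp [pabs]
  rcases le_total s c with h | h
  · obtain ⟨d, rfl⟩ := Nat.exists_eq_add_of_le h
    rw [pow_add, mul_comm ((p : ℚ) ^ s), mul_assoc]
    exact mul_mem (pow_mem (natCast_mem_intQ p) d) hs
  · obtain ⟨d, rfl⟩ := Nat.exists_eq_add_of_le h
    obtain ⟨z, hz⟩ := mem_intQ.1 hs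
    have h1 : pabs p (z : ℚ) ≤ (p : ℝ) ^ (-(d : ℤ)) := by
      rw [← hz, pabs_mul, hpp]
      calc (p : ℝ) ^ (-((c + d : ℕ) : ℤ)) * pabs p t
          ≤ (p : ℝ) ^ (-((c + d : ℕ) : ℤ)) * (p : ℝ) ^ c := by gcongr
        _ = (p : ℝ) ^ (-(d : ℤ)) := by
          rw [← zpow_natCast, ← zpow_add₀ hpr.ne']; congr 1; push_cast; ring
    obtain ⟨w, hw⟩ := dvd_of_pabs_le h1
    refine mem_intQ.2 ⟨w, ?_⟩
    have hd : (p : ℚ) ^ d ≠ 0 := pow_ne_zero _ hp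
    apply mul_left_cancel₀ hd
    rw [← mul_assoc, ← pow_add, add_comm d, hz, hw]
    push_cast; ring

variable (ha : a < 0) (hb : b < 0)
include ha hb

/-- The coordinates of a quaternion are bounded in terms of the entries of its matrix. -/
lemma exists_coord_bound (c : ℕ) : ∃ c' : ℕ, ∀ z : Quat a b, EntryLe (ι z) ((p : ℝ) ^ c) →
    pabs p z.re ≤ (p : ℝ) ^ c' ∧ pabs p z.imI ≤ (p : ℝ) ^ c' ∧ pabs p z.imJ ≤ (p : ℝ) ^ c' ∧
      pabs p z.imK ≤ (p : ℝ) ^ c' := by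
  have hp1 : (1 : ℝ) < p := by exact_mod_cast (Fact.out : p.Prime).one_lt
  have key : ∀ (y : Quat a b) (r : ℚ), ∃ c' : ℕ, ∀ z : Quat a b, EntryLe (ι z) ((p : ℝ) ^ c) →
      pabs p (r * tr (z * y)) ≤ (p : ℝ) ^ c' := by
    intro y r
    obtain ⟨d, hd⟩ := exists_entryLe (ι y)
    obtain ⟨e, he⟩ := pow_unbounded_of_one_lt (pabs p r) hp1
    refine ⟨e + (c + d), fun z hz => ?_⟩
    have h1 := (hz.mul hd).norm_trace_le
    rw [← map_mul, trace_map ι ha hb] at h1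
    rw [pabs_mul, pow_add, pow_add]
    exact mul_le_mul he.le h1 (norm_nonneg _) (by positivity)
  -- Each coordinate of `z` is a constant multiple of the trace of `z` times a standard basis
  -- element.
  obtain ⟨c0, h0⟩ := key 1 (1 / 2)
  obtain ⟨c1, h1⟩ := key ⟨0, 1, 0, 0⟩ (1 / (2 * a))
  obtain ⟨c2, h2⟩ := key ⟨0, 0, 1, 0⟩ (1 / (2 * b))
  obtain ⟨c3, h3⟩ := key ⟨0, 0, 0, 1⟩ (-1 / (2 * a * b))
  have ha' := ha.ne
  have hb' := hb.ne
  have hmono : ∀ d, d ≤ c0 + c1 + c2 + c3 → (p : ℝ) ^ d ≤ (p : ℝ) ^ (c0 + c1 + c2 + c3) :=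
    fun d hd => pow_le_pow_right₀ hp1.le hd
  refine ⟨c0 + c1 + c2 + c3, fun z hz => ⟨?_, ?_, ?_, ?_⟩⟩
  · refine le_trans (le_of_eq ?_) ((h0 z hz).trans (hmono c0 (by omega)))
    congr 1; simp [tr]
  · refine le_trans (le_of_eq ?_) ((h1 z hz).trans (hmono c1 (by omega)))
    congr 1; simp [tr]; field_simp
  · refine le_trans (le_of_eq ?_) ((h2 z hz).trans (hmono c2 (by omega)))
    congr 1; simp [tr]; field_simp
  · refine le_trans (le_of_eq ?_) ((h3 z hz).trans (hmono c3 (by omega)))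
    congr 1; simp [tr]; field_simp

/-- Elements of `R[1/p]` with bounded `p`-adic entries have bounded denominators. -/
lemma IsOrder.exists_pow_smul_mem (hR : IsOrder R) (c : ℕ) :
    ∃ k : ℕ, ∀ z ∈ invP p R, EntryLe (ι z) ((p : ℝ) ^ c) → ((p : ℚ) ^ k) • z ∈ R := by
  obtain ⟨c', hc'⟩ := exists_coord_bound ι ha hb c
  obtain ⟨D, hD, hD'⟩ := hR.exists_latticeD
  obtain ⟨N, hN, hN'⟩ := hR.exists_smul_latticeD
  -- The p-part of `N D` goes into the exponent of p. The part `N'` prime to p is then cancelled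
  -- against the denominator p^s that is already known.
  obtain ⟨v, N', hN'p, hNe⟩ := Nat.exists_eq_pow_mul_and_not_dvd
    (Nat.mul_pos hN hD).ne' p (Fact.out : p.Prime).ne_one
  refine ⟨v + c', fun z hz hb' => ?_⟩
  obtain ⟨s, hs⟩ := mem_invP.1 hz
  have hcp : N'.Coprime (p ^ s) :=
    (((Nat.Prime.coprime_iff_not_dvd Fact.out).2 hN'p).pow_left s).symm
  refine mem_of_coprime_smul hcp ?_ ?_
  · have hint : ∀ r : ℚ, (D : ℚ) * ((p : ℚ) ^ s * r) ∈ intQ → pabs p r ≤ (p : ℝ) ^ c' →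
        1 * ((D : ℚ) * ((p : ℚ) ^ c' * r)) ∈ intQ := by
      intro r h1 h2
      have : (p : ℚ) ^ c' * (D * r) ∈ intQ := by
        refine mem_intQ_of_pow_smul (s := s) ?_ ?_
        · convert h1 using 1; ring
        · rw [pabs_mul]
          exact (mul_le_of_le_one_left (pabs_nonneg _)
            (pabs_le_one_of_mem_intQ (natCast_mem_intQ D))).trans h2
      convert this using 1; ring
    obtain ⟨h1, h2, h3, h4⟩ := hD' _ hs
    obtain ⟨k1, k2, k3, k4⟩ := hc' z hb'
    simp only [QuaternionAlgebra.re_smul, QuaternionAlgebra.imI_smul, QuaternionAlgebra.imJ_smul,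
      QuaternionAlgebra.imK_smul, smul_eq_mul] at h1 h2 h3 h4
    have hmem : (D : ℚ) • ((p : ℚ) ^ c') • z ∈ latticeD a b 1 :=
      ⟨hint _ h1 k1, hint _ h2 k2, hint _ h3 k3, hint _ h4 k4⟩
    have := hN' _ hmem
    rw [smul_smul, smul_smul] at this
    rw [smul_smul]
    convert this using 2
    have : (N : ℚ) * D = (p : ℚ) ^ v * N' := by exact_mod_cast hNe
    rw [this, pow_add]; ring
  · rw [smul_comm]
    push_cast
    rw [← Nat.cast_pow]
    exact natCast_smul_mem _ hs

end Returns
end ArithQuot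

namespace ArithQuot

/-! ### Uniform bound for the number of returns. -/

section ReturnCount

variable {p : ℕ} [Fact p.Prime] {a b : ℚ} {R : Subring (Quat a b)}
  (ι : Quat a b →ₐ[ℚ] Matrix (Fin 2) (Fin 2) ℚ_[p])
  (ha : a < 0) (hb : b < 0)
include ha hb

omit ha hb in
lemma pabs_natCast_of_not_dvd {ℓ n : ℕ} [Fact ℓ.Prime] (h : ¬ ℓ ∣ n) : pabs ℓ (n : ℚ) = 1 := by
  rw [pabs, Rat.cast_natCast, Padic.norm_natCast_eq_one_iff]
  exact (Nat.Prime.coprime_iff_not_dvd Fact.out).2 h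

omit ha hb in
lemma pabs_natCast_pow_mul {ℓ n : ℕ} [Fact ℓ.Prime] (k : ℕ) (h : ¬ ℓ ∣ n) :
    pabs ℓ ((ℓ ^ k * n : ℕ) : ℚ) = (ℓ : ℝ) ^ (-(k : ℤ)) := by
  rw [Nat.cast_mul, pabs_mul, pabs_natCast_of_not_dvd h, mul_one]
  simp [pabs]

/-- The elements that bring `x B(C, ε)` back to itself through the Hecke correspondences of
degrees `ℓ^e` and `ℓ'^e'`. -/
def returnSet (R : Subring (Quat a b)) (x : G p) (ε : ℝ) (ℓ e ℓ' e' : ℕ) : Set (Quat a b) :=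
  {η | (∃ j ∈ nbhd (unitsC p) ε, ι η = (x * j * x⁻¹ : G p).val) ∧
    ((ℓ : ℚ) ^ e) • η ∈ invP p R ∧ (ℓ : ℚ) ^ e * nr η = (ℓ' : ℚ) ^ e'}

/-- The number of returns is bounded as long as the degrees are small compared to `ε`. -/
theorem IsOrder.exists_card_returnSet_le (hR : IsOrder R) {Ω : Set (G p)} (hΩ : IsCompact Ω) :
    ∃ k C : ℕ, ∀ (n L : ℕ), 0 < n → 4 * (p ^ (2 * k) * L ^ 4) ^ 2 < p ^ (2 * n) →
      ∀ x ∈ Ω, ∀ ℓ ℓ' : ℕ, ℓ.Prime → ℓ'.Prime → ℓ ≠ p → ℓ' ≠ p → ℓ ≤ L → ℓ' ≤ L →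
      ∀ e e' : ℕ, e ≤ 2 → e' ≤ 2 → ∀ S : Finset (Quat a b),
        (∀ η ∈ S, η ∈ returnSet ι R x ((p : ℝ) ^ (-(n : ℤ))) ℓ e ℓ' e') → S.card ≤ C := by
  classical
  have hp := (Fact.out : p.Prime)
  have hpr : (1 : ℝ) < p := by exact_mod_cast hp.one_lt
  have hpq : (p : ℚ) ≠ 0 := by exact_mod_cast hp.ne_zero
  obtain ⟨c, hc⟩ := exists_entryLe_of_isCompact hΩ
  obtain ⟨k, hk⟩ := hR.exists_pow_smul_mem ι ha hb (c + c)
  refine ⟨k, 2 * (4 * p ^ (2 * k) + 1) * ((2 * 4 + 1) * (2 * 4 + 1)), ?_⟩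
  intro n L hn hL x hx ℓ ℓ' hℓ hℓ' hℓp hℓp' hℓL hℓL' e e' he he' S hS
  have : Fact ℓ.Prime := ⟨hℓ⟩
  have : Fact ℓ'.Prime := ⟨hℓ'⟩
  set ε := (p : ℝ) ^ (-(n : ℤ)) with hε
  have hε0 : 0 < ε := by positivity
  have hε1 : ε ≤ 1 := by rw [hε, zpow_neg, zpow_natCast]; exact inv_le_one_of_one_le₀ (one_le_pow₀ hpr.le)
  -- Scaling by `s` clears the denominators at p and ℓ. The scaled elements lie in `R` and all have
  -- norm m p^(2k) with m = ℓ^e ℓ'^e'.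
  set s : ℚ := (p : ℚ) ^ k * (ℓ : ℚ) ^ e with hs
  have hs0 : s ≠ 0 := by have := hℓ.pos; positivity
  set T : Finset (Quat a b) := S.image fun η => s • η with hT
  have hcard : S.card = T.card := by
    rw [hT, Finset.card_image_of_injective _ (smul_right_injective _ hs0)]
  set m := ℓ ^ e * ℓ' ^ e' with hm
  have hm0 : 0 < m := by have := hℓ.pos; have := hℓ'.pos; positivity
  have hmL : m ≤ L ^ 4 := by
    have hL1 : 1 ≤ L := hℓ.pos.trans_le hℓL
    calc m ≤ L ^ e * L ^ e' := Nat.mul_le_mul (Nat.pow_le_pow_left hℓL _) (Nat.pow_le_pow_left hℓL' _)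
      _ = L ^ (e + e') := (pow_add _ _ _).symm
      _ ≤ L ^ 4 := Nat.pow_le_pow_right hL1 (by omega)
  have hTR : ∀ y ∈ T, y ∈ R := by
    intro y hy
    obtain ⟨η, hη, rfl⟩ := Finset.mem_image.1 hy
    obtain ⟨⟨j, hj, hj'⟩, h2, h3⟩ := hS η hη
    rw [hs, mul_smul]
    refine hk _ h2 ?_
    rw [map_smul', hj']
    have hj1 : EntryLe j.val 1 := by
      obtain ⟨h1, h2, h3, h4⟩ := mem_nbhd.1 hj
      intro i i'
      fin_cases i <;> fin_cases i' <;> simp only [Fin.zero_eta, Fin.mk_one, Fin.isValue]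
      exacts [h1.le, h3.trans hε1, h4.trans hε1, h2.le]
    have := (((hc x hx).1.mul hj1).mul (hc x hx).2)
    have h5 := EntryLe.smul (s := (((ℓ : ℚ) ^ e : ℚ) : ℚ_[p])) (d := 1) ?_ this
    · rw [one_mul, mul_one, ← pow_add] at h5
      simpa using h5
    · exact pabs_le_one_of_mem_intQ (pow_mem (natCast_mem_intQ ℓ) e)
  have hTn : ∀ y ∈ T, nr y = (m * p ^ (2 * k) : ℕ) := by
    intro y hy
    obtain ⟨η, hη, rfl⟩ := Finset.mem_image.1 hy
    obtain ⟨-, -, h3⟩ := hS η hη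
    rw [nr_smul, hs, hm]
    push_cast
    rw [← h3]; ring
  -- The norm of the commutator is a nonnegative integer divisible by p^(2n), by the p-adic
  -- estimate, and smaller than p^(2n), by the archimedean one. So it is 0, and definiteness makes
  -- the commutator 0.
  have hTc : ∀ y ∈ T, ∀ z ∈ T, y * z = z * y := by
    intro y hy z hz
    have hyR := hTR y hy
    have hzR := hTR z hz
    have hyn := hTn y hy
    have hzn := hTn z hz
    obtain ⟨η, hη, rfl⟩ := Finset.mem_image.1 hy
    obtain ⟨ζ, hζ, rfl⟩ := Finset.mem_image.1 hz
    obtain ⟨⟨j, hj, hj'⟩, -, -⟩ := hS η hη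
    obtain ⟨⟨i, hi, hi'⟩, -, -⟩ := hS ζ hζ
    set w := (s • η) * (s • ζ) - (s • ζ) * (s • η) with hw
    have hwR : w ∈ R := sub_mem (mul_mem hyR hzR) (mul_mem hzR hyR)
    obtain ⟨N, hN⟩ := mem_intQ.1 (hR.nr_mem hwR)
    have hcomm : nr w = s ^ 2 * (s ^ 2 * nr (η * ζ - ζ * η)) := by
      have : w = s • s • (η * ζ - ζ * η) := by
        rw [hw, smul_mul_smul_comm, smul_mul_smul_comm, ← smul_sub, smul_smul]
      rw [this, nr_smul, nr_smul]
    have hdet : pabs p (nr (η * ζ - ζ * η)) ≤ ε ^ 2 := by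
      rw [pabs, ← det_map ι ha hb, map_sub, map_mul, map_mul, hj', hi']
      have : (x * j * x⁻¹ : G p).val * (x * i * x⁻¹ : G p).val
          - (x * i * x⁻¹ : G p).val * (x * j * x⁻¹ : G p).val
          = x.val * (j.val * i.val - i.val * j.val) * (x⁻¹).val := by
        have hxx : (x⁻¹).val * x.val = 1 := by rw [← Units.val_mul, inv_mul_cancel]; rfl
        simp only [Units.val_mul, mul_sub, sub_mul]
        congr 1
        · calc x.val * j.val * (x⁻¹).val * (x.val * i.val * (x⁻¹).val)
              = x.val * j.val * ((x⁻¹).val * x.val) * i.val * (x⁻¹).val := by simp only [mul_assoc]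
            _ = _ := by rw [hxx, mul_one]; simp only [mul_assoc]
        · calc x.val * i.val * (x⁻¹).val * (x.val * j.val * (x⁻¹).val)
              = x.val * i.val * ((x⁻¹).val * x.val) * j.val * (x⁻¹).val := by simp only [mul_assoc]
            _ = _ := by rw [hxx, mul_one]; simp only [mul_assoc]
      have hxd : x.val.det * (x⁻¹).val.det = 1 := by
        rw [← Matrix.det_mul, ← Units.val_mul, mul_inv_cancel]; simp
      rw [this, Matrix.det_mul, Matrix.det_mul, mul_right_comm, hxd, one_mul]
      exact norm_det_commutator_le hε0 hε1 hj hi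
    have hsint : pabs p (s ^ 2) ≤ 1 := pabs_le_one_of_mem_intQ
      (pow_mem (mul_mem (pow_mem (natCast_mem_intQ p) k) (pow_mem (natCast_mem_intQ ℓ) e)) 2)
    have hNp : pabs p (N : ℚ) ≤ (p : ℝ) ^ (-((2 * n : ℕ) : ℤ)) := by
      rw [← hN, hcomm, pabs_mul, pabs_mul]
      have e1 : ε ^ 2 = (p : ℝ) ^ (-((2 * n : ℕ) : ℤ)) := by
        rw [hε, ← zpow_natCast, ← zpow_mul]; congr 1; push_cast; ring
      rw [← e1]
      have h0 := pabs_nonneg (ℓ := p) (s ^ 2)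
      have h1 := pabs_nonneg (ℓ := p) (nr (η * ζ - ζ * η))
      calc _ ≤ 1 * (1 * ε ^ 2) := by gcongr
        _ = _ := by ring
    have hdvd := dvd_of_pabs_le hNp
    have hNle : (N : ℚ) < ((p ^ (2 * n) : ℕ) : ℚ) := by
      have h1 := nr_add_le ha hb ((s • η) * (s • ζ)) (-((s • ζ) * (s • η)))
      rw [← sub_eq_add_neg, ← hw, hN, nr_neg, nr_mul, nr_mul, hyn, hzn] at h1
      have h2 : ((4 * (p ^ (2 * k) * L ^ 4) ^ 2 : ℕ) : ℚ) < ((p ^ (2 * n) : ℕ) : ℚ) := by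
        exact_mod_cast hL
      have h3 : ((m * p ^ (2 * k) : ℕ) : ℚ) ≤ ((p ^ (2 * k) * L ^ 4 : ℕ) : ℚ) := by
        rw [mul_comm]; exact_mod_cast Nat.mul_le_mul_left _ hmL
      have h4 : (0 : ℚ) ≤ ((m * p ^ (2 * k) : ℕ) : ℚ) := by positivity
      refine h1.trans_lt (lt_of_le_of_lt ?_ h2)
      rw [Nat.cast_mul 4, Nat.cast_pow (p ^ (2 * k) * L ^ 4)]
      push_cast at h3 h4 ⊢
      nlinarith
    have hN0 : 0 ≤ N := by
      have := nr_nonneg ha hb w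
      rw [hN] at this; exact_mod_cast this
    have hN0' : N = 0 := by
      apply Int.eq_zero_of_dvd_of_nonneg_of_lt hN0 _ hdvd
      exact_mod_cast hNle
    rw [hN0', Int.cast_zero, nr_eq_zero ha hb] at hN
    exact sub_eq_zero.1 hN
  rw [hcard]
  have hpl : ∀ q : ℕ, q.Prime → q ≠ p → ¬ q ∣ p ^ (2 * k) := by
    intro q hq hqp h
    exact hqp ((Nat.prime_dvd_prime_iff_eq hq hp).1 (hq.dvd_of_dvd_pow h))
  -- For equal primes both divisibility conditions of `card_commuting_le` are taken at the same
  -- prime, with exponent e + e' ≤ 4; hence the factors 2 · 4 + 1.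
  by_cases hll : ℓ = ℓ'
  · subst hll
    have hv : pabs ℓ ((m * p ^ (2 * k) : ℕ) : ℚ) = (ℓ : ℝ) ^ (-((e + e' : ℕ) : ℤ)) := by
      rw [hm, ← pow_add]
      exact pabs_natCast_pow_mul _ (hpl ℓ hℓ hℓp)
    refine (card_commuting_le ha hb hR T hTR hTc m (p ^ (2 * k)) (e + e') (e + e') hm0 hTn hv hv
      ?_).trans ?_
    · intro z hz _
      rw [hm, ← pow_add]; exact_mod_cast hz
    · gcongr <;> omega
  · have hcop : (ℓ ^ e).Coprime (ℓ' ^ e') := Nat.Coprime.pow _ _ ((Nat.coprime_primes hℓ hℓ').2 hll)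
    have hv : pabs ℓ ((m * p ^ (2 * k) : ℕ) : ℚ) = (ℓ : ℝ) ^ (-(e : ℤ)) := by
      rw [hm, mul_assoc]
      refine pabs_natCast_pow_mul _ fun h => ?_
      rcases (Nat.Prime.dvd_mul hℓ).1 h with h | h
      · exact hll ((Nat.prime_dvd_prime_iff_eq hℓ hℓ').1 (hℓ.dvd_of_dvd_pow h))
      · exact hpl ℓ hℓ hℓp h
    have hv' : pabs ℓ' ((m * p ^ (2 * k) : ℕ) : ℚ) = (ℓ' : ℝ) ^ (-(e' : ℤ)) := by
      rw [hm, mul_comm (ℓ ^ e), mul_assoc]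
      refine pabs_natCast_pow_mul _ fun h => ?_
      rcases (Nat.Prime.dvd_mul hℓ').1 h with h | h
      · exact hll ((Nat.prime_dvd_prime_iff_eq hℓ' hℓ).1 (hℓ'.dvd_of_dvd_pow h)).symm
      · exact hpl ℓ' hℓ' hℓp' h
    refine (card_commuting_le ha hb hR T hTR hTc m (p ^ (2 * k)) e e' hm0 hTn hv hv'
      ?_).trans ?_
    · intro z hz hz'
      rw [hm]; push_cast
      refine IsCoprime.mul_dvd ?_ hz hz'
      exact_mod_cast Nat.isCoprime_iff_coprime.2 hcop
    · gcongr <;> omega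

end ReturnCount
end ArithQuot

namespace ArithQuot

/-! ### A lower bound for the number of primes congruent to 1. -/

section PrimeCount

-- Once its pole is subtracted, the Dirichlet series of a residue class extends continuously to Re s
-- ≥ 1, hence is bounded on the compact interval [1, 2].
open ArithmeticFunction ArithmeticFunction.vonMangoldt Complex in
lemma residueClass_tsum_bounds {q : ℕ} [NeZero q] {a : ZMod q} (ha : IsUnit a) :
    ∃ C : ℝ, ∀ x : ℝ, x ∈ Set.Ioc 1 2 →
      |∑' n, residueClass a n / (n : ℝ) ^ x - (q.totient : ℝ)⁻¹ / (x - 1)| ≤ C := by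
  have H {x : ℝ} (hx : 1 < x) :
      ∑' n, residueClass a n / (n : ℝ) ^ x =
        (LFunctionResidueClassAux a x).re + (q.totient : ℝ)⁻¹ / (x - 1) := by
    refine ofReal_injective ?_
    simp only [ofReal_tsum, ofReal_div, ofReal_cpow (Nat.cast_nonneg _), ofReal_natCast,
      ofReal_add, ofReal_inv, ofReal_sub, ofReal_one]
    simp_rw [← LFunctionResidueClassAux_real ha hx,
      eqOn_LFunctionResidueClassAux ha <| Set.mem_ofPred.mpr (ofReal_re x ▸ hx), sub_add_cancel,
      LSeries, LSeries.term]
    refine tsum_congr fun n ↦ ?_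
    split_ifs with hn
    · simp only [hn, residueClass_apply_zero, ofReal_zero, zero_div]
    · rfl
  have : ContinuousOn (fun x : ℝ ↦ (LFunctionResidueClassAux a x).re) (Set.Icc 1 2) :=
    continuous_re.continuousOn.comp (t := Set.univ) (continuousOn_LFunctionResidueClassAux a)
      (fun ⦃x⦄ a ↦ trivial) |>.comp continuous_ofReal.continuousOn fun x hx ↦ by
        simpa only [Set.mem_ofPred_eq, ofReal_re] using hx.1
  obtain ⟨C, hC⟩ := isCompact_Icc.exists_bound_of_continuousOn this
  refine ⟨C, fun x hx => ?_⟩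
  rw [H hx.1, add_sub_cancel_right]
  exact hC x (Set.mem_Icc_of_Ioc hx)

/-- The von Mangoldt function on the primes congruent to `1` modulo `q`. -/
def primeMangoldt (q n : ℕ) : ℝ :=
  if n.Prime then ArithmeticFunction.vonMangoldt.residueClass (1 : ZMod q) n else 0

open ArithmeticFunction.vonMangoldt in
lemma primeMangoldt_nonneg (q n : ℕ) : 0 ≤ primeMangoldt q n := by
  unfold primeMangoldt; split_ifs; exacts [residueClass_nonneg _ _, le_rfl]

open ArithmeticFunction.vonMangoldt in
lemma primeMangoldt_le_log (q n : ℕ) : primeMangoldt q n ≤ Real.log n := by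
  unfold primeMangoldt
  split_ifs with h
  · refine (residueClass_le _ _).trans ?_
    rw [ArithmeticFunction.vonMangoldt_apply_prime h]
  · exact Real.log_natCast_nonneg n

lemma primeMangoldt_eq_zero {q n : ℕ} (h : ¬ (n.Prime ∧ (n : ZMod q) = 1)) :
    primeMangoldt q n = 0 := by
  unfold primeMangoldt
  split_ifs with h1
  · unfold ArithmeticFunction.vonMangoldt.residueClass
    refine Set.indicator_of_notMem (M := ℝ) (s := {m : ℕ | (m : ZMod q) = 1}) ?_ _
    exact fun h2 => h ⟨h1, h2⟩
  · rfl

open ArithmeticFunction.vonMangoldt in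
lemma summable_residueClass_rpow {q : ℕ} (a : ZMod q) {x : ℝ} (hx : 1 < x) :
    Summable fun n : ℕ => residueClass a n / (n : ℝ) ^ x := by
  refine LSeries.summable_real_of_abscissaOfAbsConv_lt (f := residueClass a) ?_
  refine (abscissaOfAbsConv_residueClass_le_one a).trans_lt ?_
  exact_mod_cast hx

open ArithmeticFunction.vonMangoldt in
lemma summable_primeMangoldt {q : ℕ} {x : ℝ} (hx : 1 < x) :
    Summable fun n : ℕ => primeMangoldt q n / (n : ℝ) ^ x := by
  refine Summable.of_nonneg_of_le (fun n => div_nonneg (primeMangoldt_nonneg _ _) (by positivity))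
    (fun n => ?_) (summable_residueClass_rpow (1 : ZMod q) hx)
  refine div_le_div_of_nonneg_right ?_ (by positivity)
  unfold primeMangoldt
  split_ifs; exacts [le_rfl, residueClass_nonneg _ _]

-- The higher prime powers contribute a series that converges already at 1, so dropping them costs a
-- constant.
open ArithmeticFunction.vonMangoldt in
lemma primeMangoldt_tsum_bounds (q : ℕ) [NeZero q] :
    ∃ C : ℝ, ∀ x : ℝ, x ∈ Set.Ioc 1 2 →
      |∑' n, primeMangoldt q n / (n : ℝ) ^ x - (q.totient : ℝ)⁻¹ / (x - 1)| ≤ C := by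
  obtain ⟨C, hC⟩ := residueClass_tsum_bounds (q := q) (a := 1) isUnit_one
  have hs := summable_residueClass_non_primes_div (1 : ZMod q)
  refine ⟨C + ∑' n : ℕ, (if n.Prime then 0 else residueClass (1 : ZMod q) n) / n, fun x hx => ?_⟩
  set r : ℕ → ℝ := fun n => (if n.Prime then 0 else residueClass (1 : ZMod q) n)
  have hr0 : ∀ n, 0 ≤ r n := by
    intro n; simp only [r]; split_ifs; exacts [le_rfl, residueClass_nonneg _ _]
  have hle : ∀ n : ℕ, r n / (n : ℝ) ^ x ≤ r n / n := by
    intro n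
    rcases n.eq_zero_or_pos with rfl | hn
    · simp [r]
    · refine div_le_div_of_nonneg_left (hr0 n) (mod_cast hn) ?_
      conv_lhs => rw [← Real.rpow_one n]
      exact Real.rpow_le_rpow_of_exponent_le (by norm_cast) hx.1.le
  have hr0' : ∀ n : ℕ, 0 ≤ r n / (n : ℝ) ^ x := fun n => div_nonneg (hr0 n) (by positivity)
  have hsr : Summable fun n : ℕ => r n / (n : ℝ) ^ x := Summable.of_nonneg_of_le hr0' hle hs
  have hsum : ∑' n, residueClass (1 : ZMod q) n / (n : ℝ) ^ x
      = ∑' n, primeMangoldt q n / (n : ℝ) ^ x + ∑' n : ℕ, r n / (n : ℝ) ^ x := by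
    rw [← (summable_primeMangoldt hx.1).tsum_add hsr]
    refine tsum_congr fun n => ?_
    rw [← add_div]
    congr 1
    simp only [primeMangoldt, r]
    split_ifs <;> simp
  have h1 := hC x hx
  rw [hsum] at h1
  have h2 : ∑' n : ℕ, r n / (n : ℝ) ^ x ≤ ∑' n : ℕ, r n / n := hsr.tsum_le_tsum hle hs
  have h3 : 0 ≤ ∑' n : ℕ, r n / (n : ℝ) ^ x := tsum_nonneg hr0'
  have h4 : 0 ≤ ∑' n : ℕ, r n / n := h3.trans h2
  rw [abs_le] at h1 ⊢
  constructor <;> linarith [h1.1, h1.2]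

/-- There are at least a power of `L` primes up to `L` in the residue class of `1`. -/
theorem exists_many_primes (q : ℕ) [NeZero q] :
    ∃ δ c : ℝ, 0 < δ ∧ 0 < c ∧ ∃ L₀ : ℕ, ∀ L : ℕ, L₀ ≤ L →
      c * (L : ℝ) ^ δ ≤ (((Finset.range (L + 1)).filter fun ℓ : ℕ =>
        ℓ.Prime ∧ (ℓ : ZMod q) = 1 ∧ (L : ℝ) ^ δ < (ℓ : ℝ)).card : ℝ) := by
  classical
  obtain ⟨C, hC⟩ := primeMangoldt_tsum_bounds q
  set κ : ℝ := (q.totient : ℝ)⁻¹ with hκ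
  have hκ0 : 0 < κ := inv_pos.2 (mod_cast q.totient.pos_of_neZero)
  have hC0 : 0 ≤ C := (abs_nonneg _).trans (hC 2 (by norm_num))
  -- two-sided bounds near `1`
  set σ₀ : ℝ := min 1 (κ / (2 * (C + 1))) with hσ₀
  have hσ₀0 : 0 < σ₀ := lt_min one_pos (by positivity)
  have hbd : ∀ σ : ℝ, 0 < σ → σ ≤ σ₀ → κ / (2 * σ) ≤ ∑' n, primeMangoldt q n / (n : ℝ) ^ (1 + σ) ∧
      ∑' n, primeMangoldt q n / (n : ℝ) ^ (1 + σ) ≤ 2 * κ / σ := by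
    intro σ h0 h1
    have h2 := hC (1 + σ) ⟨by linarith, by have := h1.trans (min_le_left _ _); linarith⟩
    rw [add_sub_cancel_left, abs_le] at h2
    have h3 : C ≤ κ / (2 * σ) := by
      rw [le_div_iff₀ (by positivity)]
      have := h1.trans (min_le_right _ _)
      rw [le_div_iff₀ (by positivity)] at this
      nlinarith
    have h4 : κ / σ = κ / (2 * σ) + κ / (2 * σ) := by field_simp; ring
    have h5 : 2 * κ / σ = κ / σ + κ / σ := by field_simp; ring
    have h6 : 0 ≤ κ / (2 * σ) := by positivity
    constructor <;> linarith [h2.1, h2.2]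
  -- With σ = 8 / log L below, 44 σ δ log L = 1.
  set δ : ℝ := 1 / 352 with hδ
  obtain ⟨L₀, hL₀⟩ := exists_nat_gt (Real.exp (8 * 45 / σ₀) + 3)
  refine ⟨δ, κ / 32, by norm_num, by positivity, L₀, fun L hL => ?_⟩
  have hLr : Real.exp (8 * 45 / σ₀) + 3 < L := hL₀.trans_le (by exact_mod_cast hL)
  have hL3 : (3 : ℝ) < L := by have := Real.exp_pos (8 * 45 / σ₀); linarith
  have hLpos : (0 : ℝ) < L := by linarith
  set lg := Real.log L with hlg
  have hlg1 : 8 * 45 / σ₀ < lg := by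
    rw [hlg, Real.lt_log_iff_exp_lt hLpos]; linarith
  have hlg0 : 0 < lg := lt_trans (by positivity) hlg1
  set σ : ℝ := 8 / lg with hσ
  have hσ0 : 0 < σ := by positivity
  have hσlg : σ * lg = 8 := by rw [hσ]; field_simp
  have hσle : 45 * σ ≤ σ₀ := by
    rw [div_lt_iff₀ hσ₀0] at hlg1
    rw [hσ, mul_div_assoc', div_le_iff₀ hlg0]; linarith
  set y : ℝ := (L : ℝ) ^ δ with hy
  have hy0 : 0 < y := by positivity
  set F := (Finset.range (L + 1)).filter fun ℓ : ℕ => ℓ.Prime ∧ (ℓ : ZMod q) = 1 ∧ y < (ℓ : ℝ) with hF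
  have hlow := (hbd σ hσ0 (by linarith)).1
  have hhead := (hbd (45 * σ) (by positivity) hσle).2
  have htail := (hbd (σ / 2) (by positivity) (by linarith)).2
  -- The series at 1 + σ is split at y = L^δ and at L. Terms with n ≤ y are dominated by e times the
  -- series at 1 + 45σ, since n^(44σ) ≤ e. Terms with n > L are dominated by e^(-4) times the series
  -- at 1 + σ/2, since n^(σ/2) ≥ e⁴. Every term in between is at most log L / y.
  set f : ℕ → ℝ := fun n => primeMangoldt q n / (n : ℝ) ^ (1 + σ)
  set g : ℕ → ℝ := fun n => Real.exp 1 * (primeMangoldt q n / (n : ℝ) ^ (1 + 45 * σ))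
  set h : ℕ → ℝ := fun n => Real.exp (-4) * (primeMangoldt q n / (n : ℝ) ^ (1 + σ / 2))
  set k : ℕ → ℝ := fun n => if n ∈ F then lg / y else 0
  have hg0 : ∀ n, 0 ≤ g n := fun n => mul_nonneg (Real.exp_pos _).le
    (div_nonneg (primeMangoldt_nonneg _ _) (by positivity))
  have hh0 : ∀ n, 0 ≤ h n := fun n => mul_nonneg (Real.exp_pos _).le
    (div_nonneg (primeMangoldt_nonneg _ _) (by positivity))
  have hk0 : ∀ n, 0 ≤ k n := fun n => by simp only [k]; split_ifs <;> positivity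
  have hpt : ∀ n, f n ≤ g n + h n + k n := by
    intro n
    by_cases hn : n.Prime ∧ (n : ZMod q) = 1
    swap
    · have : f n = 0 := by simp only [f, primeMangoldt_eq_zero hn, zero_div]
      rw [this]; have := hg0 n; have := hh0 n; have := hk0 n; positivity
    have hn0 : (0 : ℝ) < n := by exact_mod_cast hn.1.pos
    have hn1 : (1 : ℝ) ≤ n := by exact_mod_cast hn.1.one_le
    have hP := primeMangoldt_nonneg q n
    by_cases hny : (n : ℝ) ≤ y
    · have : f n ≤ g n := by
        simp only [f, g]
        rw [mul_div_assoc', div_le_div_iff₀ (by positivity) (by positivity)]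
        have e1 : (n : ℝ) ^ (1 + 45 * σ) = (n : ℝ) ^ (1 + σ) * (n : ℝ) ^ (44 * σ) := by
          rw [← Real.rpow_add hn0]; congr 1; ring
        have e2 : (n : ℝ) ^ (44 * σ) ≤ Real.exp 1 := by
          calc (n : ℝ) ^ (44 * σ) ≤ y ^ (44 * σ) := by gcongr
            _ = Real.exp 1 := by
              rw [hy, ← Real.rpow_mul hLpos.le, Real.rpow_def_of_pos hLpos]
              congr 1
              rw [← hlg, hδ]; linear_combination (1 / 8) * hσlg
        rw [e1]
        have e3 : 0 ≤ primeMangoldt q n * (n : ℝ) ^ (1 + σ) := by positivity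
        calc primeMangoldt q n * ((n : ℝ) ^ (1 + σ) * (n : ℝ) ^ (44 * σ))
            = primeMangoldt q n * (n : ℝ) ^ (1 + σ) * (n : ℝ) ^ (44 * σ) := by ring
          _ ≤ primeMangoldt q n * (n : ℝ) ^ (1 + σ) * Real.exp 1 := by gcongr
          _ = _ := by ring
      have := hh0 n; have := hk0 n; linarith
    · push Not at hny
      by_cases hnL : n ≤ L
      · have hmem : n ∈ F := by
          rw [hF, Finset.mem_filter, Finset.mem_range]
          exact ⟨by omega, hn.1, hn.2, hny⟩
        have : f n ≤ k n := by
          simp only [f, k, if_pos hmem]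
          have h1 : primeMangoldt q n ≤ lg := (primeMangoldt_le_log q n).trans
            (Real.log_le_log hn0 (by exact_mod_cast hnL))
          have h2 : y ≤ (n : ℝ) ^ (1 + σ) := by
            refine hny.le.trans ?_
            conv_lhs => rw [← Real.rpow_one n]
            exact Real.rpow_le_rpow_of_exponent_le hn1 (by linarith)
          exact div_le_div₀ hlg0.le h1 hy0 h2
        have := hh0 n; have := hg0 n; linarith
      · push Not at hnL
        have : f n ≤ h n := by
          simp only [f, h]
          rw [mul_div_assoc', div_le_div_iff₀ (by positivity) (by positivity)]
          have e1 : (n : ℝ) ^ (1 + σ) = (n : ℝ) ^ (1 + σ / 2) * (n : ℝ) ^ (σ / 2) := by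
            rw [← Real.rpow_add hn0]; congr 1; ring
          have e2 : Real.exp 4 ≤ (n : ℝ) ^ (σ / 2) := by
            calc Real.exp 4 = (L : ℝ) ^ (σ / 2) := by
                  rw [Real.rpow_def_of_pos hLpos]
                  congr 1
                  rw [← hlg]; linear_combination (-1 / 2) * hσlg
              _ ≤ (n : ℝ) ^ (σ / 2) := by gcongr
          rw [e1, Real.exp_neg]
          have e3 : 1 ≤ (Real.exp 4)⁻¹ * (n : ℝ) ^ (σ / 2) := by
            rw [← div_eq_inv_mul, le_div_iff₀ (Real.exp_pos _), one_mul]; exact e2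
          have e4 : 0 ≤ primeMangoldt q n * (n : ℝ) ^ (1 + σ / 2) := by positivity
          calc primeMangoldt q n * (n : ℝ) ^ (1 + σ / 2)
              = primeMangoldt q n * (n : ℝ) ^ (1 + σ / 2) * 1 := by ring
            _ ≤ primeMangoldt q n * (n : ℝ) ^ (1 + σ / 2) * ((Real.exp 4)⁻¹ * (n : ℝ) ^ (σ / 2)) := by
              gcongr
            _ = _ := by ring
        have := hk0 n; have := hg0 n; linarith
  have sg : Summable g := (summable_primeMangoldt (by linarith)).mul_left _
  have sh : Summable h := (summable_primeMangoldt (by linarith)).mul_left _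
  have sk : Summable k := summable_of_ne_finset_zero (s := F) fun n hn => by simp only [k, if_neg hn]
  have tk : ∑' n, k n = F.card * (lg / y) := by
    rw [tsum_eq_sum (s := F) fun n hn => by simp only [k, if_neg hn],
      Finset.sum_congr rfl (g := fun _ => lg / y) fun n hn => by simp only [k, if_pos hn]]
    rw [Finset.sum_const, nsmul_eq_mul]
  have htot : ∑' n, f n ≤ ∑' n, g n + ∑' n, h n + ∑' n, k n := by
    rw [← sg.tsum_add sh, ← (sg.add sh).tsum_add sk]
    exact (summable_primeMangoldt (by linarith)).tsum_le_tsum hpt ((sg.add sh).add sk)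
  have tg : ∑' n, g n ≤ κ / (8 * σ) := by
    simp only [g]
    rw [tsum_mul_left]
    have he : Real.exp 1 ≤ 2.72 := Real.exp_one_lt_d9.le.trans (by norm_num)
    calc _ ≤ 2.72 * (2 * κ / (45 * σ)) := by
          refine mul_le_mul he hhead (tsum_nonneg fun n => ?_) (by norm_num)
          exact div_nonneg (primeMangoldt_nonneg _ _) (by positivity)
      _ ≤ κ / (8 * σ) := by
        rw [mul_div_assoc', div_le_div_iff₀ (by positivity) (by positivity)]
        have : 0 < κ * σ := by positivity
        nlinarith
  have th : ∑' n, h n ≤ κ / (8 * σ) := by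
    simp only [h]
    rw [tsum_mul_left]
    have he : Real.exp (-4) ≤ 1 / 32 := by
      rw [Real.exp_neg, one_div]
      refine inv_anti₀ (by norm_num) ?_
      have h1 : (2.7 : ℝ) ≤ Real.exp 1 := le_trans (by norm_num) Real.exp_one_gt_d9.le
      have h2 : Real.exp 4 = Real.exp 1 ^ 4 := by rw [← Real.exp_nat_mul]; norm_num
      rw [h2]
      calc (32 : ℝ) ≤ 2.7 ^ 4 := by norm_num
        _ ≤ _ := by gcongr
    calc _ ≤ 1 / 32 * (2 * κ / (σ / 2)) := by
          refine mul_le_mul he htail (tsum_nonneg fun n => ?_) (by norm_num)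
          exact div_nonneg (primeMangoldt_nonneg _ _) (by positivity)
      _ = κ / (8 * σ) := by field_simp; norm_num
  -- The total is at least κ/(2σ), and head and tail take at most κ/(8σ) each. The rest comes from
  -- the primes in `F`, and 1/σ = log L / 8 cancels the logarithm.
  have hfin : κ / (4 * σ) ≤ F.card * (lg / y) := by
    rw [← tk]
    have e1 : κ / (2 * σ) = κ / (4 * σ) + κ / (8 * σ) + κ / (8 * σ) := by field_simp; norm_num
    linarith
  have e2 : κ / (4 * σ) = κ * lg / 32 := by
    rw [hσ]; field_simp; norm_num
  rw [e2, mul_div_assoc', le_div_iff₀ hy0] at hfin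
  have : lg * (κ / 32 * y) ≤ lg * F.card := by linarith
  exact le_of_mul_le_mul_left this hlg0

end PrimeCount
end ArithQuot

namespace ArithQuot

/-! ### Finiteness of R[1/p]/n and infinitely many elements of norm one. -/

section NormOne

variable {a b : ℚ}

/-- The additive group `R[1/p] / n` is finite. -/
theorem IsOrder.exists_finite_classes {p : ℕ} [Fact p.Prime] {R : Subring (Quat a b)}
    (hR : IsOrder R) {n : ℕ} (hn0 : n ≠ 0) (hn : n.Coprime p) :
    ∃ (T : Type) (_ : Finite T) (c : Quat a b → T), ∀ x ∈ invP p R, ∀ y ∈ invP p R,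
      c x = c y → ∃ z ∈ invP p R, x - y = (n : ℚ) • z := by
  classical
  set N : AddSubgroup (invP p R) := (nsmulAddMonoidHom n : invP p R →+ invP p R).range
  have hfin : Finite (invP p R ⧸ N) := by
    have hfg : AddGroup.FG R.toAddSubgroup := (AddGroup.fg_iff_addSubgroup_fg _).2 hR.fg
    let f : R.toAddSubgroup →+ invP p R :=
      { toFun := fun x => ⟨x.1, le_invP p x.2⟩
        map_zero' := rfl
        map_add' := fun _ _ => rfl }
    let g : R.toAddSubgroup →+ invP p R ⧸ N := (QuotientAddGroup.mk' N).comp f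
    -- p is invertible modulo n, so x is congruent to p^(φ(n) k) x, which lies in `R` for the k that
    -- clears the denominator of x. The quotient is then finitely generated and killed by n.
    have hg : Function.Surjective g := by
      intro t
      obtain ⟨⟨x, hx⟩, rfl⟩ := QuotientAddGroup.mk_surjective t
      obtain ⟨k, hk⟩ := mem_invP.1 hx
      have hpow : p ^ (n.totient * k) ≡ 1 [MOD n] := by
        rw [pow_mul]
        simpa using (Nat.ModEq.pow_totient hn.symm).pow k
      have htp : k ≤ n.totient * k := Nat.le_mul_of_pos_left _ (Nat.totient_pos.2 (by omega))
      obtain ⟨u, hu⟩ := (Nat.modEq_iff_dvd.1 hpow.symm)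
      refine ⟨⟨((p : ℚ) ^ (n.totient * k)) • x, ?_⟩, ?_⟩
      · change _ ∈ R
        have := natCast_smul_mem (p ^ (n.totient * k - k)) hk
        rw [smul_smul] at this
        convert this using 2
        push_cast
        rw [← pow_add]; congr 1; omega
      · change QuotientAddGroup.mk _ = QuotientAddGroup.mk _
        rw [QuotientAddGroup.eq]
        refine ⟨⟨(-u : ℤ) • x, zsmul_mem hx _⟩, ?_⟩
        apply Subtype.ext
        change n • ((-u : ℤ) • x) = -(((p : ℚ) ^ (n.totient * k)) • x) + x
        have h2 : ((p : ℚ) ^ (n.totient * k)) = 1 + n * u := by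
          have h3 : ((p : ℤ) ^ (n.totient * k)) - 1 = n * u := by exact_mod_cast hu
          have h4 : ((p : ℤ) ^ (n.totient * k)) = 1 + n * u := by linarith
          exact_mod_cast congrArg (Int.cast : ℤ → ℚ) h4
        rw [h2, ← Int.cast_smul_eq_zsmul ℚ, ← Nat.cast_smul_eq_nsmul ℚ, smul_smul]
        push_cast
        module
    have h1 : AddGroup.FG (invP p R ⧸ N) := AddGroup.fg_of_surjective hg
    refine AddCommGroup.finite_of_fg_isAddTorsion _ fun t => ?_
    obtain ⟨x, rfl⟩ := QuotientAddGroup.mk_surjective t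
    refine isOfFinAddOrder_iff_nsmul_eq_zero.2 ⟨n, Nat.pos_of_ne_zero hn0, ?_⟩
    exact (QuotientAddGroup.eq_zero_iff (N := N) (n • x)).2 ⟨x, rfl⟩
  refine ⟨invP p R ⧸ N, hfin, fun x => if hx : x ∈ invP p R then
    QuotientAddGroup.mk ⟨x, hx⟩ else 0, fun x hx y hy h => ?_⟩
  simp only [dif_pos hx, dif_pos hy] at h
  rw [QuotientAddGroup.eq] at h
  obtain ⟨z, hz⟩ := h
  have hz' : n • (z : Quat a b) = -x + y := congrArg Subtype.val hz
  refine ⟨-z, neg_mem z.2, ?_⟩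
  rw [smul_neg, Nat.cast_smul_eq_nsmul, hz']; abel

lemma nr_sum_le (ha : a < 0) (hb : b < 0) {κ : Type*} (s : Finset κ) (x : κ → Quat a b) :
    nr (∑ i ∈ s, x i) ≤ 2 ^ s.card * ∑ i ∈ s, nr (x i) := by
  classical
  induction s using Finset.induction_on with
  | empty => simp
  | insert i s hi ih =>
    rw [Finset.sum_insert hi, Finset.sum_insert hi, Finset.card_insert_of_notMem hi, pow_succ]
    have h1 := nr_add_le ha hb (x i) (∑ i ∈ s, x i)
    have h2 := nr_nonneg ha hb (x i)
    have h3 : (1 : ℚ) ≤ 2 ^ s.card := one_le_pow₀ (by norm_num)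
    nlinarith

/-- A pigeonhole argument: small elements on which the functionals `f` are divisible by
high powers of `q`. -/
lemma exists_small {q : ℕ} [Fact q.Prime] {s : ℕ} (hs : 0 < s) (e : Fin s × Fin 2 → Quat a b)
    (f : Quat a b →+ (Fin s → ℚ_[q])) (hf1 : ∀ i k, ‖f (e i) k‖ ≤ 1) (j : ℕ) :
    ∃ n : Fin s × Fin 2 → ℤ, n ≠ 0 ∧ (∀ i, |n i| ≤ q ^ j) ∧
      ∀ k, ‖f (∑ i, n i • e i) k‖ ≤ (q : ℝ) ^ (-(2 * j : ℕ) : ℤ) := by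
  have hint : ∀ (n : Fin s × Fin 2 → ℤ) k, ‖f (∑ i, n i • e i) k‖ ≤ 1 := by
    intro n k
    rw [map_sum, Finset.sum_apply]
    refine IsUltrametricDist.norm_sum_le_of_forall_le_of_nonneg zero_le_one fun i _ => ?_
    rw [map_zsmul, Pi.smul_apply, zsmul_eq_mul, norm_mul]
    exact mul_le_one₀ (Padic.norm_int_le_one _) (norm_nonneg _) (hf1 i k)
  let ev : (Fin s × Fin 2 → Fin (q ^ j + 1)) → (Fin s × Fin 2 → ℤ) := fun n i => ((n i : ℕ) : ℤ)
  let v : (Fin s × Fin 2 → ℤ) → Fin s → ℤ_[q] := fun n k => ⟨f (∑ i, n i • e i) k, hint _ k⟩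
  have hv : ∀ n k, ((v n k : ℤ_[q]) : ℚ_[q]) = f (∑ i, n i • e i) k := fun _ _ => rfl
  let F : (Fin s × Fin 2 → Fin (q ^ j + 1)) → (Fin s → ZMod (q ^ (2 * j))) := fun n k =>
    PadicInt.toZModPow (2 * j) (v (ev n) k)
  have hq : 0 < q := (Fact.out : q.Prime).pos
  have : NeZero (q ^ (2 * j)) := ⟨by positivity⟩
  obtain ⟨n, n', hne, hF⟩ : ∃ n n', n ≠ n' ∧ F n = F n' := by
    apply Fintype.exists_ne_map_eq_of_card_lt
    simp only [Fintype.card_pi, ZMod.card, Fintype.card_fin, Finset.prod_const, Finset.card_univ,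
      Fintype.card_prod]
    -- The box of coefficients has (q^j + 1)^(2s) points and there are only q^(2js) residue vectors.
    calc (q ^ (2 * j)) ^ s = (q ^ j) ^ (s * 2) := by rw [← pow_mul, ← pow_mul]; congr 1; ring
      _ < (q ^ j + 1) ^ (s * 2) := Nat.pow_lt_pow_left (by omega) (by omega)
  refine ⟨ev n - ev n', ?_, ?_, ?_⟩
  · intro h
    apply hne
    ext i
    have := congrFun h i
    simp only [ev, Pi.sub_apply, Pi.zero_apply] at this
    omega
  · intro i
    have h1 := (n i).2
    have h2 := (n' i).2
    simp only [ev, Pi.sub_apply]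
    have h3 : ((q : ℤ) ^ j) = ((q ^ j : ℕ) : ℤ) := by push_cast; rfl
    rw [h3, abs_le]; omega
  · intro k
    have h1 := congrFun hF k
    simp only [F] at h1
    rw [← sub_eq_zero, ← map_sub, ← RingHom.mem_ker, PadicInt.ker_toZModPow,
      ← PadicInt.norm_le_pow_iff_mem_span_pow, PadicInt.norm_def] at h1
    convert h1 using 2
    rw [PadicInt.coe_sub, hv, hv, ← Pi.sub_apply, ← map_sub, ← Finset.sum_sub_distrib]
    simp only [← sub_smul, Pi.sub_apply]

/-- A subring closed under conjugation and with enough elements that are small at the prime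
`q` has infinitely many elements of norm one after inverting `q`. -/
theorem infinite_norm_one (ha : a < 0) (hb : b < 0) {q : ℕ} [Fact q.Prime]
    {O : Subring (Quat a b)} (hstar : ∀ x ∈ O, star x ∈ O) (hnr : ∀ x ∈ O, nr x ∈ intQ)
    {s : ℕ} (hs : 0 < s) (e : Fin s × Fin 2 → Quat a b) (he : ∀ i, e i ∈ O)
    (hli : ∀ n : Fin s × Fin 2 → ℤ, ∑ i, n i • e i = 0 → n = 0)
    (f : Quat a b →+ (Fin s → ℚ_[q])) (hf1 : ∀ i k, ‖f (e i) k‖ ≤ 1)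
    (hf : ∀ (n : Fin s × Fin 2 → ℤ) (c : ℝ), (∀ k, ‖f (∑ i, n i • e i) k‖ ≤ c) →
      ‖((nr (∑ i, n i • e i) : ℚ) : ℚ_[q])‖ ≤ c) :
    {γ : Quat a b | γ ∈ invP q O ∧ nr γ = 1}.Infinite := by
  classical
  have hqp : q.Prime := Fact.out
  have hq0 : (q : ℚ) ≠ 0 := by exact_mod_cast hqp.ne_zero
  choose n hn0 hnb hnf using fun j => exists_small hs e f hf1 j
  set x : ℕ → Quat a b := fun j => ∑ i, n j i • e i
  have hxO : ∀ j, x j ∈ O := fun j => sum_mem fun i _ => zsmul_mem (he i) _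
  have hx0 : ∀ j, x j ≠ 0 := fun j h => hn0 j (hli _ h)
  -- a bound for the cofactors
  obtain ⟨C, hC⟩ := exists_nat_ge (2 ^ (Fintype.card (Fin s × Fin 2)) * ∑ i, nr (e i))
  -- The coefficients of `x j` are at most q^j, so its norm is at most C q^(2j), while smallness of
  -- `f` makes the norm divisible by q^(2j). Only a bounded cofactor is left.
  have hm : ∀ j, ∃ m : ℕ, 0 < m ∧ m ≤ C ∧ nr (x j) = m * (q : ℚ) ^ (2 * j) := by
    intro j
    obtain ⟨z, hz⟩ := mem_intQ.1 (hnr _ (hxO j))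
    have h1 := hf (n j) _ (hnf j)
    rw [show ∑ i, n j i • e i = x j from rfl, hz, Rat.cast_intCast,
      Padic.norm_int_le_pow_iff_dvd] at h1
    obtain ⟨m, rfl⟩ := h1
    have hpos : 0 < nr (x j) := nr_pos ha hb (hx0 j)
    have hqj : (0 : ℚ) < (q : ℚ) ^ (2 * j) := by have := hqp.pos; positivity
    rw [hz] at hpos
    push_cast at hpos hz
    have hm0 : (0 : ℚ) < m := by
      by_contra h
      push Not at h
      nlinarith
    lift m to ℕ using by exact_mod_cast hm0.le
    refine ⟨m, by exact_mod_cast hm0, ?_, by rw [hz]; push_cast; ring⟩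
    have h2 : nr (x j) ≤ C * (q : ℚ) ^ (2 * j) := by
      refine (nr_sum_le ha hb _ _).trans ?_
      refine le_trans ?_ (mul_le_mul_of_nonneg_right hC hqj.le)
      rw [mul_assoc, Finset.card_univ]
      refine mul_le_mul_of_nonneg_left ?_ (by positivity)
      rw [Finset.sum_mul]
      refine Finset.sum_le_sum fun i _ => ?_
      rw [← Int.cast_smul_eq_zsmul ℚ, nr_smul, mul_comm]
      refine mul_le_mul_of_nonneg_left ?_ (nr_nonneg ha hb _)
      have h3 : |((n j i : ℤ) : ℚ)| ≤ (q : ℚ) ^ j := by exact_mod_cast hnb j i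
      calc ((n j i : ℤ) : ℚ) ^ 2 = |((n j i : ℤ) : ℚ)| ^ 2 := (sq_abs _).symm
        _ ≤ ((q : ℚ) ^ j) ^ 2 := by gcongr
        _ = _ := by rw [← pow_mul, mul_comm]
    rw [hz, mul_comm] at h2
    have h3 := le_of_mul_le_mul_right h2 hqj
    exact_mod_cast h3
  choose m hm0 hmC hm using hm
  -- Residues modulo C! determine residues modulo every possible cofactor. Indices of one colour
  -- give `x j` with equal cofactor m that are congruent modulo m, so that x_j x̄_{j₀} / m has no
  -- denominator.
  let col : ℕ → Fin (C + 1) × (Fin s × Fin 2 → ZMod C.factorial) := fun j =>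
    (⟨m j, Nat.lt_succ_of_le (hmC j)⟩, fun i => (n j i : ZMod C.factorial))
  have : NeZero C.factorial := ⟨C.factorial_ne_zero⟩
  obtain ⟨y, hy⟩ := Finite.exists_infinite_fiber col
  rw [Set.infinite_coe_iff] at hy
  obtain ⟨j0, hj0⟩ := hy.nonempty
  have hcol : ∀ j ∈ col ⁻¹' {y}, m j = m j0 ∧ ∃ w ∈ O, x j = x j0 + (m j0 : ℚ) • w := by
    intro j hj
    have h1 : col j = col j0 := by rw [Set.mem_preimage, Set.mem_singleton_iff] at hj hj0; rw [hj, hj0]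
    have h2 : m j = m j0 := by
      have := congrArg Prod.fst h1
      simpa [col] using this
    refine ⟨h2, ?_⟩
    have h3 : ∀ i, ((m j0 : ℕ) : ℤ) ∣ n j i - n j0 i := by
      intro i
      have := congrFun (congrArg Prod.snd h1) i
      simp only [col] at this
      rw [eq_comm, ZMod.intCast_eq_intCast_iff_dvd_sub] at this
      exact (Int.natCast_dvd_natCast.2 (Nat.dvd_factorial (hm0 j0) (hmC j0))).trans this
    choose w hw using h3
    refine ⟨∑ i, w i • e i, sum_mem fun i _ => zsmul_mem (he i) _, ?_⟩
    have : x j - x j0 = (m j0 : ℚ) • ∑ i, w i • e i := by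
      simp only [x]
      rw [← Finset.sum_sub_distrib, Finset.smul_sum]
      refine Finset.sum_congr rfl fun i _ => ?_
      rw [← sub_smul, hw, mul_smul, ← Int.cast_smul_eq_zsmul ℚ ((m j0 : ℕ) : ℤ)]
      simp
    rw [← this]; abel
  have hmq : (m j0 : ℚ) ≠ 0 := by exact_mod_cast (hm0 j0).ne'
  let γ : ℕ → Quat a b := fun j => ((m j0 : ℚ)⁻¹ * ((q : ℚ) ^ (j + j0))⁻¹) • (x j * star (x j0))
  have hγ : ∀ j ∈ col ⁻¹' {y}, γ j ∈ {γ : Quat a b | γ ∈ invP q O ∧ nr γ = 1} := by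
    intro j hj
    obtain ⟨h1, w, hw, h2⟩ := hcol j hj
    constructor
    · refine mem_invP.2 ⟨j + j0, ?_⟩
      have h3 : ((q : ℚ) ^ (j + j0)) • γ j
          = ((q ^ (2 * j0) : ℕ) : Quat a b) + w * star (x j0) := by
        simp only [γ]
        rw [smul_smul, h2, add_mul, mul_star_self, hm, smul_mul_assoc]
        rw [← mul_one ((_ : ℚ) : Quat a b), QuaternionAlgebra.coe_mul_eq_smul,
          ← mul_one ((q ^ (2 * j0) : ℕ) : Quat a b), natCast_mul_eq_smul, smul_add, smul_smul,
          smul_smul]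
        push_cast
        congr 2
        · field_simp
        · rw [mul_assoc, mul_assoc, mul_left_comm]
          convert one_smul ℚ _ using 2
          field_simp
      rw [h3]
      exact add_mem (natCast_mem _ _) (mul_mem hw (hstar _ (hxO j0)))
    · simp only [γ]
      rw [nr_smul, nr_mul, nr_star, hm, hm, h1]
      field_simp
      ring
  by_contra hfin
  rw [Set.not_infinite] at hfin
  -- some value is taken infinitely often
  have hyi : Infinite (col ⁻¹' {y}) := hy.to_subtype
  have hfi : Finite {γ : Quat a b | γ ∈ invP q O ∧ nr γ = 1} := hfin
  obtain ⟨g, hg⟩ := Finite.exists_infinite_fiber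
    (fun j : col ⁻¹' {y} => (⟨γ j, hγ j j.2⟩ : {γ : Quat a b | γ ∈ invP q O ∧ nr γ = 1}))
  rw [Set.infinite_coe_iff] at hg
  obtain ⟨J, hJ, hJg⟩ : ∃ J : Set ℕ, J.Infinite ∧ ∀ j ∈ J, γ j = g := by
    refine ⟨_, hg.image (f := Subtype.val) Subtype.val_injective.injOn, ?_⟩
    rintro _ ⟨j, hj, rfl⟩
    exact congrArg Subtype.val hj
  obtain ⟨j1, hj1⟩ := hJ.nonempty
  have hq1 : (1 : ℝ) < q := by exact_mod_cast hqp.one_lt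
  -- If infinitely many j gave the same element of norm one, the `x j` would be proportional by
  -- powers of q, and q^(-2j)-smallness of `f (x j)` would pass to the fixed `x j1`. Its norm would
  -- then vanish.
  have hbound : ∀ j ∈ J, ∀ k, ‖f (x j1) k‖ ≤ (q : ℝ) ^ (-(j : ℤ)) := by
    intro j hj k
    have h1 : γ j = γ j1 := (hJg j hj).trans (hJg j1 hj1).symm
    have h2 : ((q : ℚ) ^ j1 • x j) * star (x j0) = ((q : ℚ) ^ j • x j1) * star (x j0) := by
      have h3 := congrArg (fun z => ((m j0 : ℚ) * (q : ℚ) ^ (j + j1 + j0)) • z) h1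
      simp only [γ, smul_smul] at h3
      rw [smul_mul_assoc, smul_mul_assoc]
      convert h3 using 2
      · rw [show j + j1 + j0 = (j + j0) + j1 by ring, pow_add]; field_simp
      · rw [show j + j1 + j0 = (j1 + j0) + j by ring, pow_add]; field_simp
    have h3 := mul_right_cancel' ha hb (fun h => hx0 j0 (by simpa using congrArg star h)) h2
    have h4 : (q ^ j1) • x j = (q ^ j) • x j1 := by
      rw [← Nat.cast_smul_eq_nsmul ℚ, ← Nat.cast_smul_eq_nsmul ℚ]
      exact_mod_cast h3
    have h5 : ‖((q ^ j1) • f (x j)) k‖ = ‖((q ^ j) • f (x j1)) k‖ := by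
      rw [← map_nsmul, h4, map_nsmul]
    simp only [Pi.smul_apply, nsmul_eq_mul, norm_mul, Nat.cast_pow, norm_pow,
      Padic.norm_p] at h5
    have h6 := hnf j k
    rw [show ∑ i, n j i • e i = x j from rfl] at h6
    have hqj : (0 : ℝ) < ((q : ℝ)⁻¹) ^ j := by positivity
    refine le_of_mul_le_mul_left ?_ hqj
    rw [← h5]
    calc ((q : ℝ)⁻¹) ^ j1 * ‖f (x j) k‖ ≤ 1 * (q : ℝ) ^ (-(2 * j : ℕ) : ℤ) := by
          refine mul_le_mul ?_ h6 (norm_nonneg _) zero_le_one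
          exact pow_le_one₀ (by positivity) (inv_le_one_of_one_le₀ hq1.le)
      _ = _ := by
          rw [one_mul, inv_pow, ← zpow_natCast, ← zpow_neg, ← zpow_add₀ (by positivity)]
          congr 1; push_cast; ring
  have hpos : 0 < ‖((nr (x j1) : ℚ) : ℚ_[q])‖ := by
    rw [norm_pos_iff]
    exact_mod_cast (nr_pos ha hb (hx0 j1)).ne'
  obtain ⟨t, ht⟩ := exists_pow_lt_of_lt_one hpos (inv_lt_one_of_one_lt₀ hq1)
  obtain ⟨j, hj, htj⟩ := hJ.exists_gt t
  have h7 := hf (n j1) _ (hbound j hj)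
  rw [show ∑ i, n j1 i • e i = x j1 from rfl, zpow_neg, zpow_natCast, ← inv_pow] at h7
  have h8 : ((q : ℝ)⁻¹) ^ j ≤ ((q : ℝ)⁻¹) ^ t :=
    pow_le_pow_of_le_one (by positivity) (inv_le_one_of_one_le₀ hq1.le) htj.le
  linarith

end NormOne
end ArithQuot

namespace ArithQuot

/-! ### Splittings at the primes where -A is a square. -/

section Local

variable {a b : ℚ}

/-- The multiple `c i` of the first quaternion unit. -/
def elI (a b c : ℚ) : Quat a b := ⟨0, c, 0, 0⟩

/-- The multiple `c j` of the second quaternion unit. -/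
def elJ (a b c : ℚ) : Quat a b := ⟨0, 0, c, 0⟩

/-- Hensel lifting of `r`: the derivative 2r is a unit because q does not divide 2A. -/
lemma exists_sq_eq_neg {q : ℕ} [Fact q.Prime] {A : ℕ} (hA : ¬ q ∣ 2 * A) {r : ℤ}
    (hr : (q : ℤ) ∣ r ^ 2 + A) : ∃ ρ : ℚ_[q], ‖ρ‖ = 1 ∧ ρ * ρ = -A := by
  have hqp : q.Prime := Fact.out
  have hr1 : ¬ (q : ℤ) ∣ 2 * r := by
    intro h
    apply hA
    have hp : Prime (q : ℤ) := Nat.prime_iff_prime_int.1 hqp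
    rcases hp.dvd_or_dvd h with h | h
    · exact (Int.natCast_dvd_natCast.1 (by exact_mod_cast h)).mul_right _
    · have : (q : ℤ) ∣ A := by
        have h2 : (q : ℤ) ∣ r ^ 2 := dvd_pow h two_ne_zero
        exact (dvd_add_right h2).1 hr
      exact (Int.natCast_dvd_natCast.1 this).mul_left _
  let F : Polynomial ℤ_[q] := Polynomial.X ^ 2 + Polynomial.C (A : ℤ_[q])
  have hF : ∀ z : ℤ_[q], F.aeval z = z ^ 2 + A := by intro z; simp [F]
  have hF' : ∀ z : ℤ_[q], F.derivative.aeval z = 2 * z := by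
    intro z; simp [F, one_add_one_eq_two]
  have hn : ‖((2 * r : ℤ) : ℤ_[q])‖ = 1 := by
    refine le_antisymm (PadicInt.norm_le_one _) ?_
    by_contra h
    push Not at h
    exact hr1 (PadicInt.norm_int_lt_one_iff_dvd _ |>.1 h)
  obtain ⟨z, hz, hz1, hz2, -⟩ := hensels_lemma (F := F) (a := (r : ℤ_[q])) (by
    rw [hF, hF']
    push_cast at hn
    rw [hn]
    have : ((r : ℤ_[q]) ^ 2 + A) = ((r ^ 2 + A : ℤ) : ℤ_[q]) := by push_cast; rfl
    rw [this]
    simpa using (PadicInt.norm_int_lt_one_iff_dvd _).2 hr)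
  rw [hF] at hz
  refine ⟨z, ?_, ?_⟩
  · have h1 : ‖z ^ 2‖ = 1 := by
      rw [eq_neg_of_add_eq_zero_left hz, norm_neg, PadicInt.norm_def]
      have hnA : ¬ q ∣ A := fun h => hA (h.mul_left _)
      have := pabs_natCast_of_not_dvd hnA
      simpa [pabs] using this
    rw [norm_pow] at h1
    exact (pow_eq_one_iff_of_nonneg (norm_nonneg _) two_ne_zero).1 h1
  · have := congrArg (fun t : ℤ_[q] => (t : ℚ_[q])) hz
    simp only [PadicInt.coe_add, PadicInt.coe_pow, PadicInt.coe_natCast, PadicInt.coe_zero] at this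
    linear_combination this

lemma rat_smul_matrix {K : Type*} [Field K] [Algebra ℚ K] (c : ℚ) (M : Matrix (Fin 2) (Fin 2) K) :
    c • M = (c : K) • M := by
  ext i j
  simp [Algebra.smul_def]

/-- The splitting is written in coordinates so that the first quaternion unit becomes diagonal and
integrality of the matrix can be compared with integrality of the coordinates. -/
lemma exists_local_hom {q : ℕ} [Fact q.Prime] {c c' : ℚ} (hc : c ≠ 0) (hc' : c' ≠ 0)
    {A B : ℚ} (hA : A = -(c ^ 2 * a)) (hB : B = -(c' ^ 2 * b)) {ρ : ℚ_[q]}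
    (hρ : ρ * ρ = -A) :
    ∃ κ : Quat a b →ₐ[ℚ] Matrix (Fin 2) (Fin 2) ℚ_[q], ∀ x : Quat a b,
      κ x = !![(x.re : ℚ_[q]) + (x.imI / c : ℚ) * ρ,
          -(B : ℚ_[q]) * ((x.imJ / c' : ℚ) + (x.imK / (c * c') : ℚ) * ρ);
        ((x.imJ / c' : ℚ) : ℚ_[q]) - (x.imK / (c * c') : ℚ) * ρ,
          (x.re : ℚ_[q]) - (x.imI / c : ℚ) * ρ] := by
  have hcK : (c : ℚ_[q]) ≠ 0 := by exact_mod_cast hc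
  have hcK' : (c' : ℚ_[q]) ≠ 0 := by exact_mod_cast hc'
  have haK : (a : ℚ_[q]) = -(A : ℚ_[q]) / (c : ℚ_[q]) ^ 2 := by
    rw [hA]; push_cast; field_simp
  have hbK : (b : ℚ_[q]) = -(B : ℚ_[q]) / (c' : ℚ_[q]) ^ 2 := by
    rw [hB]; push_cast; field_simp
  let bs : QuaternionAlgebra.Basis (Matrix (Fin 2) (Fin 2) ℚ_[q]) a 0 b :=
    { i := !![ρ / c, 0; 0, -ρ / c]
      j := !![0, -B / c'; 1 / c', 0]
      k := !![0, -(B * ρ) / (c * c'); -ρ / (c * c'), 0]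
      i_mul_i := by
        ext i j
        fin_cases i <;> fin_cases j <;> simp [rat_smul_matrix, haK] <;> field_simp <;>
          linear_combination hρ
      j_mul_j := by
        ext i j
        fin_cases i <;> fin_cases j <;> simp [hbK] <;> field_simp
      i_mul_j := by
        ext i j
        fin_cases i <;> fin_cases j <;> simp <;> field_simp
      j_mul_i := by
        ext i j
        fin_cases i <;> fin_cases j <;> simp <;> field_simp }
  refine ⟨bs.liftHom, ?_⟩
  intro x
  change algebraMap ℚ _ x.re + x.imI • bs.i + x.imJ • bs.j + x.imK • bs.k = _
  rw [Algebra.algebraMap_eq_smul_one, rat_smul_matrix, rat_smul_matrix, rat_smul_matrix,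
    rat_smul_matrix]
  ext i j
  fin_cases i <;> fin_cases j <;> simp [bs] <;> field_simp <;> ring

lemma pabs_le_one_iff {q : ℕ} [Fact q.Prime] {x : ℚ} : pabs q x ≤ 1 ↔ ¬ q ∣ x.den := by
  have hq1 : (1 : ℝ) < q := by exact_mod_cast (Fact.out : q.Prime).one_lt
  refine ⟨fun h hd => ?_, fun h => Padic.norm_rat_le_one h⟩
  have h1 : pabs q (x.den : ℚ) < 1 := by
    rw [pabs, Rat.cast_natCast]
    exact Padic.norm_natCast_lt_one_iff.2 hd
  have h2 : pabs q (x.num : ℚ) = 1 := by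
    have h3 : ¬ q ∣ x.num.natAbs := fun h3 =>
      Nat.not_coprime_of_dvd_of_dvd (Fact.out : q.Prime).one_lt h3 hd x.reduced
    have h4 := pabs_natCast_of_not_dvd h3
    rcases Int.natAbs_eq x.num with h5 | h5
    · rwa [show (x.num : ℚ) = ((x.num.natAbs : ℕ) : ℚ) by
        rw [← Int.cast_natCast]; exact congrArg _ h5]
    · rwa [show (x.num : ℚ) = -((x.num.natAbs : ℕ) : ℚ) by
        rw [← Int.cast_natCast, ← Int.cast_neg]; exact congrArg _ h5, pabs_neg]
  have h3 : pabs q (x.num : ℚ) = pabs q x * pabs q (x.den : ℚ) := by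
    rw [← pabs_mul, Rat.mul_den_eq_num]
  rw [h2] at h3
  nlinarith [pabs_nonneg (ℓ := q) x, pabs_nonneg (ℓ := q) (x.den : ℚ)]

lemma norm_le_one_of_add_sub {q : ℕ} [Fact q.Prime] (h2 : ‖(2 : ℚ_[q])‖ = 1) {u v : ℚ_[q]}
    (h : ‖u + v‖ ≤ 1) (h' : ‖u - v‖ ≤ 1) : ‖u‖ ≤ 1 ∧ ‖v‖ ≤ 1 := by
  constructor
  · have : ‖2 * u‖ ≤ 1 := by
      rw [show 2 * u = (u + v) + (u - v) by ring]
      exact (Padic.nonarchimedean _ _).trans (max_le h h')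
    rwa [norm_mul, h2, one_mul] at this
  · have : ‖2 * v‖ ≤ 1 := by
      rw [show 2 * v = (u + v) + -(u - v) by ring]
      exact (Padic.nonarchimedean _ _).trans (max_le h (by rwa [norm_neg]))
    rwa [norm_mul, h2, one_mul] at this

/-- Multiples of the standard quaternion units in an order `R`, and splittings at
almost all primes at which the first unit splits. -/
theorem IsOrder.exists_frame {R : Subring (Quat a b)} (hR : IsOrder R) (ha : a < 0) (hb : b < 0)
    {p : ℕ} (hp : p ≠ 0) :
    ∃ c c' A B M₀ : ℕ, 0 < c ∧ 0 < c' ∧ 2 ≤ A ∧ p ∣ B ∧ 0 < M₀ ∧ 2 * A ∣ M₀ ∧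
      (A : ℚ) = -(c ^ 2 * a) ∧ (B : ℚ) = -(c' ^ 2 * b) ∧ elI a b c ∈ R ∧ elJ a b c' ∈ R ∧
      ∀ (q : ℕ) [Fact q.Prime], ¬ q ∣ M₀ → ∀ r : ℤ, (q : ℤ) ∣ r ^ 2 + A →
        ∃ (κ : Quat a b →ₐ[ℚ] Matrix (Fin 2) (Fin 2) ℚ_[q]) (ρ : ℚ_[q]), ‖ρ‖ = 1 ∧
          κ (elI a b c) = !![ρ, 0; 0, -ρ] ∧
          ∀ x, EntryLe (κ x) 1 ↔ ∃ N : ℕ, N.Coprime q ∧ (N : ℚ) • x ∈ R := by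
  obtain ⟨N, hN, hNR⟩ := hR.exists_smul_latticeD
  obtain ⟨D, hD, hDR⟩ := hR.exists_latticeD
  -- Used for a and for b. The factor N of `c` puts the multiple of the quaternion unit into `R`,
  -- the factor 2 ensures A ≥ 2, and m is a prescribed divisor. Taking m = p for b makes 1 + B prime
  -- to p.
  have key : ∀ (e : ℚ) (m : ℕ), 0 < m → e < 0 → ∃ c A : ℕ, 0 < c ∧ 2 ≤ A ∧ m ∣ A ∧ N ∣ c ∧
      (A : ℚ) = -(c ^ 2 * e) := by
    intro e m hm he
    have hden : (0 : ℚ) < e.den := by exact_mod_cast e.den_pos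
    have hnum : e.num < 0 := Rat.num_neg.2 he
    refine ⟨2 * m * N * e.den, (2 * m * N) ^ 2 * e.den * e.num.natAbs, ?_, ?_, ?_,
      ⟨2 * m * e.den, by ring⟩, ?_⟩
    · have := e.den_pos; positivity
    · have h1 : 1 ≤ e.den * e.num.natAbs :=
        Nat.mul_pos e.den_pos (Int.natAbs_pos.2 hnum.ne)
      have h2 : 2 ≤ (2 * m * N) ^ 2 := by
        have : 1 ≤ m * N := Nat.mul_pos hm hN
        nlinarith
      rw [mul_assoc]
      nlinarith
    · exact ⟨4 * m * N ^ 2 * e.den * e.num.natAbs, by ring⟩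
    · have h1 : ((e.num.natAbs : ℕ) : ℚ) = -e.num := by
        rw [Nat.cast_natAbs, abs_of_neg hnum]; push_cast; rfl
      have h2 : (e.num : ℚ) = e * e.den := (Rat.mul_den_eq_num e).symm
      push_cast
      rw [h1, h2]; ring
  obtain ⟨c, A, hc, hA2, -, hNc, hA⟩ := key a 1 one_pos ha
  obtain ⟨c', B, hc', hB2, hpB, hNc', hB⟩ := key b p (Nat.pos_of_ne_zero hp) hb
  have hmul : ∀ m : ℕ, N ∣ m → ∀ x ∈ latticeD a b 1, (m : ℚ) • x ∈ R := by
    rintro m ⟨k, rfl⟩ x hx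
    have := natCast_smul_mem k (hNR x hx)
    rw [smul_smul] at this
    convert this using 2
    push_cast; ring
  have hI : elI a b c ∈ R := by
    have := hmul c hNc ⟨0, 1, 0, 0⟩ (by simp [latticeD])
    convert this using 1
    ext <;> simp [elI]
  have hJ : elJ a b c' ∈ R := by
    have := hmul c' hNc' ⟨0, 0, 1, 0⟩ (by simp [latticeD])
    convert this using 1
    ext <;> simp [elJ]
  -- Outside the divisors of this number 2, A, B, c, c', D are units, and so is N, which divides c.
  -- There `R` agrees locally with the standard lattice, and the entries of the matrix are integral
  -- exactly when the coordinates are.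
  refine ⟨c, c', A, B, 2 * A * (B * c * c' * D), hc, hc', hA2, hpB, by positivity,
    dvd_mul_right _ _, hA, hB, hI, hJ, ?_⟩
  intro q _ hq r hr
  have h2A : ¬ q ∣ 2 * A := fun h => hq (h.mul_right _)
  have hu : ∀ m : ℕ, m ∣ 2 * A * (B * c * c' * D) → ‖(m : ℚ_[q])‖ = 1 := by
    intro m hm
    have := pabs_natCast_of_not_dvd (fun h => hq (h.trans hm))
    simpa [pabs] using this
  have u2 : ‖(2 : ℚ_[q])‖ = 1 := by
    exact_mod_cast hu 2 ((dvd_mul_right _ _).mul_right _)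
  have uB := hu B ⟨2 * A * (c * c' * D), by ring⟩
  have uc := hu c ⟨2 * A * (B * c' * D), by ring⟩
  have uc' := hu c' ⟨2 * A * (B * c * D), by ring⟩
  have uD := hu D ⟨2 * A * (B * c * c'), by ring⟩
  obtain ⟨ρ, hρ1, hρ⟩ := exists_sq_eq_neg h2A hr
  have hcQ : (c : ℚ) ≠ 0 := by exact_mod_cast hc.ne'
  have hcQ' : (c' : ℚ) ≠ 0 := by exact_mod_cast hc'.ne'
  obtain ⟨κ, hκ⟩ := exists_local_hom (a := a) (b := b) hcQ hcQ' hA hB (ρ := ρ) (by exact_mod_cast hρ)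
  refine ⟨κ, ρ, hρ1, ?_, fun x => ⟨fun h => ?_, ?_⟩⟩
  · rw [hκ]; simp [elI, hcQ]
  · have e00 := h 0 0
    have e01 := h 0 1
    have e10 := h 1 0
    have e11 := h 1 1
    rw [hκ] at e00 e01 e10 e11
    simp only [Matrix.of_apply, Matrix.cons_val', Matrix.cons_val_zero, Matrix.cons_val_one,
      Matrix.cons_val_fin_one, Rat.cast_natCast, norm_mul, norm_neg, uB, one_mul] at e00 e01 e10 e11
    have k1 := norm_le_one_of_add_sub u2 e00 e11
    have k2 := norm_le_one_of_add_sub u2 e01 e10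
    simp only [norm_mul, hρ1, mul_one, Rat.cast_div, Rat.cast_mul, Rat.cast_natCast, norm_div, uc,
      uc', div_one] at k1 k2
    have d0 := pabs_le_one_iff.1 k1.1
    have d1 := pabs_le_one_iff.1 k1.2
    have d2 := pabs_le_one_iff.1 k2.1
    have d3 := pabs_le_one_iff.1 k2.2
    have hqp : q.Prime := Fact.out
    have dc : ¬ q ∣ c := fun h => hq (h.trans ⟨2 * A * (B * c' * D), by ring⟩)
    have dc' : ¬ q ∣ c' := fun h => hq (h.trans ⟨2 * A * (B * c * D), by ring⟩)
    have hNN : ¬ q ∣ N := fun h => dc (h.trans hNc)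
    refine ⟨N * (x.re.den * x.imI.den * x.imJ.den * x.imK.den), ?_, ?_⟩
    · rw [Nat.coprime_comm, hqp.coprime_iff_not_dvd]
      simp only [hqp.dvd_mul]
      tauto
    · have := hmul N dvd_rfl (((x.re.den * x.imI.den * x.imJ.den * x.imK.den : ℕ) : ℚ) • x) (by
        have n0 := Rat.mul_den_eq_num x.re
        have n1 := Rat.mul_den_eq_num x.imI
        have n2 := Rat.mul_den_eq_num x.imJ
        have n3 := Rat.mul_den_eq_num x.imK
        change (_ ∧ _ ∧ _ ∧ _)
        simp only [one_mul, QuaternionAlgebra.re_smul, QuaternionAlgebra.imI_smul,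
          QuaternionAlgebra.imJ_smul, QuaternionAlgebra.imK_smul, smul_eq_mul]
        refine ⟨?_, ?_, ?_, ?_⟩
        · exact mem_intQ.2 ⟨x.re.num * (x.imI.den * x.imJ.den * x.imK.den), by
            push_cast; rw [← n0]; ring⟩
        · exact mem_intQ.2 ⟨x.imI.num * (x.re.den * x.imJ.den * x.imK.den), by
            push_cast; rw [← n1]; ring⟩
        · exact mem_intQ.2 ⟨x.imJ.num * (x.re.den * x.imI.den * x.imK.den), by
            push_cast; rw [← n2]; ring⟩
        · exact mem_intQ.2 ⟨x.imK.num * (x.re.den * x.imI.den * x.imJ.den), by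
            push_cast; rw [← n3]; ring⟩)
      rw [smul_smul] at this
      exact_mod_cast this
  · rintro ⟨m, hm, hmx⟩
    have um : ‖(m : ℚ_[q])‖ = 1 := (Padic.norm_natCast_eq_one_iff).2 hm.symm
    have hco : ∀ t : ℚ, (D : ℚ) * ((m : ℚ) * t) ∈ intQ → ‖(t : ℚ_[q])‖ ≤ 1 := by
      intro t ht
      have := pabs_le_one_of_mem_intQ (ℓ := q) ht
      rw [pabs_mul, pabs_mul] at this
      simpa [pabs, uD, um] using this
    obtain ⟨k0, k1, k2, k3⟩ := hDR _ hmx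
    have c0 := hco _ k0
    have c1 := hco _ k1
    have c2 := hco _ k2
    have c3 := hco _ k3
    have f1 : ‖((x.imI / c : ℚ) : ℚ_[q]) * ρ‖ ≤ 1 := by
      simpa [norm_mul, norm_div, uc, hρ1] using c1
    have f2 : ‖((x.imJ / c' : ℚ) : ℚ_[q])‖ ≤ 1 := by
      simpa [norm_div, uc'] using c2
    have f3 : ‖((x.imK / (c * c') : ℚ) : ℚ_[q]) * ρ‖ ≤ 1 := by
      simpa [norm_mul, norm_div, uc, uc', hρ1] using c3
    have hadd : ∀ u v : ℚ_[q], ‖u‖ ≤ 1 → ‖v‖ ≤ 1 → ‖u + v‖ ≤ 1 := fun u v hu hv =>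
      (Padic.nonarchimedean _ _).trans (max_le hu hv)
    have hsub : ∀ u v : ℚ_[q], ‖u‖ ≤ 1 → ‖v‖ ≤ 1 → ‖u - v‖ ≤ 1 := fun u v hu hv => by
      rw [sub_eq_add_neg]; exact hadd _ _ hu (by rwa [norm_neg])
    rw [hκ]
    intro i j
    fin_cases i <;> fin_cases j
    · exact hadd _ _ c0 f1
    · change ‖-((B : ℚ) : ℚ_[q]) * _‖ ≤ 1
      rw [norm_mul, norm_neg, Rat.cast_natCast, uB, one_mul]
      exact hadd _ _ f2 f3
    · exact hsub _ _ f2 f3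
    · exact hsub _ _ c0 f1

end Local
end ArithQuot

namespace ArithQuot

/-! ### Closed submonoids of M₂(ℚ_q) that contain SL₂(ℚ_q). -/

section Density

variable {q : ℕ} [Fact q.Prime]

-- Conjugation by diag(l, l⁻¹)^m multiplies the upper right entry by l^(2m) and shrinks the lower
-- left one. Applied to elements tending to 1, with m chosen to keep the upper right entry between r
-- and r|l|², it has a unipotent limit point by compactness.
open Filter Topology in
lemma exists_upper_mem {H : Submonoid (Matrix (Fin 2) (Fin 2) ℚ_[q])}
    (hH : IsClosed (H : Set (Matrix (Fin 2) (Fin 2) ℚ_[q]))) {l : ℚ_[q]} (hl : 1 < ‖l‖)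
    (h1 : !![l, 0; 0, l⁻¹] ∈ H) (h2 : !![l⁻¹, 0; 0, l] ∈ H)
    (hA : ∀ k : ℕ, ∃ A ∈ H, EntryLe (A - 1) ((q : ℝ) ^ (-(k : ℤ))) ∧ A 0 1 ≠ 0)
    {r : ℝ} (hr : 0 < r) : ∃ β : ℚ_[q], r ≤ ‖β‖ ∧ !![1, β; 0, 1] ∈ H := by
  have hq1 : (1 : ℝ) < q := by exact_mod_cast (Fact.out : q.Prime).one_lt
  have hl0 : l ≠ 0 := by rintro rfl; simp at hl; linarith
  obtain ⟨k0, hk0⟩ := exists_pow_lt_of_lt_one hr (inv_lt_one_of_one_lt₀ hq1)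
  choose A hAH hA1 hA0 using hA
  set y : ℝ := ‖l‖ ^ 2 with hy
  have hy1 : 1 < y := by rw [hy]; exact one_lt_pow₀ hl two_ne_zero
  have hsmall : ∀ k, ((q : ℝ) ^ (-((k0 + k : ℕ) : ℤ))) ≤ ((q : ℝ)⁻¹) ^ k := by
    intro k
    rw [zpow_neg, zpow_natCast, ← inv_pow]
    exact pow_le_pow_of_le_one (by positivity) (inv_le_one_of_one_le₀ hq1.le) (by omega)
  have hm : ∀ k, ∃ m : ℕ, r ≤ ‖l ^ (2 * m) * A (k0 + k) 0 1‖ ∧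
      ‖l ^ (2 * m) * A (k0 + k) 0 1‖ ≤ r * y := by
    intro k
    have hb0 : 0 < ‖A (k0 + k) 0 1‖ := norm_pos_iff.2 (hA0 _)
    have hbr : ‖A (k0 + k) 0 1‖ < r := by
      have h3 := hA1 (k0 + k) 0 1
      simp only [Matrix.sub_apply, Matrix.one_apply_ne (show (0 : Fin 2) ≠ 1 by decide), sub_zero] at h3
      refine lt_of_le_of_lt h3 (lt_of_le_of_lt ?_ hk0)
      rw [zpow_neg, zpow_natCast, ← inv_pow]
      exact pow_le_pow_of_le_one (by positivity) (inv_le_one_of_one_le₀ hq1.le) (by omega)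
    obtain ⟨n, hn1, hn2⟩ := exists_mem_Ico_zpow (div_pos hb0 hr) hy1
    have hn0 : n < 0 := by
      by_contra h
      push Not at h
      have : 1 ≤ y ^ n := one_le_zpow₀ hy1.le h
      have h4 : ‖A (k0 + k) 0 1‖ / r < 1 := (div_lt_one hr).2 hbr
      linarith
    obtain ⟨m, rfl⟩ : ∃ m : ℕ, n = -(m : ℤ) := ⟨n.natAbs, by omega⟩
    have hym : (0 : ℝ) < y ^ m := by positivity
    rw [le_div_iff₀ hr, zpow_neg, zpow_natCast] at hn1
    rw [div_lt_iff₀ hr, zpow_add₀ (by positivity), zpow_neg, zpow_natCast, zpow_one] at hn2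
    refine ⟨m, ?_, ?_⟩ <;> rw [norm_mul, norm_pow, pow_mul, ← hy]
    · calc r = y ^ m * ((y ^ m)⁻¹ * r) := by field_simp
        _ ≤ _ := by gcongr
    · calc y ^ m * ‖A (k0 + k) 0 1‖ ≤ y ^ m * ((y ^ m)⁻¹ * y * r) := by gcongr
        _ = r * y := by field_simp
  choose m hm1 hm2 using hm
  set β : ℕ → ℚ_[q] := fun k => l ^ (2 * m k) * A (k0 + k) 0 1
  obtain ⟨β₀, hβ₀, φ, hφ, hlim⟩ := (isCompact_closedBall (0 : ℚ_[q]) (r * y)).tendsto_subseq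
    (x := β) (fun k => mem_closedBall_zero_iff.2 (hm2 k))
  refine ⟨β₀, ?_, ?_⟩
  · exact le_of_tendsto_of_tendsto' tendsto_const_nhds hlim.norm (fun k => hm1 (φ k))
  · let N : ℕ → Matrix (Fin 2) (Fin 2) ℚ_[q] := fun k =>
      !![l, 0; 0, l⁻¹] ^ m k * A (k0 + k) * !![l⁻¹, 0; 0, l] ^ m k
    have hN : ∀ k, N k ∈ H := fun k => mul_mem (mul_mem (pow_mem h1 _) (hAH _)) (pow_mem h2 _)
    have hdiag : ∀ (u v : ℚ_[q]) (n : ℕ), !![u, 0; 0, v] ^ n = !![u ^ n, 0; 0, v ^ n] := by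
      intro u v n
      induction n with
      | zero => ext i j; fin_cases i <;> fin_cases j <;> simp
      | succ n ih => rw [pow_succ, ih]; ext i j; fin_cases i <;> fin_cases j <;> simp [pow_succ]
    have hNe : ∀ k, N k = !![A (k0 + k) 0 0, β k; (l⁻¹) ^ (2 * m k) * A (k0 + k) 1 0,
        A (k0 + k) 1 1] := by
      intro k
      simp only [N, hdiag]
      ext i j
      fin_cases i <;> fin_cases j <;> simp [Matrix.mul_apply, Fin.sum_univ_two, Matrix.vecMul, dotProduct, β] <;>
        field_simp <;> ring
    have hconv : ∀ i j, Tendsto (fun k => (A (k0 + k) - 1) i j) atTop (𝓝 0) := by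
      intro i j
      refine squeeze_zero_norm (fun k => (hA1 (k0 + k) i j).trans (hsmall k)) ?_
      exact tendsto_pow_atTop_nhds_zero_of_lt_one (by positivity) (inv_lt_one_of_one_lt₀ hq1)
    have hlimN : Tendsto (fun k => N (φ k)) atTop (𝓝 !![1, β₀; 0, 1]) := by
      refine tendsto_pi_nhds.2 fun i => tendsto_pi_nhds.2 fun j => ?_
      simp only [hNe]
      fin_cases i <;> fin_cases j
      · have := ((hconv 0 0).add_const 1).comp hφ.tendsto_atTop
        simpa [Function.comp_def] using this
      · simpa [Function.comp_def] using hlim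
      · have h3 : Tendsto (fun k => (l⁻¹) ^ (2 * m k) * A (k0 + k) 1 0) atTop (𝓝 0) := by
          refine squeeze_zero_norm (a := fun k => ((q : ℝ)⁻¹) ^ k) (fun k => ?_)
            (tendsto_pow_atTop_nhds_zero_of_lt_one (by positivity) (inv_lt_one_of_one_lt₀ hq1))
          have h4 := (hA1 (k0 + k) 1 0).trans (hsmall k)
          simp only [Matrix.sub_apply, Matrix.one_apply_ne (show (1 : Fin 2) ≠ 0 by decide),
            sub_zero] at h4
          rw [norm_mul, norm_pow, norm_inv]
          refine le_trans (mul_le_of_le_one_left (norm_nonneg _) ?_) h4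
          exact pow_le_one₀ (by positivity) (inv_le_one_of_one_le₀ hl.le)
        simpa [Function.comp_def] using h3.comp hφ.tendsto_atTop
      · have := ((hconv 1 1).add_const 1).comp hφ.tendsto_atTop
        simpa [Function.comp_def] using this
    exact hH.mem_of_tendsto hlimN (Eventually.of_forall fun k => hN _)

/-- Powers of one unipotent element and closedness give all ℤ_q-multiples of its entry β, and β can
be taken larger than `u`. -/
lemma upper_mem {H : Submonoid (Matrix (Fin 2) (Fin 2) ℚ_[q])}
    (hH : IsClosed (H : Set (Matrix (Fin 2) (Fin 2) ℚ_[q]))) {l : ℚ_[q]} (hl : 1 < ‖l‖)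
    (h1 : !![l, 0; 0, l⁻¹] ∈ H) (h2 : !![l⁻¹, 0; 0, l] ∈ H)
    (hA : ∀ k : ℕ, ∃ A ∈ H, EntryLe (A - 1) ((q : ℝ) ^ (-(k : ℤ))) ∧ A 0 1 ≠ 0) (u : ℚ_[q]) :
    !![1, u; 0, 1] ∈ H := by
  obtain ⟨β, hβ, hβH⟩ := exists_upper_mem hH hl h1 h2 hA (r := max 1 ‖u‖) (by positivity)
  have hβ0 : β ≠ 0 := by
    rintro rfl
    have := (le_max_left (1 : ℝ) ‖u‖).trans hβ
    simp at this; linarith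
  have hz : ∀ z : ℤ_[q], !![1, (z : ℚ_[q]) * β; 0, 1] ∈ H := by
    intro z
    refine PadicInt.denseRange_natCast.induction_on (p := fun z : ℤ_[q] =>
      !![1, (z : ℚ_[q]) * β; 0, 1] ∈ H) z ?_ ?_
    · refine hH.preimage (f := fun z : ℤ_[q] => !![1, (z : ℚ_[q]) * β; 0, 1]) ?_
      refine continuous_pi fun i => continuous_pi fun j => ?_
      fin_cases i <;> fin_cases j
      · exact continuous_const
      · exact continuous_subtype_val.mul continuous_const
      · exact continuous_const
      · exact continuous_const
    · intro n
      have : !![1, (((n : ℤ_[q])) : ℚ_[q]) * β; 0, 1] = !![1, β; 0, 1] ^ n := by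
        induction n with
        | zero => ext i j; fin_cases i <;> fin_cases j <;> simp
        | succ n ih =>
          rw [pow_succ, ← ih]
          ext i j
          fin_cases i <;> fin_cases j <;> simp
          ring
      rw [this]
      exact pow_mem hβH n
  have hn : ‖u / β‖ ≤ 1 := by
    rw [norm_div, div_le_one (norm_pos_iff.2 hβ0)]
    exact (le_max_right _ _).trans hβ
  have := hz ⟨u / β, hn⟩
  change !![1, u / β * β; 0, 1] ∈ H at this
  rwa [div_mul_cancel₀ _ hβ0] at this

/-- A closed submonoid of `M₂(ℚ_q)` containing a hyperbolic diagonal element and elements close to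
the identity with nonzero off-diagonal entries contains `SL₂(ℚ_q)`. -/
lemma mem_of_det_eq_one {H : Submonoid (Matrix (Fin 2) (Fin 2) ℚ_[q])}
    (hH : IsClosed (H : Set (Matrix (Fin 2) (Fin 2) ℚ_[q]))) {l : ℚ_[q]} (hl : 1 < ‖l‖)
    (h1 : !![l, 0; 0, l⁻¹] ∈ H) (h2 : !![l⁻¹, 0; 0, l] ∈ H)
    (hA : ∀ k : ℕ, ∃ A ∈ H, EntryLe (A - 1) ((q : ℝ) ^ (-(k : ℤ))) ∧ A 0 1 ≠ 0 ∧ A 1 0 ≠ 0)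
    {s : Matrix (Fin 2) (Fin 2) ℚ_[q]} (hs : s.det = 1) : s ∈ H := by
  have hup := upper_mem hH hl h1 h2 fun k => by
    obtain ⟨A, hA1, hA2, hA3, -⟩ := hA k; exact ⟨A, hA1, hA2, hA3⟩
  -- The transposed submonoid satisfies the same hypotheses, so the lower unipotents come for free;
  -- elementary matrices generate SL₂.
  let H' : Submonoid (Matrix (Fin 2) (Fin 2) ℚ_[q]) :=
    { carrier := {A | A.transpose ∈ H}
      one_mem' := by simp
      mul_mem' := by
        intro A B hA hB
        simp only [Set.mem_ofPred_eq, Matrix.transpose_mul] at hA hB ⊢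
        exact mul_mem hB hA }
  have hH' : IsClosed (H' : Set (Matrix (Fin 2) (Fin 2) ℚ_[q])) :=
    hH.preimage (continuous_id.matrix_transpose)
  have hdt : ∀ u v : ℚ_[q], (!![u, 0; 0, v] : Matrix (Fin 2) (Fin 2) ℚ_[q]).transpose
      = !![u, 0; 0, v] := by
    intro u v; ext i j; fin_cases i <;> fin_cases j <;> rfl
  have hlow : ∀ u : ℚ_[q], !![1, 0; u, 1] ∈ H := by
    intro u
    have := upper_mem hH' hl (show _ ∈ H by rw [hdt]; exact h1) (show _ ∈ H by rw [hdt]; exact h2)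
      (fun k => by
        obtain ⟨A, hA1, hA2, -, hA3⟩ := hA k
        refine ⟨A.transpose, by simpa [H'] using hA1, fun i j => ?_, hA3⟩
        have := hA2 j i
        simpa [Matrix.one_apply, eq_comm] using this) u
    have h3 : (!![1, u; 0, 1] : Matrix (Fin 2) (Fin 2) ℚ_[q]).transpose = !![1, 0; u, 1] := by
      ext i j; fin_cases i <;> fin_cases j <;> rfl
    rw [← h3]; exact this
  have key : ∀ t : Matrix (Fin 2) (Fin 2) ℚ_[q], t.det = 1 → t 1 0 ≠ 0 → t ∈ H := by
    intro t ht hc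
    have : t = !![1, (t 0 0 - 1) / t 1 0; 0, 1] * !![1, 0; t 1 0, 1] *
        !![1, (t 1 1 - 1) / t 1 0; 0, 1] := by
      rw [Matrix.det_fin_two] at ht
      ext i j
      fin_cases i <;> fin_cases j <;> simp <;> field_simp
      · ring
      · linear_combination -ht
      · ring
    rw [this]
    exact mul_mem (mul_mem (hup _) (hlow _)) (hup _)
  by_cases hc : s 1 0 = 0
  · have hd : s 1 1 ≠ 0 := by
      intro hd; rw [Matrix.det_fin_two, hc, hd] at hs; simp at hs
    have h3 : s * !![1, 0; 1, 1] ∈ H := by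
      refine key _ ?_ ?_
      · rw [Matrix.det_mul, hs, Matrix.det_fin_two]; simp
      · simp [Matrix.mul_apply, Fin.sum_univ_two, hc, hd]
    have h4 : s = s * !![1, 0; 1, 1] * !![1, 0; -1, 1] := by
      rw [mul_assoc]
      have : (!![1, 0; 1, 1] * !![1, 0; -1, 1] : Matrix (Fin 2) (Fin 2) ℚ_[q]) = 1 := by
        ext i j; fin_cases i <;> fin_cases j <;> simp
      rw [this, mul_one]
    rw [h4]
    exact mul_mem h3 (hlow _)
  · exact key s hs hc

end Density
end ArithQuot

namespace ArithQuot

/-! ### Strong approximation for elements of norm one. -/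

section Approximation

variable {a b : ℚ}

/-- The four standard basis elements. -/
def stdBasis (a b : ℚ) (i : Fin 2 × Fin 2) : Quat a b :=
  ⟨if i = (0, 0) then 1 else 0, if i = (0, 1) then 1 else 0, if i = (1, 0) then 1 else 0,
    if i = (1, 1) then 1 else 0⟩

lemma stdBasis_mem (i : Fin 2 × Fin 2) : stdBasis a b i ∈ latticeD a b 1 := by
  have h : ∀ P : Prop, [Decidable P] → (1 : ℚ) * (if P then 1 else 0) ∈ intQ := by
    intro P _; split_ifs
    · rw [mul_one]; exact one_mem _
    · rw [mul_zero]; exact zero_mem _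
  exact ⟨h _, h _, h _, h _⟩

/-- The norm one units of `R[1/p]` form an infinite set if `p` splits the quaternion algebra. -/
theorem IsOrder.infinite_norm_one_invP {p : ℕ} [Fact p.Prime] {R : Subring (Quat a b)}
    (hR : IsOrder R) (ha : a < 0) (hb : b < 0)
    (ι : Quat a b →ₐ[ℚ] Matrix (Fin 2) (Fin 2) ℚ_[p]) :
    {γ : Quat a b | γ ∈ invP p R ∧ nr γ = 1}.Infinite := by
  obtain ⟨N, hN, hNR⟩ := hR.exists_smul_latticeD
  choose c hc using fun i => exists_entryLe (ι (stdBasis a b i))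
  set C := ∑ i, c i with hC
  have hp1 : (1 : ℝ) < p := by exact_mod_cast (Fact.out : p.Prime).one_lt
  have hp0 := (Fact.out : p.Prime).pos
  -- N puts the standard basis into `R`, and p^C makes its matrices integral.
  set e : Fin 2 × Fin 2 → Quat a b := fun i => ((N * p ^ C : ℕ) : ℚ) • stdBasis a b i with he
  have heR : ∀ i, e i ∈ R := by
    intro i
    have := natCast_smul_mem (p ^ C) (hNR _ (stdBasis_mem i))
    rw [smul_smul] at this
    convert this using 2
    push_cast; ring
  have hent : ∀ i, EntryLe (ι (e i)) 1 := by
    intro i j k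
    simp only [he]
    rw [map_smul', Matrix.smul_apply, smul_eq_mul, norm_mul, Rat.cast_natCast, Nat.cast_mul,
      norm_mul]
    have h1 : ‖(N : ℚ_[p])‖ ≤ 1 := by exact_mod_cast Padic.norm_int_le_one (N : ℤ)
    have h2 : ‖((p ^ C : ℕ) : ℚ_[p])‖ = ((p : ℝ) ^ C)⁻¹ := by simp
    have h3 : (p : ℝ) ^ c i ≤ (p : ℝ) ^ C :=
      pow_le_pow_right₀ hp1.le (Finset.single_le_sum (fun _ _ => Nat.zero_le _) (Finset.mem_univ i))
    rw [h2]
    calc ‖(N : ℚ_[p])‖ * ((p : ℝ) ^ C)⁻¹ * ‖ι (stdBasis a b i) j k‖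
        ≤ 1 * ((p : ℝ) ^ C)⁻¹ * (p : ℝ) ^ C := by
          gcongr
          exact (hc i j k).trans h3
      _ = 1 := by field_simp
  have hsum : ∀ n : Fin 2 × Fin 2 → ℤ, EntryLe (ι (∑ i, n i • e i)) 1 := by
    intro n j k
    rw [map_sum, Matrix.sum_apply]
    refine IsUltrametricDist.norm_sum_le_of_forall_le_of_nonneg zero_le_one fun i _ => ?_
    rw [map_zsmul, Matrix.smul_apply, zsmul_eq_mul, norm_mul]
    exact mul_le_one₀ (Padic.norm_int_le_one _) (norm_nonneg _) (hent i j k)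
  -- The first column: it controls the determinant of an integral matrix linearly, with half as many
  -- functionals as there are basis elements.
  let f : Quat a b →+ (Fin 2 → ℚ_[p]) :=
    { toFun := fun x k => ι x k 0
      map_zero' := by ext k; simp
      map_add' := fun x y => by ext k; simp }
  refine infinite_norm_one ha hb (fun x hx => hR.star_mem hx) (fun x hx => hR.nr_mem hx) two_pos e
    heR ?_ f (fun i k => hent i k 0) ?_
  · intro n hn
    have hM : ((N * p ^ C : ℕ) : ℚ) ≠ 0 := by positivity
    have h0 := congrArg QuaternionAlgebra.re hn
    have h1 := congrArg QuaternionAlgebra.imI hn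
    have h2 := congrArg QuaternionAlgebra.imJ hn
    have h3 := congrArg QuaternionAlgebra.imK hn
    simp [Fintype.sum_prod_type, e, stdBasis, hN.ne', hp0.ne'] at h0 h1 h2 h3
    ext ⟨i, j⟩
    fin_cases i <;> fin_cases j <;> simp [*]
  · intro n c hc
    rw [← det_map ι ha hb, Matrix.det_fin_two]
    have h1 := hsum n
    have hc0 : 0 ≤ c := (norm_nonneg _).trans (hc 0)
    have g1 := hc 0
    have g2 := hc 1
    rw [sub_eq_add_neg]
    refine (Padic.nonarchimedean _ _).trans (max_le ?_ ?_)
    · rw [norm_mul]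
      calc _ ≤ c * 1 := mul_le_mul g1 (h1 1 1) (norm_nonneg _) hc0
        _ = c := mul_one _
    · rw [norm_neg, norm_mul, mul_comm]
      calc _ ≤ c * 1 := mul_le_mul g2 (h1 0 1) (norm_nonneg _) hc0
        _ = c := mul_one _

lemma commute_elI_iff (ha : a < 0) {c : ℚ} (hc : c ≠ 0) {x : Quat a b} :
    x * elI a b c = elI a b c * x ↔ x.imJ = 0 ∧ x.imK = 0 := by
  constructor
  · intro h
    have h1 := congrArg QuaternionAlgebra.imJ h
    have h2 := congrArg QuaternionAlgebra.imK h
    simp [elI] at h1 h2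
    constructor
    · have : c * x.imJ = 0 := by linarith
      exact (mul_eq_zero.1 this).resolve_left hc
    · have : (a * c) * x.imK = 0 := by linarith
      exact (mul_eq_zero.1 this).resolve_left (mul_ne_zero ha.ne hc)
  · rintro ⟨h1, h2⟩
    ext <;> simp [elI, h1, h2, mul_comm]
    ring

/-- Units of norm one close to the identity not commuting with the first quaternion unit. -/
theorem IsOrder.exists_norm_one_congr {p : ℕ} [Fact p.Prime] {R : Subring (Quat a b)}
    (hR : IsOrder R) (ha : a < 0) (hb : b < 0)
    (ι : Quat a b →ₐ[ℚ] Matrix (Fin 2) (Fin 2) ℚ_[p]) {c c' B : ℕ} (hc : 0 < c) (hc' : 0 < c')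
    (hpB : p ∣ B) (hB : (B : ℚ) = -(c' ^ 2 * b)) (hJ : elJ a b c' ∈ R) {n : ℕ}
    (hn0 : n ≠ 0) (hn : n.Coprime p) :
    ∃ δ ∈ invP p R, nr δ = 1 ∧ (∃ z ∈ invP p R, δ - 1 = (n : ℚ) • z) ∧
      δ * elI a b c ≠ elI a b c * δ := by
  classical
  have hn' : (n * (1 + B)).Coprime p := by
    refine Nat.Coprime.mul_left hn ?_
    obtain ⟨k, rfl⟩ := hpB
    simp
  -- Two norm one elements congruent modulo n(1 + B), and not equal up to sign, have a quotient δ ≠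
  -- ±1 congruent to 1. The extra factor 1 + B is a reserve against the denominator of a conjugation
  -- below.
  obtain ⟨T, hT, col, hcol⟩ := hR.exists_finite_classes (mul_ne_zero hn0 (by omega)) hn'
  have hinf := hR.infinite_norm_one_invP ha hb ι
  have hi : Infinite {γ : Quat a b | γ ∈ invP p R ∧ nr γ = 1} := hinf.to_subtype
  obtain ⟨t, ht⟩ := Finite.exists_infinite_fiber
    (fun γ : {γ : Quat a b | γ ∈ invP p R ∧ nr γ = 1} => col γ)
  rw [Set.infinite_coe_iff] at ht
  obtain ⟨S, hS, hSS⟩ : ∃ S : Set (Quat a b), S.Infinite ∧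
      ∀ x ∈ S, (x ∈ invP p R ∧ nr x = 1) ∧ col x = t := by
    refine ⟨_, ht.image (f := Subtype.val) Subtype.val_injective.injOn, ?_⟩
    rintro _ ⟨x, hx, rfl⟩
    exact ⟨x.2, hx⟩
  obtain ⟨γ₂, hγ₂⟩ := hS.nonempty
  obtain ⟨γ₁, hγ₁, hne⟩ : ∃ γ ∈ S, γ ∉ ({γ₂, -γ₂} : Finset (Quat a b)) := hS.exists_notMem_finset _
  simp only [Finset.mem_insert, Finset.mem_singleton, not_or] at hne
  obtain ⟨⟨h1, n1⟩, c1⟩ := hSS _ hγ₁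
  obtain ⟨⟨h2, n2⟩, c2⟩ := hSS _ hγ₂
  obtain ⟨z, hz, hzz⟩ := hcol _ h1 _ h2 (c1.trans c2.symm)
  have h2s : γ₂ * star γ₂ = 1 := by rw [mul_star_self, n2]; simp
  have h2s' : star γ₂ * γ₂ = 1 := by rw [star_mul_self', n2]; simp
  set δ := γ₁ * star γ₂ with hδ
  have hδR : δ ∈ invP p R := mul_mem h1 (hR.star_mem_invP h2)
  have hδn : nr δ = 1 := by rw [hδ, nr_mul, nr_star, n1, n2, mul_one]
  have hδz : δ - 1 = ((n * (1 + B) : ℕ) : ℚ) • (z * star γ₂) := by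
    rw [← smul_mul_assoc, ← hzz, sub_mul, h2s]
  have hzR : z * star γ₂ ∈ invP p R := mul_mem hz (hR.star_mem_invP h2)
  by_cases hcomm : δ * elI a b c = elI a b c * δ
  swap
  · refine ⟨δ, hδR, hδn, ⟨((1 + B : ℕ) : ℚ) • (z * star γ₂), natCast_smul_mem _ hzR, ?_⟩, hcomm⟩
    rw [hδz, smul_smul]; push_cast; rfl
  have hcQ : (c : ℚ) ≠ 0 := by exact_mod_cast hc.ne'
  have hcQ' : (c' : ℚ) ≠ 0 := by exact_mod_cast hc'.ne'
  have hBQ : (1 + B : ℚ) ≠ 0 := by positivity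
  rw [commute_elI_iff ha hcQ] at hcomm
  have hy : δ.imI ≠ 0 := by
    intro hy
    have h3 : δ.re ^ 2 = 1 := by
      rw [nr_eq] at hδn
      simp only [hcomm.1, hcomm.2, hy] at hδn
      linarith
    have h4 : γ₁ = δ * γ₂ := by rw [hδ, mul_assoc, h2s', mul_one]
    have h3' : (δ.re - 1) * (δ.re + 1) = 0 := by linear_combination h3
    rcases mul_eq_zero.1 h3' with h5 | h5
    · have : δ = 1 := by ext <;> simp [hy, hcomm, sub_eq_zero.1 h5]
      rw [this, one_mul] at h4
      exact hne.1 h4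
    · have : δ = -1 := by ext <;> simp [hy, hcomm, eq_neg_of_add_eq_zero_left h5]
      rw [this, neg_one_mul] at h4
      exact hne.2 h4
  -- If δ commutes with the first unit, it is conjugated out of that quadratic field by `g`, of norm
  -- 1 + B. The division by 1 + B is absorbed by the modulus.
  set g : Quat a b := 1 + elJ a b c' with hg
  have hgs : star g = 1 - elJ a b c' := by ext <;> simp [hg, elJ]
  have hgn : nr g = 1 + B := by rw [nr_eq, hB]; simp [hg, elJ]; ring
  have hgR : g ∈ invP p R := le_invP p (add_mem (one_mem _) hJ)
  have hgz : g * (z * star γ₂) * star g ∈ invP p R :=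
    mul_mem (mul_mem hgR hzR) (hR.star_mem_invP hgR)
  have hδ' : (1 + B : ℚ)⁻¹ • (g * δ * star g) - 1 = (n : ℚ) • (g * (z * star γ₂) * star g) := by
    have h3 : g * δ * star g = (1 + B : ℚ) • 1 + g * (δ - 1) * star g := by
      rw [mul_sub, sub_mul, mul_one, mul_star_self, hgn, ← mul_one ((_ : ℚ) : Quat a b),
        QuaternionAlgebra.coe_mul_eq_smul]
      abel
    rw [h3, hδz, mul_smul_comm, smul_mul_assoc, smul_add, smul_smul, smul_smul, inv_mul_cancel₀ hBQ,
      one_smul, add_sub_cancel_left]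
    congr 1
    push_cast
    field_simp
  refine ⟨(1 + B : ℚ)⁻¹ • (g * δ * star g), ?_, ?_, ⟨_, hgz, hδ'⟩, ?_⟩
  · rw [← sub_add_cancel ((1 + B : ℚ)⁻¹ • (g * δ * star g)) 1, hδ']
    exact add_mem (natCast_smul_mem _ hgz) (one_mem _)
  · rw [nr_smul, nr_mul, nr_mul, nr_star, hgn, hδn]; field_simp
  · rw [Ne, commute_elI_iff ha hcQ]
    rintro ⟨-, h3⟩
    have h4 : δ = ⟨δ.re, δ.imI, 0, 0⟩ := by ext <;> simp [hcomm]
    rw [h4, hgs, hg] at h3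
    simp [elJ, hBQ] at h3
    have h5 : δ.imI * (c' : ℚ) ≠ 0 := mul_ne_zero hy hcQ'
    apply h5
    linarith

/-- Elements of norm one of `R[1/q]` in the quadratic field of the first unit that are
hyperbolic at the split prime `q`. -/
theorem IsOrder.exists_hyperbolic {q : ℕ} [Fact q.Prime] {R : Subring (Quat a b)}
    (hR : IsOrder R) (ha : a < 0) (hb : b < 0) {c : ℕ} (hc : 0 < c) (hI : elI a b c ∈ R)
    {κ : Quat a b →ₐ[ℚ] Matrix (Fin 2) (Fin 2) ℚ_[q]} {ρ : ℚ_[q]}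
    (hκI : κ (elI a b c) = !![ρ, 0; 0, -ρ])
    (hκ : ∀ x, EntryLe (κ x) 1 ↔ ∃ N : ℕ, N.Coprime q ∧ (N : ℚ) • x ∈ R) :
    ∃ h ∈ invP q R, nr h = 1 ∧ ∃ l : ℚ_[q], 1 < ‖l‖ ∧ κ h = !![l, 0; 0, l⁻¹] := by
  have hcQ : (c : ℚ) ≠ 0 := by exact_mod_cast hc.ne'
  have hdiag : ∀ x : Quat a b, x * elI a b c = elI a b c * x → κ x 0 1 = 0 ∧ κ x 1 0 = 0 := by
    intro x hx
    rw [commute_elI_iff ha hcQ] at hx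
    have h1 : x = ((x.re : ℚ) : Quat a b) + (x.imI / c) • elI a b c := by
      ext <;> simp [elI, hx, hcQ]
    rw [h1, map_add, map_coe', map_smul', hκI]
    simp
  have hRint : ∀ x ∈ R, EntryLe (κ x) 1 := fun x hx =>
    (hκ x).2 ⟨1, Nat.coprime_one_left q, by simpa using hx⟩
  -- This order in a quadratic field has matrices that are diagonal at the split prime q, so a
  -- single functional, the first diagonal entry, controls the norm.
  set O : Subring (Quat a b) := R ⊓ Subring.centralizer {elI a b c} with hO
  have hOmem : ∀ x, x ∈ O ↔ x ∈ R ∧ x * elI a b c = elI a b c * x := by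
    intro x
    rw [hO, Subring.mem_inf, Subring.mem_centralizer_iff]
    simp [eq_comm]
  have hstar : ∀ x ∈ O, star x ∈ O := by
    intro x hx
    rw [hOmem] at hx ⊢
    refine ⟨hR.star_mem hx.1, ?_⟩
    rw [commute_elI_iff ha hcQ] at hx ⊢
    simpa using hx.2
  let e : Fin 1 × Fin 2 → Quat a b := fun i => if i.2 = 0 then 1 else elI a b c
  have heO : ∀ i, e i ∈ O := by
    rintro ⟨i, j⟩
    rw [hOmem]
    fin_cases j
    · exact ⟨one_mem _, by simp [e]⟩
    · exact ⟨hI, rfl⟩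
  let f : Quat a b →+ (Fin 1 → ℚ_[q]) :=
    { toFun := fun x _ => κ x 0 0
      map_zero' := by ext k; simp
      map_add' := fun x y => by ext k; simp }
  have hinf := infinite_norm_one ha hb hstar (fun x hx => hR.nr_mem ((hOmem x).1 hx).1) one_pos e heO
    (by
      intro n hn
      have h0 := congrArg QuaternionAlgebra.re hn
      have h1 := congrArg QuaternionAlgebra.imI hn
      simp [Fintype.sum_prod_type, e, elI, hc.ne'] at h0 h1
      ext ⟨i, j⟩
      fin_cases i; fin_cases j <;> simp [*]) f
    (fun i k => hRint _ ((hOmem _).1 (heO i)).1 0 0)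
    (by
      intro n t ht
      have hx : ∑ i, n i • e i ∈ O := sum_mem fun i _ => zsmul_mem (heO i) _
      set x := ∑ i, n i • e i
      rw [← det_map κ ha hb, Matrix.det_fin_two, (hdiag x ((hOmem x).1 hx).2).1, zero_mul, sub_zero,
        norm_mul]
      have g := ht 0
      calc _ ≤ t * 1 := mul_le_mul g (hRint x ((hOmem x).1 hx).1 1 1) (norm_nonneg _)
            ((norm_nonneg _).trans g)
        _ = t := mul_one _)
  have hOinv : ∀ x ∈ invP q O, x ∈ invP q R ∧ x * elI a b c = elI a b c * x := by
    intro x hx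
    obtain ⟨k, hk⟩ := mem_invP.1 hx
    rw [hOmem] at hk
    refine ⟨mem_invP.2 ⟨k, hk.1⟩, ?_⟩
    have hq : ((q : ℚ) ^ k) ≠ 0 := pow_ne_zero _ (by exact_mod_cast (Fact.out : q.Prime).ne_zero)
    have := congrArg (fun y => ((q : ℚ) ^ k)⁻¹ • y) hk.2
    simpa [smul_mul_assoc, mul_smul_comm, smul_smul, hq] using this
  -- some element is not a unit at `q`
  obtain ⟨h, hhO, hh1, hhn⟩ : ∃ h ∈ invP q O, nr h = 1 ∧ ‖κ h 0 0‖ ≠ 1 := by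
    by_contra hcon
    push Not at hcon
    refine hinf ?_
    -- If every diagonal entry were a unit, these elements would be integral at q, hence in `R`.
    -- Their traces are then integers in [-2, 2], and in the commutative centralizer each trace
    -- allows two elements, contradicting infinitude.
    have hsub : {γ : Quat a b | γ ∈ invP q O ∧ nr γ = 1} ⊆
        {γ | γ ∈ R ∧ nr γ = 1 ∧ γ * elI a b c = elI a b c * γ} := by
      rintro γ ⟨h1, h2⟩
      obtain ⟨h3, h4⟩ := hOinv γ h1
      refine ⟨?_, h2, h4⟩
      have h5 := hcon γ h1 h2
      have h6 : κ γ 0 0 * κ γ 1 1 = 1 := by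
        have := det_map κ ha hb γ
        rw [Matrix.det_fin_two, (hdiag γ h4).1, h2] at this
        simpa using this
      have h7 : ‖κ γ 1 1‖ = 1 := by
        have := congrArg norm h6
        rw [norm_mul, h5, one_mul, norm_one] at this
        exact this
      have h8 : EntryLe (κ γ) 1 := by
        intro i j
        fin_cases i <;> fin_cases j
        · exact h5.le
        · change ‖κ γ 0 1‖ ≤ 1; rw [(hdiag γ h4).1]; simp
        · change ‖κ γ 1 0‖ ≤ 1; rw [(hdiag γ h4).2]; simp
        · exact h7.le
      obtain ⟨N, hN, hNR⟩ := (hκ γ).1 h8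
      obtain ⟨k, hk⟩ := mem_invP.1 h3
      exact mem_of_coprime_smul (hN.pow_right k) hNR (by exact_mod_cast hk)
    refine Set.Finite.subset ?_ hsub
    refine Set.Finite.of_finite_fibers tr ?_ ?_
    · refine ((Set.finite_Icc (-2 : ℤ) 2).image (fun z : ℤ => (z : ℚ))).subset ?_
      rintro _ ⟨γ, ⟨h1, h2, -⟩, rfl⟩
      obtain ⟨z, hz⟩ := mem_intQ.1 (hR.tr_mem h1)
      refine ⟨z, ?_, hz.symm⟩
      have h3 := tr_sq_le ha hb γ
      rw [h2, hz] at h3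
      have h4 : z ^ 2 ≤ 4 := by exact_mod_cast (by linarith : (z : ℚ) ^ 2 ≤ 4)
      constructor <;> nlinarith
    · rintro _ ⟨γ₀, ⟨h1, h2, h3⟩, rfl⟩
      refine (Set.toFinite ({γ₀, star γ₀} : Set (Quat a b))).subset ?_
      rintro γ ⟨⟨h4, h5, h6⟩, h7⟩
      have hcomm : γ * γ₀ = γ₀ * γ := by
        rw [commute_elI_iff ha hcQ] at h3 h6
        ext <;> simp [h3, h6] <;> ring
      exact eq_or_eq_star_of_commute ha hb hcomm.symm h7.symm (h2.trans h5.symm)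
  obtain ⟨hhR, hhc⟩ := hOinv h hhO
  obtain ⟨d1, d2⟩ := hdiag h hhc
  have hdet : κ h 0 0 * κ h 1 1 = 1 := by
    have := det_map κ ha hb h
    rw [Matrix.det_fin_two, d1, hh1] at this
    simpa using this
  have hne : κ h 0 0 ≠ 0 := left_ne_zero_of_mul_eq_one hdet
  have hne' : κ h 1 1 ≠ 0 := right_ne_zero_of_mul_eq_one hdet
  rcases lt_or_gt_of_ne hhn with hlt | hgt
  · refine ⟨star h, hR.star_mem_invP hhR, by simpa using hh1, κ h 1 1, ?_, ?_⟩
    · have := congrArg norm hdet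
      rw [norm_mul, norm_one] at this
      have h0 : 0 < ‖κ h 0 0‖ := norm_pos_iff.2 hne
      by_contra hcon
      push Not at hcon
      nlinarith [norm_nonneg (κ h 1 1)]
    · rw [map_star κ ha hb, Matrix.adjugate_fin_two, d1, d2, eq_inv_of_mul_eq_one_left hdet]
      simp
  · refine ⟨h, hhR, hh1, κ h 0 0, hgt, ?_⟩
    rw [← eq_inv_of_mul_eq_one_right hdet]
    ext i j
    fin_cases i <;> fin_cases j <;> simp [d1, d2]

/-- The elements of norm one of `R[1/pq]`. -/
def normOne (p q : ℕ) (R : Subring (Quat a b)) : Submonoid (Quat a b) where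
  carrier := {δ | δ ∈ invP q (invP p R) ∧ nr δ = 1}
  one_mem' := ⟨one_mem _, nr_one⟩
  mul_mem' := fun hx hy => ⟨mul_mem hx.1 hy.1, by rw [nr_mul, hx.2, hy.2, one_mul]⟩

/-- Strong approximation: the elements of norm one of `R[1/pq]` are dense in `SL₂(ℚ_q)`. -/
theorem IsOrder.mem_closure_of_det_eq_one {p : ℕ} [Fact p.Prime] {R : Subring (Quat a b)}
    (hR : IsOrder R) (ha : a < 0) (hb : b < 0)
    (ι : Quat a b →ₐ[ℚ] Matrix (Fin 2) (Fin 2) ℚ_[p]) {c c' B : ℕ} (hc : 0 < c) (hc' : 0 < c')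
    (hpB : p ∣ B) (hB : (B : ℚ) = -(c' ^ 2 * b)) (hI : elI a b c ∈ R) (hJ : elJ a b c' ∈ R)
    {q : ℕ} [Fact q.Prime] (hqp : q ≠ p)
    {κ : Quat a b →ₐ[ℚ] Matrix (Fin 2) (Fin 2) ℚ_[q]} {ρ : ℚ_[q]}
    (hκI : κ (elI a b c) = !![ρ, 0; 0, -ρ])
    (hκ : ∀ x, EntryLe (κ x) 1 ↔ ∃ N : ℕ, N.Coprime q ∧ (N : ℚ) • x ∈ R)
    {s : Matrix (Fin 2) (Fin 2) ℚ_[q]} (hs : s.det = 1) :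
    s ∈ closure (κ '' (normOne p q R : Set (Quat a b))) := by
  have hpp : p.Prime := Fact.out
  have hqq : q.Prime := Fact.out
  have hcop : q.Coprime p := (Nat.coprime_primes hqq hpp).2 hqp
  set H : Submonoid (Matrix (Fin 2) (Fin 2) ℚ_[q]) :=
    ((normOne p q R).map (κ : Quat a b →* Matrix (Fin 2) (Fin 2) ℚ_[q])).topologicalClosure with hH
  have hmem : ∀ δ ∈ normOne p q R, κ δ ∈ H := fun δ hδ =>
    Submonoid.le_topologicalClosure _ ⟨δ, hδ, rfl⟩
  suffices h : s ∈ H from h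
  obtain ⟨h, hhR, hh1, l, hl, hκh⟩ := hR.exists_hyperbolic ha hb hc hI hκI hκ
  have hhR' : h ∈ invP q (invP p R) := by
    obtain ⟨k, hk⟩ := mem_invP.1 hhR
    exact mem_invP.2 ⟨k, le_invP p hk⟩
  have hhs : star h ∈ invP q (invP p R) := by
    obtain ⟨k, hk⟩ := mem_invP.1 (hR.star_mem_invP hhR)
    exact mem_invP.2 ⟨k, le_invP p hk⟩
  have hl0 : l ≠ 0 := by rintro rfl; simp at hl; linarith
  refine mem_of_det_eq_one (Submonoid.isClosed_topologicalClosure _) hl ?_ ?_ ?_ hs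
  · rw [← hκh]; exact hmem h ⟨hhR', hh1⟩
  · have : κ (star h) = !![l⁻¹, 0; 0, l] := by
      rw [map_star κ ha hb, hκh, Matrix.adjugate_fin_two]; simp
    rw [← this]
    exact hmem _ ⟨hhs, by simpa using hh1⟩
  · intro k
    obtain ⟨δ, hδR, hδ1, ⟨z, hz, hδz⟩, hδI⟩ := hR.exists_norm_one_congr ha hb ι hc hc' hpB hB hJ
      (n := q ^ k) (pow_ne_zero _ hqq.ne_zero) (hcop.pow_left k)
    have hzi : EntryLe (κ z) 1 := by
      obtain ⟨j, hj⟩ := mem_invP.1 hz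
      exact (hκ z).2 ⟨p ^ j, (hcop.symm.pow_left j), by exact_mod_cast hj⟩
    refine ⟨κ δ, hmem δ ⟨le_invP q hδR, hδ1⟩, ?_, ?_⟩
    · have : κ δ - 1 = κ (δ - 1) := by rw [map_sub, map_one]
      rw [this, hδz, map_smul']
      intro i j
      rw [Matrix.smul_apply, smul_eq_mul, norm_mul]
      have h1 : ‖(((q ^ k : ℕ) : ℚ) : ℚ_[q])‖ = (q : ℝ) ^ (-(k : ℤ)) := by simp
      rw [h1]
      exact mul_le_of_le_one_right (by positivity) (hzi i j)
    -- Not commuting with the first unit means, through the determinant of the commutator, that both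
    -- off-diagonal entries of `κ δ` are nonzero.
    · have h1 : nr (δ * elI a b c - elI a b c * δ) ≠ 0 := by
        rw [Ne, nr_eq_zero ha hb, sub_eq_zero]; exact hδI
      have h2 : (κ (δ * elI a b c - elI a b c * δ)).det = 4 * ρ ^ 2 * (κ δ 0 1 * κ δ 1 0) := by
        rw [map_sub, map_mul, map_mul, hκI, Matrix.eta_fin_two (κ δ)]
        simp [Matrix.det_fin_two]
        ring
      rw [det_map κ ha hb] at h2
      constructor
      · intro h3
        rw [h3] at h2
        apply h1
        exact_mod_cast (by simpa using h2 : ((nr (δ * elI a b c - elI a b c * δ) : ℚ) : ℚ_[q]) = 0)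
      · intro h3
        rw [h3] at h2
        apply h1
        exact_mod_cast (by simpa using h2 : ((nr (δ * elI a b c - elI a b c * δ) : ℚ) : ℚ_[q]) = 0)

end Approximation
end ArithQuot

namespace ArithQuot

/-! ### Removing denominators without changing the norm. -/

section Splitting

variable {a b : ℚ}

/-- A splitting at `q` for which the integral elements are those of the localization of `R`, and
for which strong approximation holds. -/
structure SplitAt (p : ℕ) (R : Subring (Quat a b)) (q : ℕ) [Fact q.Prime]
    (κ : Quat a b →ₐ[ℚ] Matrix (Fin 2) (Fin 2) ℚ_[q]) : Prop where
  integral : ∀ x, EntryLe (κ x) 1 ↔ ∃ N : ℕ, N.Coprime q ∧ (N : ℚ) • x ∈ R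
  dense : ∀ s : Matrix (Fin 2) (Fin 2) ℚ_[q], s.det = 1 →
    s ∈ closure (κ '' (normOne p q R : Set (Quat a b)))

/-- Almost all primes split by the quadratic field `ℚ(√-A)` of an element of `R`
are primes of splitting. -/
theorem IsOrder.exists_splitAt {p : ℕ} [Fact p.Prime] {R : Subring (Quat a b)}
    (hR : IsOrder R) (ha : a < 0) (hb : b < 0)
    (ι : Quat a b →ₐ[ℚ] Matrix (Fin 2) (Fin 2) ℚ_[p]) :
    ∃ c A M₀ : ℕ, 0 < c ∧ 2 ≤ A ∧ 0 < M₀ ∧ 2 * A ∣ M₀ ∧ (A : ℚ) = -(c ^ 2 * a) ∧ elI a b c ∈ R ∧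
      ∀ (q : ℕ) [Fact q.Prime], ¬ q ∣ M₀ → q ≠ p → ∀ r : ℤ, (q : ℤ) ∣ r ^ 2 + A →
        ∃ κ : Quat a b →ₐ[ℚ] Matrix (Fin 2) (Fin 2) ℚ_[q], SplitAt p R q κ := by
  obtain ⟨c, c', A, B, M₀, hc, hc', hA2, hpB, hM₀, hAM, hA, hB, hI, hJ, hloc⟩ :=
    hR.exists_frame ha hb (Fact.out : p.Prime).ne_zero
  refine ⟨c, A, M₀, hc, hA2, hM₀, hAM, hA, hI, ?_⟩
  intro q _ hq hqp r hr
  obtain ⟨κ, ρ, -, hκI, hκ⟩ := hloc q hq r hr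
  exact ⟨κ, hκ, fun s hs => hR.mem_closure_of_det_eq_one ha hb ι hc hc' hpB hB hI hJ hqp hκI hκ hs⟩

lemma exists_near_of_mem_closure {q : ℕ} [Fact q.Prime]
    {S : Set (Matrix (Fin 2) (Fin 2) ℚ_[q])} {s : Matrix (Fin 2) (Fin 2) ℚ_[q]}
    (hs : s ∈ closure S) {ε : ℝ} (hε : 0 < ε) : ∃ A ∈ S, EntryLe (A - s) ε := by
  have ho : IsOpen {A : Matrix (Fin 2) (Fin 2) ℚ_[q] | ∀ i j, ‖A i j - s i j‖ < ε} := by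
    simp only [Set.ofPred_forall]
    refine isOpen_iInter_of_finite fun i => isOpen_iInter_of_finite fun j => ?_
    refine isOpen_lt (Continuous.norm (Continuous.sub ?_ continuous_const)) continuous_const
    exact (continuous_apply j).comp (continuous_apply i)
  obtain ⟨A, hA, hAS⟩ := mem_closure_iff.1 hs _ ho (by simpa using hε)
  exact ⟨A, hAS, fun i j => (hA i j).le⟩

set_option linter.unusedSectionVars false

variable {p : ℕ} [Fact p.Prime] {R : Subring (Quat a b)} {q : ℕ} [Fact q.Prime]
  {κ : Quat a b →ₐ[ℚ] Matrix (Fin 2) (Fin 2) ℚ_[q]}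

lemma SplitAt.entryLe_of_mem_invP (hκ : SplitAt p R q κ) (hqp : q ≠ p) {x : Quat a b}
    (hx : x ∈ invP p R) : EntryLe (κ x) 1 := by
  obtain ⟨j, hj⟩ := mem_invP.1 hx
  refine (hκ.integral x).2 ⟨p ^ j, Nat.Coprime.pow_left j ?_, by exact_mod_cast hj⟩
  exact (Nat.coprime_primes Fact.out Fact.out).2 hqp.symm

/-- Inside R[1/pq], integrality of the matrix at q characterizes R[1/p]. -/
lemma SplitAt.mem_invP_of_entryLe (hκ : SplitAt p R q κ) {x : Quat a b}
    (hx : EntryLe (κ x) 1) {k : ℕ} (hk : ((q : ℚ) ^ k) • x ∈ invP p R) : x ∈ invP p R := by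
  obtain ⟨N, hN, hNR⟩ := (hκ.integral x).1 hx
  exact mem_of_coprime_smul (hN.pow_right k) (le_invP p hNR) (by exact_mod_cast hk)

/-- Any element can be made integral at `q` by an element of norm one. -/
lemma SplitAt.exists_mul_integral (hκ : SplitAt p R q κ) (ha : a < 0) (hb : b < 0)
    {β : Quat a b} {n : ℤ} (hn : n ≠ 0) (hβ : nr β = n) :
    ∃ δ ∈ normOne p q R, EntryLe (κ (δ * β)) 1 := by
  have hnK : (n : ℚ_[q]) ≠ 0 := by exact_mod_cast hn
  have hdet : (κ β).det = n := by rw [det_map κ ha hb, hβ, Rat.cast_intCast]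
  -- Determinant one and t κ(β) = diag(n, 1), which is integral. A norm one element close enough to
  -- `t` has the same effect on integrality.
  set t : Matrix (Fin 2) (Fin 2) ℚ_[q] := (n : ℚ_[q])⁻¹ • (!![(n : ℚ_[q]), 0; 0, 1] * (κ β).adjugate)
  have ht : t.det = 1 := by
    rw [Matrix.det_smul, Matrix.det_mul, Matrix.det_adjugate, hdet]
    simp [Matrix.det_fin_two]
    field_simp
  have htβ : t * κ β = !![(n : ℚ_[q]), 0; 0, 1] := by
    simp only [t]
    rw [Matrix.smul_mul, Matrix.mul_assoc, Matrix.adjugate_mul, hdet, Matrix.mul_smul, smul_smul,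
      inv_mul_cancel₀ hnK, one_smul, Matrix.mul_one]
  obtain ⟨C, hC⟩ := exists_entryLe (κ β)
  have hq0 : (0 : ℝ) < q := by exact_mod_cast (Fact.out : q.Prime).pos
  obtain ⟨_, ⟨δ, hδ, rfl⟩, hδt⟩ := exists_near_of_mem_closure (hκ.dense t ht)
    (ε := ((q : ℝ) ^ C)⁻¹) (by positivity)
  refine ⟨δ, hδ, ?_⟩
  have : κ (δ * β) = !![(n : ℚ_[q]), 0; 0, 1] + (κ δ - t) * κ β := by
    rw [sub_mul, htβ, map_mul]; abel
  rw [this]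
  refine EntryLe.add ?_ ?_
  · intro i j
    fin_cases i <;> fin_cases j <;> simp
    exact Padic.norm_int_le_one n
  · refine (hδt.mul hC).mono ?_
    rw [inv_mul_cancel₀ (by positivity)]

/-- Denominators at primes of splitting can be removed without changing the norm. -/
theorem IsOrder.exists_mem_invP_of_nr (ha : a < 0) (hb : b < 0) {n : ℤ} (hn : n ≠ 0)
    (w : ℕ) (hw : 0 < w) (β : Quat a b) (hβ : nr β = n) (hwβ : (w : ℚ) • β ∈ invP p R)
    (h : ∀ (q : ℕ) [Fact q.Prime], q ≠ p →
      (∃ κ : Quat a b →ₐ[ℚ] Matrix (Fin 2) (Fin 2) ℚ_[q], SplitAt p R q κ) ∨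
        ∃ N : ℕ, N.Coprime q ∧ (N : ℚ) • β ∈ invP p R) :
    ∃ α ∈ invP p R, nr α = n := by
  induction w using Nat.strong_induction_on generalizing β with
  | _ w ih =>
  by_cases hw1 : w = 1
  · exact ⟨β, by simpa [hw1] using hwβ, hβ⟩
  obtain ⟨q, hq, hqw⟩ := Nat.exists_prime_and_dvd hw1
  have : Fact q.Prime := ⟨hq⟩
  by_cases hqp : q = p
  · obtain ⟨w', rfl⟩ := hqw
    have hw' : 0 < w' := Nat.pos_of_mul_pos_left hw
    refine ih w' (lt_mul_of_one_lt_left hw' hq.one_lt) hw' β hβ ?_ h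
    have := zpow_smul_mem_invP (Fact.out : p.Prime).ne_zero hwβ (-1)
    rw [smul_smul] at this
    convert this using 2
    have hp0 : (p : ℚ) ≠ 0 := by exact_mod_cast (Fact.out : p.Prime).ne_zero
    rw [hqp]; push_cast; field_simp
  obtain ⟨k, w', hqw', rfl⟩ := Nat.exists_eq_pow_mul_and_not_dvd hw.ne' q hq.ne_one
  have hk : k ≠ 0 := by
    rintro rfl
    exact hqw' (by simpa using hqw)
  have hw' : 0 < w' := Nat.pos_of_mul_pos_left hw
  have hlt : w' < q ^ k * w' := lt_mul_of_one_lt_left hw' (Nat.one_lt_pow hk hq.one_lt)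
  have hred : ∀ x : Quat a b, (∃ j : ℕ, ((q : ℚ) ^ j * w') • x ∈ invP p R) →
      (∃ N : ℕ, N.Coprime q ∧ (N : ℚ) • x ∈ invP p R) → (w' : ℚ) • x ∈ invP p R := by
    rintro x ⟨j, hj⟩ ⟨N, hN, hNx⟩
    refine mem_of_coprime_smul (hN.pow_right j) (m := N) (n := q ^ j) ?_ ?_
    · rw [smul_comm]; exact natCast_smul_mem _ hNx
    · rw [smul_smul]; exact_mod_cast hj
  -- Multiplication by `δ` can worsen denominators only at q and p. The denominator at q is
  -- repaired, powers of p are harmless, and the hypothesis at the other primes survives, so the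
  -- induction on `w` continues.
  rcases h q hqp with ⟨κ, hκ⟩ | hint
  · obtain ⟨δ, ⟨hδ, hδ1⟩, hδβ⟩ := hκ.exists_mul_integral ha hb hn hβ
    obtain ⟨e, he⟩ := mem_invP.1 hδ
    have hmul : ∀ (m : ℚ), m • β ∈ invP p R → ((q : ℚ) ^ e * m) • (δ * β) ∈ invP p R := by
      intro m hm
      have := mul_mem he hm
      rwa [smul_mul_smul_comm] at this
    refine ih w' hlt hw' (δ * β) (by rw [nr_mul, hδ1, one_mul, hβ]) ?_ ?_
    · refine hred _ ⟨e + k, ?_⟩ ?_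
      · have := hmul _ hwβ
        convert this using 2
        push_cast; ring
      · obtain ⟨N, hN, hNR⟩ := (hκ.integral _).1 hδβ
        exact ⟨N, hN, le_invP p hNR⟩
    · intro q₂ _ hq₂
      by_cases hqq : q₂ = q
      · subst hqq
        exact Or.inl ⟨κ, hκ⟩
      · rcases h q₂ hq₂ with h1 | ⟨N, hN, hNβ⟩
        · exact Or.inl h1
        · refine Or.inr ⟨q ^ e * N, Nat.Coprime.mul_left (Nat.Coprime.pow_left e ?_) hN, ?_⟩
          · exact (Nat.coprime_primes hq Fact.out).2 (Ne.symm hqq)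
          · have := hmul _ hNβ
            exact_mod_cast this
  · refine ih w' hlt hw' β hβ (hred β ⟨k, ?_⟩ hint) h
    exact_mod_cast hwβ

/-- The determinant of two column vectors. -/
def wedge {K : Type*} [CommRing K] (u v : Fin 2 → K) : K := u 0 * v 1 - u 1 * v 0

/-- Integral vectors, one of whose coordinates is a unit. -/
def Unimodular (v : Fin 2 → ℚ_[q]) : Prop := (∀ i, ‖v i‖ ≤ 1) ∧ ∃ i, ‖v i‖ = 1

lemma norm_sub_le_max' (x y : ℚ_[q]) : ‖x - y‖ ≤ max ‖x‖ ‖y‖ := by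
  rw [sub_eq_add_neg, ← norm_neg y]; exact Padic.nonarchimedean _ _

lemma norm_wedge_le {u v : Fin 2 → ℚ_[q]} {ε : ℝ} (hu : ∀ i, ‖u i‖ ≤ 1) (hv : ∀ i, ‖v i‖ ≤ ε) :
    ‖wedge u v‖ ≤ ε := by
  have hε : 0 ≤ ε := (norm_nonneg _).trans (hv 0)
  refine (norm_sub_le_max' _ _).trans (max_le ?_ ?_) <;> rw [norm_mul]
  · calc _ ≤ 1 * ε := mul_le_mul (hu 0) (hv 1) (norm_nonneg _) zero_le_one
      _ = ε := one_mul _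
  · calc _ ≤ 1 * ε := mul_le_mul (hu 1) (hv 0) (norm_nonneg _) zero_le_one
      _ = ε := one_mul _

/-- Vectors both parallel to the primitive vector `w` modulo ε are parallel to each other: w_i (u ∧
v) = u_i (w ∧ v) - v_i (w ∧ u), and some w_i is a unit. -/
lemma norm_wedge_le_of_unimodular {w u v : Fin 2 → ℚ_[q]} {ε : ℝ} (hw : Unimodular w)
    (hu : ∀ i, ‖u i‖ ≤ 1) (hv : ∀ i, ‖v i‖ ≤ 1) (h1 : ‖wedge w u‖ ≤ ε) (h2 : ‖wedge w v‖ ≤ ε) :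
    ‖wedge u v‖ ≤ ε := by
  have hε : 0 ≤ ε := (norm_nonneg _).trans h1
  have key : ∀ i, ‖w i * wedge u v‖ ≤ ε := by
    intro i
    have : w i * wedge u v = u i * wedge w v - v i * wedge w u := by
      fin_cases i <;> simp [wedge] <;> ring
    rw [this]
    refine (norm_sub_le_max' _ _).trans (max_le ?_ ?_) <;> rw [norm_mul]
    · calc _ ≤ 1 * ε := mul_le_mul (hu i) h2 (norm_nonneg _) zero_le_one
        _ = ε := one_mul _
    · calc _ ≤ 1 * ε := mul_le_mul (hv i) h1 (norm_nonneg _) zero_le_one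
        _ = ε := one_mul _
  obtain ⟨i, hi⟩ := hw.2
  have := key i
  rwa [norm_mul, hi, one_mul] at this

lemma Unimodular.exists_matrix {v : Fin 2 → ℚ_[q]} (hv : Unimodular v) :
    ∃ V : Matrix (Fin 2) (Fin 2) ℚ_[q], EntryLe V 1 ∧ V.det = 1 ∧ ∀ i, V i 0 = v i := by
  obtain ⟨hv1, i, hi⟩ := hv
  have h0 : v i ≠ 0 := by rw [← norm_pos_iff, hi]; exact one_pos
  fin_cases i
  · refine ⟨!![v 0, 0; v 1, (v 0)⁻¹], ?_, ?_, ?_⟩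
    · intro i j
      fin_cases i <;> fin_cases j
      · exact hv1 0
      · simp
      · exact hv1 1
      · change ‖(v 0)⁻¹‖ ≤ 1
        rw [norm_inv]; simp at hi; rw [hi]; simp
    · rw [Matrix.det_fin_two]; simpa using mul_inv_cancel₀ h0
    · intro i; fin_cases i <;> rfl
  · refine ⟨!![v 0, -(v 1)⁻¹; v 1, 0], ?_, ?_, ?_⟩
    · intro i j
      fin_cases i <;> fin_cases j
      · exact hv1 0
      · change ‖-(v 1)⁻¹‖ ≤ 1
        rw [norm_neg, norm_inv]; simp at hi; rw [hi]; simp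
      · exact hv1 1
      · simp
    · rw [Matrix.det_fin_two]; simpa using inv_mul_cancel₀ h0
    · intro i; fin_cases i <;> rfl

/-- An integral matrix with determinant of absolute value `q⁻¹` has a unimodular column. -/
lemma exists_unimodular_col {A : Matrix (Fin 2) (Fin 2) ℚ_[q]} (hA : EntryLe A 1)
    (hd : (q : ℝ)⁻¹ ≤ ‖A.det‖) : ∃ j, Unimodular fun i => A i j := by
  by_contra hcon
  push Not at hcon
  have hlt : EntryLe A (q : ℝ)⁻¹ := by
    intro i j
    by_contra h
    refine hcon j ⟨fun i => hA i j, i, ?_⟩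
    push Not at h
    refine le_antisymm (hA i j) ?_
    by_contra h1
    push Not at h1
    have := (Padic.norm_le_pow_iff_norm_lt_pow_add_one (A i j) (-1)).2 (by simpa using h1)
    rw [zpow_neg_one] at this
    linarith
  have h2 := hlt.norm_det_le
  have hq1 : (1 : ℝ) < q := by exact_mod_cast (Fact.out : q.Prime).one_lt
  have h3 : (q : ℝ)⁻¹ < 1 := inv_lt_one_of_one_lt₀ hq1
  have h4 : (0 : ℝ) < (q : ℝ)⁻¹ := by positivity
  nlinarith

end Splitting
end ArithQuot

namespace ArithQuot

/-! ### Elements of norm q and lines modulo q. -/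

section Orbit

variable {a b : ℚ} {p : ℕ} [Fact p.Prime] {R : Subring (Quat a b)} {q : ℕ} [Fact q.Prime]
  {κ : Quat a b →ₐ[ℚ] Matrix (Fin 2) (Fin 2) ℚ_[q]}

lemma norm_eq_one_of_inv_lt {x : ℚ_[q]} (h : ‖x‖ ≤ 1) (h' : ¬ ‖x‖ ≤ (q : ℝ)⁻¹) : ‖x‖ = 1 := by
  refine le_antisymm h ?_
  by_contra h1
  push Not at h1
  have := (Padic.norm_le_pow_iff_norm_lt_pow_add_one x (-1)).2 (by simpa using h1)
  rw [zpow_neg_one] at this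
  exact h' this

/-- The elements of norm `q` realize all lines at `q`. -/
theorem SplitAt.exists_image (hκ : SplitAt p R q κ) (hqp : q ≠ p) (ha : a < 0) (hb : b < 0)
    {α₀ : Quat a b} (hα₀ : α₀ ∈ invP p R) (hn : nr α₀ = q) {w : Fin 2 → ℚ_[q]}
    (hw : Unimodular w) :
    ∃ α ∈ invP p R, nr α = q ∧ ∀ j, ‖wedge w (fun i => κ α i j)‖ ≤ (q : ℝ)⁻¹ := by
  have hA := hκ.entryLe_of_mem_invP hqp hα₀
  have hdet : (κ α₀).det = q := by rw [det_map κ ha hb, hn, Rat.cast_natCast]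
  have hdn : ‖(κ α₀).det‖ = (q : ℝ)⁻¹ := by rw [hdet, Padic.norm_p]
  have hq0 : (0 : ℝ) < (q : ℝ)⁻¹ := inv_pos.2 (by exact_mod_cast (Fact.out : q.Prime).pos)
  have hq1 : (q : ℝ)⁻¹ ≤ 1 :=
    inv_le_one_of_one_le₀ (by exact_mod_cast (Fact.out : q.Prime).one_lt.le)
  obtain ⟨j₀, hv⟩ := exists_unimodular_col hA hdn.ge
  obtain ⟨V, hV, hVd, hVv⟩ := hv.exists_matrix
  obtain ⟨W, hW, hWd, hWw⟩ := hw.exists_matrix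
  -- An integral matrix of determinant one that carries the line of α₀ modulo q to the line of `w`.
  -- Approximating it modulo q by an element of norm one, which is then integral at q, moves α₀ as
  -- desired.
  set s := W * V.adjugate with hs
  have hsd : s.det = 1 := by rw [hs, Matrix.det_mul, Matrix.det_adjugate, hWd, hVd]; simp
  have hsi : EntryLe s 1 := by simpa using hW.mul hV.adjugate
  have hsv : ∀ i, (s * V) i 0 = w i := by
    intro i
    rw [hs, Matrix.mul_assoc, Matrix.adjugate_mul, hVd, one_smul, Matrix.mul_one, hWw]
  obtain ⟨_, ⟨δ, ⟨hδ, hδ1⟩, rfl⟩, hδs⟩ := exists_near_of_mem_closure (hκ.dense s hsd) hq0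
  have hδi : EntryLe (κ δ) 1 := by
    have := (hδs.mono hq1).add hsi
    rwa [sub_add_cancel] at this
  have hδR : δ ∈ invP p R := by
    obtain ⟨k, hk⟩ := mem_invP.1 hδ
    exact hκ.mem_invP_of_entryLe hδi hk
  refine ⟨δ * α₀, mul_mem hδR hα₀, by rw [nr_mul, hδ1, one_mul, hn], fun j => ?_⟩
  set u : Fin 2 → ℚ_[q] := fun i => (s * κ α₀) i j
  set e : Fin 2 → ℚ_[q] := fun i => ((κ δ - s) * κ α₀) i j
  have h1 : wedge w (fun i => κ (δ * α₀) i j) = wedge w u + wedge w e := by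
    have : κ (δ * α₀) = s * κ α₀ + (κ δ - s) * κ α₀ := by rw [map_mul, sub_mul]; abel
    rw [this]
    simp only [wedge, u, e, Matrix.add_apply]
    ring
  have h2 : wedge w u = wedge (fun i => κ α₀ i j₀) (fun i => κ α₀ i j) := by
    have h3 : wedge w u = s.det * wedge (fun i => V i 0) (fun i => κ α₀ i j) := by
      simp only [wedge, u, ← hsv, Matrix.mul_apply, Fin.sum_univ_two, Matrix.det_fin_two]
      ring
    rw [h3, hsd, one_mul]
    simp only [hVv]
  rw [h1]
  refine (Padic.nonarchimedean _ _).trans (max_le ?_ ?_)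
  · rw [h2]
    have h4 : ‖wedge (fun i => κ α₀ i j₀) (fun i => κ α₀ i j)‖ ≤ ‖(κ α₀).det‖ := by
      fin_cases j₀ <;> fin_cases j <;>
        simp only [wedge, Matrix.det_fin_two, Fin.zero_eta, Fin.mk_one] <;> ring_nf
      · simp
      · rfl
      · rw [← norm_neg]; ring_nf; rfl
      · simp
    exact h4.trans hdn.le
  · refine norm_wedge_le hw.1 fun i => ?_
    have := hδs.mul hA
    rw [mul_one] at this
    exact this i j

lemma adjugate_mul_apply_zero {K : Type*} [CommRing K] (A B : Matrix (Fin 2) (Fin 2) K) (j : Fin 2) :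
    (A.adjugate * B) 0 j = wedge (fun i => B i j) (fun i => A i 1) := by
  rw [Matrix.adjugate_fin_two, Matrix.mul_apply, Fin.sum_univ_two]
  simp [wedge]; ring

lemma adjugate_mul_apply_one {K : Type*} [CommRing K] (A B : Matrix (Fin 2) (Fin 2) K) (j : Fin 2) :
    (A.adjugate * B) 1 j = wedge (fun i => A i 0) (fun i => B i j) := by
  rw [Matrix.adjugate_fin_two, Matrix.mul_apply, Fin.sum_univ_two]
  simp [wedge]; ring

/-- Elements whose norm is divisible by `q` are left divisible by an element of norm `q`. -/
theorem SplitAt.exists_factor (hκ : SplitAt p R q κ) (hqp : q ≠ p) (hR : IsOrder R) (ha : a < 0)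
    (hb : b < 0) {α₀ : Quat a b} (hα₀ : α₀ ∈ invP p R) (hn : nr α₀ = q) {ξ : Quat a b}
    (hξ : ξ ∈ invP p R) (hξn : pabs q (nr ξ) ≤ (q : ℝ)⁻¹) :
    ∃ α ∈ invP p R, nr α = q ∧ ∃ z ∈ invP p R, ξ = α * z := by
  have hq0 : (q : ℚ) ≠ 0 := by exact_mod_cast (Fact.out : q.Prime).ne_zero
  have hX := hκ.entryLe_of_mem_invP hqp hξ
  suffices h : ∃ α ∈ invP p R, nr α = q ∧ EntryLe ((κ α).adjugate * κ ξ) (q : ℝ)⁻¹ by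
    obtain ⟨α, hα, hαn, hαe⟩ := h
    refine ⟨α, hα, hαn, (q : ℚ)⁻¹ • (star α * ξ), ?_, ?_⟩
    · refine hκ.mem_invP_of_entryLe (k := 1) ?_ ?_
      · rw [map_smul', map_mul, map_star κ ha hb]
        intro i j
        rw [Matrix.smul_apply, smul_eq_mul, norm_mul]
        have h1 : ‖(((q : ℚ)⁻¹ : ℚ) : ℚ_[q])‖ = q := by simp
        have h2 : (q : ℝ) ≠ 0 := by exact_mod_cast hq0
        rw [h1]
        calc (q : ℝ) * _ ≤ q * (q : ℝ)⁻¹ := by gcongr; exact hαe i j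
          _ = 1 := mul_inv_cancel₀ h2
      · rw [smul_smul, pow_one, mul_inv_cancel₀ hq0, one_smul]
        exact mul_mem (hR.star_mem_invP hα) hξ
    · rw [mul_smul_comm, ← mul_assoc, mul_star_self, hαn, QuaternionAlgebra.coe_mul_eq_smul, smul_smul,
        inv_mul_cancel₀ hq0, one_smul]
  by_cases hsmall : EntryLe (κ ξ) (q : ℝ)⁻¹
  · refine ⟨α₀, hα₀, hn, ?_⟩
    have := (hκ.entryLe_of_mem_invP hqp hα₀).adjugate.mul hsmall
    rwa [one_mul] at this
  · obtain ⟨i, j, hij⟩ : ∃ i j, ¬ ‖κ ξ i j‖ ≤ (q : ℝ)⁻¹ := by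
      by_contra hcon; push Not at hcon; exact hsmall hcon
    have hw : Unimodular fun i => κ ξ i j := ⟨fun i => hX i j, i, norm_eq_one_of_inv_lt (hX i j) hij⟩
    -- Since q divides its determinant, ξ has image in one line modulo q. For α with the same image
    -- line, adj(α) ξ vanishes modulo q, so α⁻¹ ξ is integral.
    obtain ⟨α, hα, hαn, hαw⟩ := hκ.exists_image hqp ha hb hα₀ hn hw
    have hA := hκ.entryLe_of_mem_invP hqp hα
    refine ⟨α, hα, hαn, ?_⟩
    have hXX : ∀ k, ‖wedge (fun i => κ ξ i j) (fun i => κ ξ i k)‖ ≤ (q : ℝ)⁻¹ := by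
      intro k
      have h4 : ‖wedge (fun i => κ ξ i j) (fun i => κ ξ i k)‖ ≤ ‖(κ ξ).det‖ := by
        fin_cases j <;> fin_cases k <;>
          simp only [wedge, Matrix.det_fin_two, Fin.zero_eta, Fin.mk_one] <;> ring_nf
        · simp
        · rfl
        · rw [← norm_neg]; ring_nf; rfl
        · simp
      refine h4.trans ?_
      rw [det_map κ ha hb]; exact hξn
    intro i k
    fin_cases i
    · change ‖((κ α).adjugate * κ ξ) 0 k‖ ≤ _
      rw [adjugate_mul_apply_zero]
      exact norm_wedge_le_of_unimodular hw (fun i => hX i k) (fun i => hA i 1) (hXX k) (hαw 1)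
    · change ‖((κ α).adjugate * κ ξ) 1 k‖ ≤ _
      rw [adjugate_mul_apply_one]
      exact norm_wedge_le_of_unimodular hw (fun i => hA i 0) (fun i => hX i k) (hαw 0) (hXX k)

/-- There are at least `q` classes of elements of norm `q`. -/
theorem SplitAt.exists_many (hκ : SplitAt p R q κ) (hqp : q ≠ p) (ha : a < 0)
    (hb : b < 0) {α₀ : Quat a b} (hα₀ : α₀ ∈ invP p R) (hn : nr α₀ = q) :
    ∃ α : ℕ → Quat a b, (∀ t, α t ∈ invP p R ∧ nr (α t) = q) ∧
      ∀ s < q, ∀ t < q, (∃ z ∈ invP p R, star (α s) * α t = (q : ℚ) • z) → s = t := by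
  -- The q affine lines spanned by (t, 1), 0 ≤ t < q. Elements of the same coset have the same image
  -- line modulo q.
  have hw : ∀ t : ℕ, Unimodular (![(t : ℚ_[q]), 1] : Fin 2 → ℚ_[q]) := by
    intro t
    refine ⟨fun i => ?_, 1, by simp⟩
    fin_cases i
    · simpa using Padic.norm_int_le_one (t : ℤ)
    · simp
  choose α hα hαn hαw using fun t => hκ.exists_image hqp ha hb hα₀ hn (hw t)
  refine ⟨α, fun t => ⟨hα t, hαn t⟩, fun s hs t ht ⟨z, hz, hst⟩ => ?_⟩
  have hA := fun t => hκ.entryLe_of_mem_invP hqp (hα t)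
  have hcol : ∀ t, ∃ j, Unimodular fun i => κ (α t) i j := fun t =>
    exists_unimodular_col (hA t) (by rw [det_map κ ha hb, hαn, Rat.cast_natCast, Padic.norm_p])
  obtain ⟨j, hj⟩ := hcol s
  obtain ⟨k, hk⟩ := hcol t
  have hzi := hκ.entryLe_of_mem_invP hqp hz
  have hent : EntryLe ((κ (α s)).adjugate * κ (α t)) (q : ℝ)⁻¹ := by
    rw [← map_star κ ha hb, ← map_mul, hst, map_smul']
    intro i k
    rw [Matrix.smul_apply, smul_eq_mul, norm_mul]
    have h1 : ‖((q : ℚ) : ℚ_[q])‖ = (q : ℝ)⁻¹ := by simp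
    rw [h1]
    exact mul_le_of_le_one_right (by positivity) (hzi i k)
  have hanti : ∀ u v : Fin 2 → ℚ_[q], ‖wedge u v‖ = ‖wedge v u‖ := by
    intro u v; rw [← norm_neg]; congr 1; simp [wedge]; ring
  have hjk : ‖wedge (fun i => κ (α s) i j) (fun i => κ (α t) i k)‖ ≤ (q : ℝ)⁻¹ := by
    fin_cases j
    · have := hent 1 k
      rwa [adjugate_mul_apply_one] at this
    · have := hent 0 k
      rw [adjugate_mul_apply_zero] at this
      rwa [hanti] at this
  have h1 := norm_wedge_le_of_unimodular hj (fun i => hA t i k) (hw s).1 hjk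
    (by rw [hanti]; exact hαw s j)
  have h2 := norm_wedge_le_of_unimodular hk (hw s).1 (hw t).1 h1 (by rw [hanti]; exact hαw t k)
  have h3 : wedge (![(s : ℚ_[q]), 1] : Fin 2 → ℚ_[q]) ![(t : ℚ_[q]), 1] = ((s - t : ℤ) : ℚ_[q]) := by
    simp [wedge]
  have hq1 : (q : ℝ)⁻¹ < 1 :=
    inv_lt_one_of_one_lt₀ (by exact_mod_cast (Fact.out : q.Prime).one_lt)
  rw [h3] at h2
  have h4 := Padic.norm_intCast_lt_one_iff.1 (h2.trans_lt hq1)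
  have h5 : ((s : ℤ) - t) = 0 := Int.eq_zero_of_abs_lt_dvd h4 (by rw [abs_lt]; omega)
  omega

end Orbit
end ArithQuot

namespace ArithQuot

/-! ### Primes as norms: a conic and its integral points. -/

section NormElement

lemma sub_sq_le_of_fin_sqrt {n : ℕ} (x x' : Fin (Nat.sqrt n + 1)) :
    (((x : ℕ) : ℤ) - ((x' : ℕ) : ℤ)) ^ 2 ≤ n := by
  have h1 := Nat.sqrt_le n
  have h2 : |((x : ℕ) : ℤ) - ((x' : ℕ) : ℤ)| ≤ Nat.sqrt n := by
    have := x.2; have := x'.2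
    rw [abs_le]; omega
  have h3 : ((Nat.sqrt n : ℤ)) * Nat.sqrt n ≤ n := by exact_mod_cast h1
  rw [sq, ← abs_mul_abs_self]
  exact (mul_le_mul h2 h2 (abs_nonneg _) (by positivity)).trans h3

/-- Pigeonhole with boxes of sides √(Aℓ), √ℓ, √A against Aℓ residue classes. Adding 1 after rounding
down makes the inequality strict. -/
lemma exists_small_triple {A ℓ : ℕ} (hA : A ≠ 0) (hℓ : ℓ ≠ 0) (t : ℤ) :
    ∃ X Y Z : ℤ, ¬ (X = 0 ∧ Y = 0 ∧ Z = 0) ∧ X ^ 2 ≤ A * ℓ ∧ Y ^ 2 ≤ ℓ ∧ Z ^ 2 ≤ A ∧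
      (ℓ : ℤ) ∣ X - t * Y ∧ (A : ℤ) ∣ X - Z := by
  have : NeZero A := ⟨hA⟩
  have : NeZero ℓ := ⟨hℓ⟩
  let F : Fin (Nat.sqrt (A * ℓ) + 1) × Fin (Nat.sqrt ℓ + 1) × Fin (Nat.sqrt A + 1) → ZMod ℓ × ZMod A :=
    fun v => (((v.1 : ℕ) : ZMod ℓ) - (t : ZMod ℓ) * ((v.2.1 : ℕ) : ZMod ℓ),
      ((v.1 : ℕ) : ZMod A) - ((v.2.2 : ℕ) : ZMod A))
  obtain ⟨⟨x, y, z⟩, ⟨x', y', z'⟩, hne, hF⟩ : ∃ v v', v ≠ v' ∧ F v = F v' := by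
    apply Fintype.exists_ne_map_eq_of_card_lt
    simp only [Fintype.card_prod, Fintype.card_fin, ZMod.card]
    have h1 := Nat.lt_succ_sqrt (A * ℓ)
    have h2 := Nat.lt_succ_sqrt ℓ
    have h3 := Nat.lt_succ_sqrt A
    have h4 : (A * ℓ) * (ℓ * A) < ((Nat.sqrt (A * ℓ) + 1) * (Nat.sqrt (A * ℓ) + 1)) *
        (((Nat.sqrt ℓ + 1) * (Nat.sqrt ℓ + 1)) * ((Nat.sqrt A + 1) * (Nat.sqrt A + 1))) :=
      Nat.mul_lt_mul'' h1 (Nat.mul_lt_mul'' h2 h3)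
    by_contra hcon
    push Not at hcon
    have h5 := Nat.mul_le_mul hcon hcon
    nlinarith
  have hF1 := congrArg Prod.fst hF
  have hF2 := congrArg Prod.snd hF
  simp only [F] at hF1 hF2
  refine ⟨(x : ℕ) - (x' : ℕ), (y : ℕ) - (y' : ℕ), (z : ℕ) - (z' : ℕ), ?_, ?_,
    sub_sq_le_of_fin_sqrt _ _, sub_sq_le_of_fin_sqrt _ _, ?_, ?_⟩
  · rintro ⟨h1, h2, h3⟩
    apply hne
    simp only [Prod.mk.injEq]
    refine ⟨?_, ?_, ?_⟩ <;> apply Fin.ext <;> omega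
  · exact_mod_cast sub_sq_le_of_fin_sqrt x x'
  · rw [← ZMod.intCast_zmod_eq_zero_iff_dvd]
    push_cast
    linear_combination hF1
  · rw [← ZMod.intCast_zmod_eq_zero_iff_dvd]
    push_cast
    linear_combination hF2

/-- Primes `ℓ ≡ 1` are norms from `ℚ(√-A)` with small denominator. -/
lemma exists_conic {A ℓ : ℕ} (hA : 2 ≤ A) (hℓ : ℓ.Prime) (hℓA : (ℓ : ZMod A) = 1)
    (hnd : ¬ ℓ ∣ A) {t : ℤ} (ht : (ℓ : ℤ) ∣ t ^ 2 + A) :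
    ∃ X Y Z : ℤ, X ^ 2 + A * Y ^ 2 = ℓ * Z ^ 2 ∧ 0 < Z ∧ Z ≤ 2 * A := by
  obtain ⟨X, Y, Z, hne', hXl, hYl, hZl, hd1, hd2⟩ :=
    exists_small_triple (by omega : A ≠ 0) hℓ.ne_zero t
  have hℓA' : (A : ℤ) ∣ ℓ - 1 := by
    rw [← ZMod.intCast_zmod_eq_zero_iff_dvd]
    push_cast; rw [hℓA, sub_self]
  -- The congruences make Q divisible by Aℓ, and the size bounds put Q/(Aℓ) between -1 and 2. The
  -- two extreme values are excluded by the equality cases of the bounds.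
  set Q : ℤ := X ^ 2 + A * Y ^ 2 - ℓ * Z ^ 2 with hQ
  have hQ1 : (ℓ : ℤ) ∣ Q := by
    have : Q = (X - t * Y) * (X + t * Y) + (t ^ 2 + A) * Y ^ 2 - ℓ * Z ^ 2 := by rw [hQ]; ring
    rw [this]
    exact dvd_sub (dvd_add (hd1.mul_right _) (ht.mul_right _)) (dvd_mul_right _ _)
  have hQ2 : (A : ℤ) ∣ Q := by
    have : Q = (X - Z) * (X + Z) + A * Y ^ 2 - (ℓ - 1) * Z ^ 2 := by rw [hQ]; ring
    rw [this]
    exact dvd_sub (dvd_add (hd2.mul_right _) (dvd_mul_right _ _)) (hℓA'.mul_right _)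
  have hcop : IsCoprime (A : ℤ) ℓ :=
    Nat.isCoprime_iff_coprime.2 ((Nat.Prime.coprime_iff_not_dvd hℓ).2 hnd).symm
  obtain ⟨k, hk⟩ := hcop.mul_dvd hQ2 hQ1
  have hA0 : (2 : ℤ) ≤ A := by exact_mod_cast hA
  have hℓ1 : (2 : ℤ) ≤ ℓ := by exact_mod_cast hℓ.two_le
  have hAℓ : (0 : ℤ) < A * ℓ := by positivity
  have hk2 : k ≤ 2 := by
    have : (A * ℓ : ℤ) * k ≤ A * ℓ * 2 := by rw [← hk, hQ]; nlinarith [sq_nonneg Z]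
    exact le_of_mul_le_mul_left this hAℓ
  have hk1 : -1 ≤ k := by
    have : (A * ℓ : ℤ) * (-1) ≤ A * ℓ * k := by
      rw [← hk, hQ]; nlinarith [sq_nonneg X, sq_nonneg Y]
    exact le_of_mul_le_mul_left this hAℓ
  have hkn1 : k ≠ -1 := by
    rintro rfl
    have hZA : ℓ * (A - Z ^ 2) + X ^ 2 + A * Y ^ 2 = 0 := by rw [hQ] at hk; linarith
    have h1 : X ^ 2 = 0 := by nlinarith [sq_nonneg X, sq_nonneg Y]
    have h2 : Z ^ 2 = A := by nlinarith [sq_nonneg X, sq_nonneg Y]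
    have h3 : X = 0 := by simpa using h1
    rw [h3, zero_sub, dvd_neg] at hd2
    obtain ⟨m, hm⟩ := hd2
    rw [hm] at h2
    have h4 : (A : ℤ) * (A * m ^ 2) = A * 1 := by linarith
    have h5 := mul_left_cancel₀ (by omega : (A : ℤ) ≠ 0) h4
    have h6 : (A : ℤ) ∣ 1 := ⟨m ^ 2, h5.symm⟩
    have := Int.le_of_dvd one_pos h6
    omega
  have hkn2 : k ≠ 2 := by
    rintro rfl
    have h1 : X ^ 2 = A * ℓ := by rw [hQ] at hk; nlinarith [sq_nonneg Z]
    have hp := Nat.prime_iff_prime_int.1 hℓ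
    have h2 : (ℓ : ℤ) ∣ X := hp.dvd_of_dvd_pow (n := 2) ⟨A, by rw [h1]; ring⟩
    obtain ⟨m, hm⟩ := h2
    rw [hm] at h1
    have h3 : (ℓ : ℤ) * (ℓ * m ^ 2) = ℓ * A := by linarith
    have h4 := mul_left_cancel₀ (by omega : (ℓ : ℤ) ≠ 0) h3
    exact hnd (Int.natCast_dvd_natCast.1 ⟨m ^ 2, h4.symm⟩)
  have hk01 : k = 0 ∨ k = 1 := by omega
  rcases hk01 with rfl | rfl
  · have heq : X ^ 2 + A * Y ^ 2 = ℓ * Z ^ 2 := by rw [hQ] at hk; linarith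
    have hZ0 : Z ≠ 0 := by
      intro h0
      rw [h0] at heq
      have h1 : X ^ 2 = 0 := by nlinarith [sq_nonneg X, sq_nonneg Y]
      have h2 : Y ^ 2 = 0 := by nlinarith [sq_nonneg X, sq_nonneg Y]
      exact hne' ⟨by simpa using h1, by simpa using h2, h0⟩
    refine ⟨X, Y, |Z|, by rw [sq_abs]; exact heq, abs_pos.2 hZ0, ?_⟩
    have : |Z| ^ 2 ≤ A := by rw [sq_abs]; exact hZl
    nlinarith [abs_nonneg Z]
  -- Here X² + AY² = ℓ(Z² + A), and multiplicativity of the form against Z² + A turns this into a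
  -- solution of the conic.
  · refine ⟨X * Z - A * Y, X + Y * Z, Z ^ 2 + A, ?_, by positivity, by linarith⟩
    have heq : X ^ 2 + A * Y ^ 2 = ℓ * (Z ^ 2 + A) := by rw [hQ] at hk; linarith
    linear_combination (Z ^ 2 + A) * heq

/-- Simultaneous choice of signs modulo prime powers. -/
lemma exists_signs (P : Finset ℕ) (hP : ∀ q ∈ P, q.Prime) (e : ℕ) (σ : ℕ → ℤ) :
    ∃ s : ℤ, ∀ q ∈ P, ((q : ℤ) ^ e) ∣ s - σ q := by
  classical
  obtain ⟨s, hs⟩ := Nat.chineseRemainderOfFinset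
    (fun q => ((σ q) % ((q : ℤ) ^ e)).toNat) (fun q => q ^ e) P
    (fun q hq => pow_ne_zero _ (hP q hq).ne_zero)
    (fun q hq q' hq' hne => Nat.Coprime.pow _ _ ((Nat.coprime_primes (hP q hq) (hP q' hq')).2 hne))
  refine ⟨s, fun q hq => ?_⟩
  have h1 := hs q hq
  have hpos : (0 : ℤ) < (q : ℤ) ^ e := by have := (hP q hq).pos; positivity
  have h2 : ((((σ q) % ((q : ℤ) ^ e)).toNat : ℕ) : ℤ) = σ q % ((q : ℤ) ^ e) :=
    Int.toNat_of_nonneg (Int.emod_nonneg _ hpos.ne')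
  have h3 := (Nat.modEq_iff_dvd.1 h1.symm)
  rw [h2] at h3
  push_cast at h3
  have h4 : ((q : ℤ) ^ e) ∣ σ q % ((q : ℤ) ^ e) - σ q := by
    rw [Int.emod_def]; exact ⟨-(σ q / (q : ℤ) ^ e), by ring⟩
  have := dvd_add h3 h4
  rwa [sub_add_sub_cancel] at this

/-- A rational solution of `x² + A y² = ℓ` that is integral at the primes dividing `M`. -/
lemma exists_norm_eq {A ℓ M e : ℕ} (hM : 0 < M) (h2M : 2 ∣ M) (he : 16 * A ^ 2 ≤ e)
    (hℓM : ((M : ℤ) ^ e) ∣ ℓ - 1) {X Y Z : ℤ} (h : X ^ 2 + A * Y ^ 2 = ℓ * Z ^ 2) (hZ : 0 < Z)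
    (hZA : Z ≤ 2 * A) :
    ∃ x y : ℚ, x ^ 2 + A * y ^ 2 = ℓ ∧ ∀ q : ℕ, q.Prime → q ∣ M → ¬ q ∣ x.den ∧ ¬ q ∣ y.den := by
  -- The two expressions for σ = ±1 add up to 4Z², which is positive and below 2^e; q^e cannot
  -- divide both.
  have hsign : ∀ q : ℕ, q.Prime → ∃ σ : ℤ, σ ^ 2 = 1 ∧ ¬ ((q : ℤ) ^ e) ∣ 2 * Z * (Z + σ * X) := by
    intro q hq
    by_contra hcon
    push Not at hcon
    have h1 := dvd_add (hcon 1 (by norm_num)) (hcon (-1) (by norm_num))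
    have h2 : 2 * Z * (Z + 1 * X) + 2 * Z * (Z + -1 * X) = 4 * Z ^ 2 := by ring
    rw [h2] at h1
    have h3 := Int.le_of_dvd (by positivity) h1
    have h4 : 4 * Z ^ 2 ≤ 16 * (A : ℤ) ^ 2 := by nlinarith
    have h5 : 16 * A ^ 2 < q ^ e := lt_of_lt_of_le (lt_of_le_of_lt he Nat.lt_two_pow_self)
      (Nat.pow_le_pow_left hq.two_le e)
    have h6 : (16 * (A : ℤ) ^ 2) < (q : ℤ) ^ e := by exact_mod_cast h5
    linarith
  have hsign' : ∀ q : ℕ, ∃ σ : ℤ, q.Prime → σ ^ 2 = 1 ∧ ¬ ((q : ℤ) ^ e) ∣ 2 * Z * (Z + σ * X) := by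
    intro q
    by_cases hq : q.Prime
    · obtain ⟨σ, hσ⟩ := hsign q hq; exact ⟨σ, fun _ => hσ⟩
    · exact ⟨0, fun h => absurd h hq⟩
  choose σ hσ using hsign'
  obtain ⟨s, hs⟩ := exists_signs M.primeFactors (fun q hq => Nat.prime_of_mem_primeFactors hq) e σ
  -- For s ≡ σ_q modulo q^e this is 2Z(Z + σ_q X) modulo q^e, so q^e does not divide f but divides ℓ
  -- - s².
  set f : ℤ := (Z * s + X) ^ 2 + A * Y ^ 2 with hf
  have hfe : f = Z ^ 2 * s ^ 2 + 2 * Z * X * s + ℓ * Z ^ 2 := by rw [hf]; linear_combination h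
  have key : ∀ q : ℕ, q.Prime → q ∣ M → ((q : ℤ) ^ e) ∣ ℓ - s ^ 2 ∧ ¬ ((q : ℤ) ^ e) ∣ f := by
    intro q hq hqM
    have h1 := hs q (Nat.mem_primeFactors.2 ⟨hq, hqM, hM.ne'⟩)
    obtain ⟨h2, h3⟩ := hσ q hq
    have h4 : ((q : ℤ) ^ e) ∣ ℓ - 1 :=
      (pow_dvd_pow_of_dvd (Int.natCast_dvd_natCast.2 hqM) e).trans hℓM
    refine ⟨?_, fun h5 => h3 ?_⟩
    · have : (ℓ : ℤ) - s ^ 2 = (ℓ - 1) - (s - σ q) * (s + σ q) := by linear_combination -h2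
      rw [this]
      exact dvd_sub h4 (h1.mul_right _)
    · have : 2 * Z * (Z + σ q * X) = f - (s - σ q) * (Z ^ 2 * (s + σ q) + 2 * Z * X)
          - (ℓ - 1) * Z ^ 2 := by
        rw [hfe]; linear_combination (-Z ^ 2) * h2
      rw [this]
      exact dvd_sub (dvd_sub h5 (h1.mul_right _)) (h4.mul_right _)
  have hf0 : f ≠ 0 := fun h0 => (key 2 Nat.prime_two h2M).2 (h0 ▸ dvd_zero _)
  have hfQ : (f : ℚ) ≠ 0 := by exact_mod_cast hf0
  have hfeQ : (f : ℚ) = Z ^ 2 * s ^ 2 + 2 * Z * X * s + ℓ * Z ^ 2 := by exact_mod_cast hfe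
  have hfQ' : (f : ℚ) = (Z * s + X) ^ 2 + A * Y ^ 2 := by rw [hf]; push_cast; ring
  set g : ℚ := ((ℓ - s ^ 2 : ℤ) : ℚ) with hg
  have hgQ : g = ℓ - s ^ 2 := by rw [hg]; push_cast; ring
  -- The second intersection of the conic with the line through (s, 0) and its point (-X/Z, Y/Z).
  -- The only denominator is that of g/f, which is integral at the primes dividing M.
  refine ⟨s + g / f * (Z * (Z * s + X) : ℤ), g / f * (-(Z * Y) : ℤ), ?_, ?_⟩
  · have h1 : (s + g / f * (Z * (Z * s + X) : ℤ)) ^ 2 + A * (g / f * (-(Z * Y) : ℤ)) ^ 2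
        = s ^ 2 + (2 * s * Z * (Z * s + X) * g) / f
          + g ^ 2 * Z ^ 2 * ((Z * s + X) ^ 2 + A * Y ^ 2) / f ^ 2 := by
      push_cast; field_simp; ring
    rw [h1, ← hfQ']
    have h2 : g ^ 2 * Z ^ 2 * (f : ℚ) / f ^ 2 = g ^ 2 * Z ^ 2 / f := by field_simp
    rw [h2, add_assoc, ← add_div]
    have h3 : (2 * s * Z * (Z * s + X) * g + g ^ 2 * Z ^ 2 : ℚ) = g * f := by
      rw [hfeQ, hgQ]; ring
    rw [h3, mul_div_assoc, div_self hfQ, hgQ]; ring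
  · intro q hq hqM
    have : Fact q.Prime := ⟨hq⟩
    obtain ⟨h1, h2⟩ := key q hq hqM
    have hgf : pabs q (g / f) ≤ 1 := by
      rw [← Padic.norm_int_le_pow_iff_dvd] at h1 h2
      push Not at h2
      rw [pabs, Rat.cast_div, norm_div, hg, Rat.cast_intCast, Rat.cast_intCast]
      exact (div_le_one (((norm_nonneg _).trans h1).trans_lt h2)).2 (h1.trans h2.le)
    have hmul : ∀ z : ℤ, pabs q (g / f * (z : ℚ)) ≤ 1 := fun z => by
      rw [pabs_mul]
      exact mul_le_one₀ hgf (pabs_nonneg _) (pabs_intCast_le z)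
    rw [← pabs_le_one_iff, ← pabs_le_one_iff]
    exact ⟨(pabs_add_le _ _).trans (max_le (pabs_intCast_le s) (hmul _)), hmul _⟩

/-- After multiplication by the denominator of `y` the equation reads t² ≡ -A num(y)² modulo q with
t an integer, and num(y) is invertible modulo q. -/
lemma exists_dvd_sq_add {A : ℕ} {n : ℤ} {x y : ℚ} (h : x ^ 2 + A * y ^ 2 = n) {q : ℕ}
    (hy : q ∣ y.den) : ∃ r : ℤ, (q : ℤ) ∣ r ^ 2 + A := by
  have hy0 : (y.den : ℚ) ≠ 0 := by exact_mod_cast y.den_ne_zero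
  set t : ℚ := x * y.den with ht
  have hyn : y * y.den = y.num := Rat.mul_den_eq_num y
  have ht2 : t ^ 2 = ((n * (y.den : ℤ) ^ 2 - A * y.num ^ 2 : ℤ) : ℚ) := by
    push_cast
    rw [ht, ← hyn, ← h]; ring
  have htQ : t ∈ intQ := by
    have ht2' : t ^ 2 ∈ intQ := by rw [ht2]; exact intCast_mem_intQ _
    have hd : (t.den : ℚ) * t ∈ intQ := by
      rw [mul_comm, Rat.mul_den_eq_num]; exact intCast_mem_intQ _
    refine mem_intQ_of_pow (D := t.den) (by exact_mod_cast t.den_ne_zero) fun m => ?_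
    obtain ⟨j, rfl | rfl⟩ := Nat.even_or_odd' m
    · rw [pow_mul]; exact mul_mem (natCast_mem_intQ _) (pow_mem ht2' j)
    · rw [pow_succ, pow_mul, mul_left_comm]; exact mul_mem (pow_mem ht2' j) hd
  obtain ⟨k, hk⟩ := mem_intQ.1 htQ
  have hk2 : k ^ 2 = n * (y.den : ℤ) ^ 2 - A * y.num ^ 2 := by
    rw [hk] at ht2; exact_mod_cast ht2
  have hcop : IsCoprime (q : ℤ) y.num := by
    rw [Int.isCoprime_iff_gcd_eq_one, Int.gcd_comm]
    exact Nat.Coprime.coprime_dvd_right hy y.reduced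
  obtain ⟨u, v, huv⟩ := hcop
  refine ⟨k * v, ?_⟩
  obtain ⟨d, hd⟩ := hy
  have : (k * v) ^ 2 + (A : ℤ) = q * (v ^ 2 * n * q * d ^ 2 + A * (2 * u - u * q * u)) := by
    have h1 : v * y.num = 1 - u * q := by linarith
    have h2 : (y.den : ℤ) = q * d := by exact_mod_cast hd
    have h3 : (k * v) ^ 2 = v ^ 2 * n * (q * d) ^ 2 - A * (v * y.num) ^ 2 := by
      rw [mul_pow, hk2, h2]; ring
    rw [h3, h1]; ring
  exact ⟨_, this⟩

/-- Quadratic reciprocity: the Jacobi symbol of -A depends only on ℓ modulo 4A. -/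
lemma exists_dvd_sq_add_of_congr {A ℓ : ℕ} [Fact ℓ.Prime] (hA : 2 ≤ A) (hℓ : Odd ℓ)
    (h : (4 * A) ∣ ℓ - 1) : ∃ r : ℤ, (ℓ : ℤ) ∣ r ^ 2 + A := by
  have hℓ1 : 1 ≤ ℓ := (Fact.out : ℓ.Prime).one_le
  have hmod : ℓ % (4 * A) = 1 := by
    obtain ⟨k, hk⟩ := h
    have : ℓ = 1 + 4 * A * k := by omega
    rw [this, Nat.add_mul_mod_self_left, Nat.mod_eq_of_lt (by omega)]
  have hJ : jacobiSym (-(A : ℤ)) ℓ = 1 := by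
    rw [jacobiSym.mod_right _ hℓ, Int.natAbs_neg, Int.natAbs_natCast, hmod, jacobiSym.one_right]
  rw [← jacobiSym.legendreSym.to_jacobiSym] at hJ
  have h0 : ((-(A : ℤ) : ℤ) : ZMod ℓ) ≠ 0 := by
    intro h0
    rw [(legendreSym.eq_zero_iff ℓ _).2 h0] at hJ
    exact zero_ne_one hJ
  obtain ⟨r, hr⟩ := (legendreSym.eq_one_iff ℓ h0).1 hJ
  refine ⟨r.val, ?_⟩
  rw [← ZMod.intCast_zmod_eq_zero_iff_dvd]
  push_cast at hr ⊢
  rw [ZMod.natCast_zmod_val]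
  linear_combination -hr

/-- For the primes `ℓ` congruent to `1` to a suitable modulus, the ring `R[1/p]` contains elements
of norm `ℓ`. -/
theorem IsOrder.exists_norm_eq_prime {a b : ℚ} {p : ℕ} [Fact p.Prime] {R : Subring (Quat a b)}
    (hR : IsOrder R) (ha : a < 0) (hb : b < 0)
    (ι : Quat a b →ₐ[ℚ] Matrix (Fin 2) (Fin 2) ℚ_[p]) :
    ∃ m : ℕ, 0 < m ∧ ∀ (ℓ : ℕ) [Fact ℓ.Prime], ℓ ≠ p → (ℓ : ZMod m) = 1 →
      (∃ κ : Quat a b →ₐ[ℚ] Matrix (Fin 2) (Fin 2) ℚ_[ℓ], SplitAt p R ℓ κ) ∧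
        ∃ α ∈ invP p R, nr α = ℓ := by
  obtain ⟨c, A, M₀, hc, hA2, hM₀, hAM, hA, hI, hsplit⟩ := hR.exists_splitAt ha hb ι
  have h2M : 2 ∣ M₀ := (dvd_mul_right 2 A).trans hAM
  have hAM' : A ∣ M₀ := (dvd_mul_left A 2).trans hAM
  set e := 16 * A ^ 2 with he
  -- The factor 4A makes -A a square modulo ℓ, and M₀^e makes the solution of the norm equation
  -- integral at the primes dividing M₀.
  refine ⟨4 * A * M₀ ^ e, by positivity, fun ℓ _ hℓp hℓ => ?_⟩
  have hℓℓ : ℓ.Prime := Fact.out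
  have hℓ1 := hℓℓ.one_le
  have hdvd : 4 * A * M₀ ^ e ∣ ℓ - 1 := by
    have h1 : ((ℓ - 1 : ℕ) : ZMod (4 * A * M₀ ^ e)) = 0 := by
      rw [Nat.cast_sub hℓ1, hℓ]; simp
    exact (ZMod.natCast_eq_zero_iff _ _).1 h1
  have he0 : e ≠ 0 := by positivity
  have hdM : M₀ ^ e ∣ ℓ - 1 := (dvd_mul_left _ _).trans hdvd
  have hdM' : M₀ ∣ ℓ - 1 := (dvd_pow_self _ he0).trans hdM
  have hℓM : ¬ ℓ ∣ M₀ := by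
    intro h
    have h1 := Nat.le_of_dvd (Nat.sub_pos_of_lt hℓℓ.one_lt) (h.trans hdM')
    omega
  have hodd : Odd ℓ := hℓℓ.odd_of_ne_two (by rintro rfl; exact hℓM h2M)
  obtain ⟨r, hr⟩ := exists_dvd_sq_add_of_congr hA2 hodd ((dvd_mul_right _ _).trans hdvd)
  refine ⟨hsplit ℓ hℓM hℓp r hr, ?_⟩
  have hAz : (ℓ : ZMod A) = 1 := by
    have h1 : ((ℓ - 1 : ℕ) : ZMod A) = 0 := (ZMod.natCast_eq_zero_iff _ _).2 (hAM'.trans hdM')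
    rw [Nat.cast_sub hℓ1, Nat.cast_one, sub_eq_zero] at h1
    exact h1
  obtain ⟨X, Y, Z, hXYZ, hZ, hZA⟩ := exists_conic hA2 hℓℓ hAz (fun h => hℓM (h.trans hAM')) hr
  have hdMz : ((M₀ : ℤ) ^ e) ∣ ℓ - 1 := by
    have := Int.natCast_dvd_natCast.2 hdM
    rwa [Nat.cast_sub hℓ1, Nat.cast_pow, Nat.cast_one] at this
  obtain ⟨x, y, hxy, hint⟩ := exists_norm_eq hM₀ h2M le_rfl hdMz hXYZ hZ hZA
  set β : Quat a b := (x : Quat a b) + y • elI a b c with hβ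
  have hβn : nr β = ((ℓ : ℤ) : ℚ) := by
    rw [Int.cast_natCast, ← hxy, hA, nr_eq]
    simp [hβ, elI]; ring
  have hmem : (((x.den * y.den : ℕ) : ℚ)) • β ∈ invP p R := by
    refine le_invP p ?_
    have h1 : (((x.den * y.den : ℕ) : ℚ)) • β
        = (((x.num * y.den : ℤ) : ℚ) : Quat a b) + ((y.num * x.den : ℤ) : ℚ) • elI a b c := by
      have hx := Rat.mul_den_eq_num x
      have hy := Rat.mul_den_eq_num y
      have ex : ((x.num * y.den : ℤ) : ℚ) = ((x.den * y.den : ℕ) : ℚ) * x := by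
        push_cast; rw [← hx]; ring
      have ey : ((y.num * x.den : ℤ) : ℚ) = ((x.den * y.den : ℕ) : ℚ) * y := by
        push_cast; rw [← hy]; ring
      rw [ex, ey, hβ, smul_add, smul_smul]
      congr 1
      ext <;> simp
    rw [h1]
    exact add_mem (intQ_coe_mem (intCast_mem_intQ _)) (intCast_smul_mem _ hI)
  have hℓ0 : (ℓ : ℤ) ≠ 0 := by exact_mod_cast hℓℓ.ne_zero
  obtain ⟨α, hα, hαn⟩ := IsOrder.exists_mem_invP_of_nr ha hb hℓ0 _
    (Nat.mul_pos x.den_pos y.den_pos) β hβn hmem (by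
      -- At the divisors of M₀ the solution is integral. Elsewhere a prime in the denominator of y
      -- makes -A a square modulo q, so q is a splitting prime. If q does not divide that
      -- denominator, the equation makes x integral at q too.
      intro q _ hqp
      have hq : q.Prime := Fact.out
      have hinteg : ¬ q ∣ x.den → ¬ q ∣ y.den →
          ∃ N : ℕ, N.Coprime q ∧ (N : ℚ) • β ∈ invP p R := fun h1 h2 =>
        ⟨_, Nat.coprime_comm.1 ((hq.coprime_iff_not_dvd).2 (by rw [hq.dvd_mul]; tauto)), hmem⟩
      by_cases hqM : q ∣ M₀
      · obtain ⟨h1, h2⟩ := hint q hq hqM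
        exact Or.inr (hinteg h1 h2)
      by_cases hy : q ∣ y.den
      · obtain ⟨r', hr'⟩ := exists_dvd_sq_add (n := (ℓ : ℤ)) (by exact_mod_cast hxy) hy
        exact Or.inl (hsplit q hqM hqp r' hr')
      · refine Or.inr (hinteg ?_ hy)
        rw [← pabs_le_one_iff] at hy ⊢
        have h1 : pabs q (x ^ 2) ≤ 1 := by
          rw [eq_sub_of_add_eq hxy]
          refine (pabs_sub_le _ _).trans (max_le ?_ ?_)
          · exact_mod_cast pabs_intCast_le (ℓ := q) (ℓ : ℤ)
          · rw [pabs_mul, sq, pabs_mul]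
            have h2 : pabs q (A : ℚ) ≤ 1 := by exact_mod_cast pabs_intCast_le (ℓ := q) (A : ℤ)
            exact mul_le_one₀ h2 (mul_nonneg (pabs_nonneg _) (pabs_nonneg _))
              (mul_le_one₀ hy (pabs_nonneg _) hy)
        rw [sq, pabs_mul] at h1
        by_contra h3
        push Not at h3
        nlinarith)
  exact ⟨α, hα, by exact_mod_cast hαn⟩

end NormElement
end ArithQuot

namespace ArithQuot

/-! ### Cosets of Γ in the sets of elements of given norm. -/

section Cosets

set_option linter.unusedSectionVars false

variable {p : ℕ} [Fact p.Prime] {a b : ℚ} {R : Subring (Quat a b)}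
  {ι : Quat a b →ₐ[ℚ] Matrix (Fin 2) (Fin 2) ℚ_[p]}

/-- The elements of `R[1/p]` of reduced norm `n p ^ k` for some integer `k`. -/
def normSet (p : ℕ) (R : Subring (Quat a b)) (n : ℕ) : Set (Quat a b) :=
  {α | α ∈ invP p R ∧ ∃ k : ℤ, nr α = n * (p : ℚ) ^ k}

/-- The relation `α Γ = β Γ`. -/
def SameCoset (p : ℕ) (R : Subring (Quat a b)) (α β : Quat a b) : Prop :=
  ∃ γ ∈ normSet p R 1, β = α * γ

lemma prime_cast_ne_zero (p : ℕ) [Fact p.Prime] : (p : ℚ) ≠ 0 :=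
  Nat.cast_ne_zero.2 (Fact.out : p.Prime).ne_zero

lemma nr_ne_zero_of_mem_normSet {n : ℕ} (hn : n ≠ 0) {α : Quat a b} (hα : α ∈ normSet p R n) :
    nr α ≠ 0 := by
  obtain ⟨-, k, hk⟩ := hα
  rw [hk]
  exact mul_ne_zero (Nat.cast_ne_zero.2 hn) (zpow_ne_zero _ (prime_cast_ne_zero p))

lemma mul_mem_normSet {m n : ℕ} {α β : Quat a b} (hα : α ∈ normSet p R m)
    (hβ : β ∈ normSet p R n) : α * β ∈ normSet p R (m * n) := by
  obtain ⟨h1, k, hk⟩ := hα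
  obtain ⟨h2, l, hl⟩ := hβ
  refine ⟨mul_mem h1 h2, k + l, ?_⟩
  rw [nr_mul, hk, hl, zpow_add₀ (prime_cast_ne_zero p)]
  push_cast
  ring

lemma one_mem_normSet : (1 : Quat a b) ∈ normSet p R 1 :=
  ⟨one_mem _, 0, by simp⟩

lemma IsOrder.star_mem_normSet (hR : IsOrder R) {n : ℕ} {α : Quat a b} (hα : α ∈ normSet p R n) :
    star α ∈ normSet p R n := by
  obtain ⟨h1, k, hk⟩ := hα
  exact ⟨hR.star_mem_invP h1, k, by rw [nr_star, hk]⟩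

lemma IsOrder.qinv_mem_normSet (hR : IsOrder R) {γ : Quat a b} (hγ : γ ∈ normSet p R 1) :
    qinv γ ∈ normSet p R 1 := by
  obtain ⟨h1, k, hk⟩ := hγ
  refine ⟨?_, -k, ?_⟩
  · rw [qinv, hk, Nat.cast_one, one_mul, ← zpow_neg]
    exact zpow_smul_mem_invP (Fact.out : p.Prime).ne_zero (hR.star_mem_invP h1) _
  · rw [nr_qinv, hk]
    simp

lemma SameCoset.refl (α : Quat a b) : SameCoset p R α α :=
  ⟨1, one_mem_normSet, by simp⟩

lemma SameCoset.symm (hR : IsOrder R) {α β : Quat a b} (h : SameCoset p R α β) :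
    SameCoset p R β α := by
  obtain ⟨γ, hγ, rfl⟩ := h
  refine ⟨qinv γ, hR.qinv_mem_normSet hγ, ?_⟩
  rw [mul_assoc, mul_qinv (nr_ne_zero_of_mem_normSet one_ne_zero hγ), mul_one]

lemma SameCoset.trans {α β δ : Quat a b} (h : SameCoset p R α β) (h' : SameCoset p R β δ) :
    SameCoset p R α δ := by
  obtain ⟨γ, hγ, rfl⟩ := h
  obtain ⟨γ', hγ', rfl⟩ := h'
  exact ⟨γ * γ', by simpa using mul_mem_normSet hγ hγ', by rw [mul_assoc]⟩

lemma SameCoset.mul_left (ξ : Quat a b) {α β : Quat a b} (h : SameCoset p R α β) :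
    SameCoset p R (ξ * α) (ξ * β) := by
  obtain ⟨γ, hγ, rfl⟩ := h
  exact ⟨γ, hγ, by rw [mul_assoc]⟩

lemma SameCoset.mem_normSet {n : ℕ} {α β : Quat a b} (h : SameCoset p R α β)
    (hα : α ∈ normSet p R n) : β ∈ normSet p R n := by
  obtain ⟨γ, hγ, rfl⟩ := h
  simpa using mul_mem_normSet hα hγ

/-- Two elements of norm `n p ^ k` are in the same coset when `α⁻¹ β` is in `R[1/p]`. -/
lemma sameCoset_of_qinv_mul_mem {n : ℕ} (hn : n ≠ 0) {α β : Quat a b} (hα : α ∈ normSet p R n)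
    (hβ : β ∈ normSet p R n) (h : qinv α * β ∈ invP p R) : SameCoset p R α β := by
  have h0 := nr_ne_zero_of_mem_normSet hn hα
  refine ⟨qinv α * β, ⟨h, ?_⟩, ?_⟩
  · obtain ⟨-, k, hk⟩ := hα
    obtain ⟨-, l, hl⟩ := hβ
    have hn' : (n : ℚ) ≠ 0 := Nat.cast_ne_zero.2 hn
    refine ⟨l - k, ?_⟩
    rw [nr_mul, nr_qinv, hk, hl, zpow_sub₀ (prime_cast_ne_zero p)]
    have := zpow_ne_zero k (prime_cast_ne_zero p)
    field_simp
    simp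
  · rw [← mul_assoc, mul_qinv h0, one_mul]

lemma natCast_smul_qinv_mul {n : ℕ} (hn : n ≠ 0) {α : Quat a b} {k : ℤ}
    (hk : nr α = n * (p : ℚ) ^ k) (β : Quat a b) :
    (n : ℚ) • (qinv α * β) = (p : ℚ) ^ (-k) • (star α * β) := by
  rw [qinv, hk, smul_mul_assoc, smul_smul]
  congr 1
  have hn' : (n : ℚ) ≠ 0 := Nat.cast_ne_zero.2 hn
  have := zpow_ne_zero k (prime_cast_ne_zero p)
  rw [zpow_neg]
  field_simp

lemma IsOrder.smul_qinv_mul_mem (hR : IsOrder R) {n : ℕ} (hn : n ≠ 0) {α β : Quat a b}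
    (hα : α ∈ normSet p R n) (hβ : β ∈ invP p R) : (n : ℚ) • (qinv α * β) ∈ invP p R := by
  obtain ⟨h1, k, hk⟩ := hα
  rw [natCast_smul_qinv_mul hn hk]
  exact zpow_smul_mem_invP (Fact.out : p.Prime).ne_zero (mul_mem (hR.star_mem_invP h1) hβ) _

lemma sameCoset_of_star_mul {n : ℕ} (hn : n ≠ 0) {α β z : Quat a b} (hα : α ∈ normSet p R n)
    (hβ : β ∈ normSet p R n) (hz : z ∈ invP p R) (h : star α * β = (n : ℚ) • z) :
    SameCoset p R α β := by
  refine sameCoset_of_qinv_mul_mem hn hα hβ ?_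
  obtain ⟨h1, k, hk⟩ := hα
  have h2 := natCast_smul_qinv_mul hn hk β
  rw [h, smul_comm] at h2
  rw [smul_right_injective _ (Nat.cast_ne_zero.2 hn : (n : ℚ) ≠ 0) h2]
  exact zpow_smul_mem_invP (Fact.out : p.Prime).ne_zero hz _

lemma sameCoset_of_mul_left (ha : a < 0) (hb : b < 0) {ξ α β : Quat a b} (hξ : nr ξ ≠ 0)
    (h : SameCoset p R (ξ * α) (ξ * β)) : SameCoset p R α β := by
  obtain ⟨γ, hγ, h⟩ := h
  refine ⟨γ, hγ, mul_left_cancel' ha hb (x := ξ) ?_ (by rw [h, mul_assoc])⟩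
  rintro rfl
  simp at hξ

/-- A finite set of representatives of the cosets in `S / Γ`. -/
structure IsTransversal (p : ℕ) (R : Subring (Quat a b)) (S : Set (Quat a b))
    (A : Finset (Quat a b)) : Prop where
  sub : ∀ α ∈ A, α ∈ S
  inj : ∀ α ∈ A, ∀ β ∈ A, SameCoset p R α β → α = β
  surj : ∀ β ∈ S, ∃ α ∈ A, SameCoset p R α β

/-- Coset sums do not depend on representatives. Products of Hecke operators are computed by
indexing the same cosets in different ways. -/
lemma IsTransversal.sum_eq (hR : IsOrder R) {S : Set (Quat a b)} {A : Finset (Quat a b)}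
    (hA : IsTransversal p R S A) {τ : Type*} (I : Finset τ) (u : τ → Quat a b)
    (hu : ∀ i ∈ I, u i ∈ S) (hinj : ∀ i ∈ I, ∀ j ∈ I, SameCoset p R (u i) (u j) → i = j)
    (hsurj : ∀ ξ ∈ S, ∃ i ∈ I, SameCoset p R (u i) ξ) {f : Quat a b → ℂ}
    (hf : ∀ α β, SameCoset p R α β → nr α ≠ 0 → f α = f β) (h0 : ∀ ξ ∈ S, nr ξ ≠ 0) :
    ∑ i ∈ I, f (u i) = ∑ α ∈ A, f α := by
  choose! r hr hr' using fun i (hi : i ∈ I) => hA.surj (u i) (hu i hi)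
  refine Finset.sum_bij (fun i _ => r i) hr ?_ ?_ ?_
  · intro i hi j hj hij
    refine hinj i hi j hj (((hr' i hi).symm hR).trans ?_)
    rw [hij]
    exact hr' j hj
  · intro α hα
    obtain ⟨i, hi, h⟩ := hsurj α (hA.sub α hα)
    exact ⟨i, hi, hA.inj _ (hr i hi) _ hα ((hr' i hi).trans h)⟩
  · intro i hi
    exact (hf _ _ (hr' i hi) (h0 _ (hA.sub _ (hr i hi)))).symm

/-- Elements congruent modulo n lie in one coset, because α⁻¹β = 1 + n α⁻¹z has no denominator;
R[1/p]/n is finite. -/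
lemma IsOrder.exists_isTransversal (hR : IsOrder R) {n : ℕ} (hn0 : n ≠ 0) (hn : n.Coprime p) :
    ∃ A, IsTransversal p R (normSet p R n) A := by
  classical
  obtain ⟨T, _, c, hc⟩ := hR.exists_finite_classes (p := p) hn0 hn
  have key : ∀ α ∈ normSet p R n, ∀ β ∈ normSet p R n, c α = c β → SameCoset p R α β := by
    intro α hα β hβ h
    obtain ⟨z, hz, h⟩ := hc β hβ.1 α hα.1 h.symm
    refine sameCoset_of_qinv_mul_mem hn0 hα hβ ?_
    have h0 := nr_ne_zero_of_mem_normSet hn0 hα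
    have h1 : qinv α * β = 1 + (n : ℚ) • (qinv α * z) := by
      rw [← mul_smul_comm, ← h, mul_sub, qinv_mul h0]
      abel
    rw [h1]
    exact add_mem (one_mem _) (hR.smul_qinv_mul_mem hn0 hα hz)
  let s : Setoid (normSet p R n) :=
    ⟨fun α β => SameCoset p R α.1 β.1, fun α => SameCoset.refl _, fun h => h.symm hR,
      fun h h' => h.trans h'⟩
  have hfin : Finite (Quotient s) := by
    refine Finite.of_injective (β := T) (fun q => c q.out.1) fun q q' h => ?_
    rw [← Quotient.out_eq q, ← Quotient.out_eq q']
    exact Quotient.sound (key _ q.out.2 _ q'.out.2 h)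
  have := Fintype.ofFinite (Quotient s)
  refine ⟨Finset.univ.image fun q : Quotient s => q.out.1, ?_, ?_, ?_⟩
  · intro α hα
    obtain ⟨q, -, rfl⟩ := Finset.mem_image.1 hα
    exact q.out.2
  · intro α hα β hβ h
    obtain ⟨q, -, rfl⟩ := Finset.mem_image.1 hα
    obtain ⟨q', -, rfl⟩ := Finset.mem_image.1 hβ
    have : q = q' := by
      rw [← Quotient.out_eq q, ← Quotient.out_eq q']
      exact Quotient.sound h
    rw [this]
  · intro β hβ
    refine ⟨(Quotient.mk s ⟨β, hβ⟩).out.1, Finset.mem_image_of_mem _ (Finset.mem_univ _), ?_⟩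
    exact Quotient.exact (Quotient.out_eq (Quotient.mk s ⟨β, hβ⟩))

end Cosets

end ArithQuot

namespace ArithQuot

/-! ### Hecke operators as sums over quaternions. -/

section Hecke

set_option linter.unusedSectionVars false

variable {p : ℕ} [Fact p.Prime] {a b : ℚ} {R : Subring (Quat a b)}
  {ι : Quat a b →ₐ[ℚ] Matrix (Fin 2) (Fin 2) ℚ_[p]}

open Classical in
/-- The image of a quaternion of nonzero norm in `GL₂(ℚ_p)`. -/
def toG (ι : Quat a b →ₐ[ℚ] Matrix (Fin 2) (Fin 2) ℚ_[p]) (x : Quat a b) : G p :=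
  if h : (ι x).det ≠ 0 then Matrix.GeneralLinearGroup.mkOfDetNeZero (ι x) h else 1

variable (ι) in
lemma det_map_ne_zero (ha : a < 0) (hb : b < 0) {x : Quat a b} (hx : nr x ≠ 0) :
    (ι x).det ≠ 0 := by
  rw [det_map ι ha hb]
  exact_mod_cast hx

variable (ι) in
lemma toG_val (ha : a < 0) (hb : b < 0) {x : Quat a b} (hx : nr x ≠ 0) :
    (toG ι x).val = ι x := by
  rw [toG, dif_pos (det_map_ne_zero ι ha hb hx)]
  rfl

variable (ι) in
lemma toG_mul (ha : a < 0) (hb : b < 0) {x y : Quat a b} (hx : nr x ≠ 0) (hy : nr y ≠ 0) :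
    toG ι (x * y) = toG ι x * toG ι y := by
  apply Units.ext
  rw [Units.val_mul, toG_val ι ha hb hx, toG_val ι ha hb hy,
    toG_val ι ha hb (by rw [nr_mul]; exact mul_ne_zero hx hy), map_mul]

variable (ι) in
lemma toG_one (ha : a < 0) (hb : b < 0) : toG ι (1 : Quat a b) = 1 := by
  apply Units.ext
  rw [toG_val ι ha hb (by simp), map_one, Units.val_one]

variable (ι) in
lemma toG_qinv (ha : a < 0) (hb : b < 0) {x : Quat a b} (hx : nr x ≠ 0) :
    toG ι (qinv x) = (toG ι x)⁻¹ := by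
  rw [eq_inv_iff_mul_eq_one, ← toG_mul ι ha hb (by simpa using hx) hx, qinv_mul hx,
    toG_one ι ha hb]

/-- The norms of a unit and of its inverse become positive integers after multiplication by powers
of p, and the product of these integers is a power of p. Definiteness excludes the sign. -/
lemma IsOrder.exists_zpow_of_mul_eq_one (hR : IsOrder R) (ha : a < 0) (hb : b < 0)
    {x y : Quat a b} (hx : x ∈ invP p R) (hy : y ∈ invP p R) (h : x * y = 1) :
    ∃ k : ℤ, nr x = (p : ℚ) ^ k := by
  have hp := prime_cast_ne_zero p
  have hx0 : x ≠ 0 := by rintro rfl; simp at h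
  have hy0 : y ≠ 0 := by rintro rfl; simp at h
  have aux : ∀ z : Quat a b, z ≠ 0 → z ∈ invP p R →
      ∃ k m : ℕ, (p : ℚ) ^ k * nr z = m := by
    intro z hz0 hz
    obtain ⟨k, hk⟩ := mem_invP.1 hz
    obtain ⟨m, hm⟩ := mem_intQ.1 (hR.nr_mem hk)
    rw [nr_smul, ← pow_mul] at hm
    have : 0 < nr z := nr_pos ha hb hz0
    have hm0 : 0 ≤ m := by
      have h1 : 0 ≤ (m : ℚ) := by rw [← hm]; positivity
      exact_mod_cast h1
    lift m to ℕ using hm0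
    exact ⟨k * 2, m, by rw [hm]; simp⟩
  obtain ⟨k, m, hm⟩ := aux x hx0 hx
  obtain ⟨l, m', hm'⟩ := aux y hy0 hy
  have h1 : nr x * nr y = 1 := by rw [← nr_mul, h, nr_one]
  have h2 : m * m' = p ^ (k + l) := by
    have : (m : ℚ) * m' = (p : ℚ) ^ (k + l) := by
      rw [← hm, ← hm', pow_add]
      linear_combination ((p : ℚ) ^ k * (p : ℚ) ^ l) * h1
    exact_mod_cast this
  obtain ⟨i, -, hi⟩ := (Nat.dvd_prime_pow Fact.out).1 (Dvd.intro _ h2)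
  refine ⟨(i : ℤ) - k, ?_⟩
  rw [zpow_sub₀ hp, zpow_natCast, zpow_natCast, eq_div_iff (pow_ne_zero _ hp), mul_comm, hm, hi]
  push_cast
  rfl

lemma mem_Gam_iff (hR : IsOrder R) (ha : a < 0) (hb : b < 0) {g : G p} :
    g ∈ Gam R ι ↔ ∃ γ ∈ normSet p R 1, g.val = ι γ := by
  constructor
  · rintro ⟨u, rfl⟩
    refine ⟨u.val.1, ⟨u.val.2, ?_⟩, rfl⟩
    obtain ⟨k, hk⟩ := hR.exists_zpow_of_mul_eq_one ha hb u.val.2 u.inv.2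
      (congrArg Subtype.val u.val_inv)
    exact ⟨k, by rw [hk]; simp⟩
  · rintro ⟨γ, hγ, h⟩
    have h0 := nr_ne_zero_of_mem_normSet one_ne_zero hγ
    refine ⟨⟨⟨γ, hγ.1⟩, ⟨qinv γ, (hR.qinv_mem_normSet hγ).1⟩, Subtype.ext (mul_qinv h0),
      Subtype.ext (qinv_mul h0)⟩, ?_⟩
    apply Units.ext
    rw [h]
    rfl

lemma toG_mem_Gam_iff (hR : IsOrder R) (ha : a < 0) (hb : b < 0) {x : Quat a b} (hx : nr x ≠ 0) :
    toG ι x ∈ Gam R ι ↔ x ∈ normSet p R 1 := by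
  rw [mem_Gam_iff hR ha hb]
  constructor
  · rintro ⟨γ, hγ, h⟩
    rw [toG_val ι ha hb hx] at h
    have h1 : ι (x - γ) = 0 := by rw [map_sub, h, sub_self]
    have h2 : nr (x - γ) = 0 := by
      have := det_map ι ha hb (x - γ)
      rw [h1, Matrix.det_zero] at this
      exact_mod_cast this.symm
    rw [nr_eq_zero ha hb, sub_eq_zero] at h2
    rwa [h2]
  · intro h
    exact ⟨x, h, toG_val ι ha hb hx⟩

lemma mem_Gam_iff_toG (hR : IsOrder R) (ha : a < 0) (hb : b < 0) {g : G p} :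
    g ∈ Gam R ι ↔ ∃ γ ∈ normSet p R 1, g = toG ι γ := by
  rw [mem_Gam_iff hR ha hb]
  refine exists_congr fun γ => and_congr_right fun hγ => ?_
  rw [← toG_val ι ha hb (nr_ne_zero_of_mem_normSet one_ne_zero hγ), Units.ext_iff]

lemma toX_eq_iff {g h : G p} : toX R ι g = toX R ι h ↔ h * g⁻¹ ∈ Gam R ι := by
  exact Quotient.eq.trans QuotientGroup.rightRel_apply

lemma toX_surjective : Function.Surjective (toX R ι) := Quotient.mk_surjective

lemma rightTr_toX (g h : G p) : rightTr R ι h (toX R ι g) = toX R ι (g * h) := rfl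

lemma rho_toX (φ : X R ι → ℂ) (g h : G p) : rho R ι h φ (toX R ι g) = φ (toX R ι (g * h)) := rfl

/-- The value `φ(α⁻¹ g)`. -/
def ev (φ : X R ι → ℂ) (g : G p) (α : Quat a b) : ℂ := φ (toX R ι ((toG ι α)⁻¹ * g))

lemma toX_toG_inv_eq (hR : IsOrder R) (ha : a < 0) (hb : b < 0) {α β : Quat a b}
    (hα : nr α ≠ 0) (hβ : nr β ≠ 0) (g : G p) :
    toX R ι ((toG ι α)⁻¹ * g) = toX R ι ((toG ι β)⁻¹ * g) ↔ SameCoset p R α β := by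
  rw [eq_comm, toX_eq_iff]
  have h0 : nr (qinv α * β) ≠ 0 := by
    rw [nr_mul, nr_qinv]; exact mul_ne_zero (inv_ne_zero hα) hβ
  have : (toG ι α)⁻¹ * g * ((toG ι β)⁻¹ * g)⁻¹ = toG ι (qinv α * β) := by
    rw [toG_mul ι ha hb (by simpa using hα) hβ, toG_qinv ι ha hb hα]
    group
  rw [this, toG_mem_Gam_iff hR ha hb h0]
  constructor
  · intro h
    exact ⟨_, h, by rw [← mul_assoc, mul_qinv hα, one_mul]⟩
  · rintro ⟨γ, hγ, rfl⟩
    rwa [← mul_assoc, qinv_mul hα, one_mul]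

lemma ev_congr (hR : IsOrder R) (ha : a < 0) (hb : b < 0) (φ : X R ι → ℂ) (g : G p)
    (α β : Quat a b) (h : SameCoset p R α β) (hα : nr α ≠ 0) : ev φ g α = ev φ g β := by
  have hβ : nr β ≠ 0 := by
    obtain ⟨γ, hγ, rfl⟩ := h
    rw [nr_mul]
    exact mul_ne_zero hα (nr_ne_zero_of_mem_normSet one_ne_zero hγ)
  exact congrArg φ ((toX_toG_inv_eq hR ha hb hα hβ g).2 h)

lemma ev_mul (ha : a < 0) (hb : b < 0) (φ : X R ι → ℂ) (g : G p) {α β : Quat a b}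
    (hα : nr α ≠ 0) (hβ : nr β ≠ 0) :
    ev φ g (α * β) = ev φ ((toG ι α)⁻¹ * g) β := by
  rw [ev, ev, toG_mul ι ha hb hα hβ, mul_inv_rev, mul_assoc]

lemma mem_M_iff (ha : a < 0) (hb : b < 0) {n : ℕ} (hn : n ≠ 0) {g : G p} :
    g ∈ M R ι n ↔ ∃ α ∈ normSet p R n, g = toG ι α := by
  have hp : (0 : ℚ) < p := Nat.cast_pos.2 (Fact.out : p.Prime).pos
  have hn' : (0 : ℚ) < n := Nat.cast_pos.2 (Nat.pos_of_ne_zero hn)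
  constructor
  · rintro ⟨α, hα, h, k, hk⟩
    have h1 : nr α = n * (p : ℚ) ^ k := by
      refine hk.resolve_right fun h2 => ?_
      have h3 := nr_nonneg ha hb α
      have : 0 < (n : ℚ) * (p : ℚ) ^ k := by positivity
      linarith
    refine ⟨α, ⟨hα, k, h1⟩, Units.ext ?_⟩
    rw [toG_val ι ha hb (by rw [h1]; positivity), h]
  · rintro ⟨α, hα, rfl⟩
    exact ⟨α, hα.1, toG_val ι ha hb (nr_ne_zero_of_mem_normSet hn hα),
      hα.2.choose, Or.inl hα.2.choose_spec⟩

lemma heckeSet_toX (hR : IsOrder R) (ha : a < 0) (hb : b < 0) {n : ℕ} (hn : n ≠ 0)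
    {A : Finset (Quat a b)} (hA : IsTransversal p R (normSet p R n) A) (g : G p) :
    heckeSet R ι n (toX R ι g) = (fun α => toX R ι ((toG ι α)⁻¹ * g)) '' (A : Set (Quat a b)) := by
  ext y
  constructor
  · rintro ⟨h, m, hm, hgh, rfl⟩
    obtain ⟨α, hα, rfl⟩ := (mem_M_iff ha hb hn).1 hm
    rw [eq_comm, toX_eq_iff, mem_Gam_iff_toG hR ha hb] at hgh
    obtain ⟨γ, hγ, hγ'⟩ := hgh
    have h0 := nr_ne_zero_of_mem_normSet one_ne_zero hγ
    have h1 := nr_ne_zero_of_mem_normSet hn hα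
    have h2 : γ * α ∈ normSet p R n := by simpa using mul_mem_normSet hγ hα
    obtain ⟨β, hβ, hβα⟩ := hA.surj _ h2
    refine ⟨β, hβ, ?_⟩
    have h3 : (toG ι α)⁻¹ * h = (toG ι (γ * α))⁻¹ * g := by
      rw [toG_mul ι ha hb h0 h1, ← hγ']
      group
    rw [h3]
    exact (toX_toG_inv_eq hR ha hb (nr_ne_zero_of_mem_normSet hn (hA.sub _ hβ))
      (nr_ne_zero_of_mem_normSet hn h2) g).2 hβα
  · rintro ⟨α, hα, rfl⟩
    exact ⟨g, toG ι α, (mem_M_iff ha hb hn).2 ⟨α, hA.sub _ hα, rfl⟩, rfl, rfl⟩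

/-- Distinct cosets give distinct points of the quotient, so the sum over a set of points loses no
multiplicities. -/
lemma hecke_toX (hR : IsOrder R) (ha : a < 0) (hb : b < 0) {n : ℕ} (hn : n ≠ 0)
    {A : Finset (Quat a b)} (hA : IsTransversal p R (normSet p R n) A) (φ : X R ι → ℂ) (g : G p) :
    hecke R ι n φ (toX R ι g) = ∑ α ∈ A, ev φ g α := by
  rw [hecke, heckeSet_toX hR ha hb hn hA, finsum_mem_image, finsum_mem_coe_finset]
  · rfl
  · intro α hα β hβ h
    exact hA.inj α hα β hβ ((toX_toG_inv_eq hR ha hb (nr_ne_zero_of_mem_normSet hn (hA.sub _ hα))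
      (nr_ne_zero_of_mem_normSet hn (hA.sub _ hβ)) g).1 h)

lemma rho_hecke (hR : IsOrder R) (ha : a < 0) (hb : b < 0) {n : ℕ} (hn : n ≠ 0)
    (hnp : n.Coprime p) (φ : X R ι → ℂ) (h : G p) :
    rho R ι h (hecke R ι n φ) = hecke R ι n (rho R ι h φ) := by
  obtain ⟨A, hA⟩ := hR.exists_isTransversal (p := p) hn hnp
  funext x
  obtain ⟨g, rfl⟩ := toX_surjective x
  rw [rho_toX, hecke_toX hR ha hb hn hA, hecke_toX hR ha hb hn hA]
  refine Finset.sum_congr rfl fun α _ => ?_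
  rw [ev, ev, rho_toX, mul_assoc]

lemma hecke_add (hR : IsOrder R) (ha : a < 0) (hb : b < 0) {n : ℕ} (hn : n ≠ 0)
    (hnp : n.Coprime p) (φ ψ : X R ι → ℂ) :
    hecke R ι n (φ + ψ) = hecke R ι n φ + hecke R ι n ψ := by
  obtain ⟨A, hA⟩ := hR.exists_isTransversal (p := p) hn hnp
  funext x
  obtain ⟨g, rfl⟩ := toX_surjective x
  rw [Pi.add_apply, hecke_toX hR ha hb hn hA, hecke_toX hR ha hb hn hA, hecke_toX hR ha hb hn hA,
    ← Finset.sum_add_distrib]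
  rfl

lemma hecke_smul (hR : IsOrder R) (ha : a < 0) (hb : b < 0) {n : ℕ} (hn : n ≠ 0)
    (hnp : n.Coprime p) (c : ℂ) (φ : X R ι → ℂ) :
    hecke R ι n (c • φ) = c • hecke R ι n φ := by
  obtain ⟨A, hA⟩ := hR.exists_isTransversal (p := p) hn hnp
  funext x
  obtain ⟨g, rfl⟩ := toX_surjective x
  rw [Pi.smul_apply, hecke_toX hR ha hb hn hA, hecke_toX hR ha hb hn hA, Finset.smul_sum]
  rfl

end Hecke

end ArithQuot

namespace ArithQuot

/-! ### The local facts needed at an amplifying prime. -/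

section HeckeAlgebra

set_option linter.unusedSectionVars false

variable {p : ℕ} [Fact p.Prime] {a b : ℚ} {R : Subring (Quat a b)}

/-- The properties of the primes `ℓ` used for amplification. -/
structure IsGood (p : ℕ) (R : Subring (Quat a b)) (ℓ : ℕ) : Prop where
  prime : ℓ.Prime
  ne : ℓ ≠ p
  factor : ∀ n : ℕ, ∀ ξ ∈ normSet p R (ℓ * n),
    ∃ α ∈ normSet p R ℓ, ∃ z ∈ normSet p R n, ξ = α * z
  card_le : ∀ A : Finset (Quat a b), IsTransversal p R (normSet p R ℓ) A → ℓ ≤ A.card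
  -- A path of length two that does not backtrack determines its midpoint.
  primitive : ∀ α ∈ normSet p R ℓ, ∀ β ∈ normSet p R ℓ, ∀ α' ∈ normSet p R ℓ,
    ∀ β' ∈ normSet p R ℓ, (¬ ∃ z ∈ invP p R, α * β = (ℓ : ℚ) • z) →
      SameCoset p R (α * β) (α' * β') → SameCoset p R α α'

/-- A product that is not divisible by ℓ has a well-defined image line modulo ℓ, which is also the
image line of its left factor. That line determines the coset of the left factor. -/
lemma SplitAt.sameCoset_of_primitive {ℓ : ℕ} [Fact ℓ.Prime]
    {κ : Quat a b →ₐ[ℚ] Matrix (Fin 2) (Fin 2) ℚ_[ℓ]} (hκ : SplitAt p R ℓ κ) (hℓp : ℓ ≠ p)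
    (hR : IsOrder R) (ha : a < 0) (hb : b < 0) {α β α' β' : Quat a b} (hα : α ∈ normSet p R ℓ)
    (hβ : β ∈ normSet p R ℓ) (hα' : α' ∈ normSet p R ℓ) (hβ' : β' ∈ normSet p R ℓ)
    (hprim : ¬ ∃ z ∈ invP p R, α * β = (ℓ : ℚ) • z) (h : SameCoset p R (α * β) (α' * β')) :
    SameCoset p R α α' := by
  have hℓ0 : ℓ ≠ 0 := (Fact.out : ℓ.Prime).ne_zero
  have hℓ0' : (ℓ : ℚ) ≠ 0 := by exact_mod_cast hℓ0
  have hℓK : (ℓ : ℚ_[ℓ]) ≠ 0 := by exact_mod_cast hℓ0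
  have hℓpos : (0 : ℝ) < (ℓ : ℝ)⁻¹ := by positivity
  have hint : ∀ x ∈ invP p R, EntryLe (κ x) 1 := fun x hx => hκ.entryLe_of_mem_invP hℓp hx
  have hsc : ∀ x ∈ invP p R, EntryLe (κ x) (ℓ : ℝ)⁻¹ → ∃ z ∈ invP p R, x = (ℓ : ℚ) • z := by
    intro x hx hxe
    refine ⟨(ℓ : ℚ)⁻¹ • x, ?_, by rw [smul_smul, mul_inv_cancel₀ hℓ0', one_smul]⟩
    refine hκ.mem_invP_of_entryLe (k := 1) ?_ ?_
    · rw [map_smul' κ]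
      have := hxe.smul (s := (((ℓ : ℚ)⁻¹ : ℚ) : ℚ_[ℓ])) (d := ℓ) (by
        rw [Rat.cast_inv, Rat.cast_natCast, norm_inv, Padic.norm_p, inv_inv])
      rwa [mul_inv_cancel₀ (by exact_mod_cast hℓ0)] at this
    · rw [pow_one, smul_smul, mul_inv_cancel₀ hℓ0', one_smul]; exact hx
  have hdet : ∀ x ∈ normSet p R ℓ, ‖(κ x).det‖ ≤ (ℓ : ℝ)⁻¹ := by
    rintro x ⟨-, k, hk⟩
    rw [det_map κ ha hb, hk, Rat.cast_mul, Rat.cast_natCast, Rat.cast_zpow, Rat.cast_natCast,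
      norm_mul, Padic.norm_p, norm_zpow]
    have : ‖((p : ℕ) : ℚ_[ℓ])‖ = 1 := by
      refine le_antisymm (Padic.norm_int_le_one (p : ℤ)) (not_lt.1 fun h => hℓp ?_)
      exact (Nat.prime_dvd_prime_iff_eq Fact.out Fact.out).1 (Padic.norm_natCast_lt_one_iff.1 h)
    rw [this]; simp
  obtain ⟨j, hj⟩ : ∃ j, Unimodular fun i => κ (α * β) i j := by
    by_contra hcon
    refine hprim (hsc _ (mul_mem hα.1 hβ.1) fun i j => ?_)
    by_contra h1
    exact hcon ⟨j, fun i => hint _ (mul_mem hα.1 hβ.1) i j, i,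
      norm_eq_one_of_inv_lt (hint _ (mul_mem hα.1 hβ.1) i j) h1⟩
  have hw : ∀ x ∈ normSet p R ℓ, ∀ y ∈ invP p R, ∀ i,
      ‖wedge (fun i => κ (x * y) i j) (fun t => κ x t i)‖ ≤ (ℓ : ℝ)⁻¹ := by
    intro x hx y hy i
    have h1 : wedge (fun i => κ (x * y) i j) (fun t => κ x t i)
        = (κ x).det * wedge (fun i => κ y i j) (fun t => (1 : Matrix (Fin 2) (Fin 2) ℚ_[ℓ]) t i) := by
      have h10 : (1 : Matrix (Fin 2) (Fin 2) ℚ_[ℓ]) 1 0 = 0 := rfl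
      have h01 : (1 : Matrix (Fin 2) (Fin 2) ℚ_[ℓ]) 0 1 = 0 := rfl
      rw [map_mul, Matrix.det_fin_two]
      simp only [wedge, Matrix.mul_apply, Fin.sum_univ_two]
      obtain rfl | rfl : i = 0 ∨ i = 1 := by omega
      · rw [h10, Matrix.one_apply_eq]; ring
      · rw [h01, Matrix.one_apply_eq]; ring
    rw [h1, norm_mul]
    calc _ ≤ (ℓ : ℝ)⁻¹ * 1 := mul_le_mul (hdet x hx)
          (norm_wedge_le (fun t => hint y hy t j) fun t => EntryLe.one t i)
          (norm_nonneg _) hℓpos.le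
      _ = _ := mul_one _
  obtain ⟨γ, hγ, hγe⟩ := h.symm hR
  have hw' : ∀ i, ‖wedge (fun i => κ (α * β) i j) (fun t => κ α' t i)‖ ≤ (ℓ : ℝ)⁻¹ := by
    intro i
    rw [hγe, mul_assoc]
    rw [hγe, mul_assoc] at hj
    exact hw α' hα' _ (mul_mem hβ'.1 hγ.1) i
  have hwedge : ∀ i i', ‖wedge (fun t => κ α t i) (fun t => κ α' t i')‖ ≤ (ℓ : ℝ)⁻¹ := fun i i' =>
    norm_wedge_le_of_unimodular hj (fun t => hint _ hα.1 t i) (fun t => hint _ hα'.1 t i')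
      (hw α hα β hβ.1 i) (hw' i')
  obtain ⟨z, hz, hze⟩ := hsc (star α * α') (mul_mem (hR.star_mem_invP hα.1) hα'.1) (by
    rw [map_mul, map_star κ ha hb]
    intro i i'
    fin_cases i
    · change ‖((κ α).adjugate * κ α') 0 i'‖ ≤ _
      rw [adjugate_mul_apply_zero]
      have := hwedge 1 i'
      rwa [← norm_neg, show -wedge (fun t => κ α t 1) (fun t => κ α' t i')
        = wedge (fun t => κ α' t i') (fun t => κ α t 1) by simp only [wedge]; ring] at this
    · change ‖((κ α).adjugate * κ α') 1 i'‖ ≤ _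
      rw [adjugate_mul_apply_one]
      exact hwedge 0 i')
  exact sameCoset_of_star_mul hℓ0 hα hα' hz hze

lemma SplitAt.isGood {ℓ : ℕ} [Fact ℓ.Prime]
    {κ : Quat a b →ₐ[ℚ] Matrix (Fin 2) (Fin 2) ℚ_[ℓ]} (hκ : SplitAt p R ℓ κ) (hℓp : ℓ ≠ p)
    (hR : IsOrder R) (ha : a < 0) (hb : b < 0) {α₀ : Quat a b} (hα₀ : α₀ ∈ invP p R)
    (hn : nr α₀ = ℓ) : IsGood p R ℓ where
  prime := Fact.out
  ne := hℓp
  factor n ξ hξ := by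
    obtain ⟨hξ1, k, hk⟩ := hξ
    have hℓ0 : (ℓ : ℚ) ≠ 0 := by exact_mod_cast (Fact.out : ℓ.Prime).ne_zero
    have hp : pabs ℓ ((p : ℚ) ^ k) = 1 := by
      have : ‖((p : ℕ) : ℚ_[ℓ])‖ = 1 := by
        refine le_antisymm (Padic.norm_int_le_one (p : ℤ)) (not_lt.1 fun h => hℓp ?_)
        exact (Nat.prime_dvd_prime_iff_eq Fact.out Fact.out).1 (Padic.norm_natCast_lt_one_iff.1 h)
      rw [pabs, Rat.cast_zpow, Rat.cast_natCast, norm_zpow, this, one_zpow]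
    obtain ⟨α, hα, hαn, z, hz, hαz⟩ := hκ.exists_factor hℓp hR ha hb hα₀ hn hξ1 (by
      rw [hk, pabs_mul, hp, mul_one, Nat.cast_mul, pabs_mul]
      have h1 : pabs ℓ (ℓ : ℚ) = (ℓ : ℝ)⁻¹ := by rw [pabs, Rat.cast_natCast, Padic.norm_p]
      have h2 : pabs ℓ (n : ℚ) ≤ 1 := by exact_mod_cast pabs_intCast_le (ℓ := ℓ) (n : ℤ)
      rw [h1]
      exact mul_le_of_le_one_right (by positivity) h2)
    refine ⟨α, ⟨hα, 0, by rw [hαn]; simp⟩, z, ⟨hz, k, ?_⟩, hαz⟩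
    rw [hαz, nr_mul, hαn, Nat.cast_mul, mul_assoc] at hk
    exact mul_left_cancel₀ hℓ0 hk
  card_le A hA := by
    obtain ⟨α, hα, hinj⟩ := hκ.exists_many hℓp ha hb hα₀ hn
    have hmem : ∀ t, α t ∈ normSet p R ℓ := fun t => ⟨(hα t).1, 0, by rw [(hα t).2]; simp⟩
    have hℓ0 : ℓ ≠ 0 := (Fact.out : ℓ.Prime).ne_zero
    choose r hr hr' using fun t => hA.surj (α t) (hmem t)
    rw [← Finset.card_range ℓ]
    refine Finset.card_le_card_of_injOn r (fun t _ => hr t) fun s hs t ht hst => ?_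
    refine hinj s (Finset.mem_range.1 hs) t (Finset.mem_range.1 ht) ?_
    obtain ⟨γ, hγ, h⟩ : SameCoset p R (α s) (α t) :=
      ((hr' s).symm hR).trans (by rw [hst]; exact hr' t)
    refine ⟨γ, hγ.1, ?_⟩
    rw [h, ← mul_assoc, star_mul_self', (hα s).2, QuaternionAlgebra.coe_mul_eq_smul]
  primitive α hα β hβ α' hα' β' hβ' := hκ.sameCoset_of_primitive hℓp hR ha hb hα hβ hα' hβ'

theorem IsOrder.exists_isGood (hR : IsOrder R) (ha : a < 0) (hb : b < 0)
    (ι : Quat a b →ₐ[ℚ] Matrix (Fin 2) (Fin 2) ℚ_[p]) :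
    ∃ m : ℕ, 0 < m ∧ ∀ ℓ : ℕ, ℓ.Prime → ℓ ≠ p → (ℓ : ZMod m) = 1 → IsGood p R ℓ := by
  obtain ⟨m, hm, h⟩ := hR.exists_norm_eq_prime ha hb ι
  refine ⟨m, hm, fun ℓ hℓ hℓp hℓm => ?_⟩
  have := Fact.mk hℓ
  obtain ⟨⟨κ, hκ⟩, α, hα, hn⟩ := h ℓ hℓp hℓm
  exact hκ.isGood hℓp hR ha hb hα hn

end HeckeAlgebra

end ArithQuot

namespace ArithQuot

/-! ### Hecke relations and the amplifier at one prime. -/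

section Amplifier

set_option linter.unusedSectionVars false

variable {p : ℕ} [Fact p.Prime] {a b : ℚ} {R : Subring (Quat a b)}
  {ι : Quat a b →ₐ[ℚ] Matrix (Fin 2) (Fin 2) ℚ_[p]}

lemma hecke_hecke_toX (hR : IsOrder R) (ha : a < 0) (hb : b < 0) {m n : ℕ} (hm : m ≠ 0)
    (hn : n ≠ 0) {A B : Finset (Quat a b)} (hA : IsTransversal p R (normSet p R m) A)
    (hB : IsTransversal p R (normSet p R n) B) (φ : X R ι → ℂ) (g : G p) :
    hecke R ι m (hecke R ι n φ) (toX R ι g) = ∑ i ∈ A ×ˢ B, ev φ g (i.1 * i.2) := by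
  rw [hecke_toX hR ha hb hm hA, Finset.sum_product]
  refine Finset.sum_congr rfl fun α hα => ?_
  rw [ev, hecke_toX hR ha hb hn hB]
  refine Finset.sum_congr rfl fun β hβ => ?_
  rw [ev_mul ha hb φ g (nr_ne_zero_of_mem_normSet hm (hA.sub _ hα))
    (nr_ne_zero_of_mem_normSet hn (hB.sub _ hβ))]

/-- α⁻¹α' has a denominator dividing m, and being βγβ'⁻¹ also one dividing n. -/
lemma sameCoset_of_mul_of_coprime (hR : IsOrder R) {m n : ℕ}
    (hm : m ≠ 0) (hn : n ≠ 0) (hmn : m.Coprime n) {α α' β β' : Quat a b}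
    (hα : α ∈ normSet p R m) (hα' : α' ∈ normSet p R m) (hβ : β ∈ normSet p R n)
    (hβ' : β' ∈ normSet p R n) (h : SameCoset p R (α * β) (α' * β')) : SameCoset p R α α' := by
  refine sameCoset_of_qinv_mul_mem hm hα hα' ?_
  have h0 := nr_ne_zero_of_mem_normSet hm hα
  have h1 := nr_ne_zero_of_mem_normSet hn hβ'
  obtain ⟨γ, hγ, h⟩ := h
  have h2 : qinv α * α' = β * γ * qinv β' := by
    have h3 : qinv α * (α' * β') * qinv β' = qinv α * (α * β * γ) * qinv β' := by rw [h]
    rwa [mul_assoc, mul_assoc α', mul_qinv h1, mul_one, mul_assoc α, ← mul_assoc (qinv α) α,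
      qinv_mul h0, one_mul] at h3
  refine mem_of_coprime_smul hmn (hR.smul_qinv_mul_mem hm hα hα'.1) ?_
  obtain ⟨h4, k, hk⟩ := hβ'
  have hn' : (n : ℚ) ≠ 0 := Nat.cast_ne_zero.2 hn
  have : (n : ℚ) • (qinv α * α') = (p : ℚ) ^ (-k) • (β * γ * star β') := by
    rw [h2, qinv, hk, mul_smul_comm, smul_smul]
    congr 1
    have := zpow_ne_zero k (prime_cast_ne_zero p)
    rw [zpow_neg]
    field_simp
  rw [this]
  exact zpow_smul_mem_invP (Fact.out : p.Prime).ne_zero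
    (mul_mem (mul_mem hβ.1 hγ.1) (hR.star_mem_invP h4)) _

/-- T_m T_n = T_{mn} for coprime m, n. Injectivity is `sameCoset_of_mul_of_coprime`, and
surjectivity is the factorization hypothesis. Commutativity follows by exchanging m and n. -/
lemma sum_ev_mul_eq (hR : IsOrder R) (ha : a < 0) (hb : b < 0) {m n : ℕ} (hm : m ≠ 0)
    (hn : n ≠ 0) (hmn : m.Coprime n) {A B C : Finset (Quat a b)}
    (hA : IsTransversal p R (normSet p R m) A) (hB : IsTransversal p R (normSet p R n) B)
    (hC : IsTransversal p R (normSet p R (m * n)) C)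
    (hf : ∀ ξ ∈ normSet p R (m * n), ∃ α ∈ normSet p R m, ∃ β ∈ normSet p R n, ξ = α * β)
    (φ : X R ι → ℂ) (g : G p) :
    ∑ i ∈ A ×ˢ B, ev φ g (i.1 * i.2) = ∑ ξ ∈ C, ev φ g ξ := by
  refine hC.sum_eq hR (A ×ˢ B) (fun i => i.1 * i.2) ?_ ?_ ?_ (ev_congr hR ha hb φ g)
    fun ξ hξ => nr_ne_zero_of_mem_normSet (mul_ne_zero hm hn) hξ
  · rintro ⟨α, β⟩ hi
    rw [Finset.mem_product] at hi
    exact mul_mem_normSet (hA.sub _ hi.1) (hB.sub _ hi.2)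
  · rintro ⟨α, β⟩ hi ⟨α', β'⟩ hi' h
    rw [Finset.mem_product] at hi hi'
    simp only at hi hi' h
    obtain rfl : α = α' := hA.inj _ hi.1 _ hi'.1 (sameCoset_of_mul_of_coprime hR hm hn hmn
      (hA.sub _ hi.1) (hA.sub _ hi'.1) (hB.sub _ hi.2) (hB.sub _ hi'.2) h)
    obtain rfl : β = β' := hB.inj _ hi.2 _ hi'.2
      (sameCoset_of_mul_left ha hb (nr_ne_zero_of_mem_normSet hm (hA.sub _ hi.1)) h)
    rfl
  · intro ξ hξ
    obtain ⟨α, hα, β, hβ, rfl⟩ := hf ξ hξ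
    obtain ⟨α', hα', γ, hγ, rfl⟩ := hA.surj α hα
    obtain ⟨β', hβ', h⟩ := hB.surj (γ * β) (by simpa using mul_mem_normSet hγ hβ)
    exact ⟨(α', β'), Finset.mem_product.2 ⟨hα', hβ'⟩, by
      simpa [mul_assoc] using h.mul_left α'⟩

lemma IsGood.factor_right (hR : IsOrder R) {ℓ : ℕ} (hℓ : IsGood p R ℓ) (n : ℕ) (ξ : Quat a b)
    (hξ : ξ ∈ normSet p R (n * ℓ)) :
    ∃ α ∈ normSet p R n, ∃ β ∈ normSet p R ℓ, ξ = α * β := by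
  obtain ⟨α, hα, z, hz, h⟩ := hℓ.factor n (star ξ) (by
    rw [mul_comm]; exact hR.star_mem_normSet hξ)
  refine ⟨star z, hR.star_mem_normSet hz, star α, hR.star_mem_normSet hα, ?_⟩
  rw [← star_mul, ← h, star_star]

/-- The Hecke operator at a good prime commutes with all the others. -/
theorem IsGood.hecke_comm {ℓ : ℕ} (hℓ : IsGood p R ℓ) (hR : IsOrder R) (ha : a < 0) (hb : b < 0)
    {q : ℕ} (hq : q.Prime) (hqp : q ≠ p) (φ : X R ι → ℂ) :
    hecke R ι ℓ (hecke R ι q φ) = hecke R ι q (hecke R ι ℓ φ) := by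
  rcases eq_or_ne ℓ q with rfl | hne
  · rfl
  have hp : p.Prime := Fact.out
  have hℓ0 := hℓ.prime.ne_zero
  have hq0 := hq.ne_zero
  have hcop : ℓ.Coprime q := (Nat.coprime_primes hℓ.prime hq).2 hne
  have hℓp : ℓ.Coprime p := (Nat.coprime_primes hℓ.prime hp).2 hℓ.ne
  have hqp : q.Coprime p := (Nat.coprime_primes hq hp).2 hqp
  obtain ⟨A, hA⟩ := hR.exists_isTransversal (p := p) hℓ0 hℓp
  obtain ⟨B, hB⟩ := hR.exists_isTransversal (p := p) hq0 hqp
  obtain ⟨C, hC⟩ := hR.exists_isTransversal (p := p) (mul_ne_zero hℓ0 hq0)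
    (Nat.Coprime.mul_left hℓp hqp)
  funext x
  obtain ⟨g, rfl⟩ := toX_surjective x
  rw [hecke_hecke_toX hR ha hb hℓ0 hq0 hA hB, hecke_hecke_toX hR ha hb hq0 hℓ0 hB hA,
    sum_ev_mul_eq hR ha hb hℓ0 hq0 hcop hA hB hC fun ξ hξ => hℓ.factor q ξ hξ,
    sum_ev_mul_eq hR ha hb hq0 hℓ0 hcop.symm hB hA (by rwa [mul_comm q ℓ])
      (hℓ.factor_right hR q)]

lemma toG_natCast_comm (ha : a < 0) (hb : b < 0) {n : ℕ} (hn : n ≠ 0) (g : G p) :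
    (toG ι (n : Quat a b))⁻¹ * g = g * (toG ι (n : Quat a b))⁻¹ := by
  have h : toG ι (n : Quat a b) * g = g * toG ι (n : Quat a b) := by
    apply Units.ext
    have h0 : nr (n : Quat a b) ≠ 0 := by simpa using hn
    rw [Units.val_mul, Units.val_mul, toG_val ι ha hb h0, map_natCast]
    exact (Nat.cast_commute n g.val).eq
  rw [inv_mul_eq_iff_eq_mul, ← mul_assoc, h, mul_assoc, mul_inv_cancel, mul_one]

/-- The elements `w` with the amplification property for `φ`. -/
structure IsAmplifier (φ : X R ι → ℂ) (ℓ e : ℕ) (W : Finset (Quat a b)) (κ : ℝ) : Prop where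
  pos : 0 < κ
  e_le : e ≤ 2
  mem : ∀ w ∈ W, w ∈ normSet p R (ℓ ^ e)
  inj : ∀ w ∈ W, ∀ w' ∈ W, SameCoset p R w w' → w = w'
  -- The gain κ is at least of the order of the square root of the number of terms.
  card_le : (W.card : ℝ) ≤ 4 * κ ^ 2
  le : (ℓ : ℝ) ≤ 4 * κ ^ 2
  bound : ∀ g, κ * ‖φ (toX R ι g)‖ ≤ ∑ w ∈ W, ‖ev φ g w‖

/-- The backtracking pairs are those with β in the coset of ᾱ, one for each α, and each contributes
translation by the central element ℓ. -/
lemma IsGood.sum_ev_mul_self {ℓ : ℕ} (hℓ : IsGood p R ℓ) (hR : IsOrder R) (ha : a < 0)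
    (hb : b < 0) {A : Finset (Quat a b)} (hA : IsTransversal p R (normSet p R ℓ) A)
    (φ : X R ι → ℂ) (g : G p) [DecidablePred fun i : Quat a b × Quat a b =>
      ∃ z ∈ invP p R, i.1 * i.2 = (ℓ : ℚ) • z] :
    ∑ i ∈ A ×ˢ A, ev φ g (i.1 * i.2) =
      ∑ i ∈ (A ×ˢ A).filter (fun i => ¬ ∃ z ∈ invP p R, i.1 * i.2 = (ℓ : ℚ) • z),
        ev φ g (i.1 * i.2) + A.card * ev φ g (ℓ : Quat a b) := by
  have hℓ0 := hℓ.prime.ne_zero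
  have hℓ0' : (ℓ : ℚ) ≠ 0 := by exact_mod_cast hℓ0
  rw [← Finset.sum_filter_add_sum_filter_not (A ×ˢ A)
    (fun i => ∃ z ∈ invP p R, i.1 * i.2 = (ℓ : ℚ) • z), add_comm]
  congr 1
  choose! r hr hr' using fun α (hα : α ∈ A) => hA.surj (star α) (hR.star_mem_normSet (hA.sub α hα))
  have hval : ∀ i ∈ (A ×ˢ A).filter (fun i => ∃ z ∈ invP p R, i.1 * i.2 = (ℓ : ℚ) • z),
      ev φ g (i.1 * i.2) = ev φ g (ℓ : Quat a b) := by
    rintro ⟨α, β⟩ hi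
    rw [Finset.mem_filter, Finset.mem_product] at hi
    obtain ⟨⟨hα, hβ⟩, z, hz, h⟩ := hi
    simp only at hα hβ h ⊢
    rw [h]
    have h1 : (ℓ : ℚ) • z = (ℓ : Quat a b) * z := (natCast_mul_eq_smul _ _).symm
    have h0 : nr (ℓ : Quat a b) ≠ 0 := by simpa using hℓ0
    refine (ev_congr hR ha hb φ g _ _ ⟨z, ⟨hz, ?_⟩, h1⟩ h0).symm
    obtain ⟨-, k, hk⟩ := hA.sub α hα
    obtain ⟨-, l, hl⟩ := hA.sub β hβ
    refine ⟨k + l, ?_⟩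
    have h2 := congrArg nr h
    rw [nr_mul, hk, hl, nr_smul] at h2
    have h3 : (ℓ : ℚ) ^ 2 * nr z = (ℓ : ℚ) ^ 2 * (p : ℚ) ^ (k + l) := by
      rw [← h2, zpow_add₀ (prime_cast_ne_zero p)]; ring
    rw [Nat.cast_one, one_mul]
    exact mul_left_cancel₀ (pow_ne_zero 2 hℓ0') h3
  rw [Finset.sum_congr rfl hval, Finset.sum_const, nsmul_eq_mul]
  congr 2
  refine (Finset.card_bij (fun α _ => (α, r α)) ?_ ?_ ?_).symm
  · intro α hα
    rw [Finset.mem_filter, Finset.mem_product]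
    refine ⟨⟨hα, hr α hα⟩, ?_⟩
    obtain ⟨γ, hγ, h⟩ := (hr' α hα).symm hR
    obtain ⟨h1, k, hk⟩ := hA.sub α hα
    refine ⟨(p : ℚ) ^ k • γ, zpow_smul_mem_invP (Fact.out : p.Prime).ne_zero hγ.1 _, ?_⟩
    simp only
    rw [h, ← mul_assoc, mul_star_self, hk, QuaternionAlgebra.coe_mul_eq_smul, smul_smul]
  · intro α _ β _ h
    exact congrArg Prod.fst h
  · rintro ⟨α, β⟩ hi
    rw [Finset.mem_filter, Finset.mem_product] at hi
    obtain ⟨⟨hα, hβ⟩, z, hz, h⟩ := hi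
    simp only at hα hβ h
    refine ⟨α, hα, ?_⟩
    have h1 : SameCoset p R (star α) β := by
      refine sameCoset_of_star_mul hℓ0 (hR.star_mem_normSet (hA.sub α hα)) (hA.sub β hβ) hz ?_
      rw [star_star, h]
    rw [hA.inj _ (hr α hα) _ hβ ((hr' α hα).trans h1)]

/-- A large eigenvalue makes T_ℓ itself an amplifier. -/
lemma IsGood.isAmplifier_of_large {ℓ : ℕ} (hℓ : IsGood p R ℓ) (hR : IsOrder R) (ha : a < 0)
    (hb : b < 0) {A : Finset (Quat a b)} (hA : IsTransversal p R (normSet p R ℓ) A)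
    {φ : X R ι → ℂ} {c : ℂ} (hc : hecke R ι ℓ φ = c • φ) (h : (A.card : ℝ) ≤ 2 * ‖c‖ ^ 2) :
    IsAmplifier φ ℓ 1 A ‖c‖ := by
  have hcard : (ℓ : ℝ) ≤ A.card := by exact_mod_cast hℓ.card_le A hA
  have hℓ1 : (1 : ℝ) ≤ ℓ := by exact_mod_cast hℓ.prime.one_le
  have h0 := norm_nonneg c
  refine ⟨?_, by norm_num, ?_, hA.inj, by nlinarith, by nlinarith, fun g => ?_⟩
  · rcases h0.lt_or_eq with h | h'
    · exact h
    · rw [← h'] at h; linarith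
  · simpa using hA.sub
  · rw [← norm_mul, ← smul_eq_mul, ← Pi.smul_apply, ← hc,
      hecke_toX hR ha hb hℓ.prime.ne_zero hA]
    exact norm_sum_le _ _

/-- With N the degree, the primitive part of T_ℓ² has eigenvalue c² - Nω, of absolute value at least
N - |c|² ≥ N/2, against at most N² = 4(N/2)² terms. -/
lemma IsGood.isAmplifier_of_small {ℓ : ℕ} (hℓ : IsGood p R ℓ) (hR : IsOrder R) (ha : a < 0)
    (hb : b < 0) {A : Finset (Quat a b)} (hA : IsTransversal p R (normSet p R ℓ) A)
    {φ : X R ι → ℂ} {c ω : ℂ} (hc : hecke R ι ℓ φ = c • φ)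
    (hω : rho R ι (toG ι (ℓ : Quat a b))⁻¹ φ = ω • φ) (hω1 : ‖ω‖ = 1)
    (h : 2 * ‖c‖ ^ 2 ≤ A.card) :
    ∃ W, IsAmplifier φ ℓ 2 W (A.card / 2 : ℝ) := by
  classical
  have hℓ0 := hℓ.prime.ne_zero
  have hcard : (ℓ : ℝ) ≤ A.card := by exact_mod_cast hℓ.card_le A hA
  have hℓ1 : (1 : ℝ) ≤ ℓ := by exact_mod_cast hℓ.prime.one_le
  set P := (A ×ˢ A).filter (fun i => ¬ ∃ z ∈ invP p R, i.1 * i.2 = (ℓ : ℚ) • z) with hP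
  have hPmem : ∀ i ∈ P, (i.1 ∈ A ∧ i.2 ∈ A) ∧
      ¬ ∃ z ∈ invP p R, i.1 * i.2 = (ℓ : ℚ) • z := fun i hi => by
    rwa [hP, Finset.mem_filter, Finset.mem_product] at hi
  have hinj : ∀ i ∈ P, ∀ j ∈ P, SameCoset p R (i.1 * i.2) (j.1 * j.2) → i = j := by
    rintro ⟨α, β⟩ hi ⟨α', β'⟩ hj hij
    obtain ⟨⟨hα, hβ⟩, hprim⟩ := hPmem _ hi
    obtain ⟨⟨hα', hβ'⟩, -⟩ := hPmem _ hj
    simp only at hα hβ hα' hβ' hprim hij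
    obtain rfl : α = α' := hA.inj _ hα _ hα' (hℓ.primitive α (hA.sub _ hα) β (hA.sub _ hβ)
      α' (hA.sub _ hα') β' (hA.sub _ hβ') hprim hij)
    obtain rfl : β = β' := hA.inj _ hβ _ hβ'
      (sameCoset_of_mul_left ha hb (nr_ne_zero_of_mem_normSet hℓ0 (hA.sub _ hα)) hij)
    rfl
  refine ⟨P.image fun i => i.1 * i.2, by linarith, le_rfl, ?_, ?_, ?_, by nlinarith, ?_⟩
  · intro w hw
    obtain ⟨i, hi, rfl⟩ := Finset.mem_image.1 hw
    obtain ⟨⟨h1, h2⟩, -⟩ := hPmem i hi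
    rw [sq]
    exact mul_mem_normSet (hA.sub _ h1) (hA.sub _ h2)
  · intro w hw w' hw' hww
    obtain ⟨i, hi, rfl⟩ := Finset.mem_image.1 hw
    obtain ⟨j, hj, rfl⟩ := Finset.mem_image.1 hw'
    rw [hinj i hi j hj hww]
  · have h1 : (P.image fun i => i.1 * i.2).card ≤ A.card * A.card := by
      refine Finset.card_image_le.trans ((Finset.card_filter_le _ _).trans ?_)
      rw [Finset.card_product]
    have h2 : ((P.image fun i => i.1 * i.2).card : ℝ) ≤ A.card * A.card := by exact_mod_cast h1
    nlinarith
  · intro g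
    rw [Finset.sum_image fun i hi j hj hij => hinj i hi j hj (by
      rw [hij]; exact SameCoset.refl _)]
    have hsum := hℓ.sum_ev_mul_self hR ha hb hA φ g
    rw [← hecke_hecke_toX hR ha hb hℓ0 hℓ0 hA hA, hc,
      hecke_smul hR ha hb hℓ0 ((Nat.coprime_primes hℓ.prime Fact.out).2 hℓ.ne), hc, ← hP] at hsum
    have hev : ev φ g (ℓ : Quat a b) = ω * φ (toX R ι g) := by
      have := congrFun hω (toX R ι g)
      rw [rho_toX, ← toG_natCast_comm ha hb hℓ0] at this
      exact this
    rw [hev, Pi.smul_apply, Pi.smul_apply, smul_eq_mul, smul_eq_mul] at hsum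
    have hle : ‖∑ i ∈ P, ev φ g (i.1 * i.2)‖ ≤ ∑ i ∈ P, ‖ev φ g (i.1 * i.2)‖ := norm_sum_le _ _
    have hS : (A.card : ℂ) * (ω * φ (toX R ι g))
        = c * (c * φ (toX R ι g)) - ∑ i ∈ P, ev φ g (i.1 * i.2) := by
      rw [hsum]; ring
    have h3 := (congrArg norm hS).le.trans (norm_sub_le _ _)
    rw [norm_mul, norm_mul, norm_mul, norm_mul, hω1, one_mul, Complex.norm_natCast] at h3
    have h4 := norm_nonneg (φ (toX R ι g))
    nlinarith

theorem IsGood.exists_isAmplifier {ℓ : ℕ} (hℓ : IsGood p R ℓ) (hR : IsOrder R) (ha : a < 0)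
    (hb : b < 0) {φ : X R ι → ℂ} {c ω : ℂ} (hc : hecke R ι ℓ φ = c • φ)
    (hω : rho R ι (toG ι (ℓ : Quat a b))⁻¹ φ = ω • φ) (hω1 : ‖ω‖ = 1) :
    ∃ e W κ, IsAmplifier φ ℓ e W κ := by
  obtain ⟨A, hA⟩ := hR.exists_isTransversal (p := p) hℓ.prime.ne_zero
    ((Nat.coprime_primes hℓ.prime Fact.out).2 hℓ.ne)
  rcases le_total (A.card : ℝ) (2 * ‖c‖ ^ 2) with h | h
  · exact ⟨1, A, _, hℓ.isAmplifier_of_large hR ha hb hA hc h⟩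
  · obtain ⟨W, hW⟩ := hℓ.isAmplifier_of_small hR ha hb hA hc hω hω1 h
    exact ⟨2, W, _, hW⟩

end Amplifier

end ArithQuot

namespace ArithQuot

/-! ### Orbits of small open subgroups on the quotient. -/

section Cells

set_option linter.unusedSectionVars false

variable {p : ℕ} [Fact p.Prime] {a b : ℚ} {R : Subring (Quat a b)}
  {ι : Quat a b →ₐ[ℚ] Matrix (Fin 2) (Fin 2) ℚ_[p]}

instance secondCountable_G : SecondCountableTopology (G p) := by
  have : SecondCountableTopology (Matrix (Fin 2) (Fin 2) ℚ_[p]) :=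
    inferInstanceAs (SecondCountableTopology (Fin 2 → Fin 2 → ℚ_[p]))
  have : SecondCountableTopology (Matrix (Fin 2) (Fin 2) ℚ_[p])ᵐᵒᵖ :=
    MulOpposite.opHomeomorph.symm.secondCountableTopology
  exact Units.isEmbedding_embedProduct.secondCountableTopology

lemma isQuotientMap_toX : Topology.IsQuotientMap (toX R ι) := isQuotientMap_quot_mk

lemma continuous_rightTr (h : G p) : Continuous (rightTr R ι h) := by
  rw [isQuotientMap_toX.continuous_iff]
  exact isQuotientMap_toX.continuous.comp (continuous_mul_const h)

lemma rightTr_mul (g h : G p) (x : X R ι) : rightTr R ι h (rightTr R ι g x) = rightTr R ι (g * h) x := by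
  obtain ⟨y, rfl⟩ := toX_surjective x
  rw [rightTr_toX, rightTr_toX, rightTr_toX, mul_assoc]

lemma rightTr_one (x : X R ι) : rightTr R ι 1 x = x := by
  obtain ⟨y, rfl⟩ := toX_surjective x
  rw [rightTr_toX, mul_one]

/-- Sets that are stable under an open subgroup are open. -/
lemma isOpen_of_stable {K : Subgroup (G p)} (hK : IsOpen (K : Set (G p))) {S : Set (X R ι)}
    (hS : ∀ x ∈ S, ∀ k ∈ K, rightTr R ι k x ∈ S) : IsOpen S := by
  rw [← isQuotientMap_toX.isOpen_preimage, isOpen_iff_mem_nhds]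
  intro g hg
  have h1 : (fun h => g⁻¹ * h) ⁻¹' (K : Set (G p)) ∈ nhds g :=
    (hK.preimage (continuous_const_mul g⁻¹)).mem_nhds (by simp [K.one_mem])
  refine Filter.mem_of_superset h1 fun h hh => ?_
  have := hS _ hg _ hh
  rwa [rightTr_toX, mul_inv_cancel_left] at this

/-- The image of `g K` in the quotient. -/
def cell (R : Subring (Quat a b)) (ι : Quat a b →ₐ[ℚ] Matrix (Fin 2) (Fin 2) ℚ_[p])
    (K : Set (G p)) (g : G p) : Set (X R ι) :=
  (fun k => toX R ι (g * k)) '' K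

lemma isOpen_cell {K : Subgroup (G p)} (hK : IsOpen (K : Set (G p))) (g : G p) :
    IsOpen (cell R ι K g) := by
  refine isOpen_of_stable hK ?_
  rintro _ ⟨k, hk, rfl⟩ l hl
  exact ⟨k * l, mul_mem hk hl, by rw [rightTr_toX, mul_assoc]⟩

lemma measurableSet_cell {K : Subgroup (G p)} (hK : IsOpen (K : Set (G p))) (g : G p) :
    MeasurableSet (cell R ι K g) := (isOpen_cell hK g).measurableSet

variable {ν : Measure (X R ι)}

lemma IsUniform.measure_image (hν : IsUniform R ι ν) (h : G p) {S : Set (X R ι)}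
    (hS : MeasurableSet S) : ν (rightTr R ι h '' S) = ν S := by
  have h1 : rightTr R ι h '' S = rightTr R ι h⁻¹ ⁻¹' S := by
    ext x
    constructor
    · rintro ⟨y, hy, rfl⟩
      rwa [Set.mem_preimage, rightTr_mul, mul_inv_cancel, rightTr_one]
    · intro hx
      exact ⟨_, hx, by rw [rightTr_mul, inv_mul_cancel, rightTr_one]⟩
  rw [h1, (hν.invariant h⁻¹).measure_preimage hS.nullMeasurableSet]

lemma rightTr_image_cell (K : Set (G p)) (g h : G p) :
    rightTr R ι h '' cell R ι K g = cell R ι ((fun k => k * h) '' K) g := by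
  rw [cell, cell, Set.image_image, Set.image_image]
  simp_rw [rightTr_toX, mul_assoc]

lemma cell_mul (K : Set (G p)) (g h : G p) :
    cell R ι K (g * h) = cell R ι ((fun k => h * k) '' K) g := by
  rw [cell, cell, Set.image_image]
  simp_rw [mul_assoc]

/-- Subgroups whose conjugates meet `Γ` trivially. -/
def IsSmall (R : Subring (Quat a b)) (ι : Quat a b →ₐ[ℚ] Matrix (Fin 2) (Fin 2) ℚ_[p])
    (K : Subgroup (G p)) : Prop :=
  ∀ g, ∀ k ∈ K, g * k * g⁻¹ ∈ Gam R ι → k = 1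

lemma IsSmall.eq_of_toX_eq {K : Subgroup (G p)} (hK : IsSmall R ι K) {g k l : G p} (hk : k ∈ K)
    (hl : l ∈ K) (h : toX R ι (g * k) = toX R ι (g * l)) : k = l := by
  rw [toX_eq_iff] at h
  have := hK g (l * k⁻¹) (mul_mem hl (inv_mem hk)) (by convert h using 1; group)
  exact (mul_inv_eq_one.1 this).symm

/-- By second countability countably many translates of a cell cover the quotient, and translates
have equal measure. -/
lemma IsUniform.measure_cell_pos (hν : IsUniform R ι ν) {K : Subgroup (G p)}
    (hK : IsOpen (K : Set (G p))) (g : G p) : 0 < ν (cell R ι K g) := by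
  rw [pos_iff_ne_zero]
  intro h0
  have := hν.prob
  obtain ⟨s, hs, hcov⟩ := TopologicalSpace.countable_cover_nhds
    (f := fun x : G p => (fun h => h * x⁻¹) ⁻¹' (K : Set (G p))) fun x =>
      (hK.preimage (continuous_mul_const x⁻¹)).mem_nhds (by simp [K.one_mem])
  have h1 : (Set.univ : Set (X R ι)) ⊆ ⋃ x ∈ s, rightTr R ι x '' cell R ι K g := by
    intro y _
    obtain ⟨h, rfl⟩ := toX_surjective y
    obtain ⟨x, hx, hxh⟩ := Set.mem_iUnion₂.1 (hcov.ge (Set.mem_univ (g⁻¹ * h)))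
    refine Set.mem_iUnion₂.2 ⟨x, hx, _, ⟨_, hxh, rfl⟩, ?_⟩
    rw [rightTr_toX]
    congr 1
    group
  have h2 : ν Set.univ = 0 := by
    refine measure_mono_null h1 ((measure_biUnion_null_iff hs).2 fun x _ => ?_)
    rw [hν.measure_image x (measurableSet_cell hK g), h0]
  simp at h2

/-- The measure of cells is proportional to the index. -/
lemma IsUniform.exists_measure_cell_eq (hν : IsUniform R ι ν) {U V : Subgroup (G p)}
    (hU : IsOpen (U : Set (G p))) (hUV : U ≤ V) (hsmall : IsSmall R ι V) :
    ∃ n : ℕ, 0 < n ∧ ∀ g, ν (cell R ι V g) = n * ν (cell R ι U g) := by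
  have := hν.prob
  -- Smallness makes v ↦ Γgv injective on V. So the V-cell is the disjoint union of translates of
  -- the U-cell, one per coset in U\V; positivity of the measure forces finitely many.
  let Q := Quotient (QuotientGroup.rightRel (U.subgroupOf V))
  let v : Q → G p := fun q => (q.out : G p)
  have hv : ∀ q, v q ∈ V := fun q => q.out.2
  let S : G p → Q → Set (X R ι) := fun g q => rightTr R ι (v q) '' cell R ι U g
  have hSm : ∀ g q, MeasurableSet (S g q) := by
    intro g q
    have hopen : IsOpen (S g q) := by
      have : S g q = rightTr R ι (v q)⁻¹ ⁻¹' cell R ι U g := by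
        ext x
        constructor
        · rintro ⟨y, hy, rfl⟩
          rwa [Set.mem_preimage, rightTr_mul, mul_inv_cancel, rightTr_one]
        · intro hx
          exact ⟨_, hx, by rw [rightTr_mul, inv_mul_cancel, rightTr_one]⟩
      rw [this]
      exact (isOpen_cell hU g).preimage (continuous_rightTr _)
    exact hopen.measurableSet
  have hSν : ∀ g q, ν (S g q) = ν (cell R ι U g) := fun g q =>
    hν.measure_image _ (measurableSet_cell hU g)
  have hdisj : ∀ g, Pairwise (Function.onFun Disjoint (S g)) := by
    intro g q q' hne
    refine Set.disjoint_left.2 ?_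
    rintro _ ⟨_, ⟨u, hu, rfl⟩, rfl⟩ ⟨_, ⟨u', hu', rfl⟩, h⟩
    simp only at h
    rw [rightTr_toX, rightTr_toX, mul_assoc, mul_assoc] at h
    have h1 := hsmall.eq_of_toX_eq (mul_mem (hUV hu') (hv q')) (mul_mem (hUV hu) (hv q)) h
    apply hne
    rw [← Quotient.out_eq q, ← Quotient.out_eq q']
    refine Quotient.sound (QuotientGroup.rightRel_apply.2 ?_)
    rw [Subgroup.mem_subgroupOf]
    change v q' * (v q)⁻¹ ∈ U
    have h2 : v q' * (v q)⁻¹ = u'⁻¹ * u := by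
      rw [mul_inv_eq_iff_eq_mul, mul_assoc, ← h1, inv_mul_cancel_left]
    rw [h2]
    exact mul_mem (inv_mem hu') hu
  have hunion : ∀ g, ⋃ q, S g q = cell R ι V g := by
    intro g
    ext x
    rw [Set.mem_iUnion]
    constructor
    · rintro ⟨q, _, ⟨u, hu, rfl⟩, rfl⟩
      exact ⟨u * v q, mul_mem (hUV hu) (hv q), by simp only [rightTr_toX, mul_assoc]⟩
    · rintro ⟨w, hw, rfl⟩
      let q : Q := Quotient.mk _ ⟨w, hw⟩
      have h1 : QuotientGroup.rightRel (U.subgroupOf V) q.out ⟨w, hw⟩ :=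
        Quotient.exact (Quotient.out_eq q)
      rw [QuotientGroup.rightRel_apply, Subgroup.mem_subgroupOf] at h1
      refine ⟨q, _, ⟨w * (v q)⁻¹, h1, rfl⟩, ?_⟩
      simp only [rightTr_toX, mul_assoc, inv_mul_cancel, mul_one]
  have hfin : Finite Q := by
    have h1 := Measure.finite_const_le_meas_of_disjoint_iUnion ν (hν.measure_cell_pos hU 1)
      (hSm 1) (hdisj 1) (measure_ne_top _ _)
    have h2 : {q | ν (cell R ι U 1) ≤ ν (S 1 q)} = Set.univ := by
      ext q; simp [hSν 1 q]
    rw [h2] at h1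
    exact Set.finite_univ_iff.1 h1
  refine ⟨Nat.card Q, Nat.card_pos_iff.2 ⟨⟨Quotient.mk _ 1⟩, hfin⟩, fun g => ?_⟩
  have := Fintype.ofFinite Q
  rw [← hunion, measure_iUnion (hdisj g) (hSm g), tsum_fintype]
  simp_rw [hSν g]
  rw [Finset.sum_const, Finset.card_univ, Nat.card_eq_fintype_card, nsmul_eq_mul]

end Cells

end ArithQuot

namespace ArithQuot

/-! ### Equality of the volumes of all cells. -/

section Volume

set_option linter.unusedSectionVars false

variable {p : ℕ} [Fact p.Prime] {a b : ℚ} {R : Subring (Quat a b)}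
  {ι : Quat a b →ₐ[ℚ] Matrix (Fin 2) (Fin 2) ℚ_[p]} {ν : Measure (X R ι)}

/-- A matrix of size two is conjugate to its adjugate. -/
lemma exists_mul_eq_adjugate_mul {F : Type*} [Field F] (A : Matrix (Fin 2) (Fin 2) F) :
    ∃ H : Matrix (Fin 2) (Fin 2) F, H.det ≠ 0 ∧ H * A = A.adjugate * H := by
  have key : ∀ x y z : F, (A 0 0 - A 1 1) * x + A 0 1 * z + A 1 0 * y = 0 →
      !![x, y; z, -x] * A = A.adjugate * !![x, y; z, -x] := by
    intro x y z h
    have e : A = !![A 0 0, A 0 1; A 1 0, A 1 1] := A.eta_fin_two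
    rw [Matrix.adjugate_fin_two]
    conv_lhs => rw [e]
    ext i j
    fin_cases i <;> fin_cases j <;>
      simp only [Matrix.mul_fin_two, Matrix.of_apply, Matrix.cons_val', Matrix.cons_val_zero,
        Matrix.cons_val_one, Matrix.cons_val_fin_one, Fin.zero_eta, Fin.mk_one, Fin.isValue]
    · linear_combination h
    · ring
    · ring
    · linear_combination h
  by_cases h01 : A 0 1 = 0
  · by_cases h10 : A 1 0 = 0
    · refine ⟨!![0, 1; 1, -0], by simp [Matrix.det_fin_two], key 0 1 1 (by rw [h01, h10]; ring)⟩
    · refine ⟨!![1, -(A 0 0 - A 1 1) / A 1 0; 0, -1], by simp [Matrix.det_fin_two],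
        key 1 _ 0 (by field_simp; ring)⟩
  · refine ⟨!![1, 0; -(A 0 0 - A 1 1) / A 0 1, -1], by simp [Matrix.det_fin_two],
      key 1 0 _ (by field_simp; ring)⟩

/-- g is conjugate to adj(g) = det(g) g⁻¹, so g times a conjugate of g is scalar. Hence D(g)² = 1,
and D is positive. -/
lemma hom_eq_one_of_scalar {D : G p → ℝ} (hpos : ∀ g, 0 < D g) (hmul : ∀ g h, D (g * h) = D g * D h)
    (hs : ∀ g : G p, (∀ h : G p, g * h = h * g) → D g = 1) (g : G p) : D g = 1 := by
  obtain ⟨H, hH, h⟩ := exists_mul_eq_adjugate_mul g.val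
  let H' : G p := Matrix.GeneralLinearGroup.mkOfDetNeZero H hH
  have h1 : ∀ k : G p, (H' * g * H'⁻¹ * g) * k = k * (H' * g * H'⁻¹ * g) := by
    have h2 : (H' * g * H'⁻¹ * g).val = g.val.det • (1 : Matrix (Fin 2) (Fin 2) ℚ_[p]) := by
      have h3 : (H' * g).val = g.val.adjugate * H'.val := h
      rw [Units.val_mul, Units.val_mul, h3, mul_assoc _ H'.val, Units.mul_inv, mul_one,
        Matrix.adjugate_mul]
    intro k
    apply Units.ext
    rw [Units.val_mul _ k, Units.val_mul k, h2, smul_mul_assoc, mul_smul_comm, one_mul, mul_one]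
  have h4 := hs _ h1
  have h5 : D (H' * g * H'⁻¹) = D g := by
    have h6 := hmul (H' * g * H'⁻¹) H'
    rw [inv_mul_cancel_right, hmul] at h6
    have := hpos H'
    nlinarith
  rw [hmul, h5] at h4
  have := hpos g
  nlinarith

lemma IsSmall.mono {K L : Subgroup (G p)} (hK : IsSmall R ι K) (h : L ≤ K) : IsSmall R ι L :=
  fun g k hk => hK g k (h hk)

lemma IsSmall.conj {K : Subgroup (G p)} (hK : IsSmall R ι K) (h : G p) :
    IsSmall R ι (K.map (MulAut.conj h).toMonoidHom) := by
  rintro g _ ⟨k, hk, rfl⟩ h1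
  have : k = 1 := hK (g * h) k hk (by
    convert h1 using 1
    simp [mul_assoc])
  simp [this]

/-- All cells have the same measure. -/
theorem IsUniform.measure_cell_eq (hν : IsUniform R ι ν) {K : Subgroup (G p)}
    (hK : IsOpen (K : Set (G p))) (hsmall : IsSmall R ι K) (g : G p) :
    ν (cell R ι K g) = ν (cell R ι K 1) := by
  have := hν.prob
  have hopen : ∀ h : G p,
      IsOpen ((K.map (MulAut.conj h).toMonoidHom : Subgroup (G p)) : Set (G p)) := by
    intro h
    rw [Subgroup.coe_map]
    have : (MulAut.conj h).toMonoidHom '' (K : Set (G p)) = (fun x => h⁻¹ * x * h) ⁻¹' K := by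
      ext x
      constructor
      · rintro ⟨k, hk, rfl⟩
        simpa [mul_assoc] using hk
      · intro hx
        exact ⟨_, hx, by simp [mul_assoc]⟩
    rw [this]
    exact hK.preimage ((continuous_const_mul h⁻¹).mul_const h)
  have hcell : ∀ g h, ν (cell R ι K (g * h))
      = ν (cell R ι (K.map (MulAut.conj h).toMonoidHom : Subgroup (G p)) g) := by
    intro g h
    rw [← hν.measure_image h (measurableSet_cell (hopen h) g), rightTr_image_cell, cell_mul]
    congr 2
    ext x
    simp only [Set.mem_image, SetLike.mem_coe, Subgroup.mem_map]
    constructor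
    · rintro ⟨k, hk, rfl⟩
      exact ⟨h * k * h⁻¹, ⟨k, hk, rfl⟩, by group⟩
    · rintro ⟨_, ⟨k, hk, rfl⟩, rfl⟩
      exact ⟨k, hk, by simp⟩
  -- The cell at gh has the measure of the cell of hKh⁻¹ at g. Comparing K and hKh⁻¹ with their
  -- intersection gives a ratio of indices independent of g, which is therefore multiplicative in h.
  have hratio : ∀ h, ∃ r : ℝ, ∀ g, (ν (cell R ι K (g * h))).toReal
      = r * (ν (cell R ι K g)).toReal := by
    intro h
    set K' := K.map (MulAut.conj h).toMonoidHom with hK'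
    have hU : IsOpen ((K ⊓ K' : Subgroup (G p)) : Set (G p)) := hK.inter (hopen h)
    obtain ⟨n, hn, h1⟩ := hν.exists_measure_cell_eq hU inf_le_left hsmall
    obtain ⟨m, hm, h2⟩ := hν.exists_measure_cell_eq hU inf_le_right (hsmall.conj h)
    refine ⟨m / n, fun g => ?_⟩
    have hn' : (n : ℝ) ≠ 0 := by positivity
    rw [hcell, h2, h1, ENNReal.toReal_mul, ENNReal.toReal_mul, ENNReal.toReal_natCast,
      ENNReal.toReal_natCast]
    field_simp
  have hpos : ∀ g, 0 < (ν (cell R ι K g)).toReal := fun g =>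
    ENNReal.toReal_pos (hν.measure_cell_pos hK g).ne' (measure_ne_top _ _)
  choose D hD using hratio
  have hDpos : ∀ h, 0 < D h := fun h => by
    have h1 := hpos (1 * h)
    rw [hD] at h1
    exact pos_of_mul_pos_left h1 (hpos 1).le
  have hDmul : ∀ g h, D (g * h) = D g * D h := by
    intro g h
    have h1 := hD (g * h) 1
    rw [← mul_assoc, hD, hD g] at h1
    have := hpos 1
    have h2 : (ν (cell R ι K 1)).toReal * (D (g * h) - D g * D h) = 0 := by linarith
    exact sub_eq_zero.1 ((mul_eq_zero.1 h2).resolve_left this.ne')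
  have hDone : D g = 1 := by
    refine hom_eq_one_of_scalar hDpos hDmul (fun z hz => ?_) g
    have h1 := hD z 1
    rw [hcell] at h1
    have h2 : K.map (MulAut.conj z).toMonoidHom = K := by
      ext x
      simp [Subgroup.mem_map, hz]
    rw [h2] at h1
    have := hpos 1
    nlinarith
  have h1 := hD g 1
  rw [hDone, one_mul, one_mul] at h1
  exact (ENNReal.toReal_eq_toReal_iff' (measure_ne_top _ _) (measure_ne_top _ _)).1 h1

end Volume

/-! ### Principal congruence subgroups are small. -/

section Principal

variable {p : ℕ} [Fact p.Prime] {a b : ℚ} {R : Subring (Quat a b)}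
  {ι : Quat a b →ₐ[ℚ] Matrix (Fin 2) (Fin 2) ℚ_[p]}

/-- The principal congruence subgroup of level `p ^ m`. -/
def congrSubgroup (p : ℕ) [Fact p.Prime] (m : ℕ) : Subgroup (G p) where
  carrier := {g | EntryLe (g.val - 1) (((p : ℝ) ^ m)⁻¹) ∧ EntryLe (g⁻¹.val - 1) (((p : ℝ) ^ m)⁻¹)}
  one_mem' := by
    have : EntryLe (0 : Matrix (Fin 2) (Fin 2) ℚ_[p]) (((p : ℝ) ^ m)⁻¹) := fun i j => by
      rw [Matrix.zero_apply, norm_zero]; positivity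
    simpa using this
  inv_mem' := by
    rintro g ⟨h1, h2⟩
    exact ⟨h2, by rwa [inv_inv]⟩
  mul_mem' := by
    have hp : ((p : ℝ) ^ m)⁻¹ ≤ 1 := inv_le_one_of_one_le₀
      (one_le_pow₀ (by exact_mod_cast (Fact.out : p.Prime).one_le))
    have key : ∀ A B : Matrix (Fin 2) (Fin 2) ℚ_[p], EntryLe (A - 1) (((p : ℝ) ^ m)⁻¹) →
        EntryLe (B - 1) (((p : ℝ) ^ m)⁻¹) → EntryLe (A * B - 1) (((p : ℝ) ^ m)⁻¹) := by
      intro A B hA hB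
      have h1 : A * B - 1 = (A - 1) * B + (B - 1) := by noncomm_ring
      have h2 : EntryLe B 1 := by
        have := (hB.mono hp).add EntryLe.one
        simpa using this
      rw [h1]
      have := hA.mul h2
      rw [mul_one] at this
      exact this.add hB
    rintro g h ⟨h1, h2⟩ ⟨h3, h4⟩
    refine ⟨key _ _ h1 h3, ?_⟩
    rw [mul_inv_rev]
    exact key _ _ h4 h2

lemma isOpen_entryLe {c : ℝ} (hc : c ≠ 0) :
    IsOpen {A : Matrix (Fin 2) (Fin 2) ℚ_[p] | EntryLe A c} := by
  have : {A : Matrix (Fin 2) (Fin 2) ℚ_[p] | EntryLe A c}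
      = ⋂ i : Fin 2, ⋂ j : Fin 2, (fun A => A i j) ⁻¹' Metric.closedBall 0 c := by
    ext A
    simp [EntryLe]
  rw [this]
  refine isOpen_iInter_of_finite fun i => isOpen_iInter_of_finite fun j => ?_
  exact (IsUltrametricDist.isOpen_closedBall 0 hc).preimage (by fun_prop)

lemma isOpen_congrSubgroup (m : ℕ) : IsOpen (congrSubgroup p m : Set (G p)) := by
  have hc : ((p : ℝ) ^ m)⁻¹ ≠ 0 := by
    have := (Fact.out : p.Prime).ne_zero
    positivity
  have h1 : Continuous fun g : G p => g.val - 1 := Units.continuous_val.sub continuous_const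
  have h2 : Continuous fun g : G p => g⁻¹.val - 1 :=
    (Units.continuous_val.comp continuous_inv).sub continuous_const
  exact ((isOpen_entryLe hc).preimage h1).inter ((isOpen_entryLe hc).preimage h2)

lemma congrSubgroup_le_nbhd {m n : ℕ} (hn : 0 < n) (hnm : n ≤ m) {g : G p}
    (hg : g ∈ congrSubgroup p m) : g ∈ nbhd (unitsC p) ((p : ℝ) ^ (-(n : ℤ))) := by
  have hp : (1 : ℝ) < p := by exact_mod_cast (Fact.out : p.Prime).one_lt
  have h1 : ((p : ℝ) ^ m)⁻¹ ≤ (p : ℝ) ^ (-(n : ℤ)) := by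
    rw [zpow_neg, zpow_natCast]
    exact inv_anti₀ (by positivity) (pow_le_pow_right₀ hp.le hnm)
  have h2 : ((p : ℝ) ^ m)⁻¹ < 1 := inv_lt_one_of_one_lt₀ (one_lt_pow₀ hp (by omega))
  obtain ⟨h, -⟩ := hg
  have hdiag : ∀ x : ℚ_[p], ‖x - 1‖ ≤ ((p : ℝ) ^ m)⁻¹ → ‖x‖ = 1 := by
    intro x hx
    have h3 : ‖x - 1‖ < ‖(1 : ℚ_[p])‖ := by rw [norm_one]; exact hx.trans_lt h2
    have := IsUltrametricDist.norm_add_eq_max_of_norm_ne_norm h3.ne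
    rwa [sub_add_cancel, max_eq_right h3.le, norm_one] at this
  rw [mem_nbhd]
  refine ⟨hdiag _ (by simpa using h 0 0), hdiag _ (by simpa using h 1 1), ?_, ?_⟩
  · exact (by simpa using h 0 1 : ‖g.val 0 1‖ ≤ _).trans h1
  · exact (by simpa using h 1 0 : ‖g.val 1 0‖ ≤ _).trans h1

/-- Principal congruence subgroups of high level meet the conjugates of `Γ` trivially. -/
lemma IsOrder.isSmall_congrSubgroup (hR : IsOrder R) (ha : a < 0) (hb : b < 0) {m : ℕ}
    (hm : 4 < p ^ m) : IsSmall R ι (congrSubgroup p m) := by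
  intro g k hk hkΓ
  obtain ⟨γ, ⟨hγ, j, hj⟩, h⟩ := (mem_Gam_iff hR ha hb).1 hkΓ
  have hp : (1 : ℝ) < p := by exact_mod_cast (Fact.out : p.Prime).one_lt
  have hm1 : ((p : ℝ) ^ m)⁻¹ ≤ 1 := inv_le_one_of_one_le₀ (one_le_pow₀ hp.le)
  have hent : ∀ A : Matrix (Fin 2) (Fin 2) ℚ_[p], EntryLe (A - 1) (((p : ℝ) ^ m)⁻¹) →
      EntryLe A 1 := fun A hA => by simpa using (hA.mono hm1).add EntryLe.one
  have htr : k.val.trace = ((tr γ : ℚ) : ℚ_[p]) := by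
    rw [← trace_map ι ha hb, ← h]
    exact (Matrix.trace_units_conj g k.val).symm
  have hdet : k.val.det = ((nr γ : ℚ) : ℚ_[p]) := by
    rw [← det_map ι ha hb, ← h]
    exact (Matrix.det_units_conj g k.val).symm
  have hnorm : ‖k.val.det‖ = 1 := by
    have h1 : ‖k.val.det‖ * ‖k⁻¹.val.det‖ = 1 := by
      rw [← norm_mul, ← Matrix.det_mul, Units.mul_inv, Matrix.det_one, norm_one]
    have h2 := (hent _ hk.1).norm_det_le
    have h3 := (hent _ hk.2).norm_det_le
    have h4 := norm_nonneg k.val.det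
    nlinarith
  have hnr : nr γ = 1 := by
    rw [hdet, hj, Nat.cast_one, one_mul, Rat.cast_zpow, Rat.cast_natCast, norm_zpow,
      Padic.norm_p, inv_zpow', zpow_eq_one_iff_right₀ (by positivity) hp.ne'] at hnorm
    rw [hj, neg_eq_zero.1 hnorm]
    simp
  obtain ⟨t, ht⟩ : ∃ t : ℤ, (t : ℚ) = tr γ := by
    obtain ⟨i, hi⟩ := mem_invP.1 hγ
    have h1 := hR.tr_mem hi
    rw [tr_smul] at h1
    have h2 := mem_intQ_of_pow_smul (c := 0) h1 (by
      rw [pabs, ← htr, pow_zero]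
      exact (hent _ hk.1).norm_trace_le)
    rw [pow_zero, one_mul] at h2
    obtain ⟨t, ht⟩ := mem_intQ.1 h2
    exact ⟨t, ht.symm⟩
  have hle : t ^ 2 ≤ 4 := by
    have := tr_sq_le ha hb γ
    rw [hnr, ← ht] at this
    have h1 : (t : ℚ) ^ 2 ≤ 4 := by linarith
    exact_mod_cast h1
  -- The trace is an integer with |t| ≤ 2 by definiteness and t ≡ 2 modulo p^m > 4. So t = 2, and nr
  -- (γ - 1) = nr γ - tr γ + 1 = 0.
  have hdvd : ((p ^ m : ℕ) : ℤ) ∣ t - 2 := by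
    have h1 := hk.1.norm_trace_le
    rw [Matrix.trace_sub, htr, ← ht, Matrix.trace_one] at h1
    have h2 : ‖((t - 2 : ℤ) : ℚ_[p])‖ ≤ (p : ℝ) ^ (-(m : ℤ)) := by
      rw [zpow_neg, zpow_natCast]
      convert h1 using 2
      push_cast [Fintype.card_fin]
      ring
    exact_mod_cast (Padic.norm_int_le_pow_iff_dvd _ _).1 h2
  have ht2 : t = 2 := by
    have h1 : t - 2 = 0 := by
      refine Int.eq_zero_of_abs_lt_dvd hdvd ?_
      have h2 : (4 : ℤ) < (p ^ m : ℕ) := by exact_mod_cast hm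
      have h3 : |t - 2| ≤ 4 := abs_le.2 ⟨by nlinarith, by nlinarith⟩
      omega
    omega
  have hγ1 : γ = 1 := by
    rw [← sub_eq_zero, ← nr_eq_zero ha hb]
    have h1 : nr (γ - 1) = nr γ - tr γ + 1 := by
      simp only [nr_eq, tr, QuaternionAlgebra.re_sub, QuaternionAlgebra.imI_sub,
        QuaternionAlgebra.imJ_sub, QuaternionAlgebra.imK_sub, QuaternionAlgebra.re_one,
        QuaternionAlgebra.imI_one, QuaternionAlgebra.imJ_one, QuaternionAlgebra.imK_one]
      ring
    rw [h1, hnr, ← ht, ht2]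
    norm_num
  have h1 : g * k * g⁻¹ = 1 := Units.ext (by rw [h, hγ1, map_one, Units.val_one])
  rwa [mul_inv_eq_one, mul_eq_left] at h1

end Principal

end ArithQuot

namespace ArithQuot

/-! ### Finitely many cells and integration as a finite sum. -/

section CellSystem

set_option linter.unusedSectionVars false

variable {p : ℕ} [Fact p.Prime] {a b : ℚ} {R : Subring (Quat a b)}
  {ι : Quat a b →ₐ[ℚ] Matrix (Fin 2) (Fin 2) ℚ_[p]} {ν : Measure (X R ι)}
  {K : Subgroup (G p)}

lemma mem_cell_iff {x : X R ι} {g : G p} :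
    x ∈ cell R ι K g ↔ ∃ k ∈ K, rightTr R ι k (toX R ι g) = x := Iff.rfl

lemma mem_cell_symm {g h : G p} (H : toX R ι h ∈ cell R ι K g) : toX R ι g ∈ cell R ι K h := by
  obtain ⟨k, hk, H⟩ := mem_cell_iff.1 H
  exact mem_cell_iff.2 ⟨k⁻¹, inv_mem hk, by rw [← H, rightTr_mul, mul_inv_cancel, rightTr_one]⟩

lemma mem_cell_trans {g h : G p} {x : X R ι} (H : toX R ι h ∈ cell R ι K g)
    (H' : x ∈ cell R ι K h) : x ∈ cell R ι K g := by
  obtain ⟨k, hk, H⟩ := mem_cell_iff.1 H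
  obtain ⟨l, hl, H'⟩ := mem_cell_iff.1 H'
  exact mem_cell_iff.2 ⟨k * l, mul_mem hk hl, by rw [← rightTr_mul, H, H']⟩

lemma mem_cell_self (g : G p) : toX R ι g ∈ cell R ι K g :=
  mem_cell_iff.2 ⟨1, one_mem K, rightTr_one _⟩

variable (R ι K) in
/-- Representatives of the orbits of `K` on the quotient. -/
structure IsCellSystem (Y : Finset (G p)) : Prop where
  inj : ∀ y ∈ Y, ∀ y' ∈ Y, toX R ι y' ∈ cell R ι K y → y = y'
  surj : ∀ x : X R ι, ∃ y ∈ Y, x ∈ cell R ι K y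

/-- Disjoint cells of equal positive measure in a probability space are finite in number. This
replaces compactness of the quotient. -/
theorem IsUniform.exists_isCellSystem (hν : IsUniform R ι ν) (hK : IsOpen (K : Set (G p)))
    (hsmall : IsSmall R ι K) : ∃ Y, IsCellSystem R ι K Y := by
  classical
  have := hν.prob
  let s : Setoid (G p) := ⟨fun g h => toX R ι h ∈ cell R ι K g, mem_cell_self, mem_cell_symm,
    mem_cell_trans⟩
  have hfin : Finite (Quotient s) := by
    have h1 := Measure.finite_const_le_meas_of_disjoint_iUnion ν (hν.measure_cell_pos hK 1)
      (As := fun q : Quotient s => cell R ι K q.out) (fun q => measurableSet_cell hK _) (by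
        intro q q' hne
        refine Set.disjoint_left.2 fun x hx hx' => hne ?_
        obtain ⟨g, rfl⟩ := toX_surjective x
        rw [← Quotient.out_eq q, ← Quotient.out_eq q']
        exact Quotient.sound (mem_cell_trans hx (mem_cell_symm hx'))) (measure_ne_top _ _)
    have h2 : {q : Quotient s | ν (cell R ι K 1) ≤ ν (cell R ι K q.out)} = Set.univ := by
      ext q
      simp [hν.measure_cell_eq hK hsmall q.out]
    rw [h2] at h1
    exact Set.finite_univ_iff.1 h1
  have := Fintype.ofFinite (Quotient s)
  refine ⟨Finset.univ.image fun q : Quotient s => q.out, ?_, fun x => ?_⟩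
  · intro y hy y' hy' h
    obtain ⟨q, -, rfl⟩ := Finset.mem_image.1 hy
    obtain ⟨q', -, rfl⟩ := Finset.mem_image.1 hy'
    have : q = q' := by
      rw [← Quotient.out_eq q, ← Quotient.out_eq q']
      exact Quotient.sound h
    rw [this]
  · obtain ⟨g, rfl⟩ := toX_surjective x
    exact ⟨_, Finset.mem_image_of_mem _ (Finset.mem_univ (Quotient.mk s g)),
      Quotient.exact (Quotient.out_eq (Quotient.mk s g))⟩

theorem IsUniform.lintegral_eq (hν : IsUniform R ι ν) (hK : IsOpen (K : Set (G p)))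
    (hsmall : IsSmall R ι K) {Y : Finset (G p)} (hY : IsCellSystem R ι K Y) {F : X R ι → ENNReal}
    (hF : ∀ k ∈ K, ∀ x, F (rightTr R ι k x) = F x) :
    ∫⁻ x, F x ∂ν = ∑ y ∈ Y, F (toX R ι y) * ν (cell R ι K 1) := by
  have h1 : (⋃ y ∈ Y, cell R ι K y) = Set.univ :=
    Set.eq_univ_of_forall fun x => by
      obtain ⟨y, hy, hx⟩ := hY.surj x
      exact Set.mem_iUnion₂.2 ⟨y, hy, hx⟩
  rw [← setLIntegral_univ, ← h1, lintegral_biUnion_finset]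
  · refine Finset.sum_congr rfl fun y _ => ?_
    rw [← hν.measure_cell_eq hK hsmall y, ← setLIntegral_const]
    refine setLIntegral_congr_fun (measurableSet_cell hK y) ?_
    rintro _ ⟨k, hk, rfl⟩
    exact hF k hk (toX R ι y)
  · intro y hy y' hy' hne
    refine Set.disjoint_left.2 fun x hx hx' => hne ?_
    obtain ⟨g, rfl⟩ := toX_surjective x
    exact hY.inj y hy y' hy' (mem_cell_trans hx (mem_cell_symm hx'))
  · exact fun y _ => measurableSet_cell hK y

end CellSystem

/-! ### Schur's lemma and eigenvalues on irreducible submodules. -/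

section Schur

set_option linter.unusedSectionVars false

variable {p : ℕ} [Fact p.Prime] {a b : ℚ} {R : Subring (Quat a b)}
  {ι : Quat a b →ₐ[ℚ] Matrix (Fin 2) (Fin 2) ℚ_[p]} {ν : Measure (X R ι)}

/-- The exponent 3 suffices for smallness at every prime, since 2³ > 4. -/
lemma exists_open_small (hR : IsOrder R) (ha : a < 0) (hb : b < 0) {φ : X R ι → ℂ}
    (hφ : φ ∈ smoothFun R ι) (n : ℕ) : ∃ K : Subgroup (G p), IsOpen (K : Set (G p)) ∧
      IsSmall R ι K ∧ (∀ k ∈ K, rho R ι k φ = φ) ∧ ∀ k ∈ K, k ∈ congrSubgroup p n := by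
  obtain ⟨U, hU, h⟩ := hφ
  have hp := (Fact.out : p.Prime).two_le
  have h3 : 4 < p ^ 3 := lt_of_lt_of_le (by norm_num) (Nat.pow_le_pow_left hp 3)
  refine ⟨U ⊓ (congrSubgroup p 3 ⊓ congrSubgroup p n),
    hU.inter ((isOpen_congrSubgroup 3).inter (isOpen_congrSubgroup n)),
    (hR.isSmall_congrSubgroup ha hb h3).mono (inf_le_right.trans inf_le_left), ?_, ?_⟩
  · intro k hk
    funext x
    exact h k hk.1 x
  · exact fun k hk => hk.2.2

/-- Schur's lemma for the irreducible submodules of the space of smooth functions. -/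
theorem IsIrred.exists_eigenvalue (hν : IsUniform R ι ν) (hR : IsOrder R) (ha : a < 0) (hb : b < 0)
    {π : Submodule ℂ (X R ι → ℂ)} (hπ : IsIrred R ι π) (T : Module.End ℂ (X R ι → ℂ))
    (hTπ : ∀ ψ ∈ π, T ψ ∈ π) (hTrho : ∀ g ψ, T (rho R ι g ψ) = rho R ι g (T ψ))
    (hTh : ∀ q : ℕ, q.Prime → q ≠ p → ∀ ψ, T (hecke R ι q ψ) = hecke R ι q (T ψ)) :
    ∃ c : ℂ, ∀ ψ ∈ π, T ψ = c • ψ := by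
  obtain ⟨ψ₀, hψ₀, hne⟩ := (Submodule.ne_bot_iff _).1 hπ.ne_bot
  obtain ⟨K, hK, hsmall, hKψ, -⟩ := exists_open_small hR ha hb (hπ.le_smooth hψ₀) 0
  obtain ⟨Y, hY⟩ := hν.exists_isCellSystem hK hsmall
  let V : Submodule ℂ (X R ι → ℂ) :=
    { carrier := {ψ | ψ ∈ π ∧ ∀ k ∈ K, rho R ι k ψ = ψ}
      zero_mem' := ⟨zero_mem π, fun k _ => rfl⟩
      add_mem' := by
        rintro ψ ψ' ⟨h1, h2⟩ ⟨h3, h4⟩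
        refine ⟨add_mem h1 h3, fun k hk => ?_⟩
        change rho R ι k ψ + rho R ι k ψ' = _
        rw [h2 k hk, h4 k hk]
      smul_mem' := by
        rintro c ψ ⟨h1, h2⟩
        refine ⟨π.smul_mem c h1, fun k hk => ?_⟩
        change c • rho R ι k ψ = _
        rw [h2 k hk] }
  have hTV : ∀ ψ ∈ V, T ψ ∈ V := by
    rintro ψ ⟨h1, h2⟩
    exact ⟨hTπ ψ h1, fun k hk => by rw [← hTrho, h2 k hk]⟩
  -- A K-invariant function is determined by its values on the finite cell system, so `T` has an
  -- eigenvector in `V`.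
  have hfd : FiniteDimensional ℂ V := by
    let L : V →ₗ[ℂ] (Y → ℂ) :=
      { toFun := fun ψ y => ψ.1 (toX R ι y.1)
        map_add' := fun _ _ => rfl
        map_smul' := fun _ _ => rfl }
    refine FiniteDimensional.of_injective L ((injective_iff_map_eq_zero L).2 fun ψ hψ => ?_)
    refine Subtype.ext (funext fun x => ?_)
    obtain ⟨y, hy, k, hk, rfl⟩ := hY.surj x
    have h1 : ψ.1 (toX R ι y) = 0 := congrFun hψ ⟨y, hy⟩
    have h2 := congrFun (ψ.2.2 k hk) (toX R ι y)
    rw [h1] at h2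
    exact h2
  have hnt : Nontrivial V :=
    ⟨⟨ψ₀, hψ₀, hKψ⟩, 0, fun h => hne (congrArg Subtype.val h)⟩
  obtain ⟨c, hc⟩ := Module.End.exists_eigenvalue (T.restrict hTV)
  obtain ⟨⟨ψ₁, hψ₁⟩, h1, h2⟩ := hc.exists_hasEigenvector
  have hTψ₁ : T ψ₁ = c • ψ₁ := congrArg Subtype.val (Module.End.mem_eigenspace_iff.1 h1)
  have hψ₁0 : ψ₁ ≠ 0 := fun h => h2 (Subtype.ext h)
  let σ : Submodule ℂ (X R ι → ℂ) := π ⊓ Module.End.eigenspace T c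
  have hσ : ∀ ψ, ψ ∈ σ ↔ ψ ∈ π ∧ T ψ = c • ψ := fun ψ => by
    rw [Submodule.mem_inf, Module.End.mem_eigenspace_iff]
  have hst : IsStable R ι σ := by
    refine ⟨fun g ψ h => ?_, fun q hq hqp ψ h => ?_⟩
    · rw [hσ] at h ⊢
      refine ⟨hπ.stable.rho_mem g ψ h.1, ?_⟩
      rw [hTrho, h.2]
      rfl
    · rw [hσ] at h ⊢
      refine ⟨hπ.stable.hecke_mem q hq hqp ψ h.1, ?_⟩
      rw [hTh q hq hqp, h.2, hecke_smul hR ha hb hq.ne_zero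
        ((Nat.coprime_primes hq Fact.out).2 hqp)]
  refine ⟨c, fun ψ hψ => ?_⟩
  rcases hπ.eq_bot_or_eq σ inf_le_left hst with h | h
  · exact absurd ((Submodule.mem_bot ℂ).1 (h ▸ (hσ ψ₁).2 ⟨hψ₁.1, hTψ₁⟩)) hψ₁0
  · rw [← h] at hψ
    exact ((hσ ψ).1 hψ).2

/-- Translation preserves the L²-norm, so its eigenvalue is unitary. -/
lemma IsUniform.norm_eq_one_of_rho_eq (hν : IsUniform R ι ν) {φ : X R ι → ℂ}
    (hφ : (∫ x, ‖φ x‖ ^ 2 ∂ν) = 1) {z : G p} {ω : ℂ} (h : rho R ι z φ = ω • φ) : ‖ω‖ = 1 := by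
  let e : X R ι ≃ₜ X R ι :=
    { toFun := rightTr R ι z
      invFun := rightTr R ι z⁻¹
      left_inv := fun x => by rw [rightTr_mul, mul_inv_cancel, rightTr_one]
      right_inv := fun x => by rw [rightTr_mul, inv_mul_cancel, rightTr_one]
      continuous_toFun := continuous_rightTr z
      continuous_invFun := continuous_rightTr z⁻¹ }
  have h1 := (hν.invariant z).integral_comp e.measurableEmbedding (fun x => ‖φ x‖ ^ 2)
  have h2 : ∀ x, ‖φ (rightTr R ι z x)‖ ^ 2 = ‖ω‖ ^ 2 * ‖φ x‖ ^ 2 := by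
    intro x
    have := congrFun h x
    rw [← mul_pow, ← norm_mul]
    exact congrArg (fun t : ℂ => ‖t‖ ^ 2) this
  simp_rw [h2] at h1
  rw [integral_const_mul, hφ, mul_one] at h1
  exact (pow_eq_one_iff_of_nonneg (norm_nonneg _) two_ne_zero).1 h1

theorem IsIrred.exists_isAmplifier (hν : IsUniform R ι ν) (hR : IsOrder R) (ha : a < 0)
    (hb : b < 0) {π : Submodule ℂ (X R ι → ℂ)} (hπ : IsIrred R ι π) {φ : X R ι → ℂ} (hφπ : φ ∈ π)
    (hφ : (∫ x, ‖φ x‖ ^ 2 ∂ν) = 1) {ℓ : ℕ} (hℓ : IsGood p R ℓ) :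
    ∃ e W κ, IsAmplifier φ ℓ e W κ := by
  have hℓ0 := hℓ.prime.ne_zero
  have hcop : ∀ q : ℕ, q.Prime → q ≠ p → q.Coprime p := fun q hq hqp =>
    (Nat.coprime_primes hq Fact.out).2 hqp
  have hℓp := hcop ℓ hℓ.prime hℓ.ne
  obtain ⟨c, hc⟩ := hπ.exists_eigenvalue hν hR ha hb
    { toFun := hecke R ι ℓ
      map_add' := hecke_add hR ha hb hℓ0 hℓp
      map_smul' := hecke_smul hR ha hb hℓ0 hℓp }
    (hπ.stable.hecke_mem ℓ hℓ.prime hℓ.ne)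
    (fun g ψ => (rho_hecke hR ha hb hℓ0 hℓp ψ g).symm)
    (fun q hq hqp ψ => hℓ.hecke_comm hR ha hb hq hqp ψ)
  set z : G p := (toG ι (ℓ : Quat a b))⁻¹
  obtain ⟨ω, hω⟩ := hπ.exists_eigenvalue hν hR ha hb
    { toFun := rho R ι z
      map_add' := fun _ _ => rfl
      map_smul' := fun _ _ => rfl }
    (hπ.stable.rho_mem z)
    (fun g ψ => by
      funext x
      change ψ (rightTr R ι g (rightTr R ι z x)) = ψ (rightTr R ι z (rightTr R ι g x))
      rw [rightTr_mul, rightTr_mul, toG_natCast_comm ha hb hℓ0])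
    (fun q hq hqp ψ => rho_hecke hR ha hb hq.ne_zero (hcop q hq hqp) ψ z)
  exact hℓ.exists_isAmplifier hR ha hb (hc φ hφπ) (hω φ hφπ)
    (hν.norm_eq_one_of_rho_eq hφ (hω φ hφπ))

end Schur

end ArithQuot

namespace ArithQuot

/-! ### Cauchy–Schwarz on a finite set. -/

section Duality

/-- Cauchy–Schwarz over the values of ρ, followed by 2 v_i v_j ≤ v_i² + v_j² in each fibre. The
off-diagonal information is reduced to the weights k alone. -/
lemma sq_sum_le_of_fibers {τ α : Type*} [DecidableEq α] (T : Finset τ) (Y : Finset α) (ρ : τ → α)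
    (hρ : ∀ i ∈ T, ρ i ∈ Y) {k v : τ → ℝ} (hk : ∀ i ∈ T, 0 ≤ k i) (f : α → ℝ) :
    (∑ i ∈ T, k i * v i * f (ρ i)) ^ 2 ≤
      (∑ y ∈ Y, f y ^ 2) * ∑ i ∈ T, k i * v i ^ 2 * ∑ j ∈ T with ρ j = ρ i, k j := by
  set H : α → ℝ := fun y => ∑ i ∈ T with ρ i = y, k i * v i with hH
  have h1 : ∑ i ∈ T, k i * v i * f (ρ i) = ∑ y ∈ Y, f y * H y := by
    rw [← Finset.sum_fiberwise_of_maps_to hρ]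
    refine Finset.sum_congr rfl fun y _ => ?_
    rw [hH, Finset.mul_sum]
    refine Finset.sum_congr rfl fun i hi => ?_
    rw [(Finset.mem_filter.1 hi).2]
    ring
  rw [h1]
  refine (Finset.sum_mul_sq_le_sq_mul_sq Y f H).trans
    (mul_le_mul_of_nonneg_left ?_ (Finset.sum_nonneg fun y _ => sq_nonneg _))
  have h2 : ∑ y ∈ Y, H y ^ 2 = ∑ i ∈ T, ∑ j ∈ T with ρ j = ρ i, k i * v i * (k j * v j) := by
    rw [← Finset.sum_fiberwise_of_maps_to hρ]
    refine Finset.sum_congr rfl fun y _ => ?_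
    rw [hH, sq, Finset.sum_mul_sum]
    refine Finset.sum_congr rfl fun i hi => ?_
    rw [(Finset.mem_filter.1 hi).2]
  have h3 : ∑ i ∈ T, ∑ j ∈ T with ρ j = ρ i, k i * k j * v j ^ 2
      = ∑ i ∈ T, ∑ j ∈ T with ρ j = ρ i, k i * k j * v i ^ 2 := by
    simp_rw [Finset.sum_filter]
    rw [Finset.sum_comm]
    refine Finset.sum_congr rfl fun i _ => Finset.sum_congr rfl fun j _ => ?_
    by_cases h : ρ i = ρ j
    · rw [if_pos h, if_pos h.symm]; ring
    · rw [if_neg h, if_neg (Ne.symm h)]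
  have h4 : ∑ i ∈ T, k i * v i ^ 2 * ∑ j ∈ T with ρ j = ρ i, k j
      = ∑ i ∈ T, ∑ j ∈ T with ρ j = ρ i, k i * k j * v i ^ 2 := by
    refine Finset.sum_congr rfl fun i _ => ?_
    rw [Finset.mul_sum]
    exact Finset.sum_congr rfl fun j _ => by ring
  have h5 : ∑ i ∈ T, ∑ j ∈ T with ρ j = ρ i, 2 * (k i * v i * (k j * v j))
      ≤ ∑ i ∈ T, ∑ j ∈ T with ρ j = ρ i, (k i * k j * v i ^ 2 + k i * k j * v j ^ 2) := by
    refine Finset.sum_le_sum fun i hi => Finset.sum_le_sum fun j hj => ?_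
    have := mul_nonneg (mul_nonneg (hk i hi) (hk j (Finset.mem_filter.1 hj).1))
      (sq_nonneg (v i - v j))
    nlinarith
  simp_rw [← Finset.mul_sum, Finset.sum_add_distrib] at h5
  rw [h2, h4]
  simp_rw [← Finset.mul_sum]
  linarith

/-- The amplification inequality for a function on a finite set. -/
theorem sq_card_mul_sum_le {α β : Type*} [DecidableEq α] {Y S : Finset α} {P : Finset ℕ}
    {W : ℕ → Finset β} {κ : ℕ → ℝ} {r : β → α → α} {f : α → ℝ} {B : ℝ} (hB : 0 ≤ B)
    (hr : ∀ w y, r w y ∈ Y) (hf : ∀ y, 0 ≤ f y) (hκ : ∀ ℓ ∈ P, 0 < κ ℓ)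
    (h : ∀ y ∈ S, ∀ ℓ ∈ P, κ ℓ * f y ≤ ∑ w ∈ W ℓ, f (r w y))
    (hcount : ∀ y ∈ S, ∑ ℓ ∈ P, ∑ ℓ' ∈ P, (κ ℓ)⁻¹ * (κ ℓ')⁻¹ *
      ((W ℓ ×ˢ S ×ˢ W ℓ').filter fun t => r t.2.2 t.2.1 = r t.1 y).card ≤ B) :
    (P.card : ℝ) ^ 2 * ∑ y ∈ S, f y ^ 2 ≤ B * ∑ y ∈ Y, f y ^ 2 := by
  -- Indices are triples (y, ℓ, w) with weight κ_ℓ⁻¹ and value f(y). The image r w y plays the part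
  -- of w⁻¹y, and fibres of the image map are coincidences.
  set T : Finset (α × (_ : ℕ) × β) := S ×ˢ P.sigma W with hT
  have hTm : ∀ i ∈ T, i.1 ∈ S ∧ i.2.1 ∈ P ∧ i.2.2 ∈ W i.2.1 := fun i hi => by
    rwa [hT, Finset.mem_product, Finset.mem_sigma] at hi
  have h1 := sq_sum_le_of_fibers T Y (fun i => r i.2.2 i.1) (fun i _ => hr _ _)
    (k := fun i => (κ i.2.1)⁻¹) (v := fun i => f i.1)
    (fun i hi => (inv_pos.2 (hκ _ (hTm i hi).2.1)).le) f
  have h2 : P.card * ∑ y ∈ S, f y ^ 2 ≤ ∑ i ∈ T, (κ i.2.1)⁻¹ * f i.1 * f (r i.2.2 i.1) := by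
    rw [hT, Finset.sum_product, Finset.mul_sum]
    refine Finset.sum_le_sum fun y hy => ?_
    rw [Finset.sum_sigma, ← nsmul_eq_mul, ← Finset.sum_const]
    refine Finset.sum_le_sum fun ℓ hℓ => ?_
    simp only
    rw [← Finset.mul_sum]
    have h3 := hκ ℓ hℓ
    calc f y ^ 2 = (κ ℓ)⁻¹ * f y * (κ ℓ * f y) := by field_simp
      _ ≤ _ := mul_le_mul_of_nonneg_left (h y hy ℓ hℓ) (mul_nonneg (inv_pos.2 h3).le (hf y))
  have h3 : ∑ i ∈ T, (κ i.2.1)⁻¹ * f i.1 ^ 2 * ∑ j ∈ T with r j.2.2 j.1 = r i.2.2 i.1, (κ j.2.1)⁻¹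
      ≤ B * ∑ y ∈ S, f y ^ 2 := by
    rw [hT, Finset.sum_product, Finset.mul_sum, ← hT]
    refine Finset.sum_le_sum fun y hy => ?_
    refine le_trans (le_of_eq ?_) (mul_le_mul_of_nonneg_right (hcount y hy) (sq_nonneg (f y)))
    rw [Finset.sum_sigma, Finset.sum_mul]
    refine Finset.sum_congr rfl fun ℓ _ => ?_
    have h4 : ∀ w, ∑ j ∈ T with r j.2.2 j.1 = r w y, (κ j.2.1)⁻¹
        = ∑ ℓ' ∈ P, ∑ t ∈ S ×ˢ W ℓ', if r t.2 t.1 = r w y then (κ ℓ')⁻¹ else 0 := by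
      intro w
      rw [Finset.sum_filter, hT, Finset.sum_product]
      simp_rw [Finset.sum_sigma, Finset.sum_product]
      rw [Finset.sum_comm]
    simp only [h4]
    rw [Finset.sum_mul]
    simp_rw [Finset.mul_sum]
    rw [Finset.sum_comm]
    refine Finset.sum_congr rfl fun ℓ' _ => ?_
    rw [← Finset.sum_product', Finset.card_filter, Nat.cast_sum, Finset.mul_sum, Finset.sum_mul]
    refine Finset.sum_congr rfl fun t _ => ?_
    by_cases hc : r t.2.2 t.2.1 = r t.1 y
    · simp only [if_pos hc]; push_cast; ring
    · simp only [if_neg hc]; push_cast; ring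
  set M := ∑ y ∈ S, f y ^ 2
  have hM : 0 ≤ M := Finset.sum_nonneg fun y _ => sq_nonneg _
  have hF : 0 ≤ ∑ y ∈ Y, f y ^ 2 := Finset.sum_nonneg fun y _ => sq_nonneg _
  rcases hM.eq_or_lt with h0 | h0
  · rw [← h0, mul_zero]
    exact mul_nonneg hB hF
  · have h5 : (P.card * M) ^ 2 ≤ (∑ y ∈ Y, f y ^ 2) * (B * M) :=
      (pow_le_pow_left₀ (by positivity) h2 2).trans
        (h1.trans (mul_le_mul_of_nonneg_left h3 hF))
    refine le_of_mul_le_mul_right ?_ h0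
    linarith

end Duality

end ArithQuot

namespace ArithQuot

/-! ### B(C, ε) is closed under products and inverses. -/

section NbhdGroup

variable {p : ℕ} [Fact p.Prime]

lemma norm_add_eq_one {x y : ℚ_[p]} (hx : ‖x‖ = 1) (hy : ‖y‖ < 1) : ‖x + y‖ = 1 := by
  have h : ‖y‖ < ‖x‖ := by rwa [hx]
  rw [IsUltrametricDist.norm_add_eq_max_of_norm_ne_norm h.ne', max_eq_left h.le, hx]

lemma norm_det_of_mem_nbhd {ε : ℝ} (hε : ε < 1) {g : G p} (hg : g ∈ nbhd (unitsC p) ε) :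
    ‖g.val.det‖ = 1 := by
  obtain ⟨h1, h2, h3, h4⟩ := mem_nbhd.1 hg
  have hε0 := (norm_nonneg _).trans h3
  rw [Matrix.det_fin_two, sub_eq_add_neg]
  refine norm_add_eq_one ?_ ?_
  · rw [norm_mul]
    exact (congrArg₂ _ h1 h2).trans (one_mul 1)
  · rw [norm_neg, norm_mul]
    calc _ ≤ ε * ε := mul_le_mul h3 h4 (norm_nonneg _) hε0
      _ < 1 := by nlinarith

lemma mul_mem_nbhd {ε : ℝ} (hε : ε < 1) {g h : G p} (hg : g ∈ nbhd (unitsC p) ε)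
    (hh : h ∈ nbhd (unitsC p) ε) : g * h ∈ nbhd (unitsC p) ε := by
  obtain ⟨g1, g2, g3, g4⟩ := mem_nbhd.1 hg
  obtain ⟨h1, h2, h3, h4⟩ := mem_nbhd.1 hh
  have hε0 := (norm_nonneg _).trans g3
  have hm : ∀ i j, (g * h) i j = g i 0 * h 0 j + g i 1 * h 1 j := fun i j => by
    change (g.val * h.val) i j = _
    rw [Matrix.mul_apply, Fin.sum_univ_two]
  rw [mem_nbhd, hm, hm, hm, hm]
  have hlt : ∀ x y : ℚ_[p], ‖x‖ ≤ ε → ‖y‖ ≤ ε → ‖x * y‖ < 1 := fun x y hx hy => by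
    rw [norm_mul]
    calc _ ≤ ε * ε := mul_le_mul hx hy (norm_nonneg _) hε0
      _ < 1 := by nlinarith
  refine ⟨norm_add_eq_one (by rw [norm_mul, g1, h1, one_mul]) (hlt _ _ g3 h4), ?_, ?_, ?_⟩
  · rw [add_comm]
    exact norm_add_eq_one (by rw [norm_mul, g2, h2, one_mul]) (hlt _ _ g4 h3)
  · refine (Padic.nonarchimedean _ _).trans (max_le ?_ ?_)
    · rwa [norm_mul, g1, one_mul]
    · rwa [norm_mul, h2, mul_one]
  · refine (Padic.nonarchimedean _ _).trans (max_le ?_ ?_)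
    · rwa [norm_mul, h1, mul_one]
    · rwa [norm_mul, g2, one_mul]

lemma inv_mem_nbhd {ε : ℝ} (hε : ε < 1) {g : G p} (hg : g ∈ nbhd (unitsC p) ε) :
    g⁻¹ ∈ nbhd (unitsC p) ε := by
  have hdet := norm_det_of_mem_nbhd hε hg
  obtain ⟨h1, h2, h3, h4⟩ := mem_nbhd.1 hg
  have hinv : ∀ i j, g⁻¹ i j = (g.val.det)⁻¹ * g.val.adjugate i j := by
    intro i j
    rw [Matrix.coe_units_inv, Matrix.inv_def, Ring.inverse_eq_inv', Matrix.smul_apply, smul_eq_mul]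
  rw [mem_nbhd, hinv, hinv, hinv, hinv, norm_mul, norm_mul, norm_mul, norm_mul, norm_inv, hdet,
    inv_one, one_mul, one_mul, one_mul, one_mul, Matrix.adjugate_fin_two]
  exact ⟨h2, h1, (norm_neg _).trans_le h3, (norm_neg _).trans_le h4⟩

end NbhdGroup

/-! ### From coincidences to returns. -/

section ReturnCount

set_option linter.unusedSectionVars false

variable {p : ℕ} [Fact p.Prime] {a b : ℚ} {R : Subring (Quat a b)}
  {ι : Quat a b →ₐ[ℚ] Matrix (Fin 2) (Fin 2) ℚ_[p]} {K : Subgroup (G p)}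

/-- Two translates of points of `x J` in the same cell give a return to `x J`. -/
lemma exists_mem_returnSet (hR : IsOrder R) (ha : a < 0) (hb : b < 0) {ε : ℝ} (hε : ε < 1)
    (hKJ : ∀ k ∈ K, k ∈ nbhd (unitsC p) ε) {x j j' : G p} (hj : j ∈ nbhd (unitsC p) ε)
    (hj' : j' ∈ nbhd (unitsC p) ε) {ℓ ℓ' e e' : ℕ} (hℓ : ℓ.Prime) (hℓ' : ℓ'.Prime) (hℓp : ℓ ≠ p)
    (hℓp' : ℓ' ≠ p) {w w' : Quat a b} (hw : w ∈ normSet p R (ℓ ^ e))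
    (hw' : w' ∈ normSet p R (ℓ' ^ e'))
    (h : toX R ι ((toG ι w')⁻¹ * (x * j')) ∈ cell R ι K ((toG ι w)⁻¹ * (x * j))) :
    ∃ η ∈ returnSet ι R x ε ℓ e ℓ' e', SameCoset p R w' (η * w) ∧
      ∃ k ∈ K, x * j' = toG ι η * (x * j) * k := by
  have hw0 := nr_ne_zero_of_mem_normSet (pow_ne_zero e hℓ.ne_zero) hw
  have hw0' := nr_ne_zero_of_mem_normSet (pow_ne_zero e' hℓ'.ne_zero) hw'
  have hℓ0 : ((ℓ ^ e : ℕ) : ℚ) ≠ 0 := Nat.cast_ne_zero.2 (pow_ne_zero e hℓ.ne_zero)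
  obtain ⟨k, hk, h⟩ := h
  rw [toX_eq_iff, mem_Gam_iff_toG hR ha hb] at h
  obtain ⟨γ, hγ, h⟩ := h
  have hγ0 := nr_ne_zero_of_mem_normSet one_ne_zero hγ
  have hwγ : nr (w' * γ) ≠ 0 := by rw [nr_mul]; exact mul_ne_zero hw0' hγ0
  -- A coincidence w'⁻¹xj' ∈ Γ w⁻¹xj K rewritten as a relation between the two points of xJ.
  set η := w' * γ * qinv w with hη
  have hη0 : toG ι η = toG ι w' * toG ι γ * (toG ι w)⁻¹ := by
    rw [hη, toG_mul ι ha hb hwγ (by simpa using hw0), toG_mul ι ha hb hw0' hγ0, toG_qinv ι ha hb hw0]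
  have hxj : x * j' = toG ι η * (x * j) * k := by
    rw [hη0, ← h]
    group
  have hηn : nr η ≠ 0 := by
    rw [hη, nr_mul, nr_qinv]
    exact mul_ne_zero hwγ (inv_ne_zero hw0)
  have hJ : j' * k⁻¹ * j⁻¹ ∈ nbhd (unitsC p) ε :=
    mul_mem_nbhd hε (mul_mem_nbhd hε hj' (hKJ _ (inv_mem hk))) (inv_mem_nbhd hε hj)
  have hηJ : ι η = (x * (j' * k⁻¹ * j⁻¹) * x⁻¹ : G p).val := by
    rw [← toG_val ι ha hb hηn]
    congr 1
    rw [eq_mul_inv_iff_mul_eq, ← mul_assoc, ← mul_assoc, hxj]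
    group
  refine ⟨η, ⟨⟨_, hJ, hηJ⟩, ?_, ?_⟩, ⟨γ, hγ, ?_⟩, k, hk, hxj⟩
  · obtain ⟨hw1, s, hs⟩ := hw
    have : ((ℓ : ℚ) ^ e) • η = (p : ℚ) ^ (-s) • (w' * γ * star w) := by
      rw [hη, qinv, hs, mul_smul_comm, smul_smul]
      congr 1
      have := zpow_ne_zero s (prime_cast_ne_zero p)
      rw [zpow_neg]
      push_cast at hℓ0 ⊢
      field_simp
    rw [this]
    exact zpow_smul_mem_invP (Fact.out : p.Prime).ne_zero
      (mul_mem (mul_mem hw'.1 hγ.1) (hR.star_mem_invP hw1)) _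
  · obtain ⟨-, s, hs⟩ := hw
    obtain ⟨-, s', hs'⟩ := hw'
    obtain ⟨-, t, ht⟩ := hγ
    have hnr : (ℓ : ℚ) ^ e * nr η = (ℓ' : ℚ) ^ e' * (p : ℚ) ^ (s' + t - s) := by
      rw [hη, nr_mul, nr_mul, nr_qinv, hs, hs', ht, zpow_sub₀ (prime_cast_ne_zero p),
        zpow_add₀ (prime_cast_ne_zero p)]
      have := zpow_ne_zero s (prime_cast_ne_zero p)
      push_cast at hℓ0 ⊢
      field_simp
    -- η is conjugate to an element of B, whose determinant is a p-adic unit. This removes the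
    -- unknown power of p from its norm.
    have hnorm : ‖((nr η : ℚ) : ℚ_[p])‖ = 1 := by
      rw [← det_map ι ha hb, hηJ, Units.val_mul, Units.val_mul, Matrix.det_units_conj]
      exact norm_det_of_mem_nbhd hε hJ
    have hp : (1 : ℝ) < p := by exact_mod_cast (Fact.out : p.Prime).one_lt
    have hcop : ∀ q : ℕ, q.Prime → q ≠ p → ‖(q : ℚ_[p])‖ = 1 := fun q hq hqp => by
      refine le_antisymm (Padic.norm_int_le_one (q : ℤ)) (not_lt.1 fun h => hqp ?_)
      exact ((Nat.prime_dvd_prime_iff_eq Fact.out hq).1 (Padic.norm_natCast_lt_one_iff.1 h)).symm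
    have h1 := congrArg (fun t : ℚ => ‖(t : ℚ_[p])‖) hnr
    simp only [Rat.cast_mul, Rat.cast_pow, Rat.cast_natCast, norm_mul, norm_pow, hnorm,
      hcop ℓ hℓ hℓp, hcop ℓ' hℓ' hℓp', one_pow, one_mul, Rat.cast_zpow, norm_zpow,
      Padic.norm_p, inv_zpow'] at h1
    rw [eq_comm, zpow_eq_one_iff_right₀ (by positivity) hp.ne', neg_eq_zero] at h1
    rw [hnr, h1, zpow_zero, mul_one]
  · rw [hη, mul_assoc, qinv_mul hw0, mul_one]

variable [DecidableEq (G p)]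

/-- The number of coincidences between the translates of a point by `W` and those of the points
of `S` by `W'`. -/
lemma card_coincidences_le (hR : IsOrder R) (ha : a < 0) (hb : b < 0) {ε : ℝ} (hε : ε < 1)
    (hKJ : ∀ k ∈ K, k ∈ nbhd (unitsC p) ε) {x : G p} {Y S : Finset (G p)}
    (hY : IsCellSystem R ι K Y) (hSY : S ⊆ Y) {j : G p → G p}
    (hj : ∀ y ∈ S, j y ∈ nbhd (unitsC p) ε ∧ toX R ι (x * j y) = toX R ι y)
    {φ : X R ι → ℂ} {ℓ ℓ' e e' : ℕ} (hℓ : ℓ.Prime) (hℓ' : ℓ'.Prime)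
    (hℓp : ℓ ≠ p) (hℓp' : ℓ' ≠ p) {W W' : Finset (Quat a b)} {κ κ' : ℝ}
    (hW : IsAmplifier φ ℓ e W κ) (hW' : IsAmplifier φ ℓ' e' W' κ')
    {r : Quat a b → G p → G p}
    (hr : ∀ w y, toX R ι ((toG ι w)⁻¹ * (x * j y)) ∈ cell R ι K (r w y)) {C : ℕ}
    (hC : ∀ N : Finset (Quat a b), (∀ η ∈ N, η ∈ returnSet ι R x ε ℓ e ℓ' e') → N.card ≤ C)
    {y : G p} (hy : y ∈ S) :
    ((W ×ˢ S ×ˢ W').filter fun t => r t.2.2 t.2.1 = r t.1 y).card ≤ C * W.card ∧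
    (ℓ ≠ ℓ' → ((W ×ˢ S ×ˢ W').filter fun t => r t.2.2 t.2.1 = r t.1 y).card ≤ C) := by
  classical
  set Z := (W ×ˢ S ×ˢ W').filter fun t => r t.2.2 t.2.1 = r t.1 y with hZ
  have hZm : ∀ t ∈ Z, (t.1 ∈ W ∧ t.2.1 ∈ S ∧ t.2.2 ∈ W') ∧ r t.2.2 t.2.1 = r t.1 y := fun t ht => by
    rwa [hZ, Finset.mem_filter, Finset.mem_product, Finset.mem_product] at ht
  have hex : ∀ t ∈ Z, ∃ η ∈ returnSet ι R x ε ℓ e ℓ' e', SameCoset p R t.2.2 (η * t.1) ∧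
      ∃ k ∈ K, x * j t.2.1 = toG ι η * (x * j y) * k := by
    intro t ht
    obtain ⟨⟨h1, h2, h3⟩, h4⟩ := hZm t ht
    refine exists_mem_returnSet hR ha hb hε hKJ (hj y hy).1 (hj _ h2).1 hℓ hℓ' hℓp hℓp'
      (hW.mem _ h1) (hW'.mem _ h3) ?_
    have h5 := hr t.2.2 t.2.1
    rw [h4] at h5
    exact mem_cell_trans (mem_cell_symm (hr t.1 y)) h5
  choose! η hη hηw hηk using hex
  -- Once w is known, η determines the rest: w' through its coset ηwΓ, and y' through the cell of
  -- ηxj.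
  have hpair : ∀ t ∈ Z, ∀ t' ∈ Z, t.1 = t'.1 → η t = η t' → t = t' := by
    intro t ht t' ht' h1 h2
    obtain ⟨⟨-, hS, hw⟩, -⟩ := hZm t ht
    obtain ⟨⟨-, hS', hw'⟩, -⟩ := hZm t' ht'
    have hww : t.2.2 = t'.2.2 := hW'.inj _ hw _ hw' ((hηw t ht).trans (by
      rw [h1, h2]; exact (hηw t' ht').symm hR))
    have hyy : t.2.1 = t'.2.1 := by
      obtain ⟨k, hk, hk1⟩ := hηk t ht
      obtain ⟨k', hk', hk1'⟩ := hηk t' ht'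
      refine hY.inj _ (hSY hS) _ (hSY hS') (mem_cell_iff.2 ⟨k⁻¹ * k', mul_mem (inv_mem hk) hk', ?_⟩)
      rw [← (hj _ hS).2, ← (hj _ hS').2, rightTr_toX, hk1, hk1', h2]
      congr 1
      group
    exact Prod.ext h1 (Prod.ext hyy hww)
  constructor
  · refine (Finset.card_le_mul_card_image (f := Prod.fst) Z C fun w _ => ?_).trans
      (Nat.mul_le_mul_left C (Finset.card_le_card fun w hw => ?_))
    · rw [← Finset.card_image_of_injOn (f := η) fun t ht t' ht' h => hpair t
        (Finset.mem_filter.1 ht).1 t' (Finset.mem_filter.1 ht').1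
        ((Finset.mem_filter.1 ht).2.trans (Finset.mem_filter.1 ht').2.symm) h]
      refine hC _ fun ξ hξ => ?_
      obtain ⟨t, ht, rfl⟩ := Finset.mem_image.1 hξ
      exact hη t (Finset.mem_filter.1 ht).1
    · obtain ⟨t, ht, rfl⟩ := Finset.mem_image.1 hw
      exact (hZm t ht).1.1
  -- For distinct primes η determines w too. For two candidates w₁, w₂, the quotient w₁⁻¹w₂ has a
  -- denominator dividing ℓ^e, and also one dividing ℓ'^e' when written as (ηw₁)⁻¹(ηw₂).
  · intro hne
    rw [← Finset.card_image_of_injOn (f := η) (s := Z) ?_]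
    · refine hC _ fun ξ hξ => ?_
      obtain ⟨t, ht, rfl⟩ := Finset.mem_image.1 hξ
      exact hη t ht
    · intro t ht t' ht' h
      refine hpair t ht t' ht' ?_ h
      obtain ⟨⟨h1, -, h3⟩, -⟩ := hZm t ht
      obtain ⟨⟨h1', -, h3'⟩, -⟩ := hZm t' ht'
      have hℓe := pow_ne_zero e hℓ.ne_zero
      have hℓe' := pow_ne_zero e' hℓ'.ne_zero
      refine hW.inj _ h1 _ h1' (sameCoset_of_qinv_mul_mem hℓe (hW.mem _ h1) (hW.mem _ h1') ?_)
      refine mem_of_coprime_smul (m := ℓ ^ e) (n := ℓ' ^ e')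
        (Nat.Coprime.pow _ _ ((Nat.coprime_primes hℓ hℓ').2 hne))
        (hR.smul_qinv_mul_mem hℓe (hW.mem _ h1) (hW.mem _ h1').1) ?_
      have hm := hηw t ht
      obtain ⟨γ, hγ, hγe⟩ := hηw t' ht'
      have hmem : η t * t.1 ∈ normSet p R (ℓ' ^ e') := hm.mem_normSet (hW'.mem _ h3)
      have hm0 := nr_ne_zero_of_mem_normSet hℓe' hmem
      have hη0 : nr (η t) ≠ 0 := by
        intro h0
        rw [nr_mul, h0, zero_mul] at hm0
        exact hm0 rfl
      have hq : qinv t.1 * t'.1 = qinv (η t * t.1) * (t'.2.2 * γ) := by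
        rw [← hγe, ← h, qinv_mul_rev, mul_assoc, ← mul_assoc (qinv (η t)), qinv_mul hη0, one_mul]
      rw [hq]
      exact hR.smul_qinv_mul_mem hℓe' hmem (mul_mem (hW'.mem _ h3').1 hγ.1)

end ReturnCount

end ArithQuot

namespace ArithQuot

/-! ### The amplified bound for the mass of one neighbourhood. -/

section MassBound

set_option linter.unusedSectionVars false

variable {p : ℕ} [Fact p.Prime] {a b : ℚ} {R : Subring (Quat a b)}
  {ι : Quat a b →ₐ[ℚ] Matrix (Fin 2) (Fin 2) ℚ_[p]} {ν : Measure (X R ι)}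

/-- Each κ is at least √D/2, so the weight of an off-diagonal pair is at most 4/D. -/
lemma inv_mul_inv_mul_le {κ κ' D C N : ℝ} (hκ : 0 < κ) (hκ' : 0 < κ') (hD : 0 < D)
    (h : D ≤ 4 * κ ^ 2) (h' : D ≤ 4 * κ' ^ 2) (hC : 0 ≤ C) (hN : N ≤ C) :
    κ⁻¹ * κ'⁻¹ * N ≤ 4 * C / D := by
  have h1 : D ≤ 4 * (κ * κ') := by
    refine le_of_sq_le_sq ?_ (by positivity)
    calc D ^ 2 = D * D := sq D
      _ ≤ (4 * κ ^ 2) * (4 * κ' ^ 2) := mul_le_mul h h' hD.le (by positivity)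
      _ = (4 * (κ * κ')) ^ 2 := by ring
  rw [← mul_inv, le_div_iff₀ hD, inv_mul_eq_div, div_mul_eq_mul_div, div_le_iff₀ (by positivity)]
  calc N * D ≤ C * D := mul_le_mul_of_nonneg_right hN hD.le
    _ ≤ C * (4 * (κ * κ')) := mul_le_mul_of_nonneg_left h1 hC
    _ = _ := by ring

/-- The bound for the mass of a neighbourhood obtained by amplification. -/
theorem IsIrred.exists_mass_eq (hν : IsUniform R ι ν) (hR : IsOrder R) (ha : a < 0) (hb : b < 0)
    {π : Submodule ℂ (X R ι → ℂ)} (hπ : IsIrred R ι π) {φ : X R ι → ℂ} (hφπ : φ ∈ π)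
    (hφ : (∫ x, ‖φ x‖ ^ 2 ∂ν) = 1) {n : ℕ} (hn : 0 < n) {x : G p} {P : Finset ℕ} {D : ℝ}
    (hD : 0 < D) (hP : ∀ ℓ ∈ P, IsGood p R ℓ ∧ D ≤ ℓ) {C : ℕ}
    (hC : ∀ ℓ ∈ P, ∀ ℓ' ∈ P, ∀ e e' : ℕ, e ≤ 2 → e' ≤ 2 → ∀ S : Finset (Quat a b),
      (∀ η ∈ S, η ∈ returnSet ι R x ((p : ℝ) ^ (-(n : ℤ))) ℓ e ℓ' e') → S.card ≤ C) :
    ∃ μ : ℝ, mass ν φ (toX R ι '' ((fun g => x * g) '' nbhd (unitsC p) ((p : ℝ) ^ (-(n : ℤ)))))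
        = ENNReal.ofReal μ ∧
      (P.card : ℝ) ^ 2 * μ ≤ 4 * C * P.card + 4 * C / D * P.card ^ 2 := by
  classical
  have := hν.prob
  have hB : 0 ≤ 4 * (C : ℝ) * P.card + 4 * C / D * P.card ^ 2 := by positivity
  set ε := (p : ℝ) ^ (-(n : ℤ)) with hε
  have hp : (1 : ℝ) < p := by exact_mod_cast (Fact.out : p.Prime).one_lt
  have hε1 : ε < 1 := by
    rw [hε, zpow_neg, zpow_natCast]
    exact inv_lt_one_of_one_lt₀ (one_lt_pow₀ hp hn.ne')
  obtain ⟨K, hK, hsmall, hKφ, hKn⟩ := exists_open_small hR ha hb (hπ.le_smooth hφπ) n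
  have hKJ : ∀ k ∈ K, k ∈ nbhd (unitsC p) ε := fun k hk => congrSubgroup_le_nbhd hn le_rfl (hKn k hk)
  obtain ⟨Y, hY⟩ := hν.exists_isCellSystem hK hsmall
  set E := toX R ι '' ((fun g => x * g) '' nbhd (unitsC p) ε) with hE
  have hEK : ∀ y ∈ E, ∀ k ∈ K, rightTr R ι k y ∈ E := by
    rintro _ ⟨_, ⟨j, hj, rfl⟩, rfl⟩ k hk
    exact ⟨_, ⟨j * k, mul_mem_nbhd hε1 hj (hKJ k hk), rfl⟩, by
      rw [rightTr_toX, mul_assoc]⟩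
  have hEK' : ∀ y, ∀ k ∈ K, (rightTr R ι k y ∈ E ↔ y ∈ E) := fun y k hk =>
    ⟨fun h => by
      have := hEK _ h k⁻¹ (inv_mem hk)
      rwa [rightTr_mul, mul_inv_cancel, rightTr_one] at this, fun h => hEK y h k hk⟩
  have hEm : MeasurableSet E := (isOpen_of_stable hK hEK).measurableSet
  have hφK : ∀ k ∈ K, ∀ y, φ (rightTr R ι k y) = φ y := fun k hk y => congrFun (hKφ k hk) y
  set c := (ν (cell R ι K 1)).toReal with hc
  have hcν : ν (cell R ι K 1) = ENNReal.ofReal c := (ENNReal.ofReal_toReal (measure_ne_top _ _)).symm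
  have hc0 : 0 ≤ c := ENNReal.toReal_nonneg
  set f : G p → ℝ := fun y => ‖φ (toX R ι y)‖ with hf
  have hsum : ∀ S : Finset (G p), ∑ y ∈ S, ENNReal.ofReal (f y ^ 2) * ν (cell R ι K 1)
      = ENNReal.ofReal (c * ∑ y ∈ S, f y ^ 2) := by
    intro S
    rw [← Finset.sum_mul, hcν, ← ENNReal.ofReal_sum_of_nonneg fun y _ => sq_nonneg _, mul_comm c,
      ENNReal.ofReal_mul (Finset.sum_nonneg fun y _ => sq_nonneg _)]
  have htotal : c * ∑ y ∈ Y, f y ^ 2 = 1 := by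
    have hint : Integrable (fun x => ‖φ x‖ ^ 2) ν :=
      Integrable.of_integral_ne_zero (by rw [hφ]; exact one_ne_zero)
    have h1 := ofReal_integral_eq_lintegral_ofReal hint (ae_of_all _ fun x => sq_nonneg _)
    rw [hφ, hν.lintegral_eq hK hsmall hY fun k hk y => by rw [hφK k hk], hsum Y] at h1
    have h2 := (ENNReal.ofReal_eq_ofReal_iff zero_le_one
      (mul_nonneg hc0 (Finset.sum_nonneg fun y _ => sq_nonneg _))).1 h1
    exact h2.symm
  set S := Y.filter fun y => toX R ι y ∈ E with hS
  have hmass : mass ν φ E = ENNReal.ofReal (c * ∑ y ∈ S, f y ^ 2) := by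
    rw [mass, withDensity_apply _ hEm, ← lintegral_indicator hEm,
      hν.lintegral_eq hK hsmall hY, ← hsum, hS, Finset.sum_filter]
    · refine Finset.sum_congr rfl fun y _ => ?_
      by_cases h : toX R ι y ∈ E
      · rw [Set.indicator_of_mem h, if_pos h]
      · rw [Set.indicator_of_notMem h, if_neg h, zero_mul]
    · intro k hk y
      by_cases h : y ∈ E
      · rw [Set.indicator_of_mem h, Set.indicator_of_mem ((hEK' y k hk).2 h), hφK k hk]
      · rw [Set.indicator_of_notMem h, Set.indicator_of_notMem (mt (hEK' y k hk).1 h)]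
  refine ⟨_, hmass, ?_⟩
  have hjex : ∀ y ∈ S, ∃ j, j ∈ nbhd (unitsC p) ε ∧ toX R ι (x * j) = toX R ι y := by
    intro y hy
    obtain ⟨_, ⟨j, hj, rfl⟩, h⟩ := (Finset.mem_filter.1 hy).2
    exact ⟨j, hj, h⟩
  choose! j hj using hjex
  choose r hrY hr using fun (w : Quat a b) (y : G p) =>
    hY.surj (toX R ι ((toG ι w)⁻¹ * (x * j y)))
  choose! e W κ hW using fun ℓ (hℓ : ℓ ∈ P) => hπ.exists_isAmplifier hν hR ha hb hφπ hφ (hP ℓ hℓ).1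
  have hmain := sq_card_mul_sum_le (Y := Y) (S := S) (P := P) (W := W) (κ := κ) (r := r) (f := f)
    (B := 4 * C * P.card + 4 * C / D * P.card ^ 2) hB hrY
    (fun y => norm_nonneg _) (fun ℓ hℓ => (hW ℓ hℓ).pos) ?_ ?_
  · calc (P.card : ℝ) ^ 2 * (c * ∑ y ∈ S, f y ^ 2) = c * ((P.card : ℝ) ^ 2 * ∑ y ∈ S, f y ^ 2) := by
          ring
      _ ≤ c * ((4 * C * P.card + 4 * C / D * P.card ^ 2) * ∑ y ∈ Y, f y ^ 2) :=
          mul_le_mul_of_nonneg_left hmain hc0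
      _ = (4 * C * P.card + 4 * C / D * P.card ^ 2) * (c * ∑ y ∈ Y, f y ^ 2) := by ring
      _ = _ := by rw [htotal, mul_one]
  · intro y hy ℓ hℓ
    have h1 := (hW ℓ hℓ).bound (x * j y)
    rw [(hj y hy).2] at h1
    refine h1.trans (le_of_eq (Finset.sum_congr rfl fun w _ => ?_))
    obtain ⟨k, hk, h2⟩ := mem_cell_iff.1 (hr w y)
    rw [ev, ← h2, hφK k hk]
  · intro y hy
    -- On the diagonal, at most C|W| ≤ 4Cκ² coincidences cost 4C. Off the diagonal, at most C
    -- coincidences with weight at most 4/D cost 4C/D.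
    have hpair : ∀ ℓ ∈ P, ∀ ℓ' ∈ P, (κ ℓ)⁻¹ * (κ ℓ')⁻¹ *
        ((W ℓ ×ˢ S ×ˢ W ℓ').filter fun t => r t.2.2 t.2.1 = r t.1 y).card
        ≤ 4 * C / D + if ℓ = ℓ' then 4 * (C : ℝ) else 0 := by
      intro ℓ hℓ ℓ' hℓ'
      obtain ⟨h1, h2⟩ := card_coincidences_le hR ha hb hε1 hKJ hY (Finset.filter_subset _ _) hj
        (hP ℓ hℓ).1.prime (hP ℓ' hℓ').1.prime (hP ℓ hℓ).1.ne (hP ℓ' hℓ').1.ne (hW ℓ hℓ) (hW ℓ' hℓ')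
        hr (hC ℓ hℓ ℓ' hℓ' _ _ (hW ℓ hℓ).e_le (hW ℓ' hℓ').e_le) hy
      have hpos := (hW ℓ hℓ).pos
      have hpos' := (hW ℓ' hℓ').pos
      by_cases hne : ℓ = ℓ'
      · subst hne
        rw [if_pos rfl]
        have h3 : (((W ℓ ×ˢ S ×ˢ W ℓ).filter fun t => r t.2.2 t.2.1 = r t.1 y).card : ℝ)
            ≤ C * (W ℓ).card := by exact_mod_cast h1
        have h4 : (C : ℝ) * (W ℓ).card ≤ C * (4 * κ ℓ ^ 2) :=
          mul_le_mul_of_nonneg_left (hW ℓ hℓ).card_le (Nat.cast_nonneg C)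
        have h5 : (0 : ℝ) ≤ 4 * C / D := by positivity
        calc _ ≤ (κ ℓ)⁻¹ * (κ ℓ)⁻¹ * (C * (4 * κ ℓ ^ 2)) :=
              mul_le_mul_of_nonneg_left (h3.trans h4) (by positivity)
          _ = 4 * C := by field_simp
          _ ≤ _ := by linarith
      · rw [if_neg hne, add_zero]
        exact inv_mul_inv_mul_le hpos hpos' hD ((hP ℓ hℓ).2.trans (hW ℓ hℓ).le)
          ((hP ℓ' hℓ').2.trans (hW ℓ' hℓ').le) (Nat.cast_nonneg C) (by exact_mod_cast h2 hne)
    refine (Finset.sum_le_sum fun ℓ hℓ => Finset.sum_le_sum fun ℓ' hℓ' => hpair ℓ hℓ ℓ' hℓ').trans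
      (le_of_eq ?_)
    simp_rw [Finset.sum_add_distrib, Finset.sum_ite_eq, Finset.sum_const, nsmul_eq_mul]
    rw [Finset.sum_congr rfl fun ℓ hℓ => if_pos hℓ, Finset.sum_const, nsmul_eq_mul]
    ring

lemma mass_le_one {φ : X R ι → ℂ} (hφ : (∫ x, ‖φ x‖ ^ 2 ∂ν) = 1)
    (E : Set (X R ι)) : mass ν φ E ≤ 1 := by
  have hint : Integrable (fun x => ‖φ x‖ ^ 2) ν :=
    Integrable.of_integral_ne_zero (by rw [hφ]; exact one_ne_zero)
  have h1 := ofReal_integral_eq_lintegral_ofReal hint (ae_of_all _ fun x => sq_nonneg _)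
  rw [hφ, ENNReal.ofReal_one] at h1
  calc mass ν φ E ≤ mass ν φ Set.univ := measure_mono (Set.subset_univ E)
    _ = 1 := by rw [mass, withDensity_apply _ MeasurableSet.univ, setLIntegral_univ, h1]

end MassBound

end ArithQuot

namespace ArithQuot

/-! ### Choice of parameters and conclusion. -/

section MassDecay

set_option linter.unusedSectionVars false

variable {p : ℕ} [Fact p.Prime] {a b : ℚ} {R : Subring (Quat a b)}

lemma isOpen_unitsC : IsOpen (unitsC p : Set ℚ_[p]ˣ) := by
  have : (unitsC p : Set ℚ_[p]ˣ) = (fun u : ℚ_[p]ˣ => (u : ℚ_[p])) ⁻¹' Metric.sphere 0 1 := by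
    ext u
    simp [mem_unitsC]
  rw [this]
  exact (IsUltrametricDist.isOpen_sphere 0 one_ne_zero).preimage Units.continuous_val

lemma isCompact_unitsC : IsCompact (unitsC p : Set ℚ_[p]ˣ) := by
  rw [Units.isEmbedding_val₀.isInducing.isCompact_iff]
  have : (fun u : ℚ_[p]ˣ => (u : ℚ_[p])) '' (unitsC p : Set ℚ_[p]ˣ) = Metric.sphere 0 1 := by
    ext x
    rw [mem_sphere_zero_iff_norm]
    constructor
    · rintro ⟨u, hu, rfl⟩
      exact hu
    · intro hx
      have h0 : x ≠ 0 := by rintro rfl; simp at hx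
      exact ⟨Units.mk0 x h0, hx, rfl⟩
  exact this ▸ isCompact_sphere 0 1

lemma Admissible.exists_eq {ε : ℝ} (h : Admissible p ε) (hε : ε < 1) :
    ∃ n : ℕ, 0 < n ∧ ε = (p : ℝ) ^ (-(n : ℤ)) := by
  obtain ⟨y, rfl⟩ := h
  have hp : (1 : ℝ) < p := by exact_mod_cast (Fact.out : p.Prime).one_lt
  have h1 := Padic.norm_eq_zpow_neg_valuation (p := p) y.ne_zero
  have h2 : 0 < (y : ℚ_[p]).valuation := by
    by_contra h3
    rw [h1] at hε
    exact absurd hε (not_lt.2 (one_le_zpow₀ hp.le (by omega)))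
  refine ⟨(y : ℚ_[p]).valuation.toNat, by omega, ?_⟩
  rw [h1, Int.toNat_of_nonneg h2.le]

lemma rpow_pow_neg_le {q δ : ℝ} (hq : 1 < q) (hδ : 0 < δ) {n t s : ℕ} (h : n ≤ 4 * t + s) :
    ((q ^ t) ^ δ)⁻¹ ≤ q ^ (s * (δ / 4)) * (q ^ (-(n : ℤ))) ^ (δ / 4) := by
  have hq0 : 0 < q := by linarith
  rw [← Real.rpow_natCast, ← Real.rpow_intCast, ← Real.rpow_mul hq0.le, ← Real.rpow_mul hq0.le,
    ← Real.rpow_neg hq0.le, ← Real.rpow_add hq0]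
  refine Real.rpow_le_rpow_of_exponent_le hq.le ?_
  have h' : (n : ℝ) ≤ 4 * t + s := by exact_mod_cast h
  push_cast
  nlinarith

/-- Uniform decay of the mass of the neighbourhoods. -/
theorem IsOrder.exists_mass_le (hR : IsOrder R) (ha : a < 0) (hb : b < 0)
    (ι : Quat a b →ₐ[ℚ] Matrix (Fin 2) (Fin 2) ℚ_[p]) {ν : Measure (X R ι)}
    (hν : IsUniform R ι ν) {Ω : Set (G p)} (hΩ : IsCompact Ω) :
    ∃ C₁ c₂ : ℝ, 0 < C₁ ∧ 0 < c₂ ∧ ∀ n : ℕ, 0 < n → ∀ π, IsIrred R ι π → ∀ φ ∈ π,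
      (∫ y, ‖φ y‖ ^ 2 ∂ν) = 1 → ∀ x ∈ Ω,
        mass ν φ (toX R ι '' ((fun g => x * g) '' nbhd (unitsC p) ((p : ℝ) ^ (-(n : ℤ)))))
          ≤ ENNReal.ofReal (C₁ * ((p : ℝ) ^ (-(n : ℤ))) ^ c₂) := by
  classical
  have hp2 := (Fact.out : p.Prime).two_le
  have hp : (1 : ℝ) < p := by exact_mod_cast (Fact.out : p.Prime).one_lt
  have hp0 : (0 : ℝ) < p := by linarith
  obtain ⟨k, C, hret⟩ := IsOrder.exists_card_returnSet_le ι ha hb hR hΩ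
  obtain ⟨m, hm, hgood⟩ := hR.exists_isGood ha hb ι
  have : NeZero m := ⟨hm.ne'⟩
  obtain ⟨δ, c, hδ, hc, L₀, hprimes⟩ := exists_many_primes m
  -- For t ≥ t₁ the prime bound applies to L = p^t, and L^δ ≥ p, so p is not among the primes
  -- chosen.
  set t₁ := max L₀ ⌈δ⁻¹⌉₊ with ht₁
  have ht₁1 : 1 ≤ t₁ := le_trans (Nat.one_le_ceil_iff.2 (inv_pos.2 hδ)) (le_max_right _ _)
  set s := 4 * t₁ + 2 * k + 5 with hs
  set A : ℝ := 4 * C / c + 4 * C + 1 with hA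
  have hA1 : 1 ≤ A := by
    have : 0 ≤ 4 * (C : ℝ) / c + 4 * C := by positivity
    linarith
  have hq1 : 1 ≤ (p : ℝ) ^ (s * (δ / 4)) := Real.one_le_rpow hp.le (by positivity)
  refine ⟨A * (p : ℝ) ^ (s * (δ / 4)), δ / 4, by positivity, by positivity, ?_⟩
  intro n hn π hπ φ hφπ hφ x hx
  set ε := (p : ℝ) ^ (-(n : ℤ)) with hε
  rcases lt_or_ge ((n - 2 * k - 2) / 4) t₁ with hsmall | hlarge
  -- Here n ≤ s, so the claimed bound is at least 1 and there is nothing to prove.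
  · refine (mass_le_one hφ _).trans ?_
    rw [ENNReal.one_le_ofReal]
    have h1 := rpow_pow_neg_le hp hδ (n := n) (t := 0) (s := s) (by omega)
    rw [pow_zero, Real.one_rpow, inv_one] at h1
    rw [mul_assoc]
    exact one_le_mul_of_one_le_of_one_le hA1 h1
  -- The largest t this rounding allows with 2 + 4k + 8t < 2n, which is the commutation condition
  -- for L = p^t after 4 ≤ p². Conversely n ≤ 4t + s, so L^(-δ) is O(ε^(δ/4)).
  · set t := (n - 2 * k - 2) / 4 with ht
    set D : ℝ := ((p ^ t : ℕ) : ℝ) ^ δ with hD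
    have hD0 : 0 < D := Real.rpow_pos_of_pos (by positivity) _
    have hpD : (p : ℝ) ≤ D := by
      have h1 : 1 ≤ (t : ℝ) * δ := by
        have h2 : δ⁻¹ ≤ t := (Nat.le_ceil _).trans (by exact_mod_cast (le_max_right _ _).trans hlarge)
        calc 1 = δ⁻¹ * δ := (inv_mul_cancel₀ hδ.ne').symm
          _ ≤ _ := mul_le_mul_of_nonneg_right h2 hδ.le
      rw [hD, Nat.cast_pow, ← Real.rpow_natCast, ← Real.rpow_mul hp0.le]
      calc (p : ℝ) = (p : ℝ) ^ (1 : ℝ) := (Real.rpow_one _).symm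
        _ ≤ _ := Real.rpow_le_rpow_of_exponent_le hp.le h1
    have hL : L₀ ≤ p ^ t :=
      ((le_max_left _ _).trans hlarge).trans (Nat.lt_pow_self (by omega)).le
    have hcard := hprimes (p ^ t) hL
    set P := (Finset.range (p ^ t + 1)).filter fun ℓ : ℕ =>
        ℓ.Prime ∧ (ℓ : ZMod m) = 1 ∧ ((p ^ t : ℕ) : ℝ) ^ δ < (ℓ : ℝ) with hP
    have hPm : ∀ ℓ ∈ P, ℓ ≤ p ^ t ∧ IsGood p R ℓ ∧ D ≤ ℓ := by
      intro ℓ hℓ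
      rw [hP, Finset.mem_filter, Finset.mem_range] at hℓ
      obtain ⟨h1, h2, h3, h4⟩ := hℓ
      refine ⟨by omega, hgood ℓ h2 ?_ h3, h4.le⟩
      rintro rfl
      exact absurd h4 (not_lt.2 hpD)
    have hcond : 4 * (p ^ (2 * k) * (p ^ t) ^ 4) ^ 2 < p ^ (2 * n) := by
      calc 4 * (p ^ (2 * k) * (p ^ t) ^ 4) ^ 2 ≤ p ^ 2 * (p ^ (2 * k) * (p ^ t) ^ 4) ^ 2 :=
            Nat.mul_le_mul_right _ (Nat.pow_le_pow_left hp2 2)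
        _ = p ^ (2 + 4 * k + 8 * t) := by ring
        _ < p ^ (2 * n) := Nat.pow_lt_pow_right (by omega) (by omega)
    obtain ⟨μ, hμ, hμle⟩ := hπ.exists_mass_eq hν hR ha hb hφπ hφ hn (x := x) hD0
      (fun ℓ hℓ => (hPm ℓ hℓ).2) (C := C) (fun ℓ hℓ ℓ' hℓ' e e' he he' S hS =>
        hret n (p ^ t) hn hcond x hx ℓ ℓ' (hPm ℓ hℓ).2.1.prime (hPm ℓ' hℓ').2.1.prime
          (hPm ℓ hℓ).2.1.ne (hPm ℓ' hℓ').2.1.ne (hPm ℓ hℓ).1 (hPm ℓ' hℓ').1 e e' he he' S hS)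
    rw [hμ]
    refine ENNReal.ofReal_le_ofReal ?_
    have hN : 0 < (P.card : ℝ) := lt_of_lt_of_le (mul_pos hc hD0) hcard
    have h1 : μ ≤ 4 * C / P.card + 4 * C / D := by
      have h2 : 4 * (C : ℝ) * P.card + 4 * C / D * (P.card : ℝ) ^ 2
          = (P.card : ℝ) ^ 2 * (4 * C / P.card + 4 * C / D) := by
        field_simp
      rw [h2] at hμle
      exact le_of_mul_le_mul_left hμle (by positivity)
    have h2 : 4 * (C : ℝ) / P.card ≤ 4 * C / (c * D) :=
      div_le_div_of_nonneg_left (by positivity) (by positivity) hcard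
    have h3 : μ ≤ A * D⁻¹ := by
      have h4 : 4 * (C : ℝ) / (c * D) + 4 * C / D = (4 * C / c + 4 * C) * D⁻¹ := by field_simp
      have h5 : 0 < D⁻¹ := inv_pos.2 hD0
      rw [hA, add_mul _ 1]
      linarith
    refine h3.trans ?_
    rw [mul_assoc]
    refine mul_le_mul_of_nonneg_left ?_ (by linarith)
    have h4 := rpow_pow_neg_le hp hδ (n := n) (t := t) (s := s) (by omega)
    rw [hD, Nat.cast_pow]
    exact h4

end MassDecay

end ArithQuot

end

theorem theorem4p1 (p : ℕ) [Fact p.Prime] (a b : ℚ) (ha : a < 0) (hb : b < 0)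
    (R : Subring (ArithQuot.Quat a b)) (hR : ArithQuot.IsMaximalOrder R)
    (ι : ArithQuot.Quat a b →ₐ[ℚ] Matrix (Fin 2) (Fin 2) ℚ_[p])
    (ν : Measure (ArithQuot.X R ι)) (hν : ArithQuot.IsUniform R ι ν)
    (Ω : Set (ArithQuot.G p)) (hΩ : IsCompact Ω) :
    ∃ (C : Subgroup ℚ_[p]ˣ) (C₁ c₂ : ℝ),
      IsOpen (C : Set ℚ_[p]ˣ) ∧ IsCompact (C : Set ℚ_[p]ˣ) ∧ 0 < C₁ ∧ 0 < c₂ ∧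
      ∀ ε : ℝ, ArithQuot.Admissible p ε → 0 < ε → ε < 1 →
      ∀ π ∈ ArithQuot.A₀ R ι, ∀ φ ∈ π, (∫ y, ‖φ y‖ ^ 2 ∂ν) = 1 →
      ∀ x ∈ Ω,
        ArithQuot.mass ν φ (ArithQuot.toX R ι '' ((fun g => x * g) '' ArithQuot.nbhd C ε))
          ≤ ENNReal.ofReal (C₁ * ε ^ c₂) := by
  obtain ⟨C₁, c₂, hC₁, hc₂, h⟩ := hR.1.exists_mass_le ha hb ι hν hΩ
  -- C is taken to be ℤ_pˣ. The dependence on Ω enters only through C₁.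
  refine ⟨ArithQuot.unitsC p, C₁, c₂, ArithQuot.isOpen_unitsC, ArithQuot.isCompact_unitsC,
    hC₁, hc₂, fun ε hε _ hε1 π hπ φ hφπ hφ x hx => ?_⟩
  obtain ⟨n, hn, rfl⟩ := hε.exists_eq hε1
  exact h n hn π hπ.1 φ hφπ hφ x hx
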